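/- A graph property $\Phi$ assigns to every finite simple graph a value in $\{0,1\}$ that depends only on its isomorphism class. It satisfies the matching criterion if $\Phi(M_k)=1$ for all but finitely many $k$, where $M_k$ is the graph consisting of $k$ pairwise disjoint edges; it satisfies the star criterion if $\Phi(K_{1,k})=1$ for all but finitely many $k$; and it has bounded treewidth if there is a constant $B$ such that $\Phi$ is false on all graphs of treewidth at least $B$. For a graph $G$ and $A\subseteq E(G)$ let $G[A]$ be the graph with edge set $A$ whose vertices are the endpoints of the edges in $A$. The parameterized counting problem $\#\mathrm{EdgeSub}(\Phi)$ asks, given a graph $G$ and a positive integer $k$, for the number $$\#\{A\subseteq E(G) : \#A=k,\ \Phi(G[A])=1\};$$ its parameter is $k$. A fixed-parameter tractable randomized approximation scheme (FPTRAS) for a parameterized counting problem $P$ with parameterization $\kappa$ is a randomized algorithm that, given an instance $x$ and rational numbers $\varepsilon>0$ and $0<\delta<1$, computes an integer $z$ with $$\Pr\bigl[(1-\varepsilon)P(x)\le z\le(1+\varepsilon)P(x)\bigr]\ge 1-\delta,$$ in time at most $f(\kappa(x))\cdot q(|x|,1/\varepsilon,\log(1/\delta))$ for some computable function $f$ and some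 polynomial $q$. (Algorithms are programs for a random access machine with addition, subtraction, indirect addressing and fair coin flips, each instruction taking unit time; $\varepsilon$ and $\delta$ are given by numerator and denominator, each in one register.) **Theorem.** Let $\Phi$ be a computable graph property. If $\Phi$ satisfies both the matching criterion and the star criterion, or if $\Phi$ has bounded treewidth, then $\#\mathrm{EdgeSub}(\Phi)$ admits an FPTRAS. -/

import Mathlib

/-! ### Graph properties -/

/-- A graph property: a predicate on finite simple graphs that depends only on the
isomorphism class of the graph. -/
structure GraphProperty where
  holds : ∀ {V : Type} [Finite V], SimpleGraph V → Prop
  iso_invariant : ∀ {V W : Type} [Finite V] [Finite W] (G : SimpleGraph V) (H : SimpleGraph W),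
    Nonempty (G ≃g H) → (holds G ↔ holds H)

/-- The adjacency matrix of a graph on `{0, …, n - 1}`, row by row, as a bit string. -/
noncomputable def adjacencyBits {n : ℕ} (G : SimpleGraph (Fin n)) : List Bool :=
  open Classical in List.ofFn fun p : Fin (n * n) => decide (G.Adj p.divNat p.modNat)

/-- The encoding of a graph as a bit string: `1ⁿ 0` followed by its adjacency matrix. -/
noncomputable def encodeGraph {n : ℕ} (G : SimpleGraph (Fin n)) : List Bool :=
  List.replicate n true ++ false :: adjacencyBits G

/-- `Φ` is computable: some computable function on bit strings decides `Φ` on encodings. -/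
def GraphProperty.IsComputable (Φ : GraphProperty) : Prop :=
  ∃ d : List Bool → Bool, Computable d ∧
    ∀ (n : ℕ) (G : SimpleGraph (Fin n)), d (encodeGraph G) = true ↔ Φ.holds G

/-- The matching `M_k`: `k` pairwise disjoint edges. -/
def matchingGraph (k : ℕ) : SimpleGraph (Fin k × Bool) where
  Adj u v := u.1 = v.1 ∧ u.2 ≠ v.2
  symm := ⟨fun _ _ h => ⟨h.1.symm, h.2.symm⟩⟩
  loopless := ⟨fun _ h => h.2 rfl⟩

/-- `Φ(M_k) = 1` for all but finitely many `k`. -/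
def GraphProperty.MatchingCriterion (Φ : GraphProperty) : Prop :=
  {k : ℕ | ¬ Φ.holds (matchingGraph k)}.Finite

/-- `Φ(K_{1,k}) = 1` for all but finitely many `k`. -/
def GraphProperty.StarCriterion (Φ : GraphProperty) : Prop :=
  {k : ℕ | ¬ Φ.holds (completeBipartiteGraph (Fin 1) (Fin k))}.Finite

/-- A tree decomposition of `G` whose tree has node set `ι`. -/
structure TreeDecomposition {V : Type} (G : SimpleGraph V) (ι : Type) where
  tree : SimpleGraph ι
  isTree : tree.IsTree
  bag : ι → Set V
  vertex_mem : ∀ v, ∃ t, v ∈ bag t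
  edge_mem : ∀ u v, G.Adj u v → ∃ t, u ∈ bag t ∧ v ∈ bag t
  connected : ∀ v, (tree.induce {t | v ∈ bag t}).Preconnected

/-- The treewidth of a finite graph: the least `w` for which there is a tree decomposition
all of whose bags have at most `w + 1` elements. -/
noncomputable def treewidth {V : Type} [Finite V] (G : SimpleGraph V) : ℕ :=
  sInf {w : ℕ | ∃ (m : ℕ) (D : TreeDecomposition G (Fin m)), ∀ t, (D.bag t).ncard ≤ w + 1}

/-- There is a constant `B` such that `Φ` is false on all graphs of treewidth at least `B`. -/
def GraphProperty.BoundedTreewidth (Φ : GraphProperty) : Prop :=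
  ∃ B : ℕ, ∀ (V : Type) [Finite V] (G : SimpleGraph V), B ≤ treewidth G → ¬ Φ.holds G

/-! ### Randomized random access machines

Programs are structured programs for a random access machine with finitely many registers and
finitely many arrays of natural numbers (those that occur in the program), addition and
truncated subtraction as the only arithmetic, indirect addressing and fair coin flips.
Every instruction and every test takes one unit of time. There is no multiplication, so
uniform cost is polynomially related to the running time of Turing machines. -/

/-- Programs of the machine. -/
inductive RamProgram : Type
  /-- do nothing -/
  | skip : RamProgram
  /-- `R_r := c` -/
  | const (r c : ℕ) : RamProgram
  /-- `R_r := R_i + R_j` -/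
  | add (r i j : ℕ) : RamProgram
  /-- `R_r := max (R_i - R_j) 0` -/
  | sub (r i j : ℕ) : RamProgram
  /-- `R_r := A_a[R_i]` -/
  | load (r a i : ℕ) : RamProgram
  /-- `A_a[R_i] := R_r` -/
  | store (a i r : ℕ) : RamProgram
  /-- `R_r :=` the outcome (`0` or `1`) of a fair coin flip -/
  | flip (r : ℕ) : RamProgram
  /-- first `p`, then `q` -/
  | seq (p q : RamProgram) : RamProgram
  /-- `p` if `R_r ≠ 0`, and `q` otherwise -/
  | cond (r : ℕ) (p q : RamProgram) : RamProgram
  /-- `p` as long as `R_r ≠ 0` -/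
  | loop (r : ℕ) (p : RamProgram) : RamProgram

/-- States of the machine: registers, arrays, and the outcomes of all future coin flips. -/
structure RamState where
  reg : ℕ → ℕ
  arr : ℕ → ℕ → ℕ
  coins : ℕ → Bool

namespace RamState

/-- `R_r := v`. -/
def setReg (s : RamState) (r v : ℕ) : RamState :=
  { s with reg := Function.update s.reg r v }

/-- `A_a[i] := v`. -/
def setArr (s : RamState) (a i v : ℕ) : RamState :=
  { s with arr := Function.update s.arr a (Function.update (s.arr a) i v) }

/-- `R_r :=` next coin, which is consumed. -/
def flipCoin (s : RamState) (r : ℕ) : RamState where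
  reg := Function.update s.reg r (s.coins 0).toNat
  arr := s.arr
  coins := fun i => s.coins (i + 1)

end RamState

/-- `RamExec p s s' t`: started in state `s`, the program `p` halts in state `s'` after exactly
`t` units of time. -/
inductive RamExec : RamProgram → RamState → RamState → ℕ → Prop
  | skip (s : RamState) : RamExec .skip s s 1
  | const (s : RamState) (r c : ℕ) : RamExec (.const r c) s (s.setReg r c) 1
  | add (s : RamState) (r i j : ℕ) :
      RamExec (.add r i j) s (s.setReg r (s.reg i + s.reg j)) 1
  | sub (s : RamState) (r i j : ℕ) :
      RamExec (.sub r i j) s (s.setReg r (s.reg i - s.reg j)) 1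
  | load (s : RamState) (r a i : ℕ) :
      RamExec (.load r a i) s (s.setReg r (s.arr a (s.reg i))) 1
  | store (s : RamState) (a i r : ℕ) :
      RamExec (.store a i r) s (s.setArr a (s.reg i) (s.reg r)) 1
  | flip (s : RamState) (r : ℕ) : RamExec (.flip r) s (s.flipCoin r) 1
  | seq {p q : RamProgram} {s₁ s₂ s₃ : RamState} {t u : ℕ} :
      RamExec p s₁ s₂ t → RamExec q s₂ s₃ u → RamExec (.seq p q) s₁ s₃ (t + u)
  | cond_true {r : ℕ} {p q : RamProgram} {s s' : RamState} {t : ℕ} :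
      s.reg r ≠ 0 → RamExec p s s' t → RamExec (.cond r p q) s s' (t + 1)
  | cond_false {r : ℕ} {p q : RamProgram} {s s' : RamState} {t : ℕ} :
      s.reg r = 0 → RamExec q s s' t → RamExec (.cond r p q) s s' (t + 1)
  | loop_stop {r : ℕ} {p : RamProgram} {s : RamState} :
      s.reg r = 0 → RamExec (.loop r p) s s 1
  | loop_step {r : ℕ} {p : RamProgram} {s₁ s₂ s₃ : RamState} {t u : ℕ} :
      s₁.reg r ≠ 0 → RamExec p s₁ s₂ t → RamExec (.loop r p) s₂ s₃ u →
        RamExec (.loop r p) s₁ s₃ (t + u + 1)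

/-- The initial state on input `(x, ε, δ)` and coin flips `ω`: the length of `x` and the numerators
and denominators of `ε` and `δ` (in lowest terms) are in registers `0, …, 4`, the bits of `x` are
in array `0`, everything else is `0`. -/
def ramInit (x : List Bool) (ε δ : ℚ) (ω : ℕ → Bool) : RamState where
  reg := fun i => [x.length, ε.num.toNat, ε.den, δ.num.toNat, δ.den].getD i 0
  arr := fun a i => if a = 0 then (x.getD i false).toNat else 0
  coins := ω

/-- The law of an infinite sequence of independent fair coin flips. -/
noncomputable def fairCoins : MeasureTheory.Measure (ℕ → Bool) :=
  MeasureTheory.Measure.infinitePi fun _ : ℕ => (PMF.uniformOfFintype Bool).toMeasure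

/-! ### Parameterized counting problems -/

/-- A parameterized counting problem, whose instances are given to algorithms as bit strings. -/
structure ParamCountingProblem where
  Inst : Type
  enc : Inst → List Bool
  enc_injective : Function.Injective enc
  count : Inst → ℕ
  param : Inst → ℕ

/-- The problem has a fixed-parameter tractable randomized approximation scheme: a randomized
algorithm that on input `(x, ε, δ)` halts, whatever the coins show, within time
`f(κ(x)) · q(|x|, 1/ε, log(1/δ))`, with `f` computable and `q` a polynomial, and whose output
(in register `0`) lies between `(1 - ε) P(x)` and `(1 + ε) P(x)` with probability at
least `1 - δ`. -/
def ParamCountingProblem.HasFPTRAS (P : ParamCountingProblem) : Prop :=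
  ∃ (A : RamProgram) (f : ℕ → ℕ) (q : MvPolynomial (Fin 3) ℕ), Computable f ∧
    ∀ (x : P.Inst) (ε δ : ℚ), 0 < ε → 0 < δ → δ < 1 →
      (∀ ω : ℕ → Bool, ∃ (s : RamState) (t : ℕ), RamExec A (ramInit (P.enc x) ε δ ω) s t ∧
        (t : ℝ) ≤ (f (P.param x) : ℝ) *
          MvPolynomial.aeval
            ![((P.enc x).length : ℝ), 1 / (ε : ℝ), Real.log (1 / (δ : ℝ))] q) ∧
      1 - (δ : ℝ) ≤ fairCoins.real
        {ω | ∃ (s : RamState) (t : ℕ), RamExec A (ramInit (P.enc x) ε δ ω) s t ∧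
          (1 - (ε : ℝ)) * (P.count x : ℝ) ≤ (s.reg 0 : ℝ) ∧
          (s.reg 0 : ℝ) ≤ (1 + (ε : ℝ)) * (P.count x : ℝ)}

/-! ### The problem `#EdgeSub(Φ)` -/

/-- The graph `G[A]` formed by a set `A` of edges: isolated vertices are deleted. -/
def edgeInduced {V : Type} (A : Set (Sym2 V)) :
    SimpleGraph (SimpleGraph.fromEdgeSet A).support :=
  (SimpleGraph.fromEdgeSet A).induce (SimpleGraph.fromEdgeSet A).support

/-- `EdgeSub(Φ, k → G)`: the sets of `k` edges of `G` that form a graph satisfying `Φ`. -/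
def edgeSubs (Φ : GraphProperty) (k : ℕ) {V : Type} [Finite V] (G : SimpleGraph V) :
    Set (Finset (Sym2 V)) :=
  {A | (A : Set (Sym2 V)) ⊆ G.edgeSet ∧ A.card = k ∧ Φ.holds (edgeInduced (A : Set (Sym2 V)))}

/-- The encoding `1ᵏ 0` followed by the encoding of the graph. As `k` is the parameter, the
choice between unary and binary for `k` does not affect fixed-parameter running times. -/
noncomputable def encodeGraphNat (x : (Σ n : ℕ, SimpleGraph (Fin n)) × ℕ+) : List Bool :=
  List.replicate (x.2 : ℕ) true ++ false :: encodeGraph x.1.2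

theorem replicate_append_inj {a b : ℕ} {l m : List Bool}
    (h : List.replicate a true ++ false :: l = List.replicate b true ++ false :: m) :
    a = b ∧ l = m := by
  induction a generalizing b with
  | zero => cases b <;> simp_all [List.replicate_succ]
  | succ a ih =>
    cases b with
    | zero => simp [List.replicate_succ] at h
    | succ b =>
      simp only [List.replicate_succ, List.cons_append, List.cons.injEq, true_and] at h
      have := ih h
      exact ⟨congrArg (· + 1) this.1, this.2⟩

theorem encodeGraphNat_injective : Function.Injective encodeGraphNat := by
  rintro ⟨⟨n, G⟩, k⟩ ⟨⟨m, H⟩, l⟩ h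
  obtain ⟨hk, h⟩ := replicate_append_inj h
  obtain ⟨hn, h⟩ := replicate_append_inj h
  subst hn
  have hk' : k = l := PNat.coe_injective hk
  subst hk'
  have hf := List.ofFn_injective h
  have hG : G = H := by
    ext i j
    have := congrFun hf (finProdFinEquiv (i, j))
    have e := finProdFinEquiv.symm_apply_apply (i, j)
    simp only [finProdFinEquiv_symm_apply, Prod.mk.injEq] at e
    simpa [e.1, e.2] using this
  subst hG
  rfl

/-- `#EdgeSub(Φ)`: given a graph `G` and a positive integer `k`, compute the number of sets of
`k` edges of `G` that form a graph satisfying `Φ`; the parameter is `k`. -/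
noncomputable def edgeSubProblem (Φ : GraphProperty) : ParamCountingProblem where
  Inst := (Σ n : ℕ, SimpleGraph (Fin n)) × ℕ+
  enc := encodeGraphNat
  enc_injective := encodeGraphNat_injective
  count x := (edgeSubs Φ x.2 x.1.2).ncard
  param x := x.2

/-! The count is estimated by an average of independent samples. Suppose that random bits determine
a natural number, computable in time f(k) times a polynomial, whose mean is μ = scale(k) ·
#solutions and which never exceeds K · μ with K ≤ bound(k) · L ^ deg, where L is the input length.
By Hoeffding's inequality, O((K/ε)² log(1/δ)) samples have an average within a factor 1 ± ε/3 of μ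
with probability at least 1 - δ (`fairCoins_estimate`). The output has to be an integer, and
rounding is harmless: a small count is recovered exactly, and for a large one the error 1/2 is
absorbed by ε (`round_estimate`). The structure `Sampler` collects the requirements, and
`Sampler.hasFPTRAS` is the reduction. What remains is one sampler for each hypothesis.

Under the matching and star criteria, k edge numbers are drawn uniformly, and a draw counts if it is
increasing and its edges form a solution. Hits are frequent enough. In a graph with m edges, m large
compared with k², either all degrees are at most m/(4k), and the greedy construction yields many
k-matchings, or some vertex has larger degree and is the centre of many k-stars. So unless there is
no solution at all, (2m)^k is at most a function of k times the number of solutions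
(`card_edgeFinset_pow_le`). The values of k at which a criterion fails lie below a constant k₀, and
there (2m)^k ≤ L^k₀ is polynomial.

Under bounded treewidth, solutions may be rare among the k-sets of edges, and colour coding takes
over. The vertices get uniformly random colours out of C = 4^k, and the sample is the weighted
number of solutions whose vertices have distinct colours. A solution with v vertices has weight C^v
(C - v)!, which makes the mean C! · #solutions regardless of v (`sum_colorValue`), while no
colouring exceeds C^C times the mean (`colorValue_le`). For a fixed colouring, the solutions are
sorted by the graph that they form on the colours. Those with a given pattern correspond to
colour-preserving homomorphisms (`colorSum_eq_card`). The patterns that satisfy Φ have bounded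
treewidth, so variable elimination along a tree decomposition counts the homomorphisms with tables
of n^B entries (`exists_factor_of_runningIntersection`). No decomposition is ever computed: an
elimination sequence is a program for a stack machine, its correctness is decidable (`Accepts`), and
a search finds one because one exists (`exists_accepts_of_treewidth`, `exists_plan`).

The machine has addition and subtraction only. Multiplication and division are built from them in
time polynomial in the number of bits, and every computable function becomes an operation with a
computable time bound (`RamOp.exists_of_computable`). Hence everything that depends on k alone, such
as deciding Φ on graphs with k edges or finding elimination programs, costs a computable function of
k. The algorithms are written in `Cmd`, a language with for-loops in which effect and cost are
functions of the state, and are compiled by `Cmd.exists_program`. -/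

set_option linter.unusedSimpArgs false

/-! ### Random access machine programs -/

namespace RamState

@[simp] theorem setReg_reg (s : RamState) (r v r' : ℕ) :
    (s.setReg r v).reg r' = if r' = r then v else s.reg r' := by
  simp [setReg, Function.update_apply]

@[simp] theorem setReg_arr (s : RamState) (r v : ℕ) : (s.setReg r v).arr = s.arr := rfl

@[simp] theorem setReg_coins (s : RamState) (r v : ℕ) : (s.setReg r v).coins = s.coins := rfl

@[simp] theorem setArr_reg (s : RamState) (a i v : ℕ) : (s.setArr a i v).reg = s.reg := rfl

@[simp] theorem setArr_coins (s : RamState) (a i v : ℕ) : (s.setArr a i v).coins = s.coins := rfl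

@[simp] theorem setArr_arr (s : RamState) (a i v a' i' : ℕ) :
    (s.setArr a i v).arr a' i' = if a' = a ∧ i' = i then v else s.arr a' i' := by
  by_cases h : a' = a
  · subst h; simp [setArr, Function.update_apply]
  · simp [setArr, h]

@[simp] theorem flipCoin_reg (s : RamState) (r r' : ℕ) :
    (s.flipCoin r).reg r' = if r' = r then (s.coins 0).toNat else s.reg r' := by
  simp [flipCoin, Function.update_apply]

@[simp] theorem flipCoin_arr (s : RamState) (r : ℕ) : (s.flipCoin r).arr = s.arr := rfl

@[simp] theorem flipCoin_coins (s : RamState) (r : ℕ) :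
    (s.flipCoin r).coins = fun i => s.coins (i + 1) := rfl

/-- `s'` has the same arrays and coins as `s`, and the same registers below `b`. -/
structure Agree (b : ℕ) (s s' : RamState) : Prop where
  reg : ∀ r < b, s'.reg r = s.reg r
  arr : s'.arr = s.arr
  coins : s'.coins = s.coins

theorem Agree.refl (b : ℕ) (s : RamState) : Agree b s s := ⟨fun _ _ => rfl, rfl, rfl⟩

theorem Agree.trans {b : ℕ} {s₁ s₂ s₃ : RamState} (h : Agree b s₁ s₂) (h' : Agree b s₂ s₃) :
    Agree b s₁ s₃ :=
  ⟨fun r hr => (h'.reg r hr).trans (h.reg r hr), h'.arr.trans h.arr, h'.coins.trans h.coins⟩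

theorem Agree.mono {b c : ℕ} {s s' : RamState} (h : Agree b s s') (hc : c ≤ b) : Agree c s s' :=
  ⟨fun r hr => h.reg r (by omega), h.arr, h.coins⟩

theorem Agree.setReg {b r : ℕ} (hr : b ≤ r) (s : RamState) (v : ℕ) : Agree b s (s.setReg r v) :=
  ⟨fun r' hr' => by simp; omega, rfl, rfl⟩

end RamState

open RamState

/-- Started in `s`, the program halts within time `T` in a state that satisfies `Q`. -/
def Runs (p : RamProgram) (s : RamState) (T : ℕ) (Q : RamState → Prop) : Prop :=
  ∃ s' t, RamExec p s s' t ∧ t ≤ T ∧ Q s'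

/-! ### Rules for executions with a time bound -/

namespace Runs

variable {p q : RamProgram} {s : RamState} {T T' : ℕ} {Q Q' : RamState → Prop}

theorem mono (h : Runs p s T Q) (hT : T ≤ T') (hQ : ∀ s', Q s' → Q' s') : Runs p s T' Q' := by
  obtain ⟨s', t, he, ht, hq⟩ := h
  exact ⟨s', t, he, ht.trans hT, hQ _ hq⟩

theorem seq (h : Runs p s T Q) (h' : ∀ s', Q s' → Runs q s' T' Q') :
    Runs (.seq p q) s (T + T') Q' := by
  obtain ⟨s', t, he, ht, hq⟩ := h
  obtain ⟨s'', t', he', ht', hq'⟩ := h' s' hq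
  exact ⟨s'', _, .seq he he', by omega, hq'⟩

theorem skip (h : Q s) : Runs .skip s 1 Q := ⟨_, _, .skip s, le_rfl, h⟩

theorem const {r c : ℕ} (h : Q (s.setReg r c)) : Runs (.const r c) s 1 Q :=
  ⟨_, _, .const s r c, le_rfl, h⟩

theorem add {r i j : ℕ} (h : Q (s.setReg r (s.reg i + s.reg j))) : Runs (.add r i j) s 1 Q :=
  ⟨_, _, .add s r i j, le_rfl, h⟩

theorem sub {r i j : ℕ} (h : Q (s.setReg r (s.reg i - s.reg j))) : Runs (.sub r i j) s 1 Q :=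
  ⟨_, _, .sub s r i j, le_rfl, h⟩

theorem load {r a i : ℕ} (h : Q (s.setReg r (s.arr a (s.reg i)))) : Runs (.load r a i) s 1 Q :=
  ⟨_, _, .load s r a i, le_rfl, h⟩

theorem store {r a i : ℕ} (h : Q (s.setArr a (s.reg i) (s.reg r))) : Runs (.store a i r) s 1 Q :=
  ⟨_, _, .store s a i r, le_rfl, h⟩

theorem flip {r : ℕ} (h : Q (s.flipCoin r)) : Runs (.flip r) s 1 Q :=
  ⟨_, _, .flip s r, le_rfl, h⟩

theorem const_seq {r c : ℕ} (h : Runs q (s.setReg r c) T Q) :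
    Runs (.seq (.const r c) q) s (T + 1) Q := by
  rw [add_comm]; exact (const (Q := fun s' => s' = s.setReg r c) rfl).seq fun s' h' => h' ▸ h

theorem add_seq {r i j : ℕ} (h : Runs q (s.setReg r (s.reg i + s.reg j)) T Q) :
    Runs (.seq (.add r i j) q) s (T + 1) Q := by
  rw [add_comm]; exact (add (Q := fun s' => s' = _) rfl).seq fun s' h' => h' ▸ h

theorem sub_seq {r i j : ℕ} (h : Runs q (s.setReg r (s.reg i - s.reg j)) T Q) :
    Runs (.seq (.sub r i j) q) s (T + 1) Q := by
  rw [add_comm]; exact (sub (Q := fun s' => s' = _) rfl).seq fun s' h' => h' ▸ h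

theorem cond {r : ℕ} (h : s.reg r ≠ 0 → Runs p s T Q) (h' : s.reg r = 0 → Runs q s T Q) :
    Runs (.cond r p q) s (T + 1) Q := by
  by_cases hr : s.reg r = 0
  · obtain ⟨s', t, he, ht, hq⟩ := h' hr
    exact ⟨s', _, .cond_false hr he, by omega, hq⟩
  · obtain ⟨s', t, he, ht, hq⟩ := h hr
    exact ⟨s', _, .cond_true hr he, by omega, hq⟩

theorem loop_stop {r : ℕ} (hr : s.reg r = 0) (h : Q s) : Runs (.loop r p) s 1 Q :=
  ⟨_, _, RamExec.loop_stop hr, le_rfl, h⟩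

theorem loop_step {r : ℕ} (hr : s.reg r ≠ 0) (h : Runs p s T Q)
    (h' : ∀ s', Q s' → Runs (.loop r p) s' T' Q') : Runs (.loop r p) s (T + T' + 1) Q' := by
  obtain ⟨s', t, he, ht, hq⟩ := h
  obtain ⟨s'', t', he', ht', hq'⟩ := h' s' hq
  exact ⟨s'', _, .loop_step hr he he', by omega, hq'⟩

/-- A loop that is executed exactly `m` times. -/
theorem loop {r m : ℕ} (I : ℕ → RamState → Prop) (τ : ℕ → ℕ) (h0 : I 0 s)
    (hstep : ∀ i < m, ∀ s, I i s → s.reg r ≠ 0 ∧ Runs p s (τ i) (I (i + 1)))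
    (hend : ∀ s, I m s → s.reg r = 0) :
    Runs (.loop r p) s (∑ i ∈ Finset.range m, (τ i + 1) + 1) (I m) := by
  -- A derivation of a loop execution is built from its last pass, so the induction runs downwards
  -- over the number of passes already completed.
  have key : ∀ j ≤ m, ∀ s, I j s →
      Runs (.loop r p) s (∑ i ∈ Finset.Ico j m, (τ i + 1) + 1) (I m) := by
    intro j hj
    induction hj using Nat.decreasingInduction with
    | self => intro s hs; simpa using loop_stop (hend s hs) hs
    | of_succ j hj ih =>
      intro s hs
      obtain ⟨hr, hp⟩ := hstep j hj s hs
      refine (loop_step hr hp fun s' hs' => ih s' hs').mono ?_ fun _ h => h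
      rw [Finset.sum_eq_sum_Ico_succ_bot hj]
      omega
  simpa using key 0 (Nat.zero_le _) s h0

end Runs

/-- A binary function on natural numbers with a program for it: the program takes its arguments
from the registers `b` and `b + 1`, leaves the value in register `b`, and changes nothing else
except registers beyond `b`. -/
structure RamOp where
  fn : ℕ → ℕ → ℕ
  code : ℕ → RamProgram
  cost : ℕ → ℕ → ℕ
  runs : ∀ b s, Runs (code b) s (cost (s.reg b) (s.reg (b + 1)))
    fun s' => s'.reg b = fn (s.reg b) (s.reg (b + 1)) ∧ Agree b s s'

/-! ### Arithmetic from addition and truncated subtraction -/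

namespace RamOp

theorem runs' (o : RamOp) {b x y : ℕ} {s : RamState} (hx : s.reg b = x) (hy : s.reg (b + 1) = y) :
    Runs (o.code b) s (o.cost x y) fun s' => s'.reg b = o.fn x y ∧ Agree b s s' := by
  subst hx hy; exact o.runs b s

def addOp : RamOp where
  fn x y := x + y
  code b := .add b b (b + 1)
  cost _ _ := 1
  runs b s := Runs.add ⟨by simp, Agree.setReg le_rfl _ _⟩

def subOp : RamOp where
  fn x y := x - y
  code b := .sub b b (b + 1)
  cost _ _ := 1
  runs b s := Runs.sub ⟨by simp, Agree.setReg le_rfl _ _⟩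

/-- One round of binary division: see `divLoop_runs`. -/
def divRound (b : ℕ) : RamProgram :=
  .seq (.const (b + 7) 0) <| .seq (.add (b + 4) (b + 1) (b + 7)) <|
  .seq (.add (b + 5) (b + 2) (b + 7)) <| .seq (.const (b + 7) 1) <|
  .seq (.add (b + 9) (b + 4) (b + 4)) <| .seq (.add (b + 8) b (b + 7)) <|
  .seq (.sub (b + 8) (b + 8) (b + 9)) <|
  .seq (.loop (b + 8) <|
    .seq (.add (b + 4) (b + 4) (b + 4)) <| .seq (.add (b + 5) (b + 5) (b + 5)) <|
    .seq (.add (b + 9) (b + 4) (b + 4)) <| .seq (.add (b + 8) b (b + 7)) <|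
    .sub (b + 8) (b + 8) (b + 9)) <|
  .seq (.sub b b (b + 4)) <| .seq (.add (b + 3) (b + 3) (b + 5)) <|
  .seq (.add (b + 6) b (b + 7)) <| .sub (b + 6) (b + 6) (b + 1)

/-- One round removes the leading binary digit of the quotient. Divisor and multiplier are doubled
together as long as the doubled divisor still fits; register `b + 8` is nonzero exactly in that
case. The hypotheses say that this stops after `i` doublings. The truncated difference a + 1 - p in
`b + 6` is nonzero exactly when p ≤ a, and serves as the test for another round. -/
theorem divRound_runs (b i : ℕ) (s : RamState) (h1 : s.reg (b + 1) * 2 ^ i ≤ s.reg b)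
    (h2 : s.reg b < s.reg (b + 1) * 2 ^ (i + 1)) :
    Runs (divRound b) s (6 * i + 12) fun s' => s'.reg b = s.reg b - s.reg (b + 1) * 2 ^ i ∧
      s'.reg (b + 1) = s.reg (b + 1) ∧ s'.reg (b + 2) = s.reg (b + 2) ∧
      s'.reg (b + 3) = s.reg (b + 3) + s.reg (b + 2) * 2 ^ i ∧
      s'.reg (b + 6) = s'.reg b + 1 - s'.reg (b + 1) ∧ Agree b s s' := by
  refine Runs.mono (Runs.const_seq <| Runs.add_seq <| Runs.add_seq <| Runs.const_seq <|
    Runs.add_seq <| Runs.add_seq <| Runs.sub_seq <| Runs.seq (T' := 4)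
    (Runs.loop (m := i) (fun j s' => s'.reg b = s.reg b ∧
      s'.reg (b + 1) = s.reg (b + 1) ∧ s'.reg (b + 2) = s.reg (b + 2) ∧
      s'.reg (b + 3) = s.reg (b + 3) ∧
      s'.reg (b + 4) = s.reg (b + 1) * 2 ^ j ∧ s'.reg (b + 5) = s.reg (b + 2) * 2 ^ j ∧
      s'.reg (b + 7) = 1 ∧ s'.reg (b + 8) = s.reg b + 1 - s.reg (b + 1) * 2 ^ (j + 1) ∧
      Agree b s s') (fun _ => 5) ?_ ?_ ?_) ?_) ?_ fun _ h => h
  · simp only [setReg_reg]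
    simp only [Nat.add_eq_left, Nat.left_eq_add, add_right_inj, OfNat.ofNat_ne_one, if_true, if_false,
      Nat.reduceEqDiff, OfNat.ofNat_ne_zero, one_ne_zero, OfNat.one_ne_ofNat]
    refine ⟨trivial, trivial, trivial, trivial, by simp, by simp, trivial, by simp [two_mul, mul_two],
      ⟨fun r hr => ?_, rfl, rfl⟩⟩
    simp only [setReg_reg]
    repeat rw [if_neg (by omega)]
  · rintro j hj s' ⟨e0, e1, e2, e3, e4, e5, e7, e8, ha⟩
    have hp : s.reg (b + 1) * 2 ^ (j + 1) ≤ s.reg (b + 1) * 2 ^ i :=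
      Nat.mul_le_mul le_rfl (Nat.pow_le_pow_right (by norm_num) hj)
    refine ⟨by omega, ?_⟩
    refine Runs.add_seq <| Runs.add_seq <| Runs.add_seq <| Runs.add_seq <| Runs.sub ?_
    simp only [setReg_reg]
    simp only [Nat.add_eq_left, Nat.left_eq_add, add_right_inj, OfNat.ofNat_ne_one, if_true, if_false,
      Nat.reduceEqDiff, OfNat.ofNat_ne_zero, one_ne_zero, OfNat.one_ne_ofNat]
    refine ⟨e0, e1, e2, e3, by rw [e4]; ring, by rw [e5]; ring, e7, ?_, ⟨fun r hr => ?_, ?_, ?_⟩⟩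
    · rw [e0, e7, e4]; congr 1; ring
    · simp only [setReg_reg]
      repeat rw [if_neg (by omega)]
      exact ha.reg r hr
    · exact ha.arr
    · exact ha.coins
  · rintro s' ⟨e0, e1, e2, e3, e4, e5, e7, e8, ha⟩
    omega
  · rintro s' ⟨e0, e1, e2, e3, e4, e5, e7, e8, ha⟩
    refine Runs.sub_seq <| Runs.add_seq <| Runs.add_seq <| Runs.sub ?_
    simp only [setReg_reg]
    simp only [Nat.add_eq_left, Nat.left_eq_add, add_right_inj, OfNat.ofNat_ne_one, if_true, if_false,
      Nat.reduceEqDiff, OfNat.ofNat_ne_zero, one_ne_zero, OfNat.one_ne_ofNat]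
    refine ⟨by rw [e0, e4], e1, e2, by rw [e3, e5], by rw [e7], ⟨fun r hr => ?_, ?_, ?_⟩⟩
    · simp only [setReg_reg]
      repeat rw [if_neg (by omega)]
      exact ha.reg r hr
    · exact ha.arr
    · exact ha.coins
  · simp; omega

/-- Binary division: with `a`, `p`, `q` in the registers `b`, `b + 1` and `b + 2`,
it adds `(a / p) * q` to register `b + 3`. -/
theorem divLoop_runs (b n : ℕ) : ∀ s : RamState, s.reg (b + 1) ≠ 0 →
    s.reg (b + 6) = s.reg b + 1 - s.reg (b + 1) → s.reg b / s.reg (b + 1) < 2 ^ n →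
    Runs (.loop (b + 6) (divRound b)) s (n * (6 * n + 13) + 1) fun s' =>
      s'.reg (b + 3) = s.reg (b + 3) + s.reg b / s.reg (b + 1) * s.reg (b + 2) ∧ Agree b s s' := by
  induction n with
  | zero =>
    intro s hp ht hq
    have hlt : s.reg b < s.reg (b + 1) := by
      by_contra hlt
      have := Nat.div_pos (not_lt.1 hlt) (Nat.pos_of_ne_zero hp)
      omega
    simp only [zero_mul, zero_add]
    exact Runs.loop_stop (by omega) ⟨by simp [Nat.div_eq_of_lt hlt], Agree.refl _ _⟩
  | succ n ih =>
    intro s hp ht hq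
    have hp' := Nat.pos_of_ne_zero hp
    -- If the digit 2 ^ n of the quotient is zero, no round is spent on it. Otherwise the next round
    -- subtracts exactly 2 ^ n from the quotient.
    by_cases hn : s.reg b / s.reg (b + 1) < 2 ^ n
    · exact (ih s hp ht hn).mono (by nlinarith) fun _ h => h
    · have h1 : s.reg (b + 1) * 2 ^ n ≤ s.reg b := by
        rw [mul_comm, ← Nat.le_div_iff_mul_le hp']; omega
      have h2 : s.reg b < s.reg (b + 1) * 2 ^ (n + 1) := by
        rw [mul_comm, ← Nat.div_lt_iff_lt_mul hp']; omega
      have h3 : (s.reg b - s.reg (b + 1) * 2 ^ n) / s.reg (b + 1) =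
          s.reg b / s.reg (b + 1) - 2 ^ n := Nat.sub_mul_div _ _ _
      refine (Runs.loop_step ?_ (divRound_runs b n s h1 h2) (T' := n * (6 * n + 13) + 1) ?_).mono
        ?_ fun _ h => h
      · have : s.reg (b + 1) * 1 ≤ s.reg (b + 1) * 2 ^ n :=
          Nat.mul_le_mul le_rfl Nat.one_le_two_pow
        omega
      · rintro s' ⟨e0, e1, e2, e3, e6, ha⟩
        refine (ih s' (by omega) e6 ?_).mono le_rfl ?_
        · rw [e0, e1, h3]
          rw [pow_succ] at hq
          omega
        · rintro s'' ⟨e, ha'⟩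
          refine ⟨?_, ha.trans ha'⟩
          rw [e, e0, e1, e2, e3, h3, Nat.sub_mul, add_assoc, mul_comm (s.reg (b + 2))]
          congr 1
          apply Nat.add_sub_cancel'
          exact Nat.mul_le_mul (not_lt.1 hn) le_rfl
      · nlinarith

theorem divLoop_runs_size (b : ℕ) (s : RamState) (hp : s.reg (b + 1) ≠ 0)
    (ht : s.reg (b + 6) = s.reg b + 1 - s.reg (b + 1)) :
    Runs (.loop (b + 6) (divRound b)) s
      ((s.reg b / s.reg (b + 1)).size * (6 * (s.reg b / s.reg (b + 1)).size + 13) + 1) fun s' =>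
      s'.reg (b + 3) = s.reg (b + 3) + s.reg b / s.reg (b + 1) * s.reg (b + 2) ∧ Agree b s s' :=
  divLoop_runs b _ s hp ht (Nat.lt_size_self _)

/-- A bound for the time of multiplications by `a`, and of divisions with quotient `a`. -/
def mulCost (a : ℕ) : ℕ := a.size * (6 * a.size + 13) + 10

theorem mulCost_mono {a a' : ℕ} (h : a ≤ a') : mulCost a ≤ mulCost a' := by
  have := Nat.size_le_size h
  unfold mulCost
  gcongr

/-- The division loop with divisor 1 and multiplier y accumulates (x / 1) * y. Its time depends on
the first factor only, which is why the order of factors matters in later cost estimates. -/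
def mulOp : RamOp where
  fn x y := x * y
  code b :=
    .seq (.const (b + 3) 0) <| .seq (.add (b + 2) (b + 1) (b + 3)) <| .seq (.const (b + 1) 1) <|
    .seq (.add (b + 6) b (b + 3)) <| .seq (.loop (b + 6) (divRound b)) <|
    .seq (.const (b + 4) 0) <| .add b (b + 3) (b + 4)
  cost x _ := mulCost x
  runs b s := by
    refine Runs.mono (Runs.const_seq <| Runs.add_seq <| Runs.const_seq <| Runs.add_seq <|
      Runs.seq (divLoop_runs_size b _ ?_ ?_) (T' := 2)
        (Q' := fun s' => s'.reg b = s.reg b * s.reg (b + 1) ∧ Agree b s s') ?_) ?_ fun _ h => h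
    · simp
    · simp
    · rintro s' ⟨e, ha⟩
      refine Runs.const_seq <| Runs.add ⟨?_, ?_⟩
      · simp [e]
      · refine Agree.trans (s₂ := s') ⟨fun r hr => ?_, ?_, ?_⟩ ⟨fun r hr => ?_, rfl, rfl⟩
        · rw [ha.reg r hr]
          simp only [setReg_reg]
          repeat rw [if_neg (by omega)]
        · rw [ha.arr]; rfl
        · rw [ha.coins]; rfl
        · simp only [setReg_reg]
          repeat rw [if_neg (by omega)]
    · simp [mulCost]; try omega

/-- The same loop with multiplier 1. The time depends on the size of the quotient, not on that of
the dividend; division by zero is caught separately, since the loop would not end. -/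
def divOp : RamOp where
  fn x y := x / y
  code b :=
    .cond (b + 1)
      (.seq (.const (b + 3) 0) <| .seq (.const (b + 2) 1) <|
      .seq (.add (b + 6) b (b + 2)) <| .seq (.sub (b + 6) (b + 6) (b + 1)) <|
      .seq (.loop (b + 6) (divRound b)) <| .seq (.const (b + 4) 0) <| .add b (b + 3) (b + 4))
      (.const b 0)
  cost x y := mulCost (x / y)
  runs b s := by
    refine Runs.mono (Runs.cond (fun hp => ?_) fun hp => ?_)
      (T := mulCost (s.reg b / s.reg (b + 1)) - 1)
      (Q := fun s' => s'.reg b = s.reg b / s.reg (b + 1) ∧ Agree b s s') ?_ fun _ h => h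
    · refine Runs.mono (Runs.const_seq <| Runs.const_seq <| Runs.add_seq <| Runs.sub_seq <|
        Runs.seq (divLoop_runs_size b _ ?_ ?_) (T' := 2)
        (Q' := fun s' => s'.reg b = s.reg b / s.reg (b + 1) ∧ Agree b s s') ?_) ?_ fun _ h => h
      · simpa using hp
      · simp
      · rintro s' ⟨e, ha⟩
        refine Runs.const_seq <| Runs.add ⟨?_, ?_⟩
        · simp [e]
        · refine Agree.trans (s₂ := s') ⟨fun r hr => ?_, ?_, ?_⟩ ⟨fun r hr => ?_, rfl, rfl⟩
          · rw [ha.reg r hr]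
            simp only [setReg_reg]
            repeat rw [if_neg (by omega)]
          · rw [ha.arr]; rfl
          · rw [ha.coins]; rfl
          · simp only [setReg_reg]
            repeat rw [if_neg (by omega)]
      · simp [mulCost]
    · refine Runs.mono (Runs.const ⟨?_, Agree.setReg le_rfl _ _⟩) ?_ fun _ h => h
      all_goals simp [mulCost, show s.reg (b + 1) = 0 from hp]
    · simp [mulCost]

/-- The least `i` with `x ≤ y * 2 ^ i`, if `y ≠ 0`. -/
def clogDiv (x y : ℕ) : ℕ := if y = 0 then 0 else Nat.clog 2 ((x + y - 1) / y)

theorem clogDiv_le_iff {x y i : ℕ} (hy : y ≠ 0) : clogDiv x y ≤ i ↔ x ≤ y * 2 ^ i := by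
  rw [clogDiv, if_neg hy, Nat.clog_le_iff_le_pow (by norm_num)]
  have hy' := Nat.pos_of_ne_zero hy
  rw [← Nat.lt_succ_iff, Nat.div_lt_iff_lt_mul hy', Nat.succ_mul, mul_comm]
  omega

theorem le_mul_two_pow_clogDiv (x : ℕ) {y : ℕ} (hy : y ≠ 0) : x ≤ y * 2 ^ clogDiv x y :=
  (clogDiv_le_iff hy).1 le_rfl

def clogDivOp : RamOp where
  fn := clogDiv
  code b :=
    .seq (.const (b + 2) 0) <| .seq (.const (b + 4) 1) <|
    .seq (.cond (b + 1)
      (.seq (.sub (b + 3) b (b + 1)) <| .loop (b + 3) <|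
        .seq (.add (b + 1) (b + 1) (b + 1)) <| .seq (.add (b + 2) (b + 2) (b + 4)) <|
        .sub (b + 3) b (b + 1)) .skip) <|
    .seq (.const (b + 3) 0) <| .add b (b + 2) (b + 3)
  cost x y := 4 * clogDiv x y + 10
  runs b s := by
    refine Runs.mono (Runs.const_seq <| Runs.const_seq <| Runs.seq (Q := fun s' =>
      s'.reg (b + 2) = clogDiv (s.reg b) (s.reg (b + 1)) ∧ Agree b s s')
      (Q' := fun s' => s'.reg b = clogDiv (s.reg b) (s.reg (b + 1)) ∧ Agree b s s')
      (Runs.cond (T := 4 * clogDiv (s.reg b) (s.reg (b + 1)) + 2)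
        (fun hp => ?_) fun hp => ?_) (T' := 2) ?_) (by omega) fun _ h => h
    · have hp' : s.reg (b + 1) ≠ 0 := by simpa using hp
      refine Runs.mono (Runs.sub_seq <| Runs.loop (m := clogDiv (s.reg b) (s.reg (b + 1)))
        (fun j s' => s'.reg b = s.reg b ∧
        s'.reg (b + 1) = s.reg (b + 1) * 2 ^ j ∧ s'.reg (b + 2) = j ∧ s'.reg (b + 4) = 1 ∧
        s'.reg (b + 3) = s.reg b - s.reg (b + 1) * 2 ^ j ∧ Agree b s s') (fun _ => 3) ?_ ?_ ?_)
        (by simp; omega) ?_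
      · simp only [setReg_reg]
        simp only [Nat.add_eq_left, Nat.left_eq_add, add_right_inj, OfNat.ofNat_ne_one, if_true,
          if_false, Nat.reduceEqDiff, OfNat.ofNat_ne_zero, one_ne_zero, OfNat.one_ne_ofNat]
        refine ⟨trivial, by simp, trivial, trivial, by simp, ⟨fun r hr => ?_, rfl, rfl⟩⟩
        simp only [setReg_reg]
        repeat rw [if_neg (by omega)]
      · rintro j hj s' ⟨e0, e1, e2, e4, e3, ha⟩
        have : ¬ clogDiv (s.reg b) (s.reg (b + 1)) ≤ j := by omega
        rw [clogDiv_le_iff hp'] at this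
        refine ⟨by omega, Runs.add_seq <| Runs.add_seq <| Runs.sub ?_⟩
        simp only [setReg_reg]
        simp only [Nat.add_eq_left, Nat.left_eq_add, add_right_inj, OfNat.ofNat_ne_one, if_true,
          if_false, Nat.reduceEqDiff, OfNat.ofNat_ne_zero, one_ne_zero, OfNat.one_ne_ofNat]
        refine ⟨e0, by rw [e1]; ring, by rw [e2, e4], e4, by rw [e0, e1]; congr 1; ring,
          ⟨fun r hr => ?_, ha.arr, ha.coins⟩⟩
        simp only [setReg_reg]
        repeat rw [if_neg (by omega)]
        exact ha.reg r hr
      · rintro s' ⟨e0, e1, e2, e4, e3, ha⟩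
        have := le_mul_two_pow_clogDiv (s.reg b) hp'
        omega
      · rintro s' ⟨e0, e1, e2, e4, e3, ha⟩
        exact ⟨e2, ha⟩
    · have hp' : s.reg (b + 1) = 0 := by simpa using hp
      refine Runs.mono (Runs.skip (Q := fun s' =>
        s'.reg (b + 2) = clogDiv (s.reg b) (s.reg (b + 1)) ∧ Agree b s s') ⟨?_, ?_⟩) (by omega)
        fun _ h => h
      · simp [hp', clogDiv]
      · refine ⟨fun r hr => ?_, rfl, rfl⟩
        simp only [setReg_reg]
        repeat rw [if_neg (by omega)]
    · rintro s' ⟨e, ha⟩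
      refine Runs.const_seq <| Runs.add ⟨by simp [e], ?_⟩
      refine ha.trans ⟨fun r hr => ?_, rfl, rfl⟩
      simp only [setReg_reg]
      repeat rw [if_neg (by omega)]

end RamOp

open RamState

/-! ### Iteration and search as operations -/

namespace RamOp

/-- Iteration of a unary operation. -/
def iterOp (o : RamOp) : RamOp where
  fn x m := (fun w => o.fn w 0)^[m] x
  code b :=
    .seq (.loop (b + 1) <|
      .seq (.const (b + 3) 0) <| .seq (.add (b + 2) b (b + 3)) <| .seq (o.code (b + 2)) <|
      .seq (.const (b + 3) 0) <| .seq (.add b (b + 2) (b + 3)) <|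
      .seq (.const (b + 3) 1) <| .sub (b + 1) (b + 1) (b + 3)) .skip
  cost x m := ∑ i ∈ Finset.range m, (o.cost ((fun w => o.fn w 0)^[i] x) 0 + 7) + 2
  runs b s := by
    refine Runs.mono (Runs.seq (T' := 1) (Runs.loop (m := s.reg (b + 1))
      (fun i s' => s'.reg b = (fun w => o.fn w 0)^[i] (s.reg b) ∧
        s'.reg (b + 1) = s.reg (b + 1) - i ∧ Agree b s s')
      (fun i => o.cost ((fun w => o.fn w 0)^[i] (s.reg b)) 0 + 6) ?_ ?_ ?_) ?_) le_rfl fun _ h => h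
    · exact ⟨rfl, rfl, Agree.refl _ _⟩
    · rintro i hi s' ⟨e0, e1, ha⟩
      refine ⟨by omega, ?_⟩
      refine Runs.mono (Runs.const_seq <| Runs.add_seq <| Runs.seq (T' := 4)
        (o.runs' (x := (fun w => o.fn w 0)^[i] (s.reg b)) (y := 0) ?_ ?_) ?_) le_rfl fun _ h => h
      · simp [e0]
      · simp
      · rintro s'' ⟨e, ha'⟩
        refine Runs.const_seq <| Runs.add_seq <| Runs.const_seq <| Runs.sub ?_
        have h1 := ha'.reg (b + 1) (by omega)
        simp only [setReg_reg] at h1 ⊢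
        simp only [Nat.add_eq_left, Nat.left_eq_add, add_right_inj, OfNat.ofNat_ne_one, if_true,
          if_false, Nat.reduceEqDiff, OfNat.ofNat_ne_zero, one_ne_zero, OfNat.one_ne_ofNat] at h1 ⊢
        refine ⟨?_, by omega, ⟨fun r hr => ?_, ?_, ?_⟩⟩
        · rw [Function.iterate_succ_apply', e]; rfl
        · have h2 := ha'.reg r (by omega)
          simp only [setReg_reg] at h2 ⊢
          repeat rw [if_neg (by omega)]
          repeat rw [if_neg (by omega)] at h2
          rw [h2, ha.reg r hr]
        · exact ha'.arr.trans ha.arr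
        · exact ha'.coins.trans ha.coins
    · rintro s' ⟨e0, e1, ha⟩
      omega
    · rintro s' ⟨e0, e1, ha⟩
      exact Runs.skip ⟨e0, ha⟩

/-- Unbounded search. -/
def searchOp (o : RamOp) (h : ∀ x, ∃ n, o.fn x n ≠ 0) : RamOp where
  fn x _ := Nat.find (h x)
  code b :=
    .seq (.const (b + 1) 0) <| .seq (.const (b + 3) 0) <| .seq (.add (b + 2) b (b + 3)) <|
    .seq (o.code (b + 2)) <| .seq (.const (b + 3) 1) <| .seq (.sub (b + 2) (b + 3) (b + 2)) <|
    .seq (.loop (b + 2) <|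
      .seq (.const (b + 3) 1) <| .seq (.add (b + 1) (b + 1) (b + 3)) <|
      .seq (.const (b + 4) 0) <| .seq (.add (b + 3) (b + 1) (b + 4)) <|
      .seq (.add (b + 2) b (b + 4)) <|
      .seq (o.code (b + 2)) <| .seq (.const (b + 3) 1) <| .sub (b + 2) (b + 3) (b + 2)) <|
    .seq (.const (b + 3) 0) <| .add b (b + 1) (b + 3)
  cost x _ := ∑ i ∈ Finset.range (Nat.find (h x)), (o.cost x (i + 1) + 8) + o.cost x 0 + 8
  runs b s := by
    refine Runs.mono (Runs.const_seq <| Runs.const_seq <| Runs.add_seq <|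
      Runs.seq (o.runs' (x := s.reg b) (y := 0) (by simp) (by simp)) (T' :=
        ∑ i ∈ Finset.range (Nat.find (h (s.reg b))), (o.cost (s.reg b) (i + 1) + 8) + 5)
        (Q' := fun s' => s'.reg b = Nat.find (h (s.reg b)) ∧ Agree b s s') ?_) (by omega)
      fun _ h => h
    rintro s₁ ⟨e, ha⟩
    have h0 := ha.reg b (by omega)
    have h1 := ha.reg (b + 1) (by omega)
    simp only [setReg_reg, Nat.add_eq_left, Nat.left_eq_add, add_right_inj, OfNat.ofNat_ne_one, if_true,
      if_false, Nat.reduceEqDiff, OfNat.ofNat_ne_zero, one_ne_zero, OfNat.one_ne_ofNat] at h0 h1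
    refine Runs.mono (Runs.const_seq <| Runs.sub_seq <| Runs.seq (T' := 2)
      (Runs.loop (m := Nat.find (h (s.reg b)))
      (fun i s' => s'.reg b = s.reg b ∧ s'.reg (b + 1) = i ∧
        s'.reg (b + 2) = 1 - o.fn (s.reg b) i ∧ Agree b s s')
      (fun i => o.cost (s.reg b) (i + 1) + 7) ?_ ?_ ?_) ?_) le_rfl fun _ h => h
    · simp only [setReg_reg, Nat.add_eq_left, Nat.left_eq_add, add_right_inj, OfNat.ofNat_ne_one,
        if_true, if_false, Nat.reduceEqDiff, OfNat.ofNat_ne_zero, one_ne_zero, OfNat.one_ne_ofNat]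
      refine ⟨h0, h1, by rw [e], ⟨fun r hr => ?_, ha.arr, ha.coins⟩⟩
      have h2 := ha.reg r (by omega)
      simp only [setReg_reg] at h2 ⊢
      repeat rw [if_neg (by omega)]
      repeat rw [if_neg (by omega)] at h2
      exact h2
    · rintro i hi s₂ ⟨e0, e1, e2, ha₂⟩
      have hz : o.fn (s.reg b) i = 0 := by
        by_contra hne
        exact Nat.find_min (h (s.reg b)) hi hne
      refine ⟨by rw [e2, hz]; norm_num, ?_⟩
      refine Runs.mono (Runs.const_seq <| Runs.add_seq <| Runs.const_seq <| Runs.add_seq <|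
        Runs.add_seq <| Runs.seq (T' := 2) (o.runs' (x := s.reg b) (y := i + 1) ?_ ?_) ?_)
        (by omega) fun _ h => h
      · simp [e0]
      · simp [e1]
      · rintro s₃ ⟨e', ha'⟩
        refine Runs.const_seq <| Runs.sub ?_
        have h3 := ha'.reg b (by omega)
        have h4 := ha'.reg (b + 1) (by omega)
        simp only [setReg_reg, Nat.add_eq_left, Nat.left_eq_add, add_right_inj, OfNat.ofNat_ne_one,
          if_true, if_false, Nat.reduceEqDiff, OfNat.ofNat_ne_zero, one_ne_zero,
          OfNat.one_ne_ofNat] at h3 h4 ⊢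
        refine ⟨h3.trans e0, by rw [h4, e1], by rw [e'], ⟨fun r hr => ?_, ?_, ?_⟩⟩
        · have h2 := ha'.reg r (by omega)
          simp only [setReg_reg] at h2 ⊢
          repeat rw [if_neg (by omega)]
          repeat rw [if_neg (by omega)] at h2
          rw [h2, ha₂.reg r hr]
        · exact ha'.arr.trans ha₂.arr
        · exact ha'.coins.trans ha₂.coins
    · rintro s₂ ⟨e0, e1, e2, ha₂⟩
      have := Nat.find_spec (h (s.reg b))
      omega
    · rintro s₂ ⟨e0, e1, e2, ha₂⟩
      refine Runs.const_seq <| Runs.add ?_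
      simp only [setReg_reg, Nat.add_eq_left, Nat.left_eq_add, add_right_inj, OfNat.ofNat_ne_one,
        if_true, if_false, Nat.reduceEqDiff, OfNat.ofNat_ne_zero, one_ne_zero, OfNat.one_ne_ofNat]
      refine ⟨by omega, ⟨fun r hr => ?_, ha₂.arr, ha₂.coins⟩⟩
      simp only [setReg_reg]
      repeat rw [if_neg (by omega)]
      exact ha₂.reg r hr

end RamOp

/-! ### Expressions -/

/-- Expressions in the registers. -/
inductive Exp : Type
  | reg (r : ℕ)
  | num (c : ℕ)
  | op (o : RamOp) (e₁ e₂ : Exp)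
  | ite (e₁ e₂ e₃ : Exp)

namespace Exp

instance : Add Exp := ⟨op .addOp⟩
instance : Sub Exp := ⟨op .subOp⟩
instance : Mul Exp := ⟨op .mulOp⟩
instance : Div Exp := ⟨op .divOp⟩
instance (n : ℕ) : OfNat Exp n := ⟨num n⟩

/-- The value of an expression when the registers contain `ρ`. -/
def eval (ρ : ℕ → ℕ) : Exp → ℕ
  | reg r => ρ r
  | num c => c
  | op o e₁ e₂ => o.fn (e₁.eval ρ) (e₂.eval ρ)
  | ite e₁ e₂ e₃ => if e₁.eval ρ ≠ 0 then e₂.eval ρ else e₃.eval ρ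

/-- A bound for the time to evaluate an expression. -/
def cost (ρ : ℕ → ℕ) : Exp → ℕ
  | reg _ => 2
  | num _ => 1
  | op o e₁ e₂ => e₁.cost ρ + (e₂.cost ρ + o.cost (e₁.eval ρ) (e₂.eval ρ))
  | ite e₁ e₂ e₃ => e₁.cost ρ + ((if e₁.eval ρ ≠ 0 then e₂.cost ρ else e₃.cost ρ) + 1)

/-- All registers of the expression satisfy `P`. -/
def All (P : ℕ → Prop) : Exp → Prop
  | reg r => P r
  | num _ => True
  | op _ e₁ e₂ => e₁.All P ∧ e₂.All P
  | ite e₁ e₂ e₃ => e₁.All P ∧ e₂.All P ∧ e₃.All P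

/-- A program that evaluates an expression, with `m r` as the name of register `r`, and leaves the
value in register `b`. -/
def code (m : ℕ → ℕ) : Exp → ℕ → RamProgram
  | reg r, b => .seq (.const b 0) (.add b (m r) b)
  | num c, b => .const b c
  | op o e₁ e₂, b => .seq (e₁.code m b) (.seq (e₂.code m (b + 1)) (o.code b))
  | ite e₁ e₂ e₃, b => .seq (e₁.code m b) (.cond b (e₂.code m b) (e₃.code m b))

theorem eval_congr {ρ ρ' : ℕ → ℕ} {e : Exp} (h : e.All fun r => ρ r = ρ' r) :
    e.eval ρ = e.eval ρ' ∧ e.cost ρ = e.cost ρ' := by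
  induction e with
  | reg r => exact ⟨h, rfl⟩
  | num c => exact ⟨rfl, rfl⟩
  | op o e₁ e₂ ih₁ ih₂ => simp [eval, cost, ih₁ h.1, ih₂ h.2]
  | ite e₁ e₂ e₃ ih₁ ih₂ ih₃ => simp [eval, cost, ih₁ h.1, ih₂ h.2.1, ih₃ h.2.2]

theorem All.mono {P Q : ℕ → Prop} (hPQ : ∀ r, P r → Q r) {e : Exp} (h : e.All P) : e.All Q := by
  induction e with
  | reg r => exact hPQ r h
  | num c => trivial
  | op o e₁ e₂ ih₁ ih₂ => exact ⟨ih₁ h.1, ih₂ h.2⟩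
  | ite e₁ e₂ e₃ ih₁ ih₂ ih₃ => exact ⟨ih₁ h.1, ih₂ h.2.1, ih₃ h.2.2⟩

/-- The registers from `b` on act as an operand stack. An operation placed at `b + 1` leaves
everything below untouched, so the first operand survives the evaluation of the second, and the
variables survive because their registers lie below `b`. -/
theorem code_runs (m : ℕ → ℕ) (e : Exp) (b : ℕ) (s : RamState) (hm : e.All fun r => m r < b) :
    Runs (e.code m b) s (e.cost fun r => s.reg (m r))
      fun s' => s'.reg b = e.eval (fun r => s.reg (m r)) ∧ Agree b s s' := by
  induction e generalizing b s with
  | reg r =>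
    refine Runs.const_seq <| Runs.add ⟨?_, ?_⟩
    · have : m r ≠ b := Nat.ne_of_lt hm
      simp [this, eval]
    · exact (Agree.setReg le_rfl _ _).trans (Agree.setReg le_rfl _ _)
  | num c => exact Runs.const ⟨by simp [eval], Agree.setReg le_rfl _ _⟩
  | op o e₁ e₂ ih₁ ih₂ =>
    refine Runs.seq (ih₁ b s hm.1) fun s₁ h₁ => ?_
    have hm' := hm.2.mono (Q := fun r => m r < b + 1) fun r h => by omega
    have hc : e₂.All fun r => s₁.reg (m r) = s.reg (m r) :=
      hm.2.mono fun r h => h₁.2.reg _ h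
    have := ih₂ (b + 1) s₁ hm'
    rw [(eval_congr hc).1, (eval_congr hc).2] at this
    refine Runs.seq this fun s₂ h₂ => ?_
    refine (o.runs' (h₂.2.reg b (by omega) |>.trans h₁.1) h₂.1).mono le_rfl fun s₃ h₃ => ?_
    exact ⟨h₃.1, h₁.2.trans <| (h₂.2.mono (by omega)).trans h₃.2⟩
  | ite e₁ e₂ e₃ ih₁ ih₂ ih₃ =>
    refine Runs.seq (ih₁ b s hm.1) fun s₁ h₁ => ?_
    have hc₂ : e₂.All fun r => s₁.reg (m r) = s.reg (m r) :=
      hm.2.1.mono fun r h => h₁.2.reg _ h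
    have hc₃ : e₃.All fun r => s₁.reg (m r) = s.reg (m r) :=
      hm.2.2.mono fun r h => h₁.2.reg _ h
    refine Runs.cond (fun h => ?_) fun h => ?_
    · rw [h₁.1] at h
      rw [if_pos h, eval, if_pos h, ← (eval_congr hc₂).1, ← (eval_congr hc₂).2]
      exact (ih₂ b s₁ hm.2.1).mono le_rfl fun s₂ h₂ => ⟨h₂.1, h₁.2.trans h₂.2⟩
    · rw [h₁.1] at h
      rw [if_neg (by simpa using h), eval, if_neg (by simpa using h), ← (eval_congr hc₃).1,
        ← (eval_congr hc₃).2]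
      exact (ih₃ b s₁ hm.2.2).mono le_rfl fun s₂ h₂ => ⟨h₂.1, h₁.2.trans h₂.2⟩

@[simp] theorem eval_reg (ρ : ℕ → ℕ) (r : ℕ) : (reg r).eval ρ = ρ r := rfl
@[simp] theorem eval_num (ρ : ℕ → ℕ) (n : ℕ) : (no_index (OfNat.ofNat n) : Exp).eval ρ = n := rfl
@[simp] theorem eval_num' (ρ : ℕ → ℕ) (n : ℕ) : (num n).eval ρ = n := rfl
@[simp] theorem eval_add (ρ : ℕ → ℕ) (e f : Exp) : (e + f).eval ρ = e.eval ρ + f.eval ρ := rfl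
@[simp] theorem eval_sub (ρ : ℕ → ℕ) (e f : Exp) : (e - f).eval ρ = e.eval ρ - f.eval ρ := rfl
@[simp] theorem eval_mul (ρ : ℕ → ℕ) (e f : Exp) : (e * f).eval ρ = e.eval ρ * f.eval ρ := rfl
@[simp] theorem eval_div (ρ : ℕ → ℕ) (e f : Exp) : (e / f).eval ρ = e.eval ρ / f.eval ρ := rfl
@[simp] theorem eval_op (ρ : ℕ → ℕ) (o : RamOp) (e f : Exp) :
    (op o e f).eval ρ = o.fn (e.eval ρ) (f.eval ρ) := rfl
@[simp] theorem eval_ite (ρ : ℕ → ℕ) (e₁ e₂ e₃ : Exp) :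
    (ite e₁ e₂ e₃).eval ρ = if e₁.eval ρ ≠ 0 then e₂.eval ρ else e₃.eval ρ := rfl

@[simp] theorem cost_reg (ρ : ℕ → ℕ) (r : ℕ) : (reg r).cost ρ = 2 := rfl
@[simp] theorem cost_num (ρ : ℕ → ℕ) (n : ℕ) : (no_index (OfNat.ofNat n) : Exp).cost ρ = 1 := rfl
@[simp] theorem cost_num' (ρ : ℕ → ℕ) (n : ℕ) : (num n).cost ρ = 1 := rfl
@[simp] theorem cost_add (ρ : ℕ → ℕ) (e f : Exp) :
    (e + f).cost ρ = e.cost ρ + (f.cost ρ + 1) := rfl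
@[simp] theorem cost_sub (ρ : ℕ → ℕ) (e f : Exp) :
    (e - f).cost ρ = e.cost ρ + (f.cost ρ + 1) := rfl
@[simp] theorem cost_mul (ρ : ℕ → ℕ) (e f : Exp) :
    (e * f).cost ρ = e.cost ρ + (f.cost ρ + RamOp.mulCost (e.eval ρ)) := rfl
@[simp] theorem cost_div (ρ : ℕ → ℕ) (e f : Exp) :
    (e / f).cost ρ = e.cost ρ + (f.cost ρ + RamOp.mulCost (e.eval ρ / f.eval ρ)) := rfl
@[simp] theorem cost_op (ρ : ℕ → ℕ) (o : RamOp) (e f : Exp) :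
    (op o e f).cost ρ = e.cost ρ + (f.cost ρ + o.cost (e.eval ρ) (f.eval ρ)) := rfl
@[simp] theorem cost_ite (ρ : ℕ → ℕ) (e₁ e₂ e₃ : Exp) :
    (ite e₁ e₂ e₃).cost ρ =
      e₁.cost ρ + ((if e₁.eval ρ ≠ 0 then e₂.cost ρ else e₃.cost ρ) + 1) := rfl

/-- The environment in which register `0` contains `x` and all others contain `y`. -/
def env (x y r : ℕ) : ℕ := if r = 0 then x else y

@[simp] theorem env_zero (x y : ℕ) : env x y 0 = x := rfl
@[simp] theorem env_one (x y : ℕ) : env x y 1 = y := rfl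

/-- The operation computed by an expression in two variables. -/
def toOp (e : Exp) : RamOp where
  fn x y := e.eval (env x y)
  code b := .seq (e.code (fun r => if r = 0 then b else b + 1) (b + 2))
    (.seq (.const (b + 3) 0) (.add b (b + 2) (b + 3)))
  cost x y := e.cost (env x y) + 2
  runs b s := by
    have h := e.code_runs (fun r => if r = 0 then b else b + 1) (b + 2) s (by
      induction e with
      | reg r => simp only [All]; split_ifs <;> omega
      | num c => trivial
      | op o e₁ e₂ ih₁ ih₂ => exact ⟨ih₁, ih₂⟩
      | ite e₁ e₂ e₃ ih₁ ih₂ ih₃ => exact ⟨ih₁, ih₂, ih₃⟩)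
    have he : (fun r => s.reg (if r = 0 then b else b + 1)) = env (s.reg b) (s.reg (b + 1)) := by
      funext r; unfold env; split_ifs <;> rfl
    rw [he] at h
    refine h.seq fun s' hs' => Runs.const_seq <| Runs.add ⟨by simp [hs'.1], ?_⟩
    refine ((hs'.2.mono (by omega)).trans (Agree.setReg (by omega) _ _)).trans
      (Agree.setReg le_rfl _ _)

end Exp

/-! ### Computable functions -/

/-- The function and the time bound of the operation are computable. -/
structure RamOp.Effective (o : RamOp) : Prop where
  fn : Computable₂ o.fn
  cost : Computable₂ o.cost

/-- The size of n is the greatest i ≤ n + 1 with 2 ^ (i - 1) ≤ n, a bounded search. For n = 0 no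
positive i qualifies and the search returns its default 0, as it should. -/
theorem Primrec.nat_size : Primrec Nat.size := by
  have h1 : Primrec fun i : ℕ => 2 ^ i := by
    refine (Primrec.nat_rec₁ 1 (f := fun _ IH => IH + IH)
      (Primrec.nat_add.comp Primrec.snd Primrec.snd).to₂).of_eq fun n => ?_
    induction n with
    | zero => rfl
    | succ n ih => simp_all [pow_succ, mul_two]
  have h2 : PrimrecRel fun (n i : ℕ) => 2 ^ (i - 1) ≤ n := Primrec.nat_le.comp
    (h1.comp (Primrec.nat_sub.comp Primrec.snd (Primrec.const 1))) Primrec.fst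
  refine (Primrec.nat_findGreatest (f := fun n : ℕ => n + 1) Primrec.succ h2).of_eq fun n => ?_
  rw [Nat.findGreatest_eq_iff]
  refine ⟨Nat.size_le.2 ?_, fun h => ?_, fun i hi _ => ?_⟩
  · exact (Nat.lt_two_pow_self).trans (Nat.pow_lt_pow_right (by norm_num) (by omega))
  · exact Nat.lt_size.1 (by omega)
  · rw [← Nat.lt_size]; omega

theorem Computable.sum_range {α : Type*} [Primcodable α] {f : α → ℕ} {g : α → ℕ → ℕ}
    (hf : Computable f) (hg : Computable₂ g) :
    Computable fun a => ∑ i ∈ Finset.range (f a), g a i := by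
  have h : Computable₂ fun (a : α) (p : ℕ × ℕ) => p.2 + g a p.1 :=
    (Primrec.nat_add.to_comp.comp (Computable.snd.comp Computable.snd)
      (hg.comp Computable.fst (Computable.fst.comp Computable.snd))).to₂
  refine (Computable.nat_rec hf (Computable.const 0) h).of_eq fun a => ?_
  induction f a with
  | zero => simp
  | succ n ih => rw [Finset.sum_range_succ, ← ih]

theorem Computable.nat_iterate' {α σ : Type*} [Primcodable α] [Primcodable σ] {f : α → ℕ}
    {g : α → σ} {h : σ → σ} (hf : Computable f) (hg : Computable g) (hh : Computable h) :
    Computable fun a => h^[f a] (g a) := by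
  have h' : Computable₂ fun (_ : α) (p : ℕ × σ) => h p.2 :=
    (hh.comp (Computable.snd.comp Computable.snd)).to₂
  refine (Computable.nat_rec hf hg h').of_eq fun a => ?_
  induction f a with
  | zero => rfl
  | succ n ih => rw [Function.iterate_succ_apply', ← ih]

theorem Computable.nat_find {α : Type*} [Primcodable α] {p : α → ℕ → Prop}
    [∀ a, DecidablePred (p a)] (hp : Computable₂ fun a n => decide (p a n))
    (h : ∀ a, ∃ n, p a n) : Computable fun a => Nat.find (h a) := by
  have := Partrec.rfind (p := fun a n => (Part.some (decide (p a n)) : Part Bool)) hp.partrec₂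
  refine Partrec.of_eq this fun a => ?_
  refine Part.eq_some_iff.2 ?_
  refine Nat.mem_rfind.2 ⟨?_, fun {m} hm => ?_⟩
  · simpa using Nat.find_spec (h a)
  · simpa using Nat.find_min (h a) hm

theorem Computable.nat_ne_zero : Computable fun n : ℕ => decide (n ≠ 0) :=
  ((Primrec.nat_lt.comp (Primrec.const 0) Primrec.id).decide.of_eq fun n => by
    simp [Nat.pos_iff_ne_zero]).to_comp

/-! ### Operations with computable values and time bounds -/

namespace RamOp

theorem computable_mulCost : Computable mulCost := by
  have : Primrec mulCost := by
    unfold mulCost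
    exact Primrec.nat_add.comp (Primrec.nat_mul.comp Primrec.nat_size (Primrec.nat_add.comp
      (Primrec.nat_mul.comp (Primrec.const 6) Primrec.nat_size) (Primrec.const 13)))
      (Primrec.const 10)
  exact this.to_comp

theorem addOp_effective : addOp.Effective :=
  ⟨Primrec.nat_add.to_comp, (Computable.const 1).to₂⟩

theorem subOp_effective : subOp.Effective :=
  ⟨Primrec.nat_sub.to_comp, (Computable.const 1).to₂⟩

theorem mulOp_effective : mulOp.Effective :=
  ⟨Primrec.nat_mul.to_comp, (computable_mulCost.comp Computable.fst).to₂⟩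

theorem Effective.iterOp {o : RamOp} (ho : o.Effective) : o.iterOp.Effective := by
  have h1 : Computable fun w => o.fn w 0 := ho.fn.comp Computable.id (Computable.const 0)
  refine ⟨(Computable.nat_iterate' Computable.snd Computable.fst h1).to₂, ?_⟩
  have h2 : Computable₂ fun (p : ℕ × ℕ) i => o.cost ((fun w => o.fn w 0)^[i] p.1) 0 + 7 :=
    (Primrec.nat_add.to_comp.comp (ho.cost.comp (Computable.nat_iterate' Computable.snd
      (Computable.fst.comp Computable.fst) h1) (Computable.const 0)) (Computable.const 7)).to₂
  exact (Primrec.nat_add.to_comp.comp (Computable.sum_range Computable.snd h2)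
    (Computable.const 2)).to₂

theorem Effective.searchOp {o : RamOp} (ho : o.Effective) (h : ∀ x, ∃ n, o.fn x n ≠ 0) :
    (o.searchOp h).Effective := by
  have h1 : Computable fun x => Nat.find (h x) :=
    Computable.nat_find (p := fun x n => o.fn x n ≠ 0) (Computable.nat_ne_zero.comp ho.fn) h
  refine ⟨(h1.comp Computable.fst).to₂, ?_⟩
  have h2 : Computable₂ fun (x : ℕ) i => o.cost x (i + 1) + 8 :=
    (Primrec.nat_add.to_comp.comp (ho.cost.comp Computable.fst
      (Computable.succ.comp Computable.snd)) (Computable.const 8)).to₂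
  have h3 : Computable fun x : ℕ => ∑ i ∈ Finset.range (Nat.find (h x)), (o.cost x (i + 1) + 8) +
      o.cost x 0 + 8 := Primrec.nat_add.to_comp.comp (Primrec.nat_add.to_comp.comp
    (Computable.sum_range h1 h2) (ho.cost.comp Computable.id (Computable.const 0)))
    (Computable.const 8)
  exact (h3.comp Computable.fst).to₂

end RamOp

namespace Exp

/-- All operations of the expression are effective. -/
def Effective : Exp → Prop
  | reg _ => True
  | num _ => True
  | op o e₁ e₂ => o.Effective ∧ e₁.Effective ∧ e₂.Effective
  | ite e₁ e₂ e₃ => e₁.Effective ∧ e₂.Effective ∧ e₃.Effective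

theorem Effective.computable {e : Exp} (he : e.Effective) :
    Computable₂ (fun x y => e.eval (env x y)) ∧ Computable₂ (fun x y => e.cost (env x y)) := by
  have hadd := Primrec.nat_add.to_comp
  induction e with
  | reg r =>
    refine ⟨?_, (Computable.const 2).to₂⟩
    by_cases hr : r = 0
    · simpa [eval, env, hr] using (Computable.fst (α := ℕ) (β := ℕ)).to₂
    · simpa [eval, env, hr] using (Computable.snd (α := ℕ) (β := ℕ)).to₂
  | num c => exact ⟨(Computable.const c).to₂, (Computable.const 1).to₂⟩
  | op o e₁ e₂ ih₁ ih₂ =>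
    obtain ⟨h₁, c₁⟩ := ih₁ he.2.1
    obtain ⟨h₂, c₂⟩ := ih₂ he.2.2
    exact ⟨(he.1.fn.comp h₁ h₂).to₂, (hadd.comp c₁ (hadd.comp c₂ (he.1.cost.comp h₁ h₂))).to₂⟩
  | ite e₁ e₂ e₃ ih₁ ih₂ ih₃ =>
    obtain ⟨h₁, c₁⟩ := ih₁ he.1
    obtain ⟨h₂, c₂⟩ := ih₂ he.2.1
    obtain ⟨h₃, c₃⟩ := ih₃ he.2.2
    have hd := Computable.nat_ne_zero.comp h₁
    refine ⟨((Computable.cond hd h₂ h₃).of_eq (g := fun p : ℕ × ℕ => if e₁.eval (env p.1 p.2) ≠ 0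
      then e₂.eval (env p.1 p.2) else e₃.eval (env p.1 p.2)) fun p => ?_).to₂, (hadd.comp c₁ (hadd.comp
      ((Computable.cond hd c₂ c₃).of_eq (g := fun p : ℕ × ℕ => if e₁.eval (env p.1 p.2) ≠ 0
      then e₂.cost (env p.1 p.2) else e₃.cost (env p.1 p.2)) fun p => ?_)
      (Computable.const 1))).to₂⟩
    · by_cases h : e₁.eval (env p.1 p.2) = 0 <;> simp [h]
    · by_cases h : e₁.eval (env p.1 p.2) = 0 <;> simp [h]

theorem effective_reg (r : ℕ) : (reg r).Effective := trivial

theorem effective_num (c : ℕ) : (num c).Effective := trivial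

theorem _root_.RamOp.Effective.op {o : RamOp} {e f : Exp} (ho : o.Effective) (he : e.Effective)
    (hf : f.Effective) : (Exp.op o e f).Effective := ⟨ho, he, hf⟩

theorem Effective.toOp {e : Exp} (he : e.Effective) : e.toOp.Effective :=
  ⟨he.computable.1, (Primrec.nat_add.to_comp.comp he.computable.2 (Computable.const 2)).to₂⟩

theorem Effective.add {e f : Exp} (he : e.Effective) (hf : f.Effective) : (e + f).Effective :=
  ⟨RamOp.addOp_effective, he, hf⟩

theorem Effective.sub {e f : Exp} (he : e.Effective) (hf : f.Effective) : (e - f).Effective :=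
  ⟨RamOp.subOp_effective, he, hf⟩

theorem Effective.mul {e f : Exp} (he : e.Effective) (hf : f.Effective) : (e * f).Effective :=
  ⟨RamOp.mulOp_effective, he, hf⟩

/-- The pairing function. -/
def pair (e f : Exp) : Exp := ite (f - e) (f * f + e) (e * e + e + f)

theorem eval_pair (ρ : ℕ → ℕ) (e f : Exp) : (pair e f).eval ρ = Nat.pair (e.eval ρ) (f.eval ρ) := by
  simp only [pair, eval_ite, eval_sub, eval_add, eval_mul, Nat.pair, Nat.sub_ne_zero_iff_lt]

theorem Effective.pair {e f : Exp} (he : e.Effective) (hf : f.Effective) :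
    (pair e f).Effective :=
  ⟨hf.sub he, (hf.mul hf).add he, ((he.mul he).add he).add hf⟩

/-- Guarantees that the search for the first n with x < (n + 1)² ends. The speed of the search is
irrelevant: square roots serve only for unpairing, on arguments controlled by the parameter. -/
theorem sqrt_aux (x : ℕ) : ∃ n, (((reg 1 + 1) * (reg 1 + 1) - reg 0 : Exp).toOp).fn x n ≠ 0 :=
  ⟨x, by simp only [toOp, eval_sub, eval_mul, eval_add, eval_reg, env_zero, env_one, eval_num]
         have : x < (x + 1) * (x + 1) := by nlinarith
         show (x + 1) * (x + 1) - x ≠ 0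
         omega⟩

/-- The integer square root. -/
def sqrt (e : Exp) : Exp := op (RamOp.searchOp _ sqrt_aux) e (num 0)

theorem eval_sqrt (ρ : ℕ → ℕ) (e : Exp) : (sqrt e).eval ρ = Nat.sqrt (e.eval ρ) := by
  have hn : ∀ n, (((reg 1 + 1) * (reg 1 + 1) - reg 0 : Exp).toOp).fn (e.eval ρ) n ≠ 0 ↔
      e.eval ρ < (n + 1) * (n + 1) := by
    intro n
    show (n + 1) * (n + 1) - e.eval ρ ≠ 0 ↔ _
    omega
  show Nat.find _ = _
  rw [Nat.find_eq_iff]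
  refine ⟨(hn _).2 (Nat.sqrt_lt.1 (Nat.lt_succ_self _)), fun m hm => ?_⟩
  rw [hn, ← Nat.sqrt_lt]
  omega

theorem Effective.sqrt {e : Exp} (he : e.Effective) : (sqrt e).Effective := by
  have h1 : (reg 1 + 1 : Exp).Effective := Effective.add (e := reg 1) (f := num 1) trivial trivial
  exact ⟨((h1.mul h1).sub (f := reg 0) trivial).toOp.searchOp _, he, trivial⟩

/-- The first component of a pair. -/
def left (e : Exp) : Exp :=
  ite (sqrt e - (e - sqrt e * sqrt e)) (e - sqrt e * sqrt e) (sqrt e)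

/-- The second component of a pair. -/
def right (e : Exp) : Exp :=
  ite (sqrt e - (e - sqrt e * sqrt e)) (sqrt e) (e - sqrt e * sqrt e - sqrt e)

theorem eval_left (ρ : ℕ → ℕ) (e : Exp) : (left e).eval ρ = (e.eval ρ).unpair.1 := by
  simp only [left, eval_ite, eval_sub, eval_mul, eval_sqrt, Nat.unpair,
    Nat.sub_ne_zero_iff_lt]
  split_ifs <;> rfl

theorem eval_right (ρ : ℕ → ℕ) (e : Exp) : (right e).eval ρ = (e.eval ρ).unpair.2 := by
  simp only [right, eval_ite, eval_sub, eval_mul, eval_sqrt, Nat.unpair,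
    Nat.sub_ne_zero_iff_lt]
  split_ifs <;> rfl

theorem Effective.left {e : Exp} (he : e.Effective) : (left e).Effective :=
  have h := he.sub (he.sqrt.mul he.sqrt)
  ⟨he.sqrt.sub h, h, he.sqrt⟩

theorem Effective.right {e : Exp} (he : e.Effective) : (right e).Effective :=
  have h := he.sub (he.sqrt.mul he.sqrt)
  ⟨he.sqrt.sub h, he.sqrt, h.sub he.sqrt⟩

end Exp

/-! ### Machine operations for all computable functions -/

namespace RamOp

open Exp

/-- Induction over the generation of primitive recursive functions. The projections of a pair come
from integer square roots, and primitive recursion is iteration of a single step function on a coded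
state. -/
theorem exists_of_primrec {f : ℕ → ℕ} (hf : Nat.Primrec f) :
    ∃ o : RamOp, (∀ x y, o.fn x y = f x) ∧ o.Effective := by
  induction hf with
  | zero => exact ⟨(num 0).toOp, fun _ _ => rfl, Effective.toOp trivial⟩
  | succ =>
    exact ⟨(reg 0 + num 1).toOp, fun _ _ => rfl, (Effective.add (effective_reg 0) (effective_num 1)).toOp⟩
  | left =>
    exact ⟨(Exp.left (reg 0)).toOp, fun _ _ => eval_left _ _,
      (effective_reg 0).left.toOp⟩
  | right =>
    exact ⟨(Exp.right (reg 0)).toOp, fun _ _ => eval_right _ _,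
      (effective_reg 0).right.toOp⟩
  | pair _ _ ihf ihg =>
    obtain ⟨o₁, h₁, e₁⟩ := ihf
    obtain ⟨o₂, h₂, e₂⟩ := ihg
    refine ⟨(Exp.pair (op o₁ (reg 0) (num 0)) (op o₂ (reg 0) (num 0))).toOp, fun x y => ?_,
      (Effective.pair (e₁.op (effective_reg 0) (effective_num 0)) (e₂.op (effective_reg 0) (effective_num 0))).toOp⟩
    simp [toOp, eval_pair, h₁, h₂]
  | comp _ _ ihf ihg =>
    obtain ⟨o₁, h₁, e₁⟩ := ihf
    obtain ⟨o₂, h₂, e₂⟩ := ihg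
    refine ⟨(op o₁ (op o₂ (reg 0) (num 0)) (num 0)).toOp, fun x y => ?_,
      Effective.toOp ⟨e₁, ⟨e₂, trivial, trivial⟩, trivial⟩⟩
    simp [toOp, h₁, h₂]
  | @prec f g _ _ ihf ihg =>
    obtain ⟨o₁, h₁, e₁⟩ := ihf
    obtain ⟨o₂, h₂, e₂⟩ := ihg
    -- The state codes the parameter, the number of steps done and the current value of the
    -- recursion; iterating the step n times therefore evaluates the recursion at n.
    let st : RamOp := (Exp.pair (Exp.left (reg 0))
      (Exp.pair (Exp.left (Exp.right (reg 0)) + num 1) (op o₂ (reg 0) (num 0)))).toOp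
    have hst : st.Effective := by
      refine (Effective.pair (effective_reg 0).left (Effective.pair
        (Effective.add (Effective.left (effective_reg 0).right) (effective_num 1))
        (e₂.op (effective_reg 0) (effective_num 0)))).toOp
    have hfn : ∀ z n a, st.fn (Nat.pair z (Nat.pair n a)) 0 =
        Nat.pair z (Nat.pair (n + 1) (g (Nat.pair z (Nat.pair n a)))) := by
      intro z n a
      simp [st, toOp, eval_pair, eval_left, eval_right, h₂]
    have hit : ∀ z n, (fun w => st.fn w 0)^[n] (Nat.pair z (Nat.pair 0 (f z))) =
        Nat.pair z (Nat.pair n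
          (n.rec (f z) fun y IH => g (Nat.pair z (Nat.pair y IH)))) := by
      intro z n
      induction n with
      | zero => rfl
      | succ n ih => rw [Function.iterate_succ_apply', ih, hfn]
    refine ⟨(Exp.right (Exp.right (op st.iterOp (Exp.pair (Exp.left (reg 0)) (Exp.pair (num 0)
      (op o₁ (Exp.left (reg 0)) (num 0)))) (Exp.right (reg 0))))).toOp, fun x y => ?_, ?_⟩
    · simp only [toOp, eval_right, eval_op, eval_pair, eval_left, eval_reg, env_zero, eval_num', h₁]
      show (Nat.unpair (Nat.unpair ((fun w => st.fn w 0)^[x.unpair.2] _)).2).2 = _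
      rw [hit]
      simp
    · refine Effective.toOp (Effective.right (Effective.right (hst.iterOp.op (Effective.pair
        (effective_reg 0).left (Effective.pair (effective_num 0)
        (e₁.op (effective_reg 0).left (effective_num 0))))
        (effective_reg 0).right)))

/-- Every computable function is computed by an operation of the machine, in computable time. -/
theorem exists_of_computable {F : ℕ → ℕ → ℕ} (hF : Computable₂ F) :
    ∃ o : RamOp, o.fn = F ∧ Computable₂ o.cost := by
  -- Kleene's normal form: evaluation of a code with limited fuel is primitive recursive, and the
  -- only unbounded search is the one for sufficient fuel.
  obtain ⟨c, hc⟩ := Nat.Partrec.Code.exists_code.1 (Partrec.nat_iff.1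
    (hF.comp (Computable.fst.comp Computable.unpair) (Computable.snd.comp Computable.unpair)))
  have hp : Nat.Primrec fun w => Encodable.encode
      (Nat.Partrec.Code.evaln w.unpair.2 c w.unpair.1) := by
    rw [← Primrec.nat_iff]
    exact Primrec.encode.comp (Nat.Partrec.Code.primrec_evaln.comp (Primrec.pair (Primrec.pair
      (Primrec.snd.comp Primrec.unpair) (Primrec.const c)) (Primrec.fst.comp Primrec.unpair)))
  obtain ⟨o, ho, he⟩ := exists_of_primrec hp
  let o' : RamOp := (op o (Exp.pair (reg 0) (reg 1)) (num 0)).toOp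
  have he' : o'.Effective := Effective.toOp ⟨he, (effective_reg 0).pair (effective_reg 1), trivial⟩
  have hfn : ∀ x n, o'.fn x n = Encodable.encode (Nat.Partrec.Code.evaln n c x) := by
    intro x n
    simp [o', toOp, eval_pair, ho]
  have hmem : ∀ x, F x.unpair.1 x.unpair.2 ∈ c.eval x := by
    intro x; rw [hc]; simp
  have hex : ∀ x, ∃ n, o'.fn x n ≠ 0 := by
    intro x
    obtain ⟨n, hn⟩ := Nat.Partrec.Code.evaln_complete.1 (hmem x)
    refine ⟨n, ?_⟩
    rw [hfn, Option.mem_def.1 hn]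
    simp
  -- The encoding of an optional number is 0 for `none` and v + 1 for `some v`. So a nonzero value
  -- signals termination, and subtracting 1 recovers the result.
  let e : Exp := op o' (Exp.pair (reg 0) (reg 1))
    (op (searchOp o' hex) (Exp.pair (reg 0) (reg 1)) (num 0)) - num 1
  have hee : e.Effective := Effective.sub ⟨he', (effective_reg 0).pair (effective_reg 1), he'.searchOp hex,
    (effective_reg 0).pair (effective_reg 1), trivial⟩ trivial
  refine ⟨e.toOp, ?_, hee.toOp.cost⟩
  funext x y
  have hs := Nat.find_spec (hex (Nat.pair x y))
  have : e.toOp.fn x y = o'.fn (Nat.pair x y) (Nat.find (hex (Nat.pair x y))) - 1 := by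
    simp [e, toOp, eval_pair, searchOp]
  rw [this]
  rw [hfn] at hs ⊢
  cases hv : Nat.Partrec.Code.evaln (Nat.find (hex (Nat.pair x y))) c (Nat.pair x y) with
  | none => simp [hv] at hs
  | some v =>
    have h1 := Part.mem_unique (Nat.Partrec.Code.evaln_sound (Option.mem_def.2 hv))
      (hmem (Nat.pair x y))
    simp at h1
    simp [h1]

end RamOp

open RamState

/-! ### A programming language with bounded loops -/

/-- Commands over the registers and arrays of the machine. -/
inductive Cmd : Type
  | skip
  | set (r : ℕ) (e : Exp)
  | load (r a : ℕ) (e : Exp)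
  | store (a : ℕ) (i e : Exp)
  | flip (r : ℕ)
  | seq (c d : Cmd)
  | ite (e : Exp) (c d : Cmd)
  | loop (r : ℕ) (e : Exp) (c : Cmd)

namespace Cmd

/-- The state after the execution of a command. -/
def den : Cmd → RamState → RamState
  | skip, s => s
  | set r e, s => s.setReg r (e.eval s.reg)
  | load r a e, s => s.setReg r (s.arr a (e.eval s.reg))
  | store a i e, s => s.setArr a (i.eval s.reg) (e.eval s.reg)
  | flip r, s => s.flipCoin r
  | seq c d, s => d.den (c.den s)
  | ite e c d, s => if e.eval s.reg ≠ 0 then c.den s else d.den s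
  | loop r e c, s => Nat.rec s (fun i t => c.den (t.setReg r i)) (e.eval s.reg)

/-- A bound for the time to execute a command. -/
def cost : Cmd → RamState → ℕ
  | skip, _ => 1
  | set _ e, s => e.cost s.reg + 2
  | load _ _ e, s => e.cost s.reg + 1
  | store _ i e, s => i.cost s.reg + (e.cost s.reg + 1)
  | flip _, _ => 1
  | seq c d, s => c.cost s + d.cost (c.den s)
  | ite e c d, s => e.cost s.reg + ((if e.eval s.reg ≠ 0 then c.cost s else d.cost s) + 1)
  | loop r e c, s => e.cost s.reg + (∑ i ∈ Finset.range (e.eval s.reg),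
      (c.cost ((Nat.rec s (fun i t => c.den (t.setReg r i)) i : RamState).setReg r i) + 6) + 2)

/-- All registers of the command are below `B`. -/
def Below (B : ℕ) : Cmd → Prop
  | skip => True
  | set r e => r < B ∧ e.All (· < B)
  | load r _ e => r < B ∧ e.All (· < B)
  | store _ i e => i.All (· < B) ∧ e.All (· < B)
  | flip r => r < B
  | seq c d => c.Below B ∧ d.Below B
  | ite e c d => e.All (· < B) ∧ c.Below B ∧ d.Below B
  | loop r e c => r < B ∧ e.All (· < B) ∧ c.Below B

/-- The code of a command, with the registers from `b` on for intermediate results. -/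
def code : Cmd → ℕ → RamProgram
  | skip, _ => .skip
  | set r e, b => .seq (e.code id b) (.seq (.const (b + 1) 0) (.add r b (b + 1)))
  | load r a e, b => .seq (e.code id b) (.load r a b)
  | store a i e, b => .seq (i.code id b) (.seq (e.code id (b + 1)) (.store a b (b + 1)))
  | flip r, _ => .flip r
  | seq c d, b => .seq (c.code b) (d.code b)
  | ite e c d, b => .seq (e.code id b) (.cond b (c.code b) (d.code b))
  | loop r e c, b => .seq (e.code id b) (.seq (.const (b + 1) 0) (.loop b
      (.seq (.const (b + 2) 0) (.seq (.add r (b + 1) (b + 2)) (.seq (c.code (b + 3))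
      (.seq (.const (b + 2) 1) (.seq (.add (b + 1) (b + 1) (b + 2)) (.sub b b (b + 2)))))))))

theorem exists_exp_all_lt (e : Exp) : ∃ B, ∀ B' ≥ B, e.All (· < B') := by
  induction e with
  | reg r => exact ⟨r + 1, fun _ h => h⟩
  | num c => exact ⟨0, fun _ _ => trivial⟩
  | op o e₁ e₂ ih₁ ih₂ =>
    obtain ⟨B₁, h₁⟩ := ih₁
    obtain ⟨B₂, h₂⟩ := ih₂
    exact ⟨max B₁ B₂, fun B' h => ⟨h₁ _ (le_of_max_le_left h), h₂ _ (le_of_max_le_right h)⟩⟩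
  | ite e₁ e₂ e₃ ih₁ ih₂ ih₃ =>
    obtain ⟨B₁, h₁⟩ := ih₁
    obtain ⟨B₂, h₂⟩ := ih₂
    obtain ⟨B₃, h₃⟩ := ih₃
    exact ⟨max B₁ (max B₂ B₃), fun B' h => ⟨h₁ _ (le_of_max_le_left h),
      h₂ _ (le_of_max_le_left (le_of_max_le_right h)),
      h₃ _ (le_of_max_le_right (le_of_max_le_right h))⟩⟩

theorem exists_below (c : Cmd) : ∃ B, ∀ B' ≥ B, c.Below B' := by
  induction c with
  | skip => exact ⟨0, fun _ _ => trivial⟩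
  | set r e =>
    obtain ⟨B, h⟩ := exists_exp_all_lt e
    exact ⟨max (r + 1) B, fun B' h' => ⟨le_of_max_le_left h', h _ (le_of_max_le_right h')⟩⟩
  | load r a e =>
    obtain ⟨B, h⟩ := exists_exp_all_lt e
    exact ⟨max (r + 1) B, fun B' h' => ⟨le_of_max_le_left h', h _ (le_of_max_le_right h')⟩⟩
  | store a i e =>
    obtain ⟨B₁, h₁⟩ := exists_exp_all_lt i
    obtain ⟨B₂, h₂⟩ := exists_exp_all_lt e
    exact ⟨max B₁ B₂, fun B' h => ⟨h₁ _ (le_of_max_le_left h), h₂ _ (le_of_max_le_right h)⟩⟩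
  | flip r => exact ⟨r + 1, fun _ h => h⟩
  | seq c d ih₁ ih₂ =>
    obtain ⟨B₁, h₁⟩ := ih₁
    obtain ⟨B₂, h₂⟩ := ih₂
    exact ⟨max B₁ B₂, fun B' h => ⟨h₁ _ (le_of_max_le_left h), h₂ _ (le_of_max_le_right h)⟩⟩
  | ite e c d ih₁ ih₂ =>
    obtain ⟨B₁, h₁⟩ := ih₁
    obtain ⟨B₂, h₂⟩ := ih₂
    obtain ⟨B₃, h₃⟩ := exists_exp_all_lt e
    exact ⟨max B₃ (max B₁ B₂), fun B' h => ⟨h₃ _ (le_of_max_le_left h),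
      h₁ _ (le_of_max_le_left (le_of_max_le_right h)),
      h₂ _ (le_of_max_le_right (le_of_max_le_right h))⟩⟩
  | loop r e c ih =>
    obtain ⟨B₁, h₁⟩ := ih
    obtain ⟨B₃, h₃⟩ := exists_exp_all_lt e
    exact ⟨max (r + 1) (max B₃ B₁), fun B' h => ⟨le_of_max_le_left h,
      h₃ _ (le_of_max_le_left (le_of_max_le_right h)),
      h₁ _ (le_of_max_le_right (le_of_max_le_right h))⟩⟩

theorem exp_runs {e : Exp} {B b : ℕ} (he : e.All (· < B)) (hb : B ≤ b) {s₀ s : RamState}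
    (h : Agree B s₀ s) : Runs (e.code id b) s (e.cost s₀.reg)
      fun s' => s'.reg b = e.eval s₀.reg ∧ Agree b s s' := by
  have := e.code_runs id b s (he.mono fun r hr => lt_of_lt_of_le hr hb)
  have hc : e.All fun r => s.reg (id r) = s₀.reg r := he.mono fun r hr => h.reg r hr
  rwa [(Exp.eval_congr hc).1, (Exp.eval_congr hc).2] at this

/-- A simulation: the machine state agrees with the abstract state below `B`, and all other
registers are scratch space. The second part of the conclusion is needed for nested loops, whose
counters lie between `B` and the scratch space of the loop body and must survive it. -/
theorem code_runs (c : Cmd) {B : ℕ} (hc : c.Below B) (b : ℕ) (hb : B ≤ b) (s₀ s : RamState)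
    (h : Agree B s₀ s) : Runs (c.code b) s (c.cost s₀)
      fun s' => Agree B (c.den s₀) s' ∧ ∀ r, B ≤ r → r < b → s'.reg r = s.reg r := by
  induction c generalizing b s₀ s with
  | skip => exact Runs.skip ⟨h, fun _ _ _ => rfl⟩
  | set r e =>
    have hr : r < B := hc.1
    refine (exp_runs hc.2 hb h).seq (T' := 2) fun s₁ h₁ => Runs.const_seq <| Runs.add
      ⟨⟨fun q hq => ?_, ?_, ?_⟩, fun q hq hq' => ?_⟩
    · have h2 := h₁.2.reg q (by omega)
      have h3 := h.reg q hq
      simp [den]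
      split_ifs with h4 h5 h5
      · exact h₁.1
      · omega
      · rw [h2, h3]
    · exact h₁.2.arr.trans h.arr
    · exact h₁.2.coins.trans h.coins
    · simp only [setReg_reg]
      rw [if_neg (by omega), if_neg (by omega)]
      exact h₁.2.reg q hq'
  | load r a e =>
    have hr : r < B := hc.1
    refine (exp_runs hc.2 hb h).seq fun s₁ h₁ => Runs.load
      ⟨⟨fun q hq => ?_, ?_, ?_⟩, fun q hq hq' => ?_⟩
    · have h2 := h₁.2.reg q (by omega)
      have h3 := h.reg q hq
      simp [den, h₁.1, h₁.2.arr, h.arr, h2, h3]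
    · exact h₁.2.arr.trans h.arr
    · exact h₁.2.coins.trans h.coins
    · simp only [setReg_reg]
      rw [if_neg (by omega)]
      exact h₁.2.reg q hq'
  | store a i e =>
    refine (exp_runs hc.1 hb h).seq fun s₁ h₁ => ?_
    refine (exp_runs hc.2 (Nat.le_succ_of_le hb) (h.trans (h₁.2.mono hb))).seq fun s₂ h₂ =>
      Runs.store ⟨⟨fun q hq => ?_, ?_, ?_⟩, fun q hq hq' => ?_⟩
    · simp [den, h₂.2.reg q (by omega), h₁.2.reg q (by omega), h.reg q hq]
    · have h3 := h₂.2.reg b (by omega)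
      funext a' i'
      simp only [setArr_arr, den, h₂.1, h3, h₁.1, h₂.2.arr, h₁.2.arr, h.arr]
    · exact h₂.2.coins.trans (h₁.2.coins.trans h.coins)
    · simp [h₂.2.reg q (by omega), h₁.2.reg q (by omega)]
  | flip r =>
    have hr : r < B := hc
    refine Runs.flip ⟨⟨fun q hq => ?_, h.arr, ?_⟩, fun q hq hq' => ?_⟩
    · simp [den, h.reg q hq, h.coins]
    · simp [den, h.coins]
    · simp only [flipCoin_reg]
      rw [if_neg (by omega)]
  | seq c d ih₁ ih₂ =>
    refine (ih₁ hc.1 b hb s₀ s h).seq fun s₁ h₁ => ?_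
    refine (ih₂ hc.2 b hb _ s₁ h₁.1).mono le_rfl fun s₂ h₂ => ⟨h₂.1, fun r hr hr' => ?_⟩
    rw [h₂.2 r hr hr', h₁.2 r hr hr']
  | ite e c d ih₁ ih₂ =>
    refine (exp_runs hc.1 hb h).seq fun s₁ h₁ => ?_
    have h' := h.trans (h₁.2.mono hb)
    refine Runs.cond (fun hz => ?_) fun hz => ?_
    · rw [h₁.1] at hz
      rw [den, if_pos hz, if_pos hz]
      refine (ih₁ hc.2.1 b hb s₀ s₁ h').mono le_rfl fun s₂ h₂ => ⟨h₂.1, fun r hr hr' => ?_⟩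
      rw [h₂.2 r hr hr', h₁.2.reg r hr']
    · rw [h₁.1] at hz
      rw [den, if_neg (by simpa using hz), if_neg (by simpa using hz)]
      refine (ih₂ hc.2.2 b hb s₀ s₁ h').mono le_rfl fun s₂ h₂ => ⟨h₂.1, fun r hr hr' => ?_⟩
      rw [h₂.2 r hr hr', h₁.2.reg r hr']
  | loop r e c ih =>
    have hr : r < B := hc.1
    refine (exp_runs hc.2.1 hb h).seq fun s₁ h₁ => ?_
    -- Register `b` holds the number of passes left and `b + 1` the number of the current pass. The
    -- loop variable is a copy of the latter, so the body may overwrite it freely.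
    refine Runs.mono (Runs.const_seq <| Runs.loop (m := e.eval s₀.reg) (fun i s' =>
      Agree B (Nat.rec s₀ (fun i t => c.den (t.setReg r i)) i) s' ∧
      s'.reg b = e.eval s₀.reg - i ∧ s'.reg (b + 1) = i ∧
      ∀ r, B ≤ r → r < b → s'.reg r = s.reg r)
      (fun i => c.cost ((Nat.rec s₀ (fun i t => c.den (t.setReg r i)) i : RamState).setReg r i) + 5)
      ?_ ?_ ?_) le_rfl ?_
    · refine ⟨⟨fun q hq => ?_, h₁.2.arr.trans h.arr, h₁.2.coins.trans h.coins⟩, ?_, ?_,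
        fun q hq hq' => ?_⟩
      · simp only [setReg_reg]
        rw [if_neg (by omega), h₁.2.reg q (by omega), h.reg q hq]
        rfl
      · simp [h₁.1]
      · simp
      · simp only [setReg_reg]
        rw [if_neg (by omega), h₁.2.reg q hq']
    · rintro i hi s₂ ⟨ha, e0, e1, hf⟩
      refine ⟨by omega, ?_⟩
      refine Runs.mono (Runs.const_seq <| Runs.add_seq <| Runs.seq (T' := 3)
        (ih hc.2.2 (b + 3) (by omega)
          ((Nat.rec s₀ (fun i t => c.den (t.setReg r i)) i : RamState).setReg r i) _
          ⟨fun q hq => ?_, ?_, ?_⟩) ?_) le_rfl fun _ h => h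
      · simp only [setReg_reg]
        by_cases hqr : q = r
        · simp [hqr, e1]
        · rw [if_neg hqr, if_neg hqr, if_neg (by omega), ha.reg q hq]
      · exact ha.arr
      · exact ha.coins
      · rintro s₃ ⟨ha', hf'⟩
        refine Runs.const_seq <| Runs.add_seq <| Runs.sub ⟨⟨fun q hq => ?_, ha'.arr, ha'.coins⟩,
          ?_, ?_, fun q hq hq' => ?_⟩
        · simp only [setReg_reg]
          rw [if_neg (by omega), if_neg (by omega), if_neg (by omega)]
          exact ha'.reg q hq
        · have := hf' b hb (by omega)
          simp only [setReg_reg] at this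
          rw [if_neg (by omega), if_neg (by omega)] at this
          simp [this, e0]
          omega
        · have := hf' (b + 1) (by omega) (by omega)
          simp only [setReg_reg] at this
          rw [if_neg (by omega), if_neg (by omega)] at this
          simp [this, e1]
        · have := hf' q (by omega) (by omega)
          simp only [setReg_reg] at this
          rw [if_neg (by omega), if_neg (by omega)] at this
          simp only [setReg_reg]
          rw [if_neg (by omega), if_neg (by omega), if_neg (by omega), this]
          exact hf q hq hq'
    · rintro s₂ ⟨ha, e0, e1, hf⟩
      omega
    · rintro s₂ ⟨ha, e0, e1, hf⟩
      exact ⟨ha, hf⟩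

/-- Every command is executed by a program. -/
theorem exists_program (c : Cmd) : ∃ p : RamProgram, ∀ s, Runs p s (c.cost s)
    fun s' => s'.reg 0 = (c.den s).reg 0 := by
  obtain ⟨B, hB⟩ := c.exists_below
  refine ⟨c.code (B + 1), fun s => ?_⟩
  exact (c.code_runs (hB (B + 1) (by omega)) (B + 1) le_rfl s s (Agree.refl _ _)).mono le_rfl
    fun s' h => h.1.reg 0 (by omega)

/-! ### Reasoning about commands -/

/-- The registers to which the command assigns values. -/
def wregs : Cmd → List ℕ
  | skip => []
  | set r _ => [r]
  | load r _ _ => [r]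
  | store _ _ _ => []
  | flip r => [r]
  | seq c d => c.wregs ++ d.wregs
  | ite _ c d => c.wregs ++ d.wregs
  | loop r _ c => r :: c.wregs

/-- The arrays to which the command assigns values. -/
def warrs : Cmd → List ℕ
  | skip => []
  | set _ _ => []
  | load _ _ _ => []
  | store a _ _ => [a]
  | flip _ => []
  | seq c d => c.warrs ++ d.warrs
  | ite _ c d => c.warrs ++ d.warrs
  | loop _ _ c => c.warrs

/-- The command does not flip coins. -/
def NoFlip : Cmd → Prop
  | skip => True
  | set _ _ => True
  | load _ _ _ => True
  | store _ _ _ => True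
  | flip _ => False
  | seq c d => c.NoFlip ∧ d.NoFlip
  | ite _ c d => c.NoFlip ∧ d.NoFlip
  | loop _ _ c => c.NoFlip

/-- `s'` agrees with `s` in everything that the command does not change. -/
structure Frame (c : Cmd) (s s' : RamState) : Prop where
  reg : ∀ r, r ∉ c.wregs → s'.reg r = s.reg r
  arr : ∀ a, a ∉ c.warrs → s'.arr a = s.arr a
  coins : c.NoFlip → s'.coins = s.coins

theorem Frame.trans {c : Cmd} {s₁ s₂ s₃ : RamState} (h : c.Frame s₁ s₂) (h' : c.Frame s₂ s₃) :
    c.Frame s₁ s₃ :=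
  ⟨fun r hr => (h'.reg r hr).trans (h.reg r hr), fun r hr => (h'.arr r hr).trans (h.arr r hr),
    fun hc => (h'.coins hc).trans (h.coins hc)⟩

theorem Frame.refl (c : Cmd) (s : RamState) : c.Frame s s :=
  ⟨fun _ _ => rfl, fun _ _ => rfl, fun _ => rfl⟩

theorem frame_loopState {r : ℕ} {e : Exp} {c : Cmd} (h : ∀ s, c.Frame s (c.den s)) (s : RamState)
    (n : ℕ) : (loop r e c).Frame s (Nat.rec s (fun i t => c.den (t.setReg r i)) n) := by
  induction n with
  | zero => exact Frame.refl _ _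
  | succ n ih =>
    refine ih.trans ⟨fun q hq => ?_, fun a ha => ?_, fun hc => ?_⟩
    · simp only [wregs, List.mem_cons, not_or] at hq
      have := (h ((Nat.rec s (fun i t => c.den (t.setReg r i)) n : RamState).setReg r n)).reg q hq.2
      simpa [hq.1] using this
    · exact (h ((Nat.rec s (fun i t => c.den (t.setReg r i)) n : RamState).setReg r n)).arr a ha
    · exact (h ((Nat.rec s (fun i t => c.den (t.setReg r i)) n : RamState).setReg r n)).coins hc

theorem frame_den (c : Cmd) (s : RamState) : c.Frame s (c.den s) := by
  induction c generalizing s with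
  | skip => exact Frame.refl _ _
  | set r e => exact ⟨fun q hq => by simp_all [wregs, den], fun _ _ => rfl, fun _ => rfl⟩
  | load r a e => exact ⟨fun q hq => by simp_all [wregs, den], fun _ _ => rfl, fun _ => rfl⟩
  | store a i e =>
    exact ⟨fun q hq => rfl, fun a' ha => by funext i; simp_all [warrs, den], fun _ => rfl⟩
  | flip r => exact ⟨fun q hq => by simp_all [wregs, den], fun _ _ => rfl, fun h => h.elim⟩
  | seq c d ih₁ ih₂ =>
    have h1 := ih₁ s
    have h2 := ih₂ (c.den s)
    refine ⟨fun q hq => ?_, fun a ha => ?_, fun hc => ?_⟩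
    · simp only [wregs, List.mem_append, not_or] at hq
      exact (h2.reg q hq.2).trans (h1.reg q hq.1)
    · simp only [warrs, List.mem_append, not_or] at ha
      exact (h2.arr a ha.2).trans (h1.arr a ha.1)
    · exact (h2.coins hc.2).trans (h1.coins hc.1)
  | ite e c d ih₁ ih₂ =>
    have h1 := ih₁ s
    have h2 := ih₂ s
    refine ⟨fun q hq => ?_, fun a ha => ?_, fun hc => ?_⟩
    · simp only [wregs, List.mem_append, not_or] at hq
      rw [den]; split_ifs
      exacts [h1.reg q hq.1, h2.reg q hq.2]
    · simp only [warrs, List.mem_append, not_or] at ha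
      rw [den]; split_ifs
      exacts [h1.arr a ha.1, h2.arr a ha.2]
    · rw [den]; split_ifs
      exacts [h1.coins hc.1, h2.coins hc.2]
  | loop r e c ih => exact frame_loopState ih s _

/-- Started in `s`, the command takes time at most `T` and leads to a state that satisfies `Q`. -/
def Spec (c : Cmd) (s : RamState) (T : ℕ) (Q : RamState → Prop) : Prop :=
  c.cost s ≤ T ∧ Q (c.den s)

variable {c d : Cmd} {s : RamState} {T T' : ℕ} {P Q Q' : RamState → Prop}

theorem Spec.mono (h : c.Spec s T Q) (hT : T ≤ T') (hQ : ∀ s', c.Frame s s' → Q s' → Q' s') :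
    c.Spec s T' Q' :=
  ⟨h.1.trans hT, hQ _ (c.frame_den s) h.2⟩

theorem Spec.le (h : c.Spec s T Q) (hT : T ≤ T') : c.Spec s T' Q := ⟨h.1.trans hT, h.2⟩

theorem Spec.seq (h : c.Spec s T P) (h' : ∀ s', c.Frame s s' → P s' → d.Spec s' T' Q) :
    (c.seq d).Spec s (T + T') Q :=
  have := h' _ (c.frame_den s) h.2
  ⟨Nat.add_le_add h.1 this.1, this.2⟩

/-- The usual invariant rule with one time bound for all passes. The frame passed to each step
records what the loop cannot change, so that invariants need to mention only what it does change. -/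
theorem Spec.loop {r : ℕ} {e : Exp} (I : ℕ → RamState → Prop) (T : ℕ) (h0 : I 0 s)
    (hstep : ∀ i < e.eval s.reg, ∀ s', (Cmd.loop r e c).Frame s s' → I i s' →
      c.Spec (s'.setReg r i) T (I (i + 1))) :
    (Cmd.loop r e c).Spec s (e.cost s.reg + (e.eval s.reg * (T + 6) + 2)) (I (e.eval s.reg)) := by
  have key : ∀ i ≤ e.eval s.reg, I i (Nat.rec s (fun i t => c.den (t.setReg r i)) i) := by
    intro i
    induction i with
    | zero => exact fun _ => h0
    | succ i ih =>
      exact fun hi => (hstep i hi _ (frame_loopState c.frame_den s i) (ih (by omega))).2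
  refine ⟨?_, key _ le_rfl⟩
  rw [cost]
  gcongr
  refine (Finset.sum_le_card_nsmul _ _ (T + 6) fun i hi => ?_).trans (by simp)
  have hi := Finset.mem_range.1 hi
  exact Nat.add_le_add_right
    (hstep i hi _ (frame_loopState c.frame_den s i) (key i (by omega))).1 _

theorem Spec.skip (h : Q s) : Cmd.skip.Spec s 1 Q := ⟨le_rfl, h⟩

theorem Spec.set {r : ℕ} {e : Exp} (h : Q (s.setReg r (e.eval s.reg))) :
    (Cmd.set r e).Spec s (e.cost s.reg + 2) Q := ⟨le_rfl, h⟩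

theorem Spec.store {a : ℕ} {i e : Exp} (h : Q (s.setArr a (i.eval s.reg) (e.eval s.reg))) :
    (Cmd.store a i e).Spec s (i.cost s.reg + (e.cost s.reg + 1)) Q := ⟨le_rfl, h⟩

theorem Spec.set_seq {r : ℕ} {e : Exp} (h : d.Spec (s.setReg r (e.eval s.reg)) T Q) :
    ((Cmd.set r e).seq d).Spec s (e.cost s.reg + 2 + T) Q :=
  ⟨Nat.add_le_add le_rfl h.1, h.2⟩

theorem Spec.load_seq {r a : ℕ} {e : Exp} (h : d.Spec (s.setReg r (s.arr a (e.eval s.reg))) T Q) :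
    ((Cmd.load r a e).seq d).Spec s (e.cost s.reg + 1 + T) Q :=
  ⟨Nat.add_le_add le_rfl h.1, h.2⟩

theorem Spec.store_seq {a : ℕ} {i e : Exp}
    (h : d.Spec (s.setArr a (i.eval s.reg) (e.eval s.reg)) T Q) :
    ((Cmd.store a i e).seq d).Spec s (i.cost s.reg + (e.cost s.reg + 1) + T) Q :=
  ⟨Nat.add_le_add le_rfl h.1, h.2⟩

theorem Spec.flip_seq {r : ℕ} (h : d.Spec (s.flipCoin r) T Q) :
    ((Cmd.flip r).seq d).Spec s (1 + T) Q :=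
  ⟨Nat.add_le_add le_rfl h.1, h.2⟩

theorem Spec.ite {e : Exp} (h : e.eval s.reg ≠ 0 → c.Spec s T Q)
    (h' : e.eval s.reg = 0 → d.Spec s T Q) :
    (Cmd.ite e c d).Spec s (e.cost s.reg + (T + 1)) Q := by
  by_cases hz : e.eval s.reg = 0
  · have := h' hz
    exact ⟨by simpa [cost, hz] using this.1, by simpa [den, hz] using this.2⟩
  · have := h hz
    exact ⟨by simpa [cost, hz] using this.1, by simpa [den, hz] using this.2⟩

end Cmd

infixr:60 " ;; " => Cmd.seq

open MeasureTheory ProbabilityTheory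

/-! ### Averages of independent samples -/

/-- The number with the binary digits `ω 0, …, ω (b - 1)`, most significant digit first. -/
def bitsVal (ω : ℕ → Bool) : ℕ → ℕ
  | 0 => 0
  | b + 1 => bitsVal ω b + bitsVal ω b + (ω b).toNat

theorem bitsVal_lt (ω : ℕ → Bool) (b : ℕ) : bitsVal ω b < 2 ^ b := by
  induction b with
  | zero => simp [bitsVal]
  | succ b ih => have := (ω b).toNat_le; simp only [bitsVal, pow_succ]; omega

theorem bitsVal_congr {ω ω' : ℕ → Bool} {b : ℕ} (h : ∀ j < b, ω j = ω' j) :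
    bitsVal ω b = bitsVal ω' b := by
  induction b with
  | zero => rfl
  | succ b ih => rw [bitsVal, bitsVal, ih fun j hj => h j (by omega), h b (by omega)]

theorem bitsVal_injective {ω ω' : ℕ → Bool} {b : ℕ} (h : bitsVal ω b = bitsVal ω' b) :
    ∀ j < b, ω j = ω' j := by
  induction b with
  | zero => intro j hj; omega
  | succ b ih =>
    simp only [bitsVal] at h
    have h1 := (ω b).toNat_le
    have h2 := (ω' b).toNat_le
    intro j hj
    rcases Nat.lt_succ_iff_lt_or_eq.1 hj with hj | rfl
    · exact ih (by omega) j hj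
    · have : (ω j).toNat = (ω' j).toNat := by omega
      revert this
      cases ω j <;> cases ω' j <;> simp

/-- `r` numbers of `b` binary digits each, read off from a sequence of bits. -/
def drawn (r b : ℕ) (ω : ℕ → Bool) : Fin r → Fin (2 ^ b) :=
  fun i => ⟨bitsVal (fun j => ω (i * b + j)) b, bitsVal_lt _ _⟩

/-- `r` numbers of `b` binary digits each, read off from a matrix of bits. -/
def ofBits {r b : ℕ} (x : Fin r × Fin b → Bool) : Fin r → Fin (2 ^ b) :=
  fun i => ⟨bitsVal (fun j => if h : j < b then x (i, ⟨j, h⟩) else false) b, bitsVal_lt _ _⟩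

/-- This turns the uniform law on matrices of bits into the uniform law on tuples of numbers below 2
^ b. Binary expansions of fixed length are injective, and both sides have the same cardinality. -/
theorem ofBits_bijective (r b : ℕ) : Function.Bijective (ofBits (r := r) (b := b)) := by
  rw [Fintype.bijective_iff_injective_and_card]
  refine ⟨fun x y h => ?_, by simp [← pow_mul, mul_comm]⟩
  funext ⟨i, j⟩
  have := bitsVal_injective (Fin.ext_iff.1 (congrFun h i)) j j.2
  simpa using this

instance : IsProbabilityMeasure fairCoins := by unfold fairCoins; infer_instance

/-- The bits that are used for the sample with number `t`. -/
def sampleBits (r b t : ℕ) (ω : ℕ → Bool) : Fin r × Fin b → Bool :=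
  fun p => ω (t * (r * b) + (p.1 * b + p.2))

theorem ofBits_sampleBits (r b t : ℕ) (ω : ℕ → Bool) :
    ofBits (sampleBits r b t ω) = drawn r b (fun j => ω (t * (r * b) + j)) := by
  funext i
  refine Fin.ext (bitsVal_congr fun j hj => ?_)
  simp [hj, sampleBits]

theorem measurable_sampleBits (r b t : ℕ) : Measurable (sampleBits r b t) :=
  measurable_pi_lambda _ fun _ => measurable_pi_apply _

/-- Different samples, and different digits within one sample, use different coins. Two divisions
with remainder recover the three indices from the position of the coin. -/
theorem sampleIndex_injective (r b : ℕ) :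
    Function.Injective fun p : ℕ × (Fin r × Fin b) => p.1 * (r * b) + (p.2.1 * b + p.2.2) := by
  rintro ⟨t, i, j⟩ ⟨t', i', j'⟩ h
  simp only at h
  have hlt : ∀ (i : Fin r) (j : Fin b), (i : ℕ) * b + j < r * b := fun i j =>
    calc (i : ℕ) * b + j < i * b + b := by omega
      _ = (i + 1) * b := by ring
      _ ≤ r * b := Nat.mul_le_mul i.2 le_rfl
  have hb : 0 < b := j.pos
  have hrb : 0 < r * b := Nat.mul_pos i.pos hb
  have h1 := congrArg (· / (r * b)) h
  simp only [mul_comm _ (r * b), Nat.mul_add_div hrb,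
    Nat.div_eq_of_lt (hlt i j), Nat.div_eq_of_lt (hlt i' j')] at h1
  obtain rfl : t = t' := by simpa using h1
  have h2 : (i : ℕ) * b + j = i' * b + j' := by omega
  have h3 := congrArg (· / b) h2
  simp only [mul_comm _ b, Nat.mul_add_div hb, Nat.div_eq_of_lt j.2, Nat.div_eq_of_lt j'.2] at h3
  obtain rfl : i = i' := Fin.ext (by simpa using h3)
  have : j = j' := Fin.ext (by omega)
  rw [this]

/-- The law of a fair coin. -/
noncomputable abbrev coinLaw : Measure Bool := (PMF.uniformOfFintype Bool).toMeasure

theorem map_sampleBits (r b t : ℕ) :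
    fairCoins.map (sampleBits r b t) = Measure.infinitePi fun _ : Fin r × Fin b => coinLaw :=
  Measure.map_infinitePi_infinitePi_of_inj (P := fun _ : ℕ => coinLaw)
    (f := fun p : Fin r × Fin b => t * (r * b) + (p.1 * b + p.2)) fun p q h => by
      have := @sampleIndex_injective r b (t, p) (t, q) h
      simpa using this

/-- Restricting a product measure along an injection of index sets gives a product measure; grouping
the coordinates by sample number then exhibits the joint law of the samples as the product of their
laws. -/
theorem iIndepFun_sampleBits (r b : ℕ) : iIndepFun (sampleBits r b) fairCoins := by
  rw [iIndepFun_iff_map_fun_eq_infinitePi_map (measurable_sampleBits r b)]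
  simp_rw [map_sampleBits]
  have h1 := Measure.map_infinitePi_infinitePi_of_inj (P := fun _ : ℕ => coinLaw)
    (sampleIndex_injective r b)
  rw [← Measure.infinitePi_map_curry (fun (_ : ℕ) (_ : Fin r × Fin b) => coinLaw), ← h1,
    Measure.map_map (by fun_prop) (by fun_prop)]
  rfl

theorem integral_sampleBits (r b t : ℕ) (g : (Fin r → Fin (2 ^ b)) → ℝ) :
    ∫ ω, g (ofBits (sampleBits r b t ω)) ∂fairCoins = (∑ I, g I) / ((2 : ℝ) ^ b) ^ r := by
  rw [← integral_map (φ := sampleBits r b t) (f := fun x => g (ofBits x))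
    (measurable_sampleBits r b t).aemeasurable
    (measurable_of_finite _).aestronglyMeasurable, map_sampleBits,
    Measure.infinitePi_eq_pi, integral_fintype (Integrable.of_finite),
    ← (ofBits_bijective r b).sum_comp, Finset.sum_div]
  refine Finset.sum_congr rfl fun x _ => ?_
  have : (Measure.pi fun _ : Fin r × Fin b => coinLaw).real {x} = 1 / ((2 : ℝ) ^ b) ^ r := by
    rw [Measure.real, Measure.pi_singleton]
    simp [PMF.toMeasure_apply_singleton, ← pow_mul, mul_comm]
  rw [this, smul_eq_mul]
  ring

/-- Hoeffding's inequality for one tail, chosen by the sign `σ`. Values in [0, Kμ] are subgaussian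
with parameter (Kμ/2)², so the deviation Nμ/(3E) of the sum has probability at most exp(-2N / (9
(EK)²)). With N ≥ 5 (EK)² (ℓ + 1) the exponent is at most -(ℓ + 1), because 10/9 ≥ 1, and e ≥ 2
gives the stated power of 1/2. -/
theorem fairCoins_deviation (r b N E K ℓ μ : ℕ) (g : (Fin r → Fin (2 ^ b)) → ℕ) (hμ : 0 < μ)
    (hsum : ∑ I, g I = (2 ^ b) ^ r * μ) (hg : ∀ I, g I ≤ K * μ) (hE : 0 < E) (hK : 0 < K)
    (hN : 5 * (E * K) ^ 2 * (ℓ + 1) ≤ N) (σ : ℝ) (hσ : σ = 1 ∨ σ = -1) :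
    fairCoins.real {ω | (N : ℝ) * μ / (3 * E) ≤ ∑ t ∈ Finset.range N,
      σ * ((g (ofBits (sampleBits r b t ω)) : ℝ) - μ)} ≤ (1 / 2) ^ (ℓ + 1) := by
  have hmeas : ∀ t, Measurable fun ω => (g (ofBits (sampleBits r b t ω)) : ℝ) := fun t =>
    (measurable_of_finite fun x => (g (ofBits x) : ℝ)).comp (measurable_sampleBits r b t)
  have hint : ∀ t, ∫ ω, (g (ofBits (sampleBits r b t ω)) : ℝ) ∂fairCoins = μ := by
    intro t
    rw [integral_sampleBits r b t fun I => (g I : ℝ)]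
    have : (∑ I, (g I : ℝ)) = ((2 : ℝ) ^ b) ^ r * μ := by exact_mod_cast hsum
    rw [this]
    field_simp
  have hsub : ∀ t, HasSubgaussianMGF (fun ω => (g (ofBits (sampleBits r b t ω)) : ℝ) - μ)
      ((‖((K * μ : ℕ) : ℝ) - 0‖₊ / 2) ^ 2) fairCoins := by
    intro t
    have := hasSubgaussianMGF_of_mem_Icc (μ := fairCoins) (a := 0) (b := ((K * μ : ℕ) : ℝ))
      (X := fun ω => (g (ofBits (sampleBits r b t ω)) : ℝ)) (hmeas t).aemeasurable
      (Filter.Eventually.of_forall fun ω => ⟨by positivity, by exact_mod_cast hg _⟩)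
    rwa [hint t] at this
  have hsub' : ∀ t, HasSubgaussianMGF
      (fun ω => σ * ((g (ofBits (sampleBits r b t ω)) : ℝ) - μ))
      ((‖((K * μ : ℕ) : ℝ) - 0‖₊ / 2) ^ 2) fairCoins := by
    intro t
    rcases hσ with rfl | rfl
    · simpa using hsub t
    · have := (hsub t).neg
      refine this.congr (Filter.Eventually.of_forall fun ω => ?_)
      simp
  have hind : iIndepFun (fun t ω => σ * ((g (ofBits (sampleBits r b t ω)) : ℝ) - μ)) fairCoins :=
    (iIndepFun_sampleBits r b).comp (fun _ x => σ * ((g (ofBits x) : ℝ) - μ))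
      fun _ => measurable_of_finite _
  refine (HasSubgaussianMGF.measure_sum_range_ge_le_of_iIndepFun hind (n := N)
    (fun t _ => hsub' t) (ε := (N : ℝ) * μ / (3 * E)) (by positivity)).trans ?_
  have hN0 : 0 < N := lt_of_lt_of_le (by positivity) hN
  have hc : (((‖((K * μ : ℕ) : ℝ) - 0‖₊ / 2) ^ 2 : NNReal) : ℝ) = ((K : ℝ) * μ / 2) ^ 2 := by
    simp
  rw [hc]
  have hN' : 5 * ((E : ℝ) * K) ^ 2 * (ℓ + 1) ≤ N := by exact_mod_cast hN
  have h1 : -((N : ℝ) * μ / (3 * E)) ^ 2 / (2 * N * ((K : ℝ) * μ / 2) ^ 2) ≤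
      -((ℓ + 1 : ℕ) : ℝ) := by
    have hE' : (0 : ℝ) < E := by exact_mod_cast hE
    have hK' : (0 : ℝ) < K := by exact_mod_cast hK
    have hμ' : (0 : ℝ) < μ := by exact_mod_cast hμ
    have hN0' : (0 : ℝ) < N := by exact_mod_cast hN0
    have : -((N : ℝ) * μ / (3 * E)) ^ 2 / (2 * N * ((K : ℝ) * μ / 2) ^ 2) =
        -(2 * N / (9 * (E * K) ^ 2)) := by
      field_simp
      ring
    rw [this, neg_le_neg_iff, le_div_iff₀ (by positivity)]
    push_cast
    nlinarith
  refine (Real.exp_le_exp.2 h1).trans ?_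
  rw [Real.exp_neg, ← Real.exp_one_pow, ← inv_pow]
  refine pow_le_pow_left₀ (by positivity) ?_ _
  rw [one_div]
  exact inv_anti₀ (by norm_num) (by linarith [Real.exp_one_gt_d9])

/-- The average of sufficiently many samples is close to the mean. -/
theorem fairCoins_estimate (r b N E K ℓ μ : ℕ) (g : (Fin r → Fin (2 ^ b)) → ℕ)
    (hsum : ∑ I, g I = (2 ^ b) ^ r * μ) (hg : ∀ I, g I ≤ K * μ) (hE : 0 < E) (hK : 0 < K)
    (hN : 5 * (E * K) ^ 2 * (ℓ + 1) ≤ N) (δ : ℝ) (hδ : (1 / 2) ^ ℓ ≤ δ) :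
    1 - δ ≤ fairCoins.real {ω | |((∑ t ∈ Finset.range N,
      g (drawn r b fun j => ω (t * (r * b) + j)) : ℕ) : ℝ) - N * μ| ≤ (N : ℝ) * μ / (3 * E)} := by
  have hδ0 : 0 ≤ δ := le_trans (by positivity) hδ
  simp_rw [← ofBits_sampleBits]
  -- With mean zero the upper bound forces every sample to vanish and there is no error at all; the
  -- tail estimates require a positive mean.
  rcases Nat.eq_zero_or_pos μ with rfl | hμ
  · have hz : ∀ I, g I = 0 := fun I => by simpa using hg I
    simp [hz, hδ0]
  · set A := {ω | |((∑ t ∈ Finset.range N, g (ofBits (sampleBits r b t ω)) : ℕ) : ℝ) - N * μ| ≤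
      (N : ℝ) * μ / (3 * E)} with hA
    have h1 := fairCoins_deviation r b N E K ℓ μ g hμ hsum hg hE hK hN 1 (Or.inl rfl)
    have h2 := fairCoins_deviation r b N E K ℓ μ g hμ hsum hg hE hK hN (-1) (Or.inr rfl)
    set B₁ := {ω | (N : ℝ) * μ / (3 * E) ≤ ∑ t ∈ Finset.range N,
      1 * ((g (ofBits (sampleBits r b t ω)) : ℝ) - μ)}
    set B₂ := {ω | (N : ℝ) * μ / (3 * E) ≤ ∑ t ∈ Finset.range N,
      -1 * ((g (ofBits (sampleBits r b t ω)) : ℝ) - μ)}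
    -- A bad outcome lies in one of the two tails, and the two bounds (1/2) ^ (ℓ + 1) add up to
    -- (1/2) ^ ℓ ≤ δ.
    have hcov : Set.univ ⊆ A ∪ (B₁ ∪ B₂) := by
      intro ω _
      by_cases hω : ω ∈ A
      · exact Or.inl hω
      · right
        simp only [hA, Set.mem_setOf_eq, not_le, lt_abs] at hω
        rcases hω with h | h
        · left
          simp only [B₁, Set.mem_setOf_eq, one_mul, Finset.sum_sub_distrib, Finset.sum_const,
            Finset.card_range, nsmul_eq_mul]
          push_cast at h
          exact h.le
        · right
          simp only [B₂, Set.mem_setOf_eq, neg_mul, one_mul, neg_sub, Finset.sum_sub_distrib,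
            Finset.sum_const, Finset.card_range, nsmul_eq_mul]
          push_cast at h
          linarith
    have h3 : (1 : ℝ) ≤ fairCoins.real A + (fairCoins.real B₁ + fairCoins.real B₂) := by
      calc (1 : ℝ) = fairCoins.real Set.univ := by simp
        _ ≤ fairCoins.real (A ∪ (B₁ ∪ B₂)) := measureReal_mono hcov
        _ ≤ _ := (measureReal_union_le _ _).trans
          (add_le_add_right (measureReal_union_le _ _) _)
    have h4 : ((1 : ℝ) / 2) ^ (ℓ + 1) + (1 / 2) ^ (ℓ + 1) = (1 / 2) ^ ℓ := by ring
    linarith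

open RamState

/-! ### Fixed-parameter time bounds -/

/-- A bound in terms of a parameter `k` and three further quantities that is the product of a
computable function of `k` and a polynomial in the others. -/
def IsFPT (g : ℕ → ℕ → ℕ → ℕ → ℕ) : Prop :=
  ∃ (f : ℕ → ℕ) (d : ℕ), Computable f ∧
    ∀ k L E ℓ, g k L E ℓ ≤ f k * ((L + 1) * (E + 1) * (ℓ + 1)) ^ d

namespace IsFPT

variable {g h : ℕ → ℕ → ℕ → ℕ → ℕ}

theorem mono (hh : IsFPT h) (hle : ∀ k L E ℓ, g k L E ℓ ≤ h k L E ℓ) : IsFPT g := by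
  obtain ⟨f, d, hf, hb⟩ := hh
  exact ⟨f, d, hf, fun k L E ℓ => (hle k L E ℓ).trans (hb k L E ℓ)⟩

theorem add (hg : IsFPT g) (hh : IsFPT h) : IsFPT fun k L E ℓ => g k L E ℓ + h k L E ℓ := by
  obtain ⟨f, d, hf, hb⟩ := hg
  obtain ⟨f', d', hf', hb'⟩ := hh
  refine ⟨fun k => f k + f' k, max d d', Primrec.nat_add.to_comp.comp hf hf', fun k L E ℓ => ?_⟩
  have hpos : 1 ≤ (L + 1) * (E + 1) * (ℓ + 1) := Nat.succ_le_of_lt (by positivity)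
  rw [add_mul]
  exact Nat.add_le_add
    ((hb k L E ℓ).trans (Nat.mul_le_mul le_rfl (Nat.pow_le_pow_right hpos (le_max_left _ _))))
    ((hb' k L E ℓ).trans (Nat.mul_le_mul le_rfl (Nat.pow_le_pow_right hpos (le_max_right _ _))))

theorem mul (hg : IsFPT g) (hh : IsFPT h) : IsFPT fun k L E ℓ => g k L E ℓ * h k L E ℓ := by
  obtain ⟨f, d, hf, hb⟩ := hg
  obtain ⟨f', d', hf', hb'⟩ := hh
  refine ⟨fun k => f k * f' k, d + d', Primrec.nat_mul.to_comp.comp hf hf', fun k L E ℓ => ?_⟩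
  rw [pow_add, mul_mul_mul_comm]
  exact Nat.mul_le_mul (hb k L E ℓ) (hb' k L E ℓ)

theorem param {f : ℕ → ℕ} (hf : Computable f) : IsFPT fun k _ _ _ => f k :=
  ⟨f, 0, hf, fun k L E ℓ => by simp⟩

theorem const (c : ℕ) : IsFPT fun _ _ _ _ => c := param (Computable.const c)

theorem length : IsFPT fun _ L _ _ => L :=
  ⟨fun _ => 1, 1, Computable.const 1, fun k L E ℓ => by
    have h1 : 1 ≤ (E + 1) * (ℓ + 1) := Nat.succ_le_of_lt (by positivity)
    simp only [pow_one, one_mul]; nlinarith⟩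

theorem invEps : IsFPT fun _ _ E _ => E :=
  ⟨fun _ => 1, 1, Computable.const 1, fun k L E ℓ => by
    have h1 : 1 ≤ (L + 1) * (ℓ + 1) := Nat.succ_le_of_lt (by positivity)
    simp only [pow_one, one_mul]; nlinarith⟩

theorem logDelta : IsFPT fun _ _ _ ℓ => ℓ :=
  ⟨fun _ => 1, 1, Computable.const 1, fun k L E ℓ => by
    have h1 : 1 ≤ (L + 1) * (E + 1) := Nat.succ_le_of_lt (by positivity)
    simp only [pow_one, one_mul]; nlinarith⟩

theorem pow (hg : IsFPT g) (d : ℕ) : IsFPT fun k L E ℓ => g k L E ℓ ^ d := by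
  induction d with
  | zero => simpa using const 1
  | succ d ih => simpa only [pow_succ] using ih.mul hg

end IsFPT

/-- The constant is 29 = 6 + 13 + 10. A bound by the number of bits matters for values such as n ^ C
that are not polynomial in the input length. -/
theorem RamOp.mulCost_le_of_lt {a m : ℕ} (h : a < 2 ^ m) : mulCost a ≤ 29 * (m + 1) ^ 2 := by
  have h1 : a.size ≤ m := Nat.size_le.2 h
  unfold mulCost
  nlinarith

theorem RamOp.mulCost_le (a : ℕ) : mulCost a ≤ 29 * (a + 1) ^ 2 :=
  mulCost_le_of_lt Nat.lt_two_pow_self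

theorem IsFPT.mulCost {g : ℕ → ℕ → ℕ → ℕ → ℕ} (hg : IsFPT g) :
    IsFPT fun k L E ℓ => RamOp.mulCost (g k L E ℓ) :=
  ((IsFPT.const 29).mul ((hg.add (IsFPT.const 1)).pow 2)).mono fun _ _ _ _ => RamOp.mulCost_le _

/-! ### The input -/

/-- Instances of `#EdgeSub(Φ)`: graphs with a positive integer. -/
abbrev EdgeSubInst := (Σ n : ℕ, SimpleGraph (Fin n)) × ℕ+

namespace EdgeSubInst

variable (x : EdgeSubInst)

/-- The number of vertices. -/
abbrev n : ℕ := x.1.1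

/-- The number of edges to be chosen. -/
abbrev k : ℕ := x.2

/-- The length of the encoding. -/
noncomputable abbrev L : ℕ := (encodeGraphNat x).length

/-- The position of the adjacency matrix in the encoding. -/
abbrev base : ℕ := x.k + 1 + x.n + 1

theorem length_eq : x.L = x.base + x.n * x.n := by
  show (encodeGraphNat x).length = (x.2 : ℕ) + 1 + x.1.1 + 1 + x.1.1 * x.1.1
  simp [encodeGraphNat, encodeGraph, adjacencyBits]
  omega

/-- The symbols of the encoding, as numbers. -/
noncomputable def bit (i : ℕ) : ℕ := ((encodeGraphNat x).getD i false).toNat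

theorem bit_of_lt {i : ℕ} (h : i < x.k) : x.bit i = 1 := by
  have : i < (x.2 : ℕ) := h
  simp [bit, encodeGraphNat, List.getElem?_append, this]

theorem bit_k : x.bit x.k = 0 := by
  simp [bit, encodeGraphNat]

theorem bit_of_lt_n {i : ℕ} (h : i < x.n) : x.bit (x.k + 1 + i) = 1 := by
  have h' : i < x.1.1 := h
  have e : x.k + 1 + i - (x.2 : ℕ) = i + 1 := by show (x.2 : ℕ) + 1 + i - (x.2 : ℕ) = i + 1; omega
  have : ¬ x.k + 1 + i < (x.2 : ℕ) := by show ¬ (x.2 : ℕ) + 1 + i < (x.2 : ℕ); omega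
  simp [bit, encodeGraphNat, encodeGraph, List.getElem?_append, this, e, h']

theorem bit_n : x.bit (x.k + 1 + x.n) = 0 := by
  have e : x.k + 1 + x.n - (x.2 : ℕ) = x.n + 1 := by
    show (x.2 : ℕ) + 1 + x.n - (x.2 : ℕ) = x.n + 1; omega
  have : ¬ x.k + 1 + x.n < (x.2 : ℕ) := by show ¬ (x.2 : ℕ) + 1 + x.n < (x.2 : ℕ); omega
  simp [bit, encodeGraphNat, encodeGraph, List.getElem?_append, this, e]

open Classical in
theorem bit_adj (u v : Fin x.n) :
    x.bit (x.base + (u * x.n + v)) = if x.1.2.Adj u v then 1 else 0 := by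
  have hlt : (u : ℕ) * x.n + v < x.n * x.n :=
    calc (u : ℕ) * x.n + v < u * x.n + x.n := by omega
      _ = (u + 1) * x.n := by ring
      _ ≤ x.n * x.n := Nat.mul_le_mul u.2 le_rfl
  set p : ℕ := u * x.n + v with hp
  have e : x.base + p - (x.2 : ℕ) = x.n + p + 2 := by
    show (x.2 : ℕ) + 1 + x.n + 1 + p - (x.2 : ℕ) = _; omega
  have h1 : ¬ x.base + p < (x.2 : ℕ) := by
    show ¬ (x.2 : ℕ) + 1 + x.n + 1 + p < (x.2 : ℕ); omega
  have h2 : ¬ x.n + p + 1 < x.1.1 := by show ¬ x.n + p + 1 < x.n; omega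
  have e2 : x.n + p + 1 - x.1.1 = p + 1 := by show x.n + p + 1 - x.n = _; omega
  have hn : 0 < x.n := u.pos
  have d1 : (⟨p, hlt⟩ : Fin (x.n * x.n)).divNat = u := by
    ext
    simp only [Fin.coe_divNat, hp]
    rw [mul_comm, Nat.mul_add_div hn, Nat.div_eq_of_lt v.2, add_zero]
  have d2 : (⟨p, hlt⟩ : Fin (x.n * x.n)).modNat = v := by
    ext
    simp only [Fin.coe_modNat, hp]
    rw [mul_comm, Nat.mul_add_mod, Nat.mod_eq_of_lt v.2]
  simp only [bit, encodeGraphNat, encodeGraph, adjacencyBits, List.getD_eq_getElem?_getD,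
    List.getElem?_append, List.length_replicate, h1, if_false, e, List.getElem?_cons_succ, h2, e2,
    List.getElem?_ofFn, hlt, dif_pos, d1, d2, Option.getD_some]
  split_ifs with h <;> simp [h]

/-- The input has been read: `L`, `k`, `n` and the position of the adjacency matrix are in
the registers `0`, `5`, `6` and `7`. -/
structure Parsed (s : RamState) : Prop where
  length : s.reg 0 = x.L
  k : s.reg 5 = x.k
  n : s.reg 6 = x.n
  base : s.reg 7 = x.base
  input : s.arr 0 = x.bit

end EdgeSubInst

open Cmd Exp

/-- Reads the input. -/
def parseCmd : Cmd :=
  .set 5 0 ;; .loop 21 (reg 0) (.load 22 0 (reg 5) ;; .set 5 (reg 5 + reg 22)) ;;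
  .set 6 0 ;; .loop 21 (reg 0) (.load 22 0 (reg 5 + 1 + reg 6) ;; .set 6 (reg 6 + reg 22)) ;;
  .set 7 (reg 5 + 1 + reg 6 + 1)

/-- Both unary prefixes are read without branching: the position advances by the bit just read,
hence stops at the first zero and stays there. After i passes the counter is the minimum of i and
the length of the prefix, and L passes always suffice. -/
theorem parseCmd_spec (x : EdgeSubInst) (s : RamState) (hL : s.reg 0 = x.L)
    (hA : s.arr 0 = x.bit) : parseCmd.Spec s (60 * x.L + 60) x.Parsed := by
  have hk : x.k ≤ x.L := by rw [x.length_eq]; unfold EdgeSubInst.base; omega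
  have hn : x.n ≤ x.L := by rw [x.length_eq]; unfold EdgeSubInst.base; omega
  refine Spec.mono (Spec.set_seq <| Spec.seq (T' := 30 * x.L + 30)
    (Spec.loop (fun i s' => s'.reg 5 = min i x.k) 12 ?_ ?_) fun s₁ f₁ h₁ => ?_) ?_ fun _ _ h => h
  · simp
  · intro i hi s' f h
    have hA' : s'.arr 0 = x.bit := by rw [f.arr 0 (by decide)]; exact hA
    refine Spec.mono (Spec.load_seq <| Spec.set ?_) ?_ fun _ _ h => h
    · simp [h, hA']
      rcases lt_or_ge i x.k with hlt | hge
      · rw [min_eq_left hlt.le, x.bit_of_lt hlt, min_eq_left hlt]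
      · rw [min_eq_right hge, x.bit_k, min_eq_right (by omega), add_zero]
    · simp
  · have h01 : s₁.reg 0 = x.L := by
      rw [f₁.reg 0 (by decide)]
      simpa using hL
    have h15 : s₁.reg 5 = x.k := by
      rw [h₁]
      simp [hL, hk]
    refine Spec.mono (Spec.set_seq <| Spec.seq (T' := 20)
      (Spec.loop (fun i s' => s'.reg 6 = min i x.n) 20 ?_ ?_) fun s₂ f₂ h₂ => ?_) ?_ fun _ _ h => h
    · simp
    · intro i hi s' f h
      have hA' : s'.arr 0 = x.bit := by
        rw [f.arr 0 (by decide)]; exact (f₁.arr 0 (by decide)).trans hA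
      have h5 : s'.reg 5 = x.k := by
        rw [f.reg 5 (by decide)]
        simp [h15]
      refine Spec.mono (Spec.load_seq <| Spec.set ?_) ?_ fun _ _ h => h
      · simp [h, hA', h5]
        rcases lt_or_ge i x.n with hlt | hge
        · rw [min_eq_left hlt.le, x.bit_of_lt_n hlt, min_eq_left hlt]
        · rw [min_eq_right hge, x.bit_n, min_eq_right (by omega), add_zero]
      · simp
    · have h0 : s₂.reg 0 = x.L := by
        rw [f₂.reg 0 (by decide)]
        simpa using h01
      have h5 : s₂.reg 5 = x.k := by
        rw [f₂.reg 5 (by decide)]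
        simpa using h15
      have h6 : s₂.reg 6 = x.n := by
        rw [h₂]
        simp [h01, hn]
      refine Spec.mono (Spec.set (Q := x.Parsed) ⟨?_, ?_, ?_, ?_, ?_⟩) ?_ fun _ _ h => h
      · simpa using h0
      · simpa using h5
      · simpa using h6
      · simp [h5, h6, EdgeSubInst.base]
      · show s₂.arr 0 = _
        rw [f₂.arr 0 (by decide)]
        exact (f₁.arr 0 (by decide)).trans hA
      · simp
    · simp [h01]
      omega
  · simp [hL]
    omega

open RamState Cmd Exp

/-! ### Approximation schemes from samplers -/

/-- The number of solutions. -/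
noncomputable abbrev solutions (Φ : GraphProperty) (x : EdgeSubInst) : ℕ :=
  (edgeSubs Φ x.2 x.1.2).ncard

/-- Draws `R₁₄` numbers of `R₁₅` bits each, and stores them in array `1`. -/
def drawCmd : Cmd :=
  .loop 17 (reg 14) (.set 19 0 ;; .loop 18 (reg 15) (.flip 20 ;; .set 19 (reg 19 + reg 19 + reg 20)) ;;
    .store 1 (reg 17) (reg 19))

theorem drawCmd_spec (r b : ℕ) (s : RamState) (hr : s.reg 14 = r) (hb : s.reg 15 = b) :
    drawCmd.Spec s (r * (b * 20 + 30) + 10) fun s' =>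
      (∀ i : Fin r, s'.arr 1 i = drawn r b s.coins i) ∧
      s'.coins = fun j => s.coins (r * b + j) := by
  refine Spec.mono (Spec.loop (fun i s' => (∀ j < i, s'.arr 1 j =
      bitsVal (fun l => s.coins (j * b + l)) b) ∧ s'.coins = fun j => s.coins (i * b + j))
      (b * 20 + 20) ?_ ?_) ?_ ?_
  · simp
  · rintro i hi s₁ f ⟨h1, h2⟩
    have h15 : s₁.reg 15 = b := by rw [f.reg 15 (by decide)]; exact hb
    refine Spec.le (Spec.set_seq <| Spec.seq (T' := 6) (Spec.loop (fun l s' =>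
      s'.reg 19 = bitsVal (fun l => s.coins (i * b + l)) l ∧
      s'.coins = fun j => s.coins (i * b + l + j)) 14 ?_ ?_) fun s₂ f₂ h₂ => ?_) ?_
    · simp [h2, bitsVal]
    · rintro l hl s₃ f₃ ⟨h3, h4⟩
      refine Spec.le (Spec.flip_seq <| Spec.set ?_) ?_
      · refine ⟨by simp [h3, h4, bitsVal], ?_⟩
        funext j
        simp only [setReg_coins, flipCoin_coins, h4]
        congr 1
        omega
      · simp
    · refine Spec.le (Spec.store (And.intro ?_ ?_)) ?_
      · intro j hj
        have h17 : s₂.reg 17 = i := by rw [f₂.reg 17 (by decide)]; simp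
        have ha : s₂.arr 1 = s₁.arr 1 := f₂.arr 1 (by decide)
        rcases Nat.lt_succ_iff_lt_or_eq.1 hj with hj | rfl
        · simp [h17, hj.ne, ha, h1 j hj]
        · simp [h17, h₂.1, h15]
      · show s₂.coins = _
        rw [h₂.2]
        simp [h15, add_mul]
      · simp
    · simp [h15]
      omega
  · simp [hr]
    nlinarith
  · rintro s' - ⟨h1, h2⟩
    simp only [eval_reg, hr] at h1 h2
    exact ⟨fun i => h1 i i.2, h2⟩

/-- A way to draw random numbers from which an instance-dependent function of mean
`scale * solutions` and of relatively bounded size can be computed. -/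
structure Sampler (Φ : GraphProperty) where
  setup : Cmd
  body : Cmd
  /-- the factor by which the values may exceed the mean is at most `bound k * L ^ deg` -/
  bound : ℕ → ℕ
  deg : ℕ
  scale : ℕ → ℕ
  r : EdgeSubInst → ℕ
  b : EdgeSubInst → ℕ
  g : ∀ x : EdgeSubInst, (Fin (r x) → Fin (2 ^ b x)) → ℕ
  Ready : EdgeSubInst → RamState → Prop
  setupTime : ℕ → ℕ → ℕ
  bodyTime : ℕ → ℕ → ℕ
  bitTime : ℕ → ℕ → ℕ
  bound_computable : Computable bound
  scale_computable : Computable scale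
  scale_pos : ∀ k, 0 < scale k
  setupTime_fpt : IsFPT fun k L _ _ => setupTime k L
  bodyTime_fpt : IsFPT fun k L _ _ => bodyTime k L
  bitTime_fpt : IsFPT fun k L _ _ => bitTime k L
  r_le : ∀ x, r x ≤ bitTime x.k x.L
  b_le : ∀ x, b x ≤ bitTime x.k x.L
  -- Storage conventions: registers 14 and 15 fix the shape of a draw, register 13 accumulates the
  -- values, and array 1 receives the draw. A sampler owns the registers from 30 on and the arrays
  -- from 2 on, so the surrounding algorithm can rely on the rest, and `Ready` may depend on nothing
  -- else.
  setup_wregs : ∀ q ∈ setup.wregs, q = 14 ∨ q = 15 ∨ 30 ≤ q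
  setup_noFlip : setup.NoFlip
  setup_warrs : ∀ a ∈ setup.warrs, 2 ≤ a
  setup_spec : ∀ x s, x.Parsed s → setup.Spec s (setupTime x.k x.L)
    fun s' => s'.reg 14 = r x ∧ s'.reg 15 = b x ∧ Ready x s'
  ready_congr : ∀ x s s', Ready x s → (∀ q, 30 ≤ q → s'.reg q = s.reg q) →
    (∀ a, 2 ≤ a → s'.arr a = s.arr a) → Ready x s'
  body_wregs : ∀ q ∈ body.wregs, q = 13 ∨ 30 ≤ q
  body_noFlip : body.NoFlip
  body_warrs : ∀ a ∈ body.warrs, 2 ≤ a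
  body_spec : ∀ x s (I : Fin (r x) → Fin (2 ^ b x)), x.Parsed s → Ready x s →
    s.reg 14 = r x → s.reg 15 = b x → (∀ i : Fin (r x), s.arr 1 i = I i) →
    body.Spec s (bodyTime x.k x.L) fun s' => s'.reg 13 = s.reg 13 + g x I ∧ Ready x s'
  sum_g : ∀ x, ∑ I, g x I = (2 ^ b x) ^ r x * (scale x.k * solutions Φ x)
  g_le : ∀ x I, g x I ≤ bound x.k * x.L ^ deg * (scale x.k * solutions Φ x)

/-- A crude bound on the number of bits of the answer: solutions are sets of vertex pairs, and the
adjacency matrix is part of the input. Only the cost of the final division relies on it. -/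
theorem solutions_le (Φ : GraphProperty) (x : EdgeSubInst) : solutions Φ x ≤ 2 ^ x.L := by
  classical
  have h1 : solutions Φ x ≤ Fintype.card (Finset (Sym2 (Fin x.1.1))) := by
    rw [← Nat.card_eq_fintype_card]
    exact (Set.ncard_le_ncard (Set.subset_univ _)).trans (by rw [Set.ncard_univ])
  refine h1.trans ?_
  rw [Fintype.card_finset]
  refine Nat.pow_le_pow_right (by norm_num) ?_
  have h2 : Fintype.card (Sym2 (Fin x.1.1)) ≤ Fintype.card (Fin x.1.1 × Fin x.1.1) :=
    Fintype.card_le_of_surjective (fun p => s(p.1, p.2)) fun z => by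
      induction z with | _ a b => exact ⟨(a, b), rfl⟩
  rw [Fintype.card_prod, Fintype.card_fin] at h2
  have h3 := x.length_eq
  have h4 : x.n * x.n = x.1.1 * x.1.1 := rfl
  omega

/-! ### The complete algorithm of a sampler -/

namespace Sampler

variable {Φ : GraphProperty} (A : Sampler Φ)

/-- Three times a bound for the quotient of the values by the mean. -/
def ratio (k L : ℕ) : ℕ := L ^ A.deg * (3 * (A.bound k + 1))

/-- The number of samples. -/
def samples (k L E ℓ : ℕ) : ℕ := E * A.ratio k L * (E * A.ratio k L) * (ℓ + 1)

theorem ratio_fpt : IsFPT fun k L _ _ => A.ratio k L :=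
  (IsFPT.length.pow _).mul ((IsFPT.const 3).mul
    ((IsFPT.param A.bound_computable).add (IsFPT.const 1)))

theorem samples_fpt : IsFPT fun k L E ℓ => A.samples k L E ℓ :=
  ((IsFPT.invEps.mul A.ratio_fpt).mul (IsFPT.invEps.mul A.ratio_fpt)).mul
    (IsFPT.logDelta.add (IsFPT.const 1))

/-- Computes the number of samples. -/
def computeCmd (oB oD : RamOp) : Cmd :=
  .set 8 ((reg 2 + reg 1 - 1) / reg 1) ;; .set 9 (op .clogDivOp (reg 4) (reg 3)) ;;
  .set 10 (op oB (reg 5) (num 0)) ;; .loop 21 (num A.deg) (.set 10 (reg 0 * reg 10)) ;;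
  .set 11 (reg 8 * reg 10) ;; .set 11 (reg 11 * reg 11 * (reg 9 + 1)) ;;
  .set 12 (op oD (reg 5) (num 0))

/-- The time of `computeCmd`. -/
def computeTime (oB oD : RamOp) (k L E ℓ : ℕ) : ℕ :=
  RamOp.mulCost E + 4 * ℓ + oB.cost k 0 + A.deg * (RamOp.mulCost L + 12) + RamOp.mulCost E +
    RamOp.mulCost (E * A.ratio k L) + RamOp.mulCost (E * A.ratio k L * (E * A.ratio k L)) +
    oD.cost k 0 + 100

theorem computeTime_fpt (oB oD : RamOp) (hB : Computable₂ oB.cost) (hD : Computable₂ oD.cost) :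
    IsFPT fun k L E ℓ => A.computeTime oB oD k L E ℓ := by
  have h1 := IsFPT.param (hB.comp Computable.id (Computable.const 0))
  have h2 := IsFPT.param (hD.comp Computable.id (Computable.const 0))
  have h3 := IsFPT.invEps.mul A.ratio_fpt
  exact ((((((((IsFPT.invEps.mulCost).add ((IsFPT.const 4).mul IsFPT.logDelta)).add h1).add
    ((IsFPT.const _).mul (IsFPT.length.mulCost.add (IsFPT.const 12)))).add
    IsFPT.invEps.mulCost).add h3.mulCost).add (h3.mul h3).mulCost).add h2).add (IsFPT.const 100)

/-- Registers 1 to 4 contain numerators and denominators of ε and δ. Hence `E` is 1/ε rounded up,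
and `ℓ` is the least number with 2 ^ ℓ ≥ 1/δ. These two integers replace ε and δ in the entire
computation. -/
theorem computeCmd_spec (oB oD : RamOp) (hB : ∀ k, oB.fn k 0 = 3 * (A.bound k + 1))
    (x : EdgeSubInst) (s : RamState) (hx : x.Parsed s) (E ℓ : ℕ)
    (hE : E = (s.reg 2 + s.reg 1 - 1) / s.reg 1) (hℓ : ℓ = RamOp.clogDiv (s.reg 4) (s.reg 3)) :
    (A.computeCmd oB oD).Spec s (A.computeTime oB oD x.k x.L E ℓ) fun s' =>
      s'.reg 11 = A.samples x.k x.L E ℓ ∧ s'.reg 12 = oD.fn x.k 0 := by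
  have h0 := hx.length
  have h5 := hx.k
  refine Spec.le (Spec.set_seq <| Spec.set_seq <| Spec.set_seq <| Spec.seq
    (T' := 2 * 30 + RamOp.mulCost E + RamOp.mulCost (E * A.ratio x.k x.L) +
      RamOp.mulCost (E * A.ratio x.k x.L * (E * A.ratio x.k x.L)) + oD.cost x.k 0)
    (Spec.loop (fun i s' => s'.reg 10 = x.L ^ i * (3 * (A.bound x.k + 1)))
      (RamOp.mulCost x.L + 6) ?_ ?_) fun s₁ f₁ h₁ => ?_) ?_
  · simp [hB, h5]
  · intro i hi s' f h
    have h0' : s'.reg 0 = x.L := by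
      rw [f.reg 0 (by simp [wregs])]
      simpa using h0
    refine Spec.le (Spec.set ?_) ?_
    · simp [h, h0', pow_succ]
      ring
    · simp [h0']
      omega
  · have h8 : s₁.reg 8 = E := by
      rw [f₁.reg 8 (by simp [wregs])]
      simp [hE]
    have h9 : s₁.reg 9 = ℓ := by
      rw [f₁.reg 9 (by simp [wregs])]
      simp [hℓ, RamOp.clogDivOp]
    have h5' : s₁.reg 5 = x.k := by
      rw [f₁.reg 5 (by simp [wregs])]
      simpa using h5
    have h10 : s₁.reg 10 = A.ratio x.k x.L := by simpa [ratio] using h₁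
    refine Spec.le (Spec.set_seq <| Spec.set_seq <| Spec.set
      ⟨?_, ?_⟩) ?_
    · simp [h8, h9, h10, samples]
    · simp [h5']
    · simp [h8, h9, h10, h5']
      omega
  · simp [h5, ← hE, ← hℓ, computeTime, RamOp.clogDivOp, add_assoc]
    omega

/-- The sampling loop. -/
def sampleCmd : Cmd := .set 13 0 ;; .loop 16 (reg 11) (drawCmd ;; A.body)

/-- The time of `sampleCmd`. -/
def sampleTime (k L E ℓ : ℕ) : ℕ :=
  A.samples k L E ℓ *
    (A.bitTime k L * (A.bitTime k L * 20 + 30) + A.bodyTime k L + 16) + 10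

theorem sampleTime_fpt : IsFPT fun k L E ℓ => A.sampleTime k L E ℓ :=
  (A.samples_fpt.mul (((A.bitTime_fpt.mul ((A.bitTime_fpt.mul (IsFPT.const 20)).add
    (IsFPT.const 30))).add A.bodyTime_fpt).add (IsFPT.const 16))).add (IsFPT.const 10)

/-- The sum of the values of the samples. -/
def total (x : EdgeSubInst) (N : ℕ) (ω : ℕ → Bool) : ℕ :=
  ∑ t ∈ Finset.range N, A.g x (drawn (A.r x) (A.b x) fun j => ω (t * (A.r x * A.b x) + j))

theorem drawCmd_wregs : ∀ q ∈ drawCmd.wregs, 16 < q ∧ q < 21 := by decide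

/-- Every draw consumes exactly r · b coins and the body consumes none, so after t passes the
remaining coins are the initial ones shifted by t · r · b. This identifies the machine's samples
with the independent blocks of the probabilistic analysis. -/
theorem sampleCmd_spec (x : EdgeSubInst) (E ℓ : ℕ) (s : RamState) (hx : x.Parsed s)
    (hs : A.Ready x s) (h14 : s.reg 14 = A.r x) (h15 : s.reg 15 = A.b x)
    (h11 : s.reg 11 = A.samples x.k x.L E ℓ) :
    A.sampleCmd.Spec s (A.sampleTime x.k x.L E ℓ) fun s' =>
      s'.reg 13 = A.total x (A.samples x.k x.L E ℓ) s.coins := by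
  refine Spec.mono (Spec.set_seq <| Spec.loop (fun t s' => s'.reg 13 = A.total x t s.coins ∧
    A.Ready x s' ∧ s'.coins = fun j => s.coins (t * (A.r x * A.b x) + j))
    (A.bitTime x.k x.L * (A.bitTime x.k x.L * 20 + 30) + A.bodyTime x.k x.L + 10) ?_ ?_) ?_ ?_
  · refine ⟨by simp [total], A.ready_congr x s _ hs (fun q hq => ?_) fun _ _ => rfl, by simp⟩
    simp only [setReg_reg]
    rw [if_neg (by omega)]
  · rintro t ht s₁ f₁ ⟨h1, h2, h3⟩
    have hreg : ∀ q < 16, q ≠ 13 → s₁.reg q = s.reg q := by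
      intro q hq hq'
      rw [f₁.reg q]
      · simp [hq']
      · simp only [wregs, List.mem_cons, List.mem_append, not_or]
        refine ⟨by omega, fun h => ?_, fun h => ?_⟩
        · have := drawCmd_wregs q h; omega
        · have := A.body_wregs q h; omega
    have harr : s₁.arr 0 = s.arr 0 := by
      rw [f₁.arr 0]
      · rfl
      · simp only [warrs, List.mem_append, not_or]
        refine ⟨by decide, fun h => ?_⟩
        have := A.body_warrs 0 h; omega
    refine Spec.le (Spec.seq (T' := A.bodyTime x.k x.L)
      (drawCmd_spec (A.r x) (A.b x) _ ?_ ?_) fun s₂ f₂ h₂ => ?_) ?_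
    · simpa [h14] using hreg 14 (by norm_num) (by norm_num)
    · simpa [h15] using hreg 15 (by norm_num) (by norm_num)
    · have hreg' : ∀ q, (q < 16 → q ≠ 13 → s₂.reg q = s.reg q) ∧
          (q = 13 ∨ 30 ≤ q → s₂.reg q = s₁.reg q) := by
        intro q
        constructor
        · intro hq hq'
          rw [f₂.reg q fun h => by have := drawCmd_wregs q h; omega, ← hreg q hq hq']
          simp only [setReg_reg]
          rw [if_neg (by omega)]
        · intro hq
          rw [f₂.reg q fun h => by have := drawCmd_wregs q h; omega]
          simp only [setReg_reg]
          rw [if_neg (by omega)]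
      have harr' : ∀ a, a ≠ 1 → s₂.arr a = s₁.arr a := fun a ha =>
        f₂.arr a (by simpa [drawCmd, warrs] using ha)
      have hx₂ : x.Parsed s₂ := by
        refine ⟨?_, ?_, ?_, ?_, ?_⟩
        · rw [(hreg' 0).1 (by norm_num) (by norm_num)]; exact hx.length
        · rw [(hreg' 5).1 (by norm_num) (by norm_num)]; exact hx.k
        · rw [(hreg' 6).1 (by norm_num) (by norm_num)]; exact hx.n
        · rw [(hreg' 7).1 (by norm_num) (by norm_num)]; exact hx.base
        · rw [harr' 0 (by norm_num), harr]; exact hx.input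
      have hr₂ : A.Ready x s₂ := A.ready_congr x s₁ s₂ h2 (fun q hq => (hreg' q).2 (Or.inr hq))
        fun a ha => harr' a (by omega)
      refine Spec.mono (A.body_spec x s₂ _ hx₂ hr₂ ((hreg' 14).1 (by norm_num) (by norm_num) ▸ h14)
        ((hreg' 15).1 (by norm_num) (by norm_num) ▸ h15) h₂.1) le_rfl
        fun s₃ f₃ h₃ => ⟨?_, h₃.2, ?_⟩
      · rw [h₃.1, (hreg' 13).2 (Or.inl rfl), h1, total, total, Finset.sum_range_succ]
        simp [h3]
      · rw [f₃.coins A.body_noFlip, h₂.2]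
        funext j
        simp only [setReg_coins, h3]
        congr 1
        ring
    · have := Nat.mul_le_mul (A.r_le x) (Nat.add_le_add_right (Nat.mul_le_mul_right 20 (A.b_le x)) 30)
      omega
  · simp [h11, sampleTime]
    nlinarith
  · rintro s' - ⟨h1, -⟩
    simpa [h11] using h1

/-- The complete algorithm. -/
def algorithm (oB oD : RamOp) : Cmd :=
  parseCmd ;; A.computeCmd oB oD ;; A.setup ;; A.sampleCmd ;;
  .set 0 ((reg 13 + reg 13 + reg 11 * reg 12) / (reg 11 * reg 12 + reg 11 * reg 12))

/-- The time of the algorithm. -/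
def algorithmTime (oB oD : RamOp) (k L E ℓ : ℕ) : ℕ :=
  60 * L + 60 + A.computeTime oB oD k L E ℓ + A.setupTime k L + A.sampleTime k L E ℓ +
    3 * RamOp.mulCost (A.samples k L E ℓ) + 29 * (A.ratio k L + L + 4) ^ 2 + 50

theorem algorithmTime_fpt (oB oD : RamOp) (hB : Computable₂ oB.cost) (hD : Computable₂ oD.cost) :
    IsFPT fun k L E ℓ => A.algorithmTime oB oD k L E ℓ :=
  ((((((((IsFPT.const 60).mul IsFPT.length).add (IsFPT.const 60)).add
    (A.computeTime_fpt oB oD hB hD)).add A.setupTime_fpt).add A.sampleTime_fpt).add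
    ((IsFPT.const 3).mul A.samples_fpt.mulCost)).add ((IsFPT.const 29).mul
    (((A.ratio_fpt.add IsFPT.length).add (IsFPT.const 4)).pow 2))).add (IsFPT.const 50)

theorem total_le (x : EdgeSubInst) (N : ℕ) (ω : ℕ → Bool) :
    A.total x N ω ≤ N * (A.ratio x.k x.L * (A.scale x.k * solutions Φ x)) := by
  refine (Finset.sum_le_card_nsmul _ _
    (A.ratio x.k x.L * (A.scale x.k * solutions Φ x)) fun t _ => ?_).trans (by simp)
  refine (A.g_le x _).trans (Nat.mul_le_mul_right _ ?_)
  unfold ratio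
  rw [mul_comm]
  exact Nat.mul_le_mul_left _ (by omega)

/-- The output is the sum of the samples divided by M = N · scale and rounded to the nearest
integer, since (2S + M) / (2M) is the integer part of S/M + 1/2. -/
theorem algorithm_spec (oB oD : RamOp) (hB : ∀ k, oB.fn k 0 = 3 * (A.bound k + 1))
    (hD : ∀ k, oD.fn k 0 = A.scale k) (x : EdgeSubInst) (s : RamState) (hL : s.reg 0 = x.L)
    (hA : s.arr 0 = x.bit) (E ℓ : ℕ) (hE : E = (s.reg 2 + s.reg 1 - 1) / s.reg 1)
    (hℓ : ℓ = RamOp.clogDiv (s.reg 4) (s.reg 3)) (N M : ℕ) (hN : N = A.samples x.k x.L E ℓ)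
    (hM : M = N * A.scale x.k) :
    (A.algorithm oB oD).Spec s (A.algorithmTime oB oD x.k x.L E ℓ) fun s' => s'.reg 0 =
      (2 * A.total x N s.coins + M) / (2 * M) := by
  refine Spec.le (Spec.seq (parseCmd_spec x s hL hA) (T' :=
    A.algorithmTime oB oD x.k x.L E ℓ - (60 * x.L + 60)) fun s₁ f₁ hx₁ => ?_) ?_
  swap
  · unfold algorithmTime; omega
  refine Spec.le (Spec.seq (A.computeCmd_spec oB oD hB x s₁ hx₁ E ℓ ?_ ?_) (T' :=
    A.setupTime x.k x.L + A.sampleTime x.k x.L E ℓ +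
    3 * RamOp.mulCost (A.samples x.k x.L E ℓ) + 29 * (A.ratio x.k x.L + x.L + 4) ^ 2 + 50)
    fun s₂ f₂ h₂ => ?_) ?_
  · rw [f₁.reg 1 (by decide), f₁.reg 2 (by decide)]; exact hE
  · rw [f₁.reg 4 (by decide), f₁.reg 3 (by decide)]; exact hℓ
  swap
  · unfold algorithmTime; omega
  have hc₂ : s₂.coins = s.coins :=
    (f₂.coins (by simp [computeCmd, NoFlip])).trans (f₁.coins (by simp [parseCmd, NoFlip]))
  have hx₂ : x.Parsed s₂ := by
    refine ⟨?_, ?_, ?_, ?_, ?_⟩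
    · rw [f₂.reg 0 (by simp [computeCmd, wregs])]; exact hx₁.length
    · rw [f₂.reg 5 (by simp [computeCmd, wregs])]; exact hx₁.k
    · rw [f₂.reg 6 (by simp [computeCmd, wregs])]; exact hx₁.n
    · rw [f₂.reg 7 (by simp [computeCmd, wregs])]; exact hx₁.base
    · rw [f₂.arr 0 (by simp [computeCmd, warrs])]; exact hx₁.input
  refine Spec.le (Spec.seq (A.setup_spec x s₂ hx₂) (T' := A.sampleTime x.k x.L E ℓ +
    3 * RamOp.mulCost (A.samples x.k x.L E ℓ) + 29 * (A.ratio x.k x.L + x.L + 4) ^ 2 + 50)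
    fun s₃ f₃ h₃ => ?_) (by omega)
  have hreg₃ : ∀ q < 14, s₃.reg q = s₂.reg q := fun q hq =>
    f₃.reg q fun h => by have := A.setup_wregs q h; omega
  have hx₃ : x.Parsed s₃ := by
    refine ⟨?_, ?_, ?_, ?_, ?_⟩
    · rw [hreg₃ 0 (by norm_num)]; exact hx₂.length
    · rw [hreg₃ 5 (by norm_num)]; exact hx₂.k
    · rw [hreg₃ 6 (by norm_num)]; exact hx₂.n
    · rw [hreg₃ 7 (by norm_num)]; exact hx₂.base
    · rw [f₃.arr 0 fun h => by have := A.setup_warrs 0 h; omega]; exact hx₂.input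
  have hc₃ : s₃.coins = s.coins := (f₃.coins A.setup_noFlip).trans hc₂
  have h11 : s₃.reg 11 = N := by rw [hreg₃ 11 (by norm_num), hN]; exact h₂.1
  have h12 : s₃.reg 12 = A.scale x.k := by rw [hreg₃ 12 (by norm_num), ← hD]; exact h₂.2
  refine Spec.le (Spec.seq (A.sampleCmd_spec x E ℓ s₃ hx₃ h₃.2.2 h₃.1 h₃.2.1 (hN ▸ h11))
    (T' := 3 * RamOp.mulCost (A.samples x.k x.L E ℓ) + 29 * (A.ratio x.k x.L + x.L + 4) ^ 2 + 50)
    fun s₄ f₄ h₄ => ?_) (by omega)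
  have hreg₄ : ∀ q, q = 11 ∨ q = 12 → s₄.reg q = s₃.reg q := by
    intro q hq
    refine f₄.reg q ?_
    simp only [sampleCmd, wregs, List.mem_cons, List.mem_append, not_or, List.not_mem_nil,
      not_false_eq_true, and_true]
    refine ⟨by omega, by omega, fun h => ?_, fun h => ?_⟩
    · have := drawCmd_wregs q h; omega
    · have := A.body_wregs q h; omega
  have e11 : s₄.reg 11 = N := (hreg₄ 11 (Or.inl rfl)).trans h11
  have e12 : s₄.reg 12 = A.scale x.k := (hreg₄ 12 (Or.inr rfl)).trans h12
  rw [hc₃, ← hN] at h₄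
  have hval : eval s₄.reg ((reg 13 + reg 13 + reg 11 * reg 12) /
      (reg 11 * reg 12 + reg 11 * reg 12)) = (2 * A.total x N s.coins + M) / (2 * M) := by
    simp only [eval_div, eval_add, eval_mul, eval_reg, e11, e12, h₄, hM, two_mul]
  refine Spec.le (Spec.set ?_) ?_
  · simpa using hval
  · have hq : (2 * A.total x N s.coins + M) / (2 * M) < 2 ^ (A.ratio x.k x.L + x.L + 3) := by
      have hs : 0 < A.scale x.k := A.scale_pos _
      rcases Nat.eq_zero_or_pos N with hN0 | hN0
      · simp [hM, hN0]
      have hM0 : 0 < M := hM ▸ Nat.mul_pos hN0 hs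
      rw [Nat.div_lt_iff_lt_mul (by omega)]
      have h1 := A.total_le x N s.coins
      have h2 : N * (A.ratio x.k x.L * (A.scale x.k * solutions Φ x)) =
          M * (A.ratio x.k x.L * solutions Φ x) := by rw [hM]; ring
      have h3 : A.ratio x.k x.L * solutions Φ x ≤ 2 ^ (A.ratio x.k x.L + x.L) := by
        rw [pow_add]
        exact Nat.mul_le_mul Nat.lt_two_pow_self.le (solutions_le Φ x)
      have h4 : 2 ^ (A.ratio x.k x.L + x.L + 3) = 8 * 2 ^ (A.ratio x.k x.L + x.L) := by
        rw [pow_add]; ring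
      have h5 : 1 ≤ 2 ^ (A.ratio x.k x.L + x.L) := Nat.one_le_two_pow
      rw [h4]
      have h6 := Nat.mul_le_mul_left M h3
      nlinarith
    have h1 := RamOp.mulCost_le_of_lt hq
    rw [← hval] at h1
    simp only [eval_div, eval_add, eval_mul, eval_reg] at h1
    simp [e11] at h1 ⊢
    rw [← hN]
    ring_nf at h1 ⊢
    omega

end Sampler

/-! ### Rounding and the final accuracy estimates -/

open RamState Cmd Exp

/-- Before rounding, the estimate deviates from c by at most c/(3E), and rounding adds at most 1/2.
If c < E, the total error is at most 1/3 + 1/2 < 1, so the integer obtained is c itself. If c ≥ E,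
then 1/2 ≤ c/(2E), and 1/(3E) + 1/(2E) ≤ 1/E ≤ ε. This is the reason for the factor 3 in the
accuracy demanded of the samples. -/
theorem round_estimate {S N D E c : ℕ} (hN : 0 < N) (hD : 0 < D) (hE : 0 < E) {ε : ℝ}
    (hε : 1 / (E : ℝ) ≤ ε)
    (h : |(S : ℝ) - N * (D * c : ℕ)| ≤ N * (D * c : ℕ) / (3 * E)) :
    (1 - ε) * c ≤ ((2 * S + N * D) / (2 * (N * D)) : ℕ) ∧
      (((2 * S + N * D) / (2 * (N * D)) : ℕ) : ℝ) ≤ (1 + ε) * c := by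
  set M := N * D with hM
  have hM0 : 0 < M := Nat.mul_pos hN hD
  set z := (2 * S + M) / (2 * M) with hz
  have h1 : z * (2 * M) ≤ 2 * S + M := Nat.div_mul_le_self _ _
  have h2 : 2 * S + M < (z + 1) * (2 * M) := by
    have := Nat.lt_div_mul_add (a := 2 * S + M) (b := 2 * M) (by omega)
    rw [← hz] at this
    rw [add_mul]; omega
  have hMr : (0 : ℝ) < M := by exact_mod_cast hM0
  have hEr : (0 : ℝ) < E := by exact_mod_cast hE
  have e : (N : ℝ) * (D * c : ℕ) = M * c := by rw [hM]; push_cast; ring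
  rw [e, abs_le] at h
  have h1r : (z : ℝ) * (2 * M) ≤ 2 * S + M := by exact_mod_cast h1
  have h2r : (2 * S + M : ℝ) < (z + 1) * (2 * M) := by exact_mod_cast h2
  have e2 : (M : ℝ) * c / (3 * E) = M * (c / (3 * E)) := by ring
  rw [e2] at h
  have h3 : (z : ℝ) ≤ c + c / (3 * E) + 1 / 2 := by
    have : (M : ℝ) * z ≤ M * (c + c / (3 * E) + 1 / 2) := by nlinarith
    exact le_of_mul_le_mul_left this hMr
  have h4 : (c : ℝ) - c / (3 * E) - 1 / 2 ≤ z := by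
    have : (M : ℝ) * (c - c / (3 * E) - 1 / 2) ≤ M * z := by nlinarith
    exact le_of_mul_le_mul_left this hMr
  have hc0 : (0 : ℝ) ≤ c := c.cast_nonneg
  have hεc : (c : ℝ) / E ≤ ε * c := by
    rw [div_eq_mul_one_div, mul_comm]; gcongr
  rcases lt_or_ge c E with hcE | hcE
  · have h5 : (c : ℝ) / (3 * E) ≤ 1 / 3 := by
      rw [div_le_div_iff₀ (by positivity) (by norm_num)]
      have : (c : ℝ) ≤ E := by exact_mod_cast hcE.le
      linarith
    have h6 : z < c + 1 := by
      have : (z : ℝ) < c + 1 := by linarith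
      exact_mod_cast this
    have h7 : c < z + 1 := by
      have : (c : ℝ) < z + 1 := by linarith
      exact_mod_cast this
    have : z = c := by omega
    rw [this]
    have : 0 ≤ (c : ℝ) / E := by positivity
    constructor <;> linarith
  · have h5 : 1 / 2 + (c : ℝ) / (3 * E) ≤ c / E := by
      have : (E : ℝ) ≤ c := by exact_mod_cast hcE
      have h8 : 1 ≤ (c : ℝ) / E := (one_le_div hEr).2 this
      have h9 : (c : ℝ) / (3 * E) = c / E / 3 := by rw [div_div, mul_comm]
      linarith
    constructor <;> linarith

theorem ceilDiv_spec {ε : ℚ} (hε : 0 < ε) {E : ℕ}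
    (hE : E = (ε.den + ε.num.toNat - 1) / ε.num.toNat) :
    0 < E ∧ 1 / (E : ℝ) ≤ ε ∧ (E : ℝ) ≤ 1 / (ε : ℝ) + 1 := by
  have hn : 0 < ε.num := Rat.num_pos.2 hε
  obtain ⟨a, ha⟩ : ∃ a : ℕ, ε.num = a := ⟨ε.num.toNat, by omega⟩
  have ha0 : 0 < a := by omega
  have hd := ε.den_pos
  have e : (ε : ℝ) = a / ε.den := by
    rw [Rat.cast_def, ha, Int.cast_natCast]
  rw [ha, Int.toNat_natCast] at hE
  have h1 : ε.den ≤ E * a := by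
    have := Nat.lt_div_mul_add (a := ε.den + a - 1) (b := a) ha0
    rw [← hE] at this; omega
  have h2 : E * a ≤ ε.den + a - 1 := hE ▸ Nat.div_mul_le_self _ _
  have hE0 : 0 < E := by
    rcases Nat.eq_zero_or_pos E with h | h
    · simp [h] at h1
    · exact h
  have har : (0 : ℝ) < a := by exact_mod_cast ha0
  have hdr : (0 : ℝ) < ε.den := by exact_mod_cast hd
  have hEr : (0 : ℝ) < E := by exact_mod_cast hE0
  refine ⟨hE0, ?_, ?_⟩
  · rw [e, div_le_div_iff₀ hEr hdr, one_mul]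
    have : (ε.den : ℝ) ≤ E * a := by exact_mod_cast h1
    linarith
  · rw [e, one_div_div, div_add_one har.ne', le_div_iff₀ har]
    have : E * a ≤ ε.den + a := by omega
    exact_mod_cast this

/-- Minimality of `ℓ` gives 2 ^ (ℓ - 1) ≤ 1/δ, and log 2 > 1/2 converts this to the natural
logarithm at the price of a factor 2. -/
theorem clogDiv_spec {δ : ℚ} (hδ : 0 < δ) (hδ1 : δ < 1) {ℓ : ℕ}
    (hℓ : ℓ = RamOp.clogDiv δ.den δ.num.toNat) :
    (1 / 2 : ℝ) ^ ℓ ≤ δ ∧ (ℓ : ℝ) ≤ 1 + 2 * Real.log (1 / δ) := by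
  have hn : 0 < δ.num := Rat.num_pos.2 hδ
  obtain ⟨a, ha⟩ : ∃ a : ℕ, δ.num = a := ⟨δ.num.toNat, by omega⟩
  have ha0 : 0 < a := by omega
  have hd := δ.den_pos
  have e : (δ : ℝ) = a / δ.den := by
    rw [Rat.cast_def, ha, Int.cast_natCast]
  rw [ha, Int.toNat_natCast] at hℓ
  have har : (0 : ℝ) < a := by exact_mod_cast ha0
  have hdr : (0 : ℝ) < δ.den := by exact_mod_cast hd
  constructor
  · have h1 : δ.den ≤ a * 2 ^ ℓ := hℓ ▸ RamOp.le_mul_two_pow_clogDiv _ ha0.ne'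
    have h1r : (δ.den : ℝ) ≤ a * 2 ^ ℓ := by exact_mod_cast h1
    rw [e, one_div, inv_pow, ← one_div, div_le_div_iff₀ (by positivity) hdr]
    linarith
  · rcases Nat.eq_zero_or_pos ℓ with h0 | h0
    · have : 0 ≤ Real.log (1 / (δ : ℝ)) := by
        refine Real.log_nonneg ?_
        rw [le_div_iff₀ (by exact_mod_cast hδ), one_mul]
        exact_mod_cast hδ1.le
      rw [h0]; push_cast; linarith
    · have h1 : a * 2 ^ (ℓ - 1) < δ.den := by
        by_contra! h
        have := (RamOp.clogDiv_le_iff ha0.ne').2 h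
        omega
      have h1r : (a : ℝ) * 2 ^ (ℓ - 1) < δ.den := by exact_mod_cast h1
      have h2 : (2 : ℝ) ^ (ℓ - 1) ≤ 1 / δ := by
        rw [e, one_div_div, le_div_iff₀ har]; linarith
      have h3 := Real.log_le_log (by positivity) h2
      rw [Real.log_pow] at h3
      have h4 := Real.log_two_gt_d9
      have h5 : ((ℓ - 1 : ℕ) : ℝ) = ℓ - 1 := by rw [Nat.cast_sub h0]; simp
      rw [h5] at h3
      have h6 : (1 : ℝ) ≤ ℓ := by exact_mod_cast h0
      nlinarith

/-- Time bound and correctness meet here: the compiled program computes the rounded average for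
every coin sequence, and the event of a good average has probability at least 1 - δ. -/
theorem Sampler.hasFPTRAS {Φ : GraphProperty} (A : Sampler Φ) :
    (edgeSubProblem Φ).HasFPTRAS := by
  obtain ⟨oB, hoB, hcB⟩ := RamOp.exists_of_computable (F := fun k _ => 3 * (A.bound k + 1))
    ((Primrec.nat_mul.to_comp.comp (Computable.const 3)
      (Computable.succ.comp A.bound_computable)).comp Computable.fst)
  obtain ⟨oD, hoD, hcD⟩ := RamOp.exists_of_computable (F := fun k _ => A.scale k)
    (A.scale_computable.comp Computable.fst)
  obtain ⟨p, hp⟩ := (A.algorithm oB oD).exists_program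
  obtain ⟨f, d, hf, hfd⟩ := A.algorithmTime_fpt oB oD hcB hcD
  -- The factors dominate L + 1, E + 1 and ℓ + 1, by E ≤ 1/ε + 1 and ℓ ≤ 1 + 2 log(1/δ).
  refine ⟨p, f, ((MvPolynomial.X 0 + 1) * (MvPolynomial.X 1 + 2) *
    (2 * MvPolynomial.X 2 + 2)) ^ d, hf, fun x ε δ hε hδ hδ1 => ?_⟩
  obtain ⟨E, hE⟩ : ∃ E : ℕ, E = (ε.den + ε.num.toNat - 1) / ε.num.toNat := ⟨_, rfl⟩
  obtain ⟨ℓ, hℓ⟩ : ∃ ℓ : ℕ, ℓ = RamOp.clogDiv δ.den δ.num.toNat := ⟨_, rfl⟩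
  obtain ⟨hE0, hE1, hE2⟩ := ceilDiv_spec hε hE
  obtain ⟨hℓ1, hℓ2⟩ := clogDiv_spec hδ hδ1 hℓ
  change EdgeSubInst at x
  have hL : 0 < x.L := by rw [x.length_eq]; unfold EdgeSubInst.base; omega
  have hspec : ∀ ω, (A.algorithm oB oD).Spec (ramInit (encodeGraphNat x) ε δ ω)
      (A.algorithmTime oB oD x.k x.L E ℓ) fun s' => s'.reg 0 =
        (2 * A.total x (A.samples x.k x.L E ℓ) ω + A.samples x.k x.L E ℓ * A.scale x.k) /
          (2 * (A.samples x.k x.L E ℓ * A.scale x.k)) := fun ω =>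
    A.algorithm_spec oB oD (fun k => by rw [hoB]) (fun k => by rw [hoD]) x _ rfl
      (by funext i; simp [ramInit, EdgeSubInst.bit]) E ℓ hE hℓ _ _ rfl rfl
  constructor
  · intro ω
    obtain ⟨s', t, hex, ht, -⟩ := hp (ramInit (encodeGraphNat x) ε δ ω)
    refine ⟨s', t, hex, ?_⟩
    have h1 : t ≤ f x.k * ((x.L + 1) * (E + 1) * (ℓ + 1)) ^ d :=
      (ht.trans (hspec ω).1).trans (hfd _ _ _ _)
    have h2 : (t : ℝ) ≤ f x.k * ((x.L + 1) * (E + 1) * (ℓ + 1)) ^ d := by exact_mod_cast h1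
    refine h2.trans ?_
    have h3 : (0 : ℝ) ≤ 1 / (ε : ℝ) := by positivity
    simp only [map_pow, map_mul, map_add, MvPolynomial.aeval_X, map_one, map_ofNat]
    show _ ≤ (f x.k : ℝ) * (((x.L : ℝ) + 1) * (1 / (ε : ℝ) + 2) *
      (2 * Real.log (1 / (δ : ℝ)) + 2)) ^ d
    have h4 : (0 : ℝ) ≤ ℓ := ℓ.cast_nonneg
    have h5 : (0 : ℝ) ≤ x.L := x.L.cast_nonneg
    exact mul_le_mul_of_nonneg_left (pow_le_pow_left₀ (by positivity) (mul_le_mul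
      (mul_le_mul_of_nonneg_left (by linarith) (by linarith)) (by linarith) (by linarith)
      (by positivity)) _) (Nat.cast_nonneg _)
  · set N := A.samples x.k x.L E ℓ with hN
    -- Adding 1 to the bound keeps K positive. Since `ratio` is 3K, the number of samples is 9 (EK)²
    -- (ℓ + 1), more than the factor 5 required.
    set K := (A.bound x.k + 1) * x.L ^ A.deg with hK
    have hK0 : 0 < K := Nat.mul_pos (Nat.succ_pos _) (pow_pos hL _)
    have hr : A.ratio x.k x.L = 3 * K := by rw [ratio, hK]; ring
    have hN5 : 5 * (E * K) ^ 2 * (ℓ + 1) ≤ N := by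
      have : N = 9 * (E * K) ^ 2 * (ℓ + 1) := by rw [hN, samples, hr]; ring
      rw [this]; gcongr; norm_num
    have hN0 : 0 < N := lt_of_lt_of_le (by positivity) hN5
    refine (fairCoins_estimate (A.r x) (A.b x) N E K ℓ (A.scale x.k * solutions Φ x) (A.g x)
      (A.sum_g x) (fun I => (A.g_le x I).trans (Nat.mul_le_mul_right _
        (Nat.mul_le_mul_right _ (Nat.le_succ _)))) hE0 hK0 hN5 δ hℓ1).trans ?_
    refine MeasureTheory.measureReal_mono fun ω hω => ?_
    obtain ⟨s', t, hex, -, hs'⟩ := hp (ramInit (encodeGraphNat x) ε δ ω)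
    refine ⟨s', t, hex, ?_⟩
    rw [hs', (hspec ω).2]
    exact round_estimate hN0 (A.scale_pos _) hE0 hE1 hω

/-! ### Graphs given by lists of pairs of numbers -/

/-- Two numbers are adjacent in the graph given by a list of pairs. -/
def PairAdj (l : List (ℕ × ℕ)) (a b : ℕ) : Prop := a ≠ b ∧ ((a, b) ∈ l ∨ (b, a) ∈ l)

/-- The numbers below `C` that occur in a list of pairs. -/
def pairVerts (C : ℕ) (l : List (ℕ × ℕ)) : List ℕ :=
  (List.range C).filter fun i => decide (∃ e ∈ l, e.1 = i ∨ e.2 = i)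

instance (l : List (ℕ × ℕ)) (a b : ℕ) : Decidable (PairAdj l a b) := by
  unfold PairAdj; infer_instance

/-- The encoding of the graph given by a list of pairs of numbers below `C`. -/
def pairCode (C : ℕ) (l : List (ℕ × ℕ)) : List Bool :=
  (List.range (pairVerts C l).length).map (fun _ => true) ++ false ::
    (List.range ((pairVerts C l).length * (pairVerts C l).length)).map fun p =>
      decide (PairAdj l ((pairVerts C l).getD (p / (pairVerts C l).length) 0)
        ((pairVerts C l).getD (p % (pairVerts C l).length) 0))

theorem primrec_pairVerts : Primrec₂ pairVerts := by
  have h1 : PrimrecRel fun (e : ℕ × ℕ) (i : ℕ) => e.1 = i ∨ e.2 = i :=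
    PrimrecPred.or (Primrec.eq.comp (Primrec.fst.comp Primrec.fst) Primrec.snd)
      (Primrec.eq.comp (Primrec.snd.comp Primrec.fst) Primrec.snd)
  have h2 : PrimrecRel fun (i : ℕ) (l : List (ℕ × ℕ)) => ∃ e ∈ l, e.1 = i ∨ e.2 = i :=
    h1.exists_mem_list.comp Primrec.snd Primrec.fst
  exact (PrimrecRel.listFilter h2).comp (Primrec.list_range.comp Primrec.fst) Primrec.snd

theorem primrecPred_pairAdj :
    PrimrecPred fun p : List (ℕ × ℕ) × ℕ × ℕ => PairAdj p.1 p.2.1 p.2.2 := by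
  have h1 : PrimrecRel fun (e : ℕ × ℕ) (p : ℕ × ℕ) => e = p := Primrec.eq
  have h2 : PrimrecRel fun (l : List (ℕ × ℕ)) (p : ℕ × ℕ) => p ∈ l :=
    PrimrecRel.of_eq h1.exists_mem_list fun l p => by simp
  have ha : Primrec fun p : List (ℕ × ℕ) × ℕ × ℕ => p.2.1 := Primrec.fst.comp Primrec.snd
  have hb : Primrec fun p : List (ℕ × ℕ) × ℕ × ℕ => p.2.2 := Primrec.snd.comp Primrec.snd
  exact (Primrec.eq.comp ha hb).not.and ((h2.comp Primrec.fst (ha.pair hb)).or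
    (h2.comp Primrec.fst (hb.pair ha)))

theorem primrec_pairCode : Primrec₂ pairCode := by
  have hv : Primrec fun p : ℕ × List (ℕ × ℕ) => pairVerts p.1 p.2 := primrec_pairVerts
  have hl := Primrec.list_length.comp hv
  have hv' := hv.comp (Primrec.fst (β := ℕ))
  have hl' := hl.comp (Primrec.fst (β := ℕ))
  refine Primrec.list_append.comp
    (Primrec.list_map (Primrec.list_range.comp hl) (Primrec.const true).to₂)
    (Primrec.list_cons.comp (Primrec.const false)
      (Primrec.list_map (Primrec.list_range.comp (Primrec.nat_mul.comp hl hl)) ?_))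
  exact (primrecPred_pairAdj.decide).comp ((Primrec.snd.comp Primrec.fst).pair
    (((Primrec.list_getD 0).comp hv' (Primrec.nat_div.comp Primrec.snd hl')).pair
    ((Primrec.list_getD 0).comp hv' (Primrec.nat_mod.comp Primrec.snd hl'))))

/-- The graph that is encoded by `pairCode`. -/
def pairGraph (C : ℕ) (l : List (ℕ × ℕ)) : SimpleGraph (Fin (pairVerts C l).length) where
  Adj i j := PairAdj l (pairVerts C l)[i] (pairVerts C l)[j]
  symm := ⟨fun _ _ h => ⟨h.1.symm, h.2.symm⟩⟩
  loopless := ⟨fun _ h => h.1 rfl⟩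

theorem encodeGraph_pairGraph (C : ℕ) (l : List (ℕ × ℕ)) :
    encodeGraph (pairGraph C l) = pairCode C l := by
  unfold encodeGraph pairCode adjacencyBits
  congr 1
  · simp
  · congr 1
    refine List.ext_getElem (by simp) fun p h1 h2 => ?_
    simp only [List.getElem_ofFn, List.getElem_map, List.getElem_range]
    have hp : p < (pairVerts C l).length * (pairVerts C l).length := by simpa using h1
    have h0 : 0 < (pairVerts C l).length := by
      rcases Nat.eq_zero_or_pos (pairVerts C l).length with h | h
      · simp [h] at hp
      · exact h
    rw [List.getD_eq_getElem _ _ (Nat.div_lt_of_lt_mul hp), List.getD_eq_getElem _ _ (Nat.mod_lt _ h0)]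
    simp only [pairGraph, Fin.divNat, Fin.modNat]
    exact decide_eq_decide.2 Iff.rfl

theorem mem_pairVerts {C : ℕ} {l : List (ℕ × ℕ)} {i : ℕ} :
    i ∈ pairVerts C l ↔ i < C ∧ ∃ e ∈ l, e.1 = i ∨ e.2 = i := by
  simp [pairVerts]

theorem nodup_pairVerts (C : ℕ) (l : List (ℕ × ℕ)) : (pairVerts C l).Nodup :=
  List.nodup_range.filter _

/-- A relabelling of the edges of a set by numbers that is injective on the endpoints gives an
isomorphic graph. -/
theorem nonempty_edgeInduced_iso_pairGraph {V : Type} (A : Set (Sym2 V)) (C : ℕ)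
    (l : List (ℕ × ℕ)) (R : V → ℕ)
    (hR : Set.InjOn R (SimpleGraph.fromEdgeSet A).support)
    (hC : ∀ v ∈ (SimpleGraph.fromEdgeSet A).support, R v < C)
    (hA : ∀ u v, (SimpleGraph.fromEdgeSet A).Adj u v → PairAdj l (R u) (R v))
    (hl : ∀ e ∈ l, ∃ u v, (SimpleGraph.fromEdgeSet A).Adj u v ∧ e = (R u, R v)) :
    Nonempty (edgeInduced A ≃g pairGraph C l) := by
  set H := SimpleGraph.fromEdgeSet A
  have hmem : ∀ v : H.support, R v ∈ pairVerts C l := by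
    rintro ⟨v, hv⟩
    refine mem_pairVerts.2 ⟨hC v hv, ?_⟩
    obtain ⟨w, hw⟩ := hv
    rcases (hA v w hw).2 with h | h
    exacts [⟨_, h, Or.inl rfl⟩, ⟨_, h, Or.inr rfl⟩]
  let f : H.support → Fin (pairVerts C l).length := fun v =>
    ⟨(pairVerts C l).idxOf (R v), List.idxOf_lt_length_of_mem (hmem v)⟩
  have hf : ∀ v, (pairVerts C l)[f v] = R v := fun v => List.getElem_idxOf _
  have hbij : Function.Bijective f := by
    constructor
    · intro v w hvw
      have := hf v
      rw [hvw, hf w] at this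
      exact Subtype.ext (hR v.2 w.2 this.symm)
    · intro i
      obtain ⟨-, e, he, hi⟩ := mem_pairVerts.1 (List.getElem_mem i.2)
      obtain ⟨u, v, huv, rfl⟩ := hl e he
      have key : ∀ w : H.support, R w = (pairVerts C l)[i.1] → f w = i := by
        intro w hw
        have h1 := hf w
        rw [hw] at h1
        exact Fin.ext ((nodup_pairVerts C l).getElem_inj_iff.1 h1)
      rcases hi with hi | hi
      · exact ⟨⟨u, v, huv⟩, key _ hi⟩
      · exact ⟨⟨v, u, huv.symm⟩, key _ hi⟩
  refine ⟨⟨Equiv.ofBijective f hbij, fun {v w} => ?_⟩⟩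
  show PairAdj l (pairVerts C l)[f v] (pairVerts C l)[f w] ↔ H.Adj v w
  rw [hf, hf]
  refine ⟨fun h => ?_, fun h => hA _ _ h⟩
  have key : ∀ a b : H.support, (R a, R b) ∈ l → H.Adj a b := by
    intro a b hab
    obtain ⟨u', v', huv, he⟩ := hl _ hab
    rw [Prod.mk.injEq] at he
    have e1 := hR a.2 ⟨v', huv⟩ he.1
    have e2 := hR b.2 ⟨u', huv.symm⟩ he.2
    rwa [e1, e2]
  rcases h.2 with h | h
  exacts [key v w h, (key w v h).symm]

theorem GraphProperty.holds_edgeInduced_iff {Φ : GraphProperty} {d : List Bool → Bool}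
    (hd : ∀ (n : ℕ) (G : SimpleGraph (Fin n)), d (encodeGraph G) = true ↔ Φ.holds G)
    {V : Type} [Finite V] (A : Set (Sym2 V)) (C : ℕ) (l : List (ℕ × ℕ)) (R : V → ℕ)
    (hR : Set.InjOn R (SimpleGraph.fromEdgeSet A).support)
    (hC : ∀ v ∈ (SimpleGraph.fromEdgeSet A).support, R v < C)
    (hA : ∀ u v, (SimpleGraph.fromEdgeSet A).Adj u v → PairAdj l (R u) (R v))
    (hl : ∀ e ∈ l, ∃ u v, (SimpleGraph.fromEdgeSet A).Adj u v ∧ e = (R u, R v)) :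
    Φ.holds (edgeInduced A) ↔ d (pairCode C l) = true := by
  rw [← encodeGraph_pairGraph, hd]
  exact Φ.iso_invariant _ _ (nonempty_edgeInduced_iso_pairGraph A C l R hR hC hA hl)

open Finset

/-! ### Many matchings or many stars -/

/-- The edges are pairwise disjoint. -/
def PairwiseDisjointEdges {V : Type} (A : Finset (Sym2 V)) : Prop :=
  ∀ e ∈ A, ∀ e' ∈ A, ∀ v, v ∈ e → v ∈ e' → e = e'

theorem PairwiseDisjointEdges.nonempty_iso {V : Type} {A : Finset (Sym2 V)}
    (hA : PairwiseDisjointEdges A) (hd : ∀ e ∈ A, ¬ e.IsDiag) {k : ℕ} (hk : A.card = k) :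
    Nonempty (matchingGraph k ≃g edgeInduced (A : Set (Sym2 V))) := by
  let g : Fin k ≃ A := (A.equivFinOfCardEq hk).symm
  have hrep : ∀ e : Sym2 V, ∃ p : V × V, e = s(p.1, p.2) := fun e => by
    induction e with | _ a b => exact ⟨(a, b), rfl⟩
  choose p hp using hrep
  let a : Fin k → V := fun i => (p (g i)).1
  let b : Fin k → V := fun i => (p (g i)).2
  have hg : ∀ i, (g i : Sym2 V) = s(a i, b i) := fun i => hp _
  have hab : ∀ i, a i ≠ b i := fun i h => hd _ (g i).2 (by rw [hg, Sym2.mk_isDiag_iff]; exact h)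
  let f : Fin k × Bool → V := fun x => if x.2 then a x.1 else b x.1
  have hfmem : ∀ x, f x ∈ (g x.1 : Sym2 V) := by
    rintro ⟨i, c⟩
    rw [hg]
    cases c <;> simp [f]
  have hinj : ∀ x y, f x = f y → x = y := by
    rintro ⟨i, c⟩ ⟨j, c'⟩ h
    have h1 := hfmem (i, c)
    have h2 := hfmem (j, c')
    rw [← h] at h2
    have : i = j := g.injective (Subtype.ext (hA _ (g i).2 _ (g j).2 _ h1 h2))
    subst this
    cases c <;> cases c'
    · rfl
    · exact absurd h.symm (hab i)
    · exact absurd h (hab i)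
    · rfl
  have hadj : ∀ x y, (SimpleGraph.fromEdgeSet (A : Set (Sym2 V))).Adj (f x) (f y) ↔
      (matchingGraph k).Adj x y := by
    rintro ⟨i, c⟩ ⟨j, c'⟩
    rw [SimpleGraph.fromEdgeSet_adj]
    constructor
    · rintro ⟨h1, h2⟩
      have h1' : s(f (i, c), f (j, c')) ∈ A := h1
      obtain ⟨l, hl⟩ := g.surjective ⟨_, h1'⟩
      have hi : i = l := g.injective (Subtype.ext (hA _ (g i).2 _ (g l).2 _ (hfmem (i, c))
        (by rw [hl]; simp)))
      have hj : j = l := g.injective (Subtype.ext (hA _ (g j).2 _ (g l).2 _ (hfmem (j, c'))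
        (by rw [hl]; simp)))
      subst hi
      subst hj
      exact ⟨rfl, fun h => h2 (by simp only at h; rw [h])⟩
    · rintro ⟨h1, h2⟩
      simp only at h1 h2
      subst h1
      have h3 : s(a i, b i) ∈ A := hg i ▸ (g i).2
      cases c <;> cases c'
      · exact absurd rfl h2
      · exact ⟨Sym2.eq_swap ▸ h3, (hab i).symm⟩
      · exact ⟨h3, hab i⟩
      · exact absurd rfl h2
  have hsupp : ∀ x, f x ∈ (SimpleGraph.fromEdgeSet (A : Set (Sym2 V))).support := by
    rintro ⟨i, c⟩
    exact ⟨f (i, !c), (hadj _ _).2 ⟨rfl, by cases c <;> simp⟩⟩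
  have hbij : Function.Bijective fun x => (⟨f x, hsupp x⟩ :
      (SimpleGraph.fromEdgeSet (A : Set (Sym2 V))).support) := by
    constructor
    · intro x y h
      exact hinj x y (congrArg Subtype.val h)
    · rintro ⟨v, w, hvw⟩
      have h1 : s(v, w) ∈ A := (SimpleGraph.fromEdgeSet_adj _).1 hvw |>.1
      obtain ⟨l, hl⟩ := g.surjective ⟨_, h1⟩
      have h2 : v ∈ s(a l, b l) := by rw [← hg, hl]; simp
      rcases Sym2.mem_iff.1 h2 with h | h
      · exact ⟨(l, true), Subtype.ext (by simp [f, h])⟩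
      · exact ⟨(l, false), Subtype.ext (by simp [f, h])⟩
  exact ⟨⟨Equiv.ofBijective _ hbij, fun {x y} => hadj x y⟩⟩

/-- Positivity of k is essential: for k = 0 the centre of the star is an isolated vertex, which
`edgeInduced` deletes. -/
theorem nonempty_iso_star {V : Type} [DecidableEq V] {v : V} {B : Finset V} (hv : v ∉ B) {k : ℕ}
    (hk : B.card = k) (hk0 : 0 < k) :
    Nonempty (completeBipartiteGraph (Fin 1) (Fin k) ≃g
      edgeInduced ((B.image fun w => s(v, w) : Finset (Sym2 V)) : Set (Sym2 V))) := by
  set H := SimpleGraph.fromEdgeSet ((B.image fun w => s(v, w) : Finset (Sym2 V)) : Set (Sym2 V))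
    with hH
  have hadj : ∀ a b, H.Adj a b ↔ (a = v ∧ b ∈ B) ∨ (b = v ∧ a ∈ B) := by
    intro a b
    rw [hH, SimpleGraph.fromEdgeSet_adj]
    simp only [coe_image, Set.mem_image, mem_coe, Sym2.eq_iff]
    constructor
    · rintro ⟨⟨w, hw, ⟨rfl, rfl⟩ | ⟨rfl, rfl⟩⟩, -⟩
      exacts [Or.inl ⟨rfl, hw⟩, Or.inr ⟨rfl, hw⟩]
    · rintro (⟨rfl, h⟩ | ⟨rfl, h⟩)
      · exact ⟨⟨b, h, Or.inl ⟨rfl, rfl⟩⟩, fun e => hv (e ▸ h)⟩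
      · exact ⟨⟨a, h, Or.inr ⟨rfl, rfl⟩⟩, fun e => hv (e ▸ h)⟩
  let g : Fin k ≃ B := (B.equivFinOfCardEq hk).symm
  have hgv : ∀ i, (g i : V) ≠ v := fun i h => hv (h ▸ (g i).2)
  let f : Fin 1 ⊕ Fin k → V := Sum.elim (fun _ => v) fun i => g i
  have hf : ∀ x y, H.Adj (f x) (f y) ↔ (completeBipartiteGraph (Fin 1) (Fin k)).Adj x y := by
    rintro (x | x) (y | y) <;> simp [hadj, f, hv, hgv]
  have hsupp : ∀ x, f x ∈ H.support := by
    rintro (x | x)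
    · exact ⟨f (Sum.inr ⟨0, hk0⟩), (hf _ _).2 (by simp)⟩
    · exact ⟨f (Sum.inl 0), (hf _ _).2 (by simp)⟩
  have hbij : Function.Bijective fun x => (⟨f x, hsupp x⟩ : H.support) := by
    constructor
    · rintro (x | x) (y | y) h
      · simp [Subsingleton.elim x y]
      · exact absurd (congrArg Subtype.val h).symm (hgv y)
      · exact absurd (congrArg Subtype.val h) (hgv x)
      · have h' : f (Sum.inr x) = f (Sum.inr y) := by simpa only [Subtype.mk.injEq] using h
        rw [g.injective (Subtype.ext h')]
    · rintro ⟨w, u, hwu⟩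
      rcases (hadj _ _).1 hwu with ⟨h, -⟩ | ⟨-, h⟩
      · exact ⟨Sum.inl 0, Subtype.ext h.symm⟩
      · exact ⟨Sum.inr (g.symm ⟨w, h⟩), Subtype.ext (by simp [f])⟩
  exact ⟨⟨Equiv.ofBijective _ hbij, fun {x y} => hf x y⟩⟩

/-! ### Lower bounds for the number of solutions -/

section Counting

variable {V : Type} [Fintype V] [DecidableEq V] (G : SimpleGraph V) [DecidableRel G.Adj]

open Classical in
/-- The sets of `j` pairwise disjoint edges. -/
noncomputable def matchingSets (j : ℕ) : Finset (Finset (Sym2 V)) :=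
  (G.edgeFinset.powersetCard j).filter PairwiseDisjointEdges

/-- Double counting of the pairs A ⊆ B of a j-matching and a (j + 1)-matching. The j edges of A have
2j ends, which block at most 2jΔ edges; every other edge extends A. Conversely B has at most j + 1
subsets of size j. -/
theorem card_matchingSets_succ (Δ : ℕ) (hΔ : ∀ v, G.degree v ≤ Δ) (j : ℕ) :
    (matchingSets G j).card * (G.edgeFinset.card - j * (2 * Δ)) ≤
      (matchingSets G (j + 1)).card * (j + 1) := by
  classical
  refine Finset.card_mul_le_card_mul (fun A B => A ⊆ B) (fun A hA => ?_) fun B hB => ?_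
  · simp only [matchingSets, mem_filter, mem_powersetCard] at hA
    obtain ⟨⟨hAG, hAj⟩, hAd⟩ := hA
    set T := A.biUnion fun e => e.toFinset.biUnion fun v => G.incidenceFinset v with hT
    have hTc : T.card ≤ j * (2 * Δ) := by
      rw [← hAj]
      refine card_biUnion_le_card_mul _ _ _ fun e he => ?_
      refine (card_biUnion_le_card_mul _ _ Δ fun v _ => ?_).trans ?_
      · rw [G.card_incidenceFinset_eq_degree]; exact hΔ v
      · refine Nat.mul_le_mul_right _ ?_
        induction e with
        | _ a b => rw [Sym2.toFinset_mk_eq]; exact card_le_two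
    have hAT : A ⊆ T := by
      intro e he
      simp only [hT, mem_biUnion, Sym2.mem_toFinset]
      induction e with
      | _ a b =>
        exact ⟨_, he, a, by simp, by
          rw [SimpleGraph.mem_incidenceFinset]
          exact ⟨SimpleGraph.mem_edgeFinset.1 (hAG he), by simp⟩⟩
    have hsub : (G.edgeFinset \ T).image (fun e => insert e A) ⊆
        bipartiteAbove (fun A B => A ⊆ B) (matchingSets G (j + 1)) A := by
      intro B hB
      obtain ⟨e, he, rfl⟩ := mem_image.1 hB
      obtain ⟨heG, heT⟩ := mem_sdiff.1 he
      have hne : ∀ e' ∈ A, ∀ v, v ∈ e → v ∈ e' → False := by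
        intro e' he' v hv hv'
        refine heT ?_
        simp only [hT, mem_biUnion, Sym2.mem_toFinset]
        refine ⟨e', he', v, hv', ?_⟩
        rw [SimpleGraph.mem_incidenceFinset]
        exact ⟨SimpleGraph.mem_edgeFinset.1 heG, hv⟩
      have heA : e ∉ A := fun h => heT (hAT h)
      simp only [bipartiteAbove, matchingSets, mem_filter, mem_powersetCard]
      refine ⟨⟨⟨insert_subset heG hAG, by rw [card_insert_of_notMem heA, hAj]⟩, ?_⟩,
        subset_insert _ _⟩
      intro e₁ h₁ e₂ h₂ v hv₁ hv₂
      rcases mem_insert.1 h₁ with h₁ | h₁ <;> rcases mem_insert.1 h₂ with h₂ | h₂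
      · rw [h₁, h₂]
      · exact (hne _ h₂ v (h₁ ▸ hv₁) hv₂).elim
      · exact (hne _ h₁ v (h₂ ▸ hv₂) hv₁).elim
      · exact hAd _ h₁ _ h₂ v hv₁ hv₂
    refine le_trans ?_ (card_le_card hsub)
    rw [card_image_of_injOn]
    · have := le_card_sdiff T G.edgeFinset
      omega
    · intro e he e' he' h
      have h1 : e ∉ A := fun h => (mem_sdiff.1 he).2 (hAT h)
      have h2 : e ∈ insert e' A := by
        have h3 : insert e A = insert e' A := h
        rw [← h3]; exact mem_insert_self _ _
      exact (mem_insert.1 h2).resolve_right h1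
  · simp only [matchingSets, mem_filter, mem_powersetCard] at hB
    have hsub : bipartiteBelow (fun A B => A ⊆ B) (matchingSets G j) B ⊆ B.powersetCard j := by
      intro A hA
      simp only [bipartiteBelow, matchingSets, mem_filter, mem_powersetCard] at hA
      exact mem_powersetCard.2 ⟨hA.2, hA.1.1.2⟩
    refine (card_le_card hsub).trans ?_
    rw [card_powersetCard, hB.1.2, Nat.choose_succ_self_right]

/-- Iteration of the extension step. In each of the k steps at least m - 2kΔ edges remain available,
and the factors j + 1 accumulate to k!, the number of orders in which a matching can be built. -/
theorem pow_le_factorial_mul_card_matchingSets (Δ : ℕ) (hΔ : ∀ v, G.degree v ≤ Δ) (k : ℕ) :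
    (G.edgeFinset.card - k * (2 * Δ)) ^ k ≤ k.factorial * (matchingSets G k).card := by
  set q := G.edgeFinset.card - k * (2 * Δ) with hq
  have key : ∀ j ≤ k, q ^ j ≤ j.factorial * (matchingSets G j).card := by
    intro j
    induction j with
    | zero =>
      intro _
      have : (∅ : Finset (Sym2 V)) ∈ matchingSets G 0 := by
        simp [matchingSets, PairwiseDisjointEdges]
      simpa using Nat.succ_le_of_lt (card_pos.2 ⟨_, this⟩)
    | succ j ih =>
      intro hj
      have h1 := card_matchingSets_succ G Δ hΔ j
      have h2 : q ≤ G.edgeFinset.card - j * (2 * Δ) := by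
        have : j * (2 * Δ) ≤ k * (2 * Δ) := Nat.mul_le_mul_right _ (by omega)
        omega
      calc q ^ (j + 1) = q ^ j * q := pow_succ _ _
        _ ≤ j.factorial * (matchingSets G j).card * (G.edgeFinset.card - j * (2 * Δ)) :=
          Nat.mul_le_mul (ih (by omega)) h2
        _ = j.factorial * ((matchingSets G j).card * (G.edgeFinset.card - j * (2 * Δ))) := by ring
        _ ≤ j.factorial * ((matchingSets G (j + 1)).card * (j + 1)) := Nat.mul_le_mul_left _ h1
        _ = (j + 1).factorial * (matchingSets G (j + 1)).card := by
          rw [Nat.factorial_succ]; ring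
  exact key k le_rfl

variable {Φ : GraphProperty} {k : ℕ}

theorem card_matchingSets_le (hk : Φ.holds (matchingGraph k)) :
    (matchingSets G k).card ≤ (edgeSubs Φ k G).ncard := by
  rw [← Set.ncard_coe_finset]
  refine Set.ncard_le_ncard (fun A hA => ?_) (Set.toFinite _)
  simp only [matchingSets, coe_filter, mem_powersetCard, Set.mem_setOf_eq] at hA
  have hAG : (A : Set (Sym2 V)) ⊆ G.edgeSet := fun e he => SimpleGraph.mem_edgeFinset.1 (hA.1.1 he)
  exact ⟨hAG, hA.1.2, (Φ.iso_invariant _ _ (hA.2.nonempty_iso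
    (fun e he => G.not_isDiag_of_mem_edgeSet (hAG he)) hA.1.2)).1 hk⟩

/-- Each k-subset of the neighbours of a vertex is the set of leaves of a star, and distinct subsets
give distinct edge sets. -/
theorem choose_degree_le (hk0 : 0 < k) (hk : Φ.holds (completeBipartiteGraph (Fin 1) (Fin k)))
    (v : V) : (G.degree v).choose k ≤ (edgeSubs Φ k G).ncard := by
  rw [← G.card_neighborFinset_eq_degree, ← card_powersetCard, ← Set.ncard_coe_finset]
  have hinj : Function.Injective fun w : V => s(v, w) := fun a b h =>
    Sym2.congr_right.1 h
  refine Set.ncard_le_ncard_of_injOn (fun B : Finset V => B.image fun w => s(v, w))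
    (fun B hB => ?_) (fun B _ B' _ h => Finset.image_injective hinj h) (Set.toFinite _)
  obtain ⟨hB, hc⟩ := mem_powersetCard.1 (mem_coe.1 hB)
  refine ⟨fun e he => ?_, ?_, ?_⟩
  · obtain ⟨w, hw, rfl⟩ := mem_image.1 (mem_coe.1 he)
    exact (G.mem_neighborFinset v w).1 (hB hw)
  · rw [card_image_of_injective _ hinj, hc]
  · refine (Φ.iso_invariant _ _ (nonempty_iso_star (fun h => ?_) hc hk0)).1 hk
    exact G.irrefl ((G.mem_neighborFinset v v).1 (hB h))

/-- If matchings and stars with `k` edges are solutions, then a positive proportion of all sets of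
`k` edges are solutions, unless there are few edges. -/
theorem card_edgeFinset_pow_le (hk0 : 0 < k) (hM : Φ.holds (matchingGraph k))
    (hS : Φ.holds (completeBipartiteGraph (Fin 1) (Fin k))) (h0 : 0 < (edgeSubs Φ k G).ncard) :
    (2 * G.edgeFinset.card) ^ k ≤
      (16 * (k * k)) ^ k * k.factorial * (edgeSubs Φ k G).ncard := by
  set m := G.edgeFinset.card
  set c := (edgeSubs Φ k G).ncard
  have hf : 1 ≤ k.factorial := Nat.succ_le_of_lt k.factorial_pos
  have hkk : k ≤ k * k := Nat.le_mul_self k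
  -- With few edges, the existence of a single solution already suffices.
  rcases le_or_gt (2 * m) (16 * (k * k)) with hm | hm
  · calc (2 * m) ^ k ≤ (16 * (k * k)) ^ k := Nat.pow_le_pow_left hm k
      _ = (16 * (k * k)) ^ k * 1 * 1 := by ring
      _ ≤ _ := by gcongr; exact h0
  -- The threshold is chosen so that a partial matching blocks at most k · 2 · m/(4k) = m/2 edges.
  -- Half of the edges stay free, and the matchings are numerous.
  by_cases hΔ : ∀ v, G.degree v ≤ m / (4 * k)
  · have h1 := pow_le_factorial_mul_card_matchingSets G _ hΔ k
    have h2 := card_matchingSets_le G hM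
    have h3 : k * (2 * (m / (4 * k))) * 2 ≤ m := by
      have := Nat.div_mul_le_self m (4 * k)
      calc k * (2 * (m / (4 * k))) * 2 = m / (4 * k) * (4 * k) := by ring
        _ ≤ m := this
    have h4 : 2 * m ≤ 4 * (m - k * (2 * (m / (4 * k)))) := by omega
    calc (2 * m) ^ k ≤ (4 * (m - k * (2 * (m / (4 * k))))) ^ k := Nat.pow_le_pow_left h4 k
      _ = 4 ^ k * (m - k * (2 * (m / (4 * k)))) ^ k := by rw [mul_pow]
      _ ≤ 4 ^ k * (k.factorial * c) :=
        Nat.mul_le_mul_left _ (h1.trans (Nat.mul_le_mul_left _ h2))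
      _ = 4 ^ k * k.factorial * c := by ring
      _ ≤ _ := by gcongr; omega
  -- Now some degree Δ exceeds m/(4k), and m > 8k² makes Δ > 2k. Then Δ + 1 - k is at least Δ/2, so
  -- the falling factorial in Δ choose k is comparable to a power of m.
  · push Not at hΔ
    obtain ⟨v, hv⟩ := hΔ
    set Δ := G.degree v
    have h1 := choose_degree_le G hk0 hS v
    have h2 : m < Δ * (4 * k) := (Nat.div_lt_iff_lt_mul (by omega)).1 hv
    have h3 : 2 * k < Δ := by
      by_contra! h
      have : Δ * (4 * k) ≤ 2 * k * (4 * k) := Nat.mul_le_mul_right _ h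
      have e : 2 * k * (4 * k) = 8 * (k * k) := by ring
      omega
    have h4 : (Δ + 1 - k) ^ k ≤ k.factorial * Δ.choose k := by
      rw [← Nat.descFactorial_eq_factorial_mul_choose]
      exact Nat.pow_sub_le_descFactorial Δ k
    have h5 : 2 * m ≤ 16 * (k * k) * (Δ + 1 - k) := by
      have h6 : Δ ≤ 2 * (Δ + 1 - k) := by omega
      calc 2 * m ≤ 2 * (Δ * (4 * k)) := by omega
        _ ≤ 2 * (2 * (Δ + 1 - k) * (4 * k)) := by gcongr
        _ = 16 * k * (Δ + 1 - k) := by ring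
        _ ≤ _ := by gcongr
    calc (2 * m) ^ k ≤ (16 * (k * k) * (Δ + 1 - k)) ^ k := Nat.pow_le_pow_left h5 k
      _ = (16 * (k * k)) ^ k * (Δ + 1 - k) ^ k := by rw [mul_pow]
      _ ≤ (16 * (k * k)) ^ k * (k.factorial * c) :=
        Nat.mul_le_mul_left _ (h4.trans (Nat.mul_le_mul_left _ h1))
      _ = _ := by ring

end Counting

/-! ### Numbering the edges -/

theorem Nat.div_lt_of_lt_mul_self {p n : ℕ} (h : p < n * n) : p / n < n := Nat.div_lt_of_lt_mul h

theorem Nat.mod_lt_of_lt_mul_self {p n : ℕ} (h : p < n * n) : p % n < n :=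
  Nat.mod_lt _ (by rcases Nat.eq_zero_or_pos n with rfl | h0 <;> omega)

theorem Nat.mul_add_lt_mul_self {a b n : ℕ} (ha : a < n) (hb : b < n) : a * n + b < n * n :=
  calc a * n + b < a * n + n := by omega
    _ = (a + 1) * n := by ring
    _ ≤ n * n := Nat.mul_le_mul_right _ ha

theorem Nat.mul_add_div_of_lt {a b n : ℕ} (hb : b < n) : (a * n + b) / n = a := by
  rw [mul_comm, Nat.mul_add_div (by omega), Nat.div_eq_of_lt hb, add_zero]

theorem Nat.mul_add_mod_of_lt' {a b n : ℕ} (hb : b < n) : (a * n + b) % n = b := by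
  rw [mul_comm, Nat.mul_add_mod, Nat.mod_eq_of_lt hb]

namespace EdgeSubInst

variable (x : EdgeSubInst)

/-- The position `p` in the adjacency matrix belongs to an edge, and is above the diagonal. -/
def IsEdgePos (p : ℕ) : Prop := p / x.n < p % x.n ∧ x.bit (x.base + p) ≠ 0

noncomputable instance : DecidablePred x.IsEdgePos := fun p => by unfold IsEdgePos; infer_instance

/-- The positions of the edges in the adjacency matrix. -/
noncomputable def edgeList : List ℕ := (List.range (x.n * x.n)).filter fun p => x.IsEdgePos p

/-- The number of edges. -/
noncomputable abbrev m : ℕ := x.edgeList.length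

theorem edgeList_lt (j : Fin x.m) : x.edgeList[j] < x.n * x.n :=
  List.mem_range.1 (List.mem_filter.1 (List.getElem_mem j.2)).1

/-- The smaller end of the `j`-th edge. -/
noncomputable def src (j : Fin x.m) : Fin x.n :=
  ⟨x.edgeList[j] / x.n, Nat.div_lt_of_lt_mul_self (x.edgeList_lt j)⟩

/-- The larger end of the `j`-th edge. -/
noncomputable def tgt (j : Fin x.m) : Fin x.n :=
  ⟨x.edgeList[j] % x.n, Nat.mod_lt_of_lt_mul_self (x.edgeList_lt j)⟩

theorem src_lt_tgt (j : Fin x.m) : x.src j < x.tgt j := by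
  have h := (List.mem_filter.1 (List.getElem_mem j.2)).2
  exact (of_decide_eq_true h : x.IsEdgePos _).1

theorem adj_src_tgt (j : Fin x.m) : x.1.2.Adj (x.src j) (x.tgt j) := by
  classical
  have h := (List.mem_filter.1 (List.getElem_mem j.2)).2
  have h2 := (of_decide_eq_true h : x.IsEdgePos _).2
  have h3 := x.bit_adj (x.src j) (x.tgt j)
  have e : (x.src j : ℕ) * x.n + x.tgt j = x.edgeList[j] := by
    rw [src, tgt, mul_comm]; exact Nat.div_add_mod _ _
  rw [e] at h3
  by_contra hc
  rw [if_neg hc] at h3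
  exact h2 h3

/-- The `j`-th edge. -/
noncomputable def edgeAt (j : Fin x.m) : Sym2 (Fin x.n) := s(x.src j, x.tgt j)

theorem edgeAt_injective : Function.Injective x.edgeAt := by
  intro i j h
  have h1 := x.src_lt_tgt i
  have h2 := x.src_lt_tgt j
  have h3 : x.src i = x.src j ∧ x.tgt i = x.tgt j := by
    rcases Sym2.eq_iff.1 h with h | h
    · exact h
    · rw [h.1, h.2] at h1
      exact absurd h1 h2.asymm
  have e : ∀ j, x.edgeList[j] = (x.src j : ℕ) * x.n + x.tgt j := fun j => by
    rw [src, tgt, mul_comm]; exact (Nat.div_add_mod _ _).symm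
  have h4 : x.edgeList[i] = x.edgeList[j] := by rw [e, e, h3.1, h3.2]
  exact Fin.ext ((List.nodup_range.filter _).getElem_inj_iff.1 h4)

theorem edgeAt_mem (j : Fin x.m) : x.edgeAt j ∈ x.1.2.edgeSet := x.adj_src_tgt j

theorem exists_edgeAt {e : Sym2 (Fin x.n)} (he : e ∈ x.1.2.edgeSet) : ∃ j, x.edgeAt j = e := by
  classical
  have key : ∀ a b : Fin x.n, a < b → x.1.2.Adj a b → ∃ j, x.edgeAt j = s(a, b) := by
    intro a b hab h
    have hd : (a * x.n + b : ℕ) / x.n = a := Nat.mul_add_div_of_lt b.2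
    have hm : (a * x.n + b : ℕ) % x.n = b := Nat.mul_add_mod_of_lt' b.2
    have hmem : (a * x.n + b : ℕ) ∈ x.edgeList := by
      refine List.mem_filter.2 ⟨List.mem_range.2 (Nat.mul_add_lt_mul_self a.2 b.2), ?_⟩
      refine decide_eq_true ⟨?_, ?_⟩
      · rw [hd, hm]; exact hab
      · rw [x.bit_adj, if_pos h]; exact one_ne_zero
    obtain ⟨j, hj, hj'⟩ := List.getElem_of_mem hmem
    refine ⟨⟨j, hj⟩, ?_⟩
    have e1 : x.src ⟨j, hj⟩ = a := Fin.ext (by simp only [src, Fin.getElem_fin, hj', hd])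
    have e2 : x.tgt ⟨j, hj⟩ = b := Fin.ext (by simp only [tgt, Fin.getElem_fin, hj', hm])
    rw [edgeAt, e1, e2]
  induction e with
  | _ a b =>
    have h : x.1.2.Adj a b := he
    rcases lt_or_gt_of_ne h.ne with hab | hab
    · exact key a b hab h
    · rw [Sym2.eq_swap]; exact key b a hab h.symm

open Classical in
theorem card_edgeFinset : x.1.2.edgeFinset.card = x.m := by
  rw [← Fintype.card_fin x.m, ← Finset.card_univ]
  refine (Finset.card_bij (fun j _ => x.edgeAt j) (fun j _ => ?_)
    (fun i _ j _ h => x.edgeAt_injective h) fun e he => ?_).symm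
  · exact SimpleGraph.mem_edgeFinset.2 (x.edgeAt_mem j)
  · obtain ⟨j, hj⟩ := x.exists_edgeAt (SimpleGraph.mem_edgeFinset.1 he)
    exact ⟨j, Finset.mem_univ _, hj⟩

theorem two_mul_m_le : 2 * x.m ≤ x.L := by
  classical
  have h1 : x.m ≤ x.n.choose 2 := by
    rw [← x.card_edgeFinset]
    simpa using x.1.2.card_edgeFinset_le_card_choose_two
  have h2 := x.length_eq
  have h3 : x.n.choose 2 * 2 ≤ x.n * x.n := by
    rw [Nat.choose_two_right]
    exact (Nat.div_mul_le_self _ _).trans (Nat.mul_le_mul_left _ (Nat.sub_le _ _))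
  omega

/-- The edges with the given numbers. -/
noncomputable def edgesOf {r : ℕ} (I : Fin r → ℕ) : Finset (Sym2 (Fin x.n)) :=
  open Classical in Finset.univ.filter fun e => ∃ i, ∃ h : I i < x.m, x.edgeAt ⟨I i, h⟩ = e

/-- The numbers are increasing, and are those of the edges of a solution. -/
def Hit (Φ : GraphProperty) (I : Fin x.k → ℕ) : Prop :=
  StrictMono I ∧ (∀ i, I i < x.m) ∧ Φ.holds (edgeInduced (x.edgesOf I : Set (Sym2 (Fin x.n))))

theorem coe_edgesOf {r : ℕ} {I : Fin r → ℕ} (h : ∀ i, I i < x.m) :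
    (x.edgesOf I : Set (Sym2 (Fin x.n))) = Set.range fun i => x.edgeAt ⟨I i, h i⟩ := by
  ext e
  simp only [edgesOf, Finset.coe_filter, Finset.mem_univ, true_and, Set.mem_setOf_eq,
    Set.mem_range]
  exact ⟨fun ⟨i, _, hi⟩ => ⟨i, hi⟩, fun ⟨i, hi⟩ => ⟨i, h i, hi⟩⟩

/-- Sorting the edge numbers turns each set of k edges into exactly one increasing tuple, so
demanding increasing draws counts every solution once. The range `W` may exceed the number of edges,
because numbers are drawn below a power of two. -/
theorem card_hit (Φ : GraphProperty) {W : ℕ} (hW : x.m ≤ W) :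
    {I : Fin x.k → Fin W | x.Hit Φ fun i => I i}.ncard = solutions Φ x := by
  classical
  refine Set.ncard_congr (fun I _ => x.edgesOf fun i => (I i : ℕ)) ?_ ?_ ?_
  · rintro I ⟨hI, hm, hΦ⟩
    refine ⟨?_, ?_, hΦ⟩
    · rw [x.coe_edgesOf hm]
      rintro e ⟨i, rfl⟩
      exact x.edgeAt_mem _
    · rw [← Set.ncard_coe_finset, x.coe_edgesOf hm, ← Set.image_univ, Set.ncard_image_of_injective,
        Set.ncard_univ, Nat.card_eq_fintype_card, Fintype.card_fin]
      intro i j h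
      exact hI.injective (Fin.mk.inj (x.edgeAt_injective h))
  · rintro I J ⟨hI, hIm, -⟩ ⟨hJ, hJm, -⟩ h
    have h1 : (Set.range fun i => x.edgeAt ⟨I i, hIm i⟩) = Set.range fun i => x.edgeAt ⟨J i, hJm i⟩ := by
      rw [← x.coe_edgesOf hIm, ← x.coe_edgesOf hJm]
      exact congrArg _ h
    have h2 : Set.range I = Set.range J := by
      have key : ∀ (I J : Fin x.k → Fin W) (hIm : ∀ i, (I i : ℕ) < x.m) (hJm : ∀ i, (J i : ℕ) < x.m),
          (Set.range fun i => x.edgeAt ⟨I i, hIm i⟩) ⊆ (Set.range fun i => x.edgeAt ⟨J i, hJm i⟩) →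
          Set.range I ⊆ Set.range J := by
        rintro I J hIm hJm h _ ⟨i, rfl⟩
        obtain ⟨j, hj⟩ := h ⟨i, rfl⟩
        exact ⟨j, Fin.ext (Fin.mk.inj (x.edgeAt_injective hj))⟩
      exact (key I J hIm hJm h1.subset).antisymm (key J I hJm hIm h1.symm.subset)
    have hI' : StrictMono I := fun i j hij => hI hij
    have hJ' : StrictMono J := fun i j hij => hJ hij
    exact (StrictMono.range_inj hI' hJ').1 h2
  · rintro A ⟨hAG, hAk, hΦ⟩
    set S : Finset (Fin x.m) := Finset.univ.filter fun j => x.edgeAt j ∈ A with hS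
    have hSA : S.image x.edgeAt = A := by
      ext e
      simp only [hS, Finset.mem_image, Finset.mem_filter, Finset.mem_univ, true_and]
      refine ⟨fun ⟨j, hj, hje⟩ => hje ▸ hj, fun he => ?_⟩
      obtain ⟨j, hj⟩ := x.exists_edgeAt (hAG he)
      exact ⟨j, hj ▸ he, hj⟩
    have hSk : S.card = x.k := by
      rw [← Finset.card_image_of_injective S x.edgeAt_injective, hSA, hAk]
    have hmem : ∀ i, ((S.orderEmbOfFin hSk i : Fin x.m) : ℕ) < x.m := fun i => Fin.is_lt _
    have hcoe : x.edgesOf (fun i => ((S.orderEmbOfFin hSk i : Fin x.m) : ℕ)) = A := by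
      rw [← Finset.coe_inj, x.coe_edgesOf hmem, ← hSA, Finset.coe_image,
        ← Finset.range_orderEmbOfFin S hSk, ← Set.range_comp]
      rfl
    refine ⟨fun i => Fin.castLE hW (S.orderEmbOfFin hSk i), ⟨?_, hmem, ?_⟩, hcoe⟩
    · intro i j hij
      exact (S.orderEmbOfFin hSk).strictMono hij
    · show Φ.holds (edgeInduced (x.edgesOf (fun i => ((S.orderEmbOfFin hSk i : Fin x.m) : ℕ)) :
        Set (Sym2 (Fin x.n))))
      rw [hcoe]
      exact hΦ

end EdgeSubInst

open RamState Cmd Exp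

/-! ### Deciding a property of the graph formed by a list of edges -/

/-- The last position before `l` at which the value is `w`. -/
def lastIndex (V : ℕ → ℕ) (w : ℕ) : ℕ → ℕ
  | 0 => 0
  | l + 1 => if V l = w then l else lastIndex V w l

theorem lastIndex_spec {V : ℕ → ℕ} {w j l : ℕ} (hj : j < l) (hw : V j = w) :
    V (lastIndex V w l) = w ∧ lastIndex V w l < l := by
  induction l with
  | zero => omega
  | succ l ih =>
    rw [lastIndex]
    split_ifs with h
    · exact ⟨h, by omega⟩
    · have : j < l := by
        rcases Nat.lt_succ_iff_lt_or_eq.1 hj with h' | rfl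
        exacts [h', absurd hw h]
      exact ⟨(ih this).1, (ih this).2.trans (by omega)⟩

theorem lastIndex_lt {V : ℕ → ℕ} {w l : ℕ} (h : 0 < l) : lastIndex V w l < l := by
  induction l with
  | zero => omega
  | succ l ih =>
    rw [lastIndex]
    split_ifs
    · omega
    · rcases Nat.eq_zero_or_pos l with rfl | h
      · simp [lastIndex]
      · exact (ih h).trans (by omega)

/-- The number with digits `q 0, …, q (i - 1)` to the base `D`. -/
def digitsVal (D : ℕ) (q : ℕ → ℕ) : ℕ → ℕ
  | 0 => 0
  | i + 1 => digitsVal D q i * D + q i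

theorem digitsVal_lt {D : ℕ} {q : ℕ → ℕ} {i : ℕ} (h : ∀ j < i, q j < D) :
    digitsVal D q i < D ^ i := by
  induction i with
  | zero => simp [digitsVal]
  | succ i ih =>
    have h1 := ih fun j hj => h j (by omega)
    have h2 := h i (by omega)
    calc digitsVal D q i * D + q i < digitsVal D q i * D + D := by omega
      _ = (digitsVal D q i + 1) * D := by ring
      _ ≤ D ^ i * D := Nat.mul_le_mul_right _ h1
      _ = D ^ (i + 1) := (pow_succ _ _).symm

/-- The pairs of numbers below `C` that are encoded by the last `r` digits to the base `C * C`. -/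
def digitPairs (r C c : ℕ) : List (ℕ × ℕ) :=
  (List.range r).map fun j => (c / (C * C) ^ j % (C * C) / C, c / (C * C) ^ j % C)

/-- The digit appended last is the lowest one: it is read off by a remainder, and division by the
base leaves the code of the shorter list. -/
theorem mem_digitPairs {C : ℕ} {a b : ℕ → ℕ} (ha : ∀ i, a i < C) (hb : ∀ i, b i < C) (r : ℕ)
    (e : ℕ × ℕ) : e ∈ digitPairs r C (digitsVal (C * C) (fun i => a i * C + b i) r) ↔
      ∃ i < r, e = (a i, b i) := by
  have hC : 0 < C := (Nat.zero_le _).trans_lt (ha 0)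
  induction r with
  | zero => simp [digitPairs]
  | succ r ih =>
    have hq := Nat.mul_add_lt_mul_self (ha r) (hb r)
    have hs : digitPairs (r + 1) C (digitsVal (C * C) (fun i => a i * C + b i) (r + 1)) =
        (a r, b r) :: digitPairs r C (digitsVal (C * C) (fun i => a i * C + b i) r) := by
      rw [digitPairs, List.range_succ_eq_map, List.map_cons, List.map_map, digitPairs, digitsVal]
      congr 1
      · simp only [pow_zero, Nat.div_one, Prod.mk.injEq]
        constructor
        · rw [Nat.mul_add_mod_of_lt' hq, Nat.mul_add_div_of_lt (hb r)]
        · rw [show ∀ t : ℕ, t * (C * C) + (a r * C + b r) = (t * C + a r) * C + b r from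
            fun t => by ring, Nat.mul_add_mod_of_lt' (hb r)]
      · refine List.map_congr_left fun j _ => ?_
        simp only [Function.comp]
        rw [Nat.succ_eq_add_one, pow_succ', ← Nat.div_div_eq_div_mul, Nat.mul_add_div_of_lt hq]
    rw [hs, List.mem_cons]
    refine (or_congr Iff.rfl ih).trans ?_
    constructor
    · rintro (rfl | ⟨i, hi, rfl⟩)
      exacts [⟨r, by omega, rfl⟩, ⟨i, by omega, rfl⟩]
    · rintro ⟨i, hi, rfl⟩
      rcases Nat.lt_succ_iff_lt_or_eq.1 hi with h | rfl
      exacts [Or.inr ⟨i, h, rfl⟩, Or.inl rfl]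

theorem Primrec.nat_pow : Primrec₂ ((· ^ ·) : ℕ → ℕ → ℕ) :=
  Primrec₂.unpaired'.1 Nat.Primrec.pow

theorem Primrec.nat_factorial : Primrec Nat.factorial := by
  have h : Primrec₂ fun (n m : ℕ) => (n + 1) * m :=
    Primrec.nat_mul.comp (Primrec.succ.comp Primrec.fst) Primrec.snd
  exact (Primrec.nat_rec₁ 1 h).of_eq fun n => by
    induction n with
    | zero => rfl
    | succ n ih => rw [Nat.factorial_succ, ← ih]

theorem primrec_digitPairs : Primrec fun p : ℕ × ℕ => digitPairs (p.1 / 2) p.1 p.2 := by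
  have hC : Primrec fun q : (ℕ × ℕ) × ℕ => q.1.1 := Primrec.fst.comp Primrec.fst
  have hc : Primrec fun q : (ℕ × ℕ) × ℕ => q.1.2 := Primrec.snd.comp Primrec.fst
  have hD := Primrec.nat_mul.comp hC hC
  have hq := Primrec.nat_div.comp hc (Primrec.nat_pow.comp hD Primrec.snd)
  exact Primrec.list_map (Primrec.list_range.comp (Primrec.nat_div.comp Primrec.fst
    (Primrec.const 2))) ((Primrec.nat_div.comp (Primrec.nat_mod.comp hq hD) hC).pair
    (Primrec.nat_mod.comp hq hC))

/-- Decides a property of the graph with `C / 2` edges that is encoded by digits. -/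
def digitsTest (d : List Bool → Bool) (C c : ℕ) : ℕ :=
  (d (pairCode C (digitPairs (C / 2) C c))).toNat

theorem computable_digitsTest {d : List Bool → Bool} (hd : Computable d) :
    Computable₂ (digitsTest d) := by
  have h1 : Computable fun p : ℕ × ℕ => pairCode p.1 (digitPairs (p.1 / 2) p.1 p.2) :=
    (primrec_pairCode.comp Primrec.fst primrec_digitPairs).to_comp
  exact (Primrec.dom_finite Bool.toNat).to_comp.comp (hd.comp h1)

/-- Every vertex is renamed to the last position at which it occurs in the list `V` of the 2k ends.
Looking up that position in `V` recovers the vertex, so the renaming is injective and the graph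
keeps its isomorphism type. The point is that the renamed graph is coded by a number bounded in
terms of k alone, and so is the time to test it. -/
theorem EdgeSubInst.holds_edgesOf_iff {Φ : GraphProperty} {d : List Bool → Bool}
    (hd : ∀ (n : ℕ) (G : SimpleGraph (Fin n)), d (encodeGraph G) = true ↔ Φ.holds G)
    (x : EdgeSubInst) {V J : ℕ → ℕ} (hJ : ∀ i < x.k, J i < x.m)
    (hV : ∀ i (hi : i < x.k), V (i + i) = x.src ⟨J i, hJ i hi⟩)
    (hV' : ∀ i (hi : i < x.k), V (i + i + 1) = x.tgt ⟨J i, hJ i hi⟩) :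
    Φ.holds (edgeInduced (x.edgesOf fun i : Fin x.k => J i : Set (Sym2 (Fin x.n)))) ↔
      digitsTest d (x.k + x.k) (digitsVal ((x.k + x.k) * (x.k + x.k)) (fun i =>
        lastIndex V (V (i + i)) (x.k + x.k) * (x.k + x.k) +
          lastIndex V (V (i + i + 1)) (x.k + x.k)) x.k) ≠ 0 := by
  set C := x.k + x.k with hC
  have hk : 0 < x.k := x.2.pos
  rw [x.coe_edgesOf (fun i : Fin x.k => hJ i i.2)]
  set A := Set.range fun i : Fin x.k => x.edgeAt ⟨J i, hJ i i.2⟩ with hA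
  let R : Fin x.n → ℕ := fun v => lastIndex V v C
  have hadj : ∀ u v, (SimpleGraph.fromEdgeSet A).Adj u v ↔ ∃ i : Fin x.k,
      (u = x.src ⟨J i, hJ i i.2⟩ ∧ v = x.tgt ⟨J i, hJ i i.2⟩) ∨
      (v = x.src ⟨J i, hJ i i.2⟩ ∧ u = x.tgt ⟨J i, hJ i i.2⟩) := by
    intro u v
    rw [SimpleGraph.fromEdgeSet_adj]
    constructor
    · rintro ⟨⟨i, hi⟩, -⟩
      refine ⟨i, ?_⟩
      rcases Sym2.eq_iff.1 hi with h | h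
      exacts [Or.inl ⟨h.1.symm, h.2.symm⟩, Or.inr ⟨h.1.symm, h.2.symm⟩]
    · rintro ⟨i, ⟨rfl, rfl⟩ | ⟨rfl, rfl⟩⟩
      · exact ⟨⟨i, rfl⟩, (x.adj_src_tgt _).ne⟩
      · exact ⟨⟨i, Sym2.eq_swap⟩, (x.adj_src_tgt _).ne'⟩
  have hsupp : ∀ v ∈ (SimpleGraph.fromEdgeSet A).support, ∃ j < C, V j = v := by
    rintro v ⟨w, hw⟩
    obtain ⟨i, ⟨rfl, -⟩ | ⟨-, rfl⟩⟩ := (hadj _ _).1 hw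
    · exact ⟨i + i, by have := i.2; omega, hV i i.2⟩
    · exact ⟨i + i + 1, by have := i.2; omega, hV' i i.2⟩
  have hR : ∀ v ∈ (SimpleGraph.fromEdgeSet A).support, V (R v) = v ∧ R v < C := by
    intro v hv
    obtain ⟨j, hj, hjv⟩ := hsupp v hv
    exact lastIndex_spec hj hjv
  have hC0 : 0 < C := by omega
  have hinj : Set.InjOn R (SimpleGraph.fromEdgeSet A).support := fun u hu v hv h =>
    Fin.ext (by rw [← (hR u hu).1, ← (hR v hv).1, h])
  have hmem := mem_digitPairs (C := C) (a := fun i => lastIndex V (V (i + i)) C)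
    (b := fun i => lastIndex V (V (i + i + 1)) C) (fun i => lastIndex_lt hC0) (fun i => lastIndex_lt hC0) x.k
  rw [Φ.holds_edgeInduced_iff hd A C _ R hinj (fun v hv => (hR v hv).2) (fun u v h => ?_)
    fun e he => ?_]
  · rw [digitsTest, show C / 2 = x.k by omega]
    exact (by simp : ∀ b : Bool, b = true ↔ b.toNat ≠ 0) _
  · refine ⟨fun e => h.ne (hinj ⟨v, h⟩ ⟨u, h.symm⟩ e), ?_⟩
    obtain ⟨i, h | h⟩ := (hadj _ _).1 h
    · refine Or.inl ((hmem _).2 ⟨i, i.2, ?_⟩)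
      simp only [R, h.1, h.2, hV i i.2, hV' i i.2]
    · refine Or.inr ((hmem _).2 ⟨i, i.2, ?_⟩)
      simp only [R, h.1, h.2, hV i i.2, hV' i i.2]
  · obtain ⟨i, hi, rfl⟩ := (hmem _).1 he
    refine ⟨_, _, (hadj _ _).2 ⟨⟨i, hi⟩, Or.inl ⟨rfl, rfl⟩⟩, ?_⟩
    simp only [R, hV i hi, hV' i hi]

/-! ### Sampling sets of edges -/

/-- Lists the edges, and computes the number of bits of the numbers of edges. -/
def edgeSetup : Cmd :=
  .set 30 0 ;; .loop 33 (reg 6 * reg 6) (.set 34 (reg 33 / reg 6) ;;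
    .set 35 (reg 33 - reg 34 * reg 6) ;; .load 36 0 (reg 7 + reg 33) ;;
    .ite (.ite (reg 36) (reg 35 - reg 34) 0)
      (.store 2 (reg 30) (reg 33) ;; .set 30 (reg 30 + 1)) .skip) ;;
  .set 14 (reg 5) ;; .set 15 (op .clogDivOp (reg 30) 1) ;; .set 31 (reg 5 + reg 5) ;;
  .set 32 1 ;; .loop 33 (reg 14) (.loop 34 (reg 15) (.set 32 (reg 32 + reg 32)))

namespace EdgeSubInst

variable (x : EdgeSubInst)

/-- The number of bits of the numbers of edges. -/
noncomputable def edgeBits : ℕ := RamOp.clogDiv x.m 1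

theorem m_le_two_pow : x.m ≤ 2 ^ x.edgeBits := by
  simpa [edgeBits] using RamOp.le_mul_two_pow_clogDiv x.m one_ne_zero

theorem edgeBits_le : x.edgeBits ≤ x.L := by
  refine (RamOp.clogDiv_le_iff one_ne_zero).2 ?_
  rw [one_mul]
  exact Nat.lt_two_pow_self.le.trans (Nat.pow_le_pow_right (by norm_num)
    (by have := x.two_mul_m_le; omega))

theorem n_mul_n_le : x.n * x.n ≤ x.L := by rw [x.length_eq]; omega

theorem n_le : x.n ≤ x.L := by rw [x.length_eq]; unfold base; omega

theorem k_le : x.k ≤ x.L := by rw [x.length_eq]; unfold base; omega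

/-- The edges are listed in array `2`. -/
structure EdgesReady (s : RamState) : Prop where
  m : s.reg 30 = x.m
  colors : s.reg 31 = x.k + x.k
  weight : s.reg 32 = (2 ^ x.edgeBits) ^ x.k
  edges : ∀ j (hj : j < x.m), s.arr 2 j = x.edgeList[j]

theorem edgeSetup_spec (s : RamState) (hx : x.Parsed s) :
    edgeSetup.Spec s (x.L * (2 * RamOp.mulCost x.L + 60) + x.k * (x.L * 20 + 20) +
      RamOp.mulCost x.L + 4 * x.L + 100) fun s' =>
      s'.reg 14 = x.k ∧ s'.reg 15 = x.edgeBits ∧ x.EdgesReady s' := by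
  have h5 := hx.k
  have h6 := hx.n
  have hnL := RamOp.mulCost_mono x.n_le
  refine Spec.le (Spec.set_seq <| Spec.seq
    (T' := x.k * (x.L * 20 + 20) + 4 * x.L + 80)
    (Spec.loop (fun p s' =>
      s'.reg 30 = ((List.range p).filter fun p => x.IsEdgePos p).length ∧
      ∀ j (hj : j < ((List.range p).filter fun p => x.IsEdgePos p).length),
        s'.arr 2 j = ((List.range p).filter fun p => x.IsEdgePos p)[j])
      (2 * RamOp.mulCost x.L + 50) ?_ ?_) fun s₁ f₁ h₁ => ?_) ?_
  · simp
  · rintro p hp s' f ⟨h1, h2⟩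
    have e6 : s'.reg 6 = x.n := by
      rw [f.reg 6 (by decide)]
      simpa using h6
    have e7 : s'.reg 7 = x.base := by
      rw [f.reg 7 (by decide)]
      simpa using hx.base
    have ea : s'.arr 0 = x.bit := by
      rw [f.arr 0 (by decide)]
      exact hx.input
    simp [h6] at hp
    have hdl : p / x.n ≤ x.L :=
      (Nat.div_lt_of_lt_mul_self hp).le.trans x.n_le
    have hmod : p - p / x.n * x.n = p % x.n := by
      have := Nat.div_add_mod' p x.n
      omega
    have hc := RamOp.mulCost_mono hdl
    refine Spec.le (Spec.set_seq <| Spec.set_seq <| Spec.load_seq <| Spec.ite (T := 15)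
      (fun hne => ?_) fun he => ?_) ?_
    · have hpos : x.IsEdgePos p := by
        simp [e6, e7, ea, hmod] at hne
        refine ⟨by omega, hne.1⟩
      have hf : ((List.range (p + 1)).filter fun p => x.IsEdgePos p) =
          ((List.range p).filter fun p => x.IsEdgePos p) ++ [p] := by
        rw [List.range_succ, List.filter_append]
        simp [hpos]
      refine Spec.le (Spec.store_seq <| Spec.set ⟨?_, fun j hj => ?_⟩) ?_
      · rw [hf]
        simp [h1]
      · rw [List.getElem_of_eq hf]
        rw [hf] at hj
        simp only [List.length_append, List.length_singleton] at hj
        rcases Nat.lt_succ_iff_lt_or_eq.1 hj with hj | rfl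
        · rw [List.getElem_append_left hj]
          simp [h1, hj.ne, h2 j hj]
        · simp [h1]
      · simp
    · have hpos : ¬ x.IsEdgePos p := by
        rintro ⟨q1, q2⟩
        simp [e6, e7, ea, hmod, q2] at he
        omega
      have hf : ((List.range (p + 1)).filter fun p => x.IsEdgePos p) =
          ((List.range p).filter fun p => x.IsEdgePos p) := by
        rw [List.range_succ, List.filter_append]
        simp [hpos]
      refine Spec.le (Spec.skip ⟨?_, fun j hj => ?_⟩) (by norm_num)
      · rw [hf]
        simpa using h1
      · rw [List.getElem_of_eq hf]
        simpa using h2 j (by rwa [hf] at hj)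
    · simp [e6]
      split_ifs <;> omega
  · have e5 : s₁.reg 5 = x.k := by
      rw [f₁.reg 5 (by decide)]
      simpa using h5
    have hl : eval (s.setReg 30 (eval s.reg 0)).reg (reg 6 * reg 6) = x.n * x.n := by
      simp [h6]
    rw [hl] at h₁
    have e30 : s₁.reg 30 = x.m := h₁.1
    refine Spec.le (Spec.set_seq <| Spec.set_seq <| Spec.set_seq <| Spec.set_seq <|
      Spec.mono (Spec.loop (fun i s' => s'.reg 32 = (2 ^ x.edgeBits) ^ i)
        (x.L * 20 + 12) ?_ ?_) le_rfl fun s₂ f₂ h₂ => ⟨?_, ?_, ?_, ?_, ?_, fun j hj => ?_⟩) ?_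
    · simp
    · intro i hi s' f h
      have e15 : s'.reg 15 = x.edgeBits := by
        rw [f.reg 15 (by decide)]
        simp [e30, RamOp.clogDivOp, edgeBits]
      refine Spec.mono (Spec.loop (fun l s' => s'.reg 32 = (2 ^ x.edgeBits) ^ i * 2 ^ l) 10 ?_ ?_)
        ?_ fun s' _ h => ?_
      · simp [h]
      · intro l hl s'' f' h'
        refine Spec.le (Spec.set ?_) ?_
        · simp [h', pow_succ]
          ring
        · simp
      · simp [e15]
        have := x.edgeBits_le
        nlinarith
      · simpa [e15, pow_succ] using h
    · rw [f₂.reg 14 (by decide)]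
      simp [e5]
    · rw [f₂.reg 15 (by decide)]
      simp [e30, RamOp.clogDivOp, edgeBits]
    · rw [f₂.reg 30 (by decide)]
      simp [e30]
    · rw [f₂.reg 31 (by decide)]
      simp [e5]
    · rw [h₂]
      simp [e5]
    · rw [f₂.arr 2 (by decide)]
      exact h₁.2 j hj
    · simp [e5, e30, RamOp.clogDivOp]
      have := x.edgeBits_le
      rw [edgeBits] at this
      nlinarith
  · simp [h6]
    have := x.n_mul_n_le
    nlinarith

end EdgeSubInst

/-! ### Testing whether the drawn edges form a solution -/

open RamState Cmd Exp

/-- Looks up the edges with the drawn numbers. -/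
def edgeLookup : Cmd :=
  .set 33 1 ;; .set 34 0 ;; .loop 35 (reg 5) (.load 36 1 (reg 35) ;;
    .ite (.ite (reg 34 - reg 36) 0 (reg 30 - reg 36))
      (.set 34 (reg 36 + 1) ;; .load 37 2 (reg 36) ;; .set 38 (reg 37 / reg 6) ;;
        .store 3 (reg 35 + reg 35) (reg 38) ;;
        .store 3 (reg 35 + reg 35 + 1) (reg 37 - reg 38 * reg 6))
      (.set 33 0))

/-- Relabels the ends of the edges, and encodes the edges by digits. -/
def edgeEncode : Cmd :=
  .set 39 0 ;; .loop 35 (reg 5) (.load 36 3 (reg 35 + reg 35) ;;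
    .load 37 3 (reg 35 + reg 35 + 1) ;; .set 40 0 ;; .set 41 0 ;;
    .loop 42 (reg 31) (.load 43 3 (reg 42) ;;
      .set 40 (.ite ((reg 43 - reg 36) + (reg 36 - reg 43)) (reg 40) (reg 42)) ;;
      .set 41 (.ite ((reg 43 - reg 37) + (reg 37 - reg 43)) (reg 41) (reg 42))) ;;
    .set 39 (reg 39 * (reg 31 * reg 31) + (reg 40 * reg 31 + reg 41)))

/-- Adds the weight of the draws. -/
def edgeBody (o : RamOp) : Cmd :=
  edgeLookup ;; .ite (reg 33)
    (edgeEncode ;; .set 13 (.ite (op o (reg 31) (reg 39)) (reg 13 + reg 32) (reg 13))) .skip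

namespace EdgeSubInst

variable (x : EdgeSubInst)

/-- The first `i` numbers are increasing and less than the number of edges. -/
def Increasing (J : ℕ → ℕ) (i : ℕ) : Prop := (∀ j < i, J j < x.m) ∧ ∀ j < i, ∀ l < j, J l < J j

theorem increasing_succ {J : ℕ → ℕ} {i : ℕ} : x.Increasing J (i + 1) ↔
    x.Increasing J i ∧ J i < x.m ∧ ∀ l < i, J l < J i := by
  constructor
  · rintro ⟨h1, h2⟩
    exact ⟨⟨fun j hj => h1 j (by omega), fun j hj => h2 j (by omega)⟩, h1 i (by omega),
      h2 i (by omega)⟩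
  · rintro ⟨⟨h1, h2⟩, h3, h4⟩
    constructor <;> intro j hj <;> rcases Nat.lt_succ_iff_lt_or_eq.1 hj with h | rfl
    exacts [h1 j h, h3, h2 j h, h4]

/-- Register 33 is a flag that stays nonzero as long as the draws are valid and increasing; register
34 is the least value admissible next. The invariant states the latter as: being at least register
34 is the same as exceeding all earlier draws. Once the flag is zero, nothing is claimed about the
stored ends. -/
theorem edgeLookup_spec (s : RamState) (hx : x.Parsed s) (hs : x.EdgesReady s) :
    edgeLookup.Spec s (x.k * (2 * RamOp.mulCost x.L + 80) + 20) fun s' =>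
      (s'.reg 33 ≠ 0 ↔ x.Increasing (s.arr 1) x.k) ∧
      (s'.reg 33 ≠ 0 → ∀ j < x.k, ∀ h : s.arr 1 j < x.m,
        s'.arr 3 (j + j) = x.src ⟨s.arr 1 j, h⟩ ∧
        s'.arr 3 (j + j + 1) = x.tgt ⟨s.arr 1 j, h⟩) := by
  have h5 := hx.k
  set J := s.arr 1 with hJ
  refine Spec.mono (Spec.set_seq <| Spec.set_seq <| Spec.loop (fun i s' =>
      (s'.reg 33 ≠ 0 ↔ x.Increasing J i) ∧
      (s'.reg 33 ≠ 0 → (∀ v, s'.reg 34 ≤ v ↔ ∀ l < i, J l < v) ∧ ∀ j < i, ∀ h : J j < x.m,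
        s'.arr 3 (j + j) = x.src ⟨J j, h⟩ ∧ s'.arr 3 (j + j + 1) = x.tgt ⟨J j, h⟩))
      (2 * RamOp.mulCost x.L + 70) ?_ ?_) ?_ ?_
  · simp [Increasing]
  · rintro i hi s' f ⟨h1, h2⟩
    have e6 : s'.reg 6 = x.n := by
      rw [f.reg 6 (by decide)]
      simpa using hx.n
    have e30 : s'.reg 30 = x.m := by
      rw [f.reg 30 (by decide)]
      simpa using hs.m
    have ea1 : s'.arr 1 = J := f.arr 1 (by decide)
    have ea2 : s'.arr 2 = s.arr 2 := f.arr 2 (by decide)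
    refine Spec.le (Spec.load_seq <| Spec.ite (T := 2 * RamOp.mulCost x.L + 50)
      (fun hne => ?_) fun he => ?_) ?_
    · simp [ea1, e30] at hne
      have hm : J i < x.m := by omega
      have hle : s'.reg 34 ≤ J i := by omega
      have hp := hs.edges _ hm
      have hplt : x.edgeList[J i] < x.n * x.n := x.edgeList_lt ⟨J i, hm⟩
      have hc := RamOp.mulCost_mono ((Nat.div_lt_of_lt_mul_self hplt).le.trans x.n_le)
      have hmod : x.edgeList[J i] - x.edgeList[J i] / x.n * x.n = x.edgeList[J i] % x.n := by
        have := Nat.div_add_mod' x.edgeList[J i] x.n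
        omega
      refine Spec.le (Spec.set_seq <| Spec.load_seq <| Spec.set_seq <| Spec.store_seq <|
        Spec.store ⟨?_, fun hf => ⟨fun v => ?_, fun j hj hjm => ?_⟩⟩) ?_
      · rw [increasing_succ]
        simp only [setArr_reg, setReg_reg]
        norm_num
        exact ⟨fun h => ⟨h1.1 h, hm, ((h2 h).1 _).1 hle⟩, fun h => h1.2 h.1⟩
      · simp only [setArr_reg, setReg_reg] at hf ⊢
        norm_num at hf ⊢
        have h3 := ((h2 hf).1 _).1 hle
        simp only [ea1]
        constructor
        · intro hv l hl
          rcases hl.lt_or_eq with hl | rfl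
          · have := h3 l hl; omega
          · omega
        · intro h
          exact h i (by omega)
      · simp only [setArr_reg, setReg_reg] at hf
        norm_num at hf
        rcases Nat.lt_succ_iff_lt_or_eq.1 hj with hj' | rfl
        · have := (h2 hf).2 j hj' hjm
          have n1 : j + j ≠ i + i + 1 := by omega
          have n2 : j + j ≠ i + i := by omega
          have n3 : j + j + 1 ≠ i + i := by omega
          have n4 : j + j + 1 ≠ i + i + 1 := by omega
          simpa [n1, n2, n3, n4] using this
        · simp [ea1, ea2, hp, e6, src, tgt, hmod]
      · simp [ea1, ea2, hp, e6]
        omega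
    · simp [ea1, e30] at he
      refine Spec.le (Spec.set ⟨?_, fun hf => ?_⟩) ?_
      · rw [increasing_succ]
        simp only [setReg_reg]
        norm_num
        intro h3 h4
        by_contra! h5
        have h6 := ((h2 (h1.2 h3)).1 (J i)).2 h5
        have := he (by omega)
        omega
      · simp at hf
      · simp
    · simp
      split_ifs <;> omega
  · simp [h5]
    nlinarith
  · rintro s' - ⟨h1, h2⟩
    have e : eval ((s.setReg 33 (eval s.reg 1)).setReg 34
        (eval (s.setReg 33 (eval s.reg 1)).reg 0)).reg (reg 5) = x.k := by simp [h5]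
    rw [e] at h1 h2
    exact ⟨h1, fun h => (h2 h).2⟩

/-- The encoding of the edges by digits. -/
def edgeDigits (V : ℕ → ℕ) : ℕ → ℕ :=
  digitsVal ((x.k + x.k) * (x.k + x.k)) fun i =>
    lastIndex V (V (i + i)) (x.k + x.k) * (x.k + x.k) + lastIndex V (V (i + i + 1)) (x.k + x.k)

theorem edgeDigits_lt (V : ℕ → ℕ) (i : ℕ) :
    x.edgeDigits V i < ((x.k + x.k) * (x.k + x.k)) ^ i := by
  have hk : 0 < x.k := x.2.pos
  exact digitsVal_lt fun j _ => Nat.mul_add_lt_mul_self (lastIndex_lt (by omega))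
    (lastIndex_lt (by omega))

theorem edgeEncode_spec (s : RamState) (hk : s.reg 5 = x.k) (hC : s.reg 31 = x.k + x.k) :
    edgeEncode.Spec s (x.k * (x.k * 100 + RamOp.mulCost (((x.k + x.k) * (x.k + x.k)) ^ x.k) +
      2 * RamOp.mulCost (x.k + x.k) + 100) + 20)
      fun s' => s'.reg 39 = x.edgeDigits (s.arr 3) x.k := by
  set C := x.k + x.k with hCdef
  have hk0 : 0 < x.k := x.2.pos
  set V := s.arr 3 with hV
  refine Spec.mono (Spec.set_seq <| Spec.loop (fun i s' => s'.reg 39 = x.edgeDigits V i)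
      (x.k * 92 + RamOp.mulCost ((C * C) ^ x.k) + 2 * RamOp.mulCost C + 90) ?_ ?_) ?_ ?_
  · simp [edgeDigits, digitsVal]
  · intro i hi s' f h
    simp [hk] at hi
    have e31 : s'.reg 31 = C := by
      rw [f.reg 31 (by decide)]
      simpa using hC
    have ea : s'.arr 3 = V := f.arr 3 (by decide)
    refine Spec.le (Spec.load_seq <| Spec.load_seq <| Spec.set_seq <| Spec.set_seq <|
      Spec.seq (T' := RamOp.mulCost ((C * C) ^ x.k) + 2 * RamOp.mulCost C + 40)
      (Spec.loop (fun l s' => s'.reg 40 = lastIndex V (V (i + i)) l ∧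
        s'.reg 41 = lastIndex V (V (i + i + 1)) l) 40 ?_ ?_) fun s₁ f₁ h₁ => ?_) ?_
    · simp [lastIndex]
    · rintro l hl s₁ f₁ ⟨h1, h2⟩
      have e36 : s₁.reg 36 = V (i + i) := by
        rw [f₁.reg 36 (by decide)]
        simp [ea]
      have e37 : s₁.reg 37 = V (i + i + 1) := by
        rw [f₁.reg 37 (by decide)]
        simp [ea]
      have ea₁ : s₁.arr 3 = V := (f₁.arr 3 (by decide)).trans ea
      have key : ∀ a b : ℕ, a - b = 0 ∧ b - a = 0 ↔ a = b := by intros; omega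
      refine Spec.le (Spec.load_seq <| Spec.set_seq <| Spec.set ⟨?_, ?_⟩) ?_
      · simp [e36, e37, ea₁, h1, h2, lastIndex, ite_not, imp_iff_not_or, ← not_and_or, key]
      · simp [e36, e37, ea₁, h1, h2, lastIndex, ite_not, imp_iff_not_or, ← not_and_or, key]
      · simp
    · have e31' : s₁.reg 31 = C := by
        rw [f₁.reg 31 (by decide)]
        simpa using e31
      have e39 : s₁.reg 39 = x.edgeDigits V i := by
        rw [f₁.reg 39 (by decide)]
        simpa using h
      simp [e31] at h₁
      refine Spec.le (Spec.set ?_) ?_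
      · simp [e31', e39, h₁, edgeDigits, digitsVal, ← hCdef]
      · have h1 := RamOp.mulCost_mono ((x.edgeDigits_lt V i).le.trans
          (Nat.pow_le_pow_right (by positivity) hi.le))
        have h2 : RamOp.mulCost (lastIndex V (V (i + i)) C) ≤ RamOp.mulCost C :=
          RamOp.mulCost_mono (lastIndex_lt (by omega)).le
        rw [← hCdef] at h1
        simp [e31', e39, h₁]
        omega
    · simp [e31]
      omega
  · simp [hk]
    nlinarith
  · intro s' _ h
    simpa [hk] using h

/-- A bound for the time that the test takes. -/
def testTime (o : RamOp) (k : ℕ) : ℕ :=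
  ∑ c ∈ Finset.range (((k + k) * (k + k)) ^ k), o.cost (k + k) c

/-- The time of `edgeBody`. -/
def edgeBodyTime (o : RamOp) (k L : ℕ) : ℕ :=
  (k * (2 * RamOp.mulCost L + 80) + 20) + (k * (k * 100 +
    RamOp.mulCost (((k + k) * (k + k)) ^ k) + 2 * RamOp.mulCost (k + k) + 100) + 20) +
    testTime o k + 50

open Classical in
-- The property is tested only for increasing valid draws, for which the array of ends is correct;
-- all other draws are no hits anyway. The test time is bounded by the sum of the costs over all
-- possible codes.
theorem edgeBody_spec {Φ : GraphProperty} {d : List Bool → Bool}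
    (hd : ∀ (n : ℕ) (G : SimpleGraph (Fin n)), d (encodeGraph G) = true ↔ Φ.holds G)
    (o : RamOp) (ho : o.fn = digitsTest d) (s : RamState) (hx : x.Parsed s) (hs : x.EdgesReady s) :
    (edgeBody o).Spec s (edgeBodyTime o x.k x.L) fun s' =>
      s'.reg 13 = s.reg 13 +
        (if x.Hit Φ (fun i => s.arr 1 i) then (2 ^ x.edgeBits) ^ x.k else 0) ∧
      x.EdgesReady s' := by
  have hready : ∀ s' : RamState, s'.reg 30 = s.reg 30 → s'.reg 31 = s.reg 31 →
      s'.reg 32 = s.reg 32 → s'.arr 2 = s.arr 2 → x.EdgesReady s' := fun s' h1 h2 h3 h4 =>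
    ⟨h1.trans hs.m, h2.trans hs.colors, h3.trans hs.weight, fun j hj => by rw [h4]; exact hs.edges j hj⟩
  refine Spec.le (Spec.seq (T' := (x.k * (x.k * 100 +
    RamOp.mulCost (((x.k + x.k) * (x.k + x.k)) ^ x.k) + 2 * RamOp.mulCost (x.k + x.k) + 100) + 20) +
    testTime o x.k + 30) (x.edgeLookup_spec s hx hs) fun s₁ f₁ h₁ => ?_) ?_
  · obtain ⟨h1, h2⟩ := h₁
    have e13 : s₁.reg 13 = s.reg 13 := f₁.reg 13 (by decide)
    have e30 : s₁.reg 30 = s.reg 30 := f₁.reg 30 (by decide)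
    have e31 : s₁.reg 31 = s.reg 31 := f₁.reg 31 (by decide)
    have e32 : s₁.reg 32 = s.reg 32 := f₁.reg 32 (by decide)
    have ea : s₁.arr 2 = s.arr 2 := f₁.arr 2 (by decide)
    refine Spec.le (Spec.ite (T := (x.k * (x.k * 100 +
      RamOp.mulCost (((x.k + x.k) * (x.k + x.k)) ^ x.k) + 2 * RamOp.mulCost (x.k + x.k) + 100) + 20) +
      (testTime o x.k + 20)) (fun hne => ?_) fun he => ?_) ?_
    · have hinc := h1.1 hne
      have h2' := h2 hne
      refine Spec.seq (x.edgeEncode_spec s₁ ((f₁.reg 5 (by decide)).trans hx.k)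
        (e31.trans hs.colors)) fun s₂ f₂ h₂ => ?_
      have e13' : s₂.reg 13 = s.reg 13 := (f₂.reg 13 (by decide)).trans e13
      have e30' : s₂.reg 30 = s.reg 30 := (f₂.reg 30 (by decide)).trans e30
      have e31' : s₂.reg 31 = s.reg 31 := (f₂.reg 31 (by decide)).trans e31
      have e32' : s₂.reg 32 = s.reg 32 := (f₂.reg 32 (by decide)).trans e32
      have ea' : s₂.arr 2 = s.arr 2 := (f₂.arr 2 (by decide)).trans ea
      have hiff := x.holds_edgesOf_iff hd (V := s₁.arr 3) hinc.1
        (fun i hi => (h2' i hi _).1) (fun i hi => (h2' i hi _).2)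
      have htest : o.fn (x.k + x.k) (s₂.reg 39) ≠ 0 ↔ x.Hit Φ fun i => s.arr 1 i := by
        rw [ho, h₂]
        refine hiff.symm.trans ⟨fun h => ⟨fun i j hij => hinc.2 j j.2 i hij,
          fun i => hinc.1 i i.2, h⟩, fun h => h.2.2⟩
      refine Spec.le (Spec.set ⟨?_, hready _ ?_ ?_ ?_ ?_⟩) ?_
      · simp only [setReg_reg, if_true, eval_ite, eval_op, eval_reg, e31', hs.colors, e13',
          eval_add, e32', hs.weight]
        by_cases hh : x.Hit Φ fun i => s.arr 1 i
        · rw [if_pos (htest.2 hh), if_pos hh]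
        · rw [if_neg (fun h => hh (htest.1 h)), if_neg hh, add_zero]
      · simpa using e30'
      · simpa using e31'
      · simpa using e32'
      · simpa using ea'
      · have hc : o.cost (x.k + x.k) (s₂.reg 39) ≤ testTime o x.k := by
          rw [h₂]
          exact Finset.single_le_sum (f := fun c => o.cost (x.k + x.k) c)
            (fun _ _ => Nat.zero_le _) (Finset.mem_range.2 (x.edgeDigits_lt _ _))
        simp only [cost_ite, cost_op, cost_reg, cost_add, eval_reg, e31', hs.colors]
        split_ifs <;> omega
    · have hnot : ¬ x.Hit Φ fun i => s.arr 1 i := by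
        intro h
        refine h1.2 ⟨fun j hj => h.2.1 ⟨j, hj⟩, fun j hj l hl => ?_⟩ he
        exact h.1 (show (⟨l, hl.trans hj⟩ : Fin x.k) < ⟨j, hj⟩ from hl)
      refine Spec.le (Spec.skip ⟨?_, hready _ e30 e31 e32 ea⟩) (by omega)
      rw [if_neg hnot, e13, add_zero]
    · simp
      omega
  · unfold edgeBodyTime
    omega

theorem computable_testTime {o : RamOp} (ho : Computable₂ o.cost) : Computable (testTime o) := by
  have h2 : Computable fun k : ℕ => k + k := (Primrec.nat_add.comp .id .id).to_comp
  have h3 : Computable fun k : ℕ => ((k + k) * (k + k)) ^ k :=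
    (Primrec.nat_pow.comp (Primrec.nat_mul.comp (Primrec.nat_add.comp .id .id)
      (Primrec.nat_add.comp .id .id)) .id).to_comp
  exact Computable.sum_range h3 (ho.comp (h2.comp Computable.fst) Computable.snd)

end EdgeSubInst

/-! ### The sampler for the matching and star criteria -/

open Classical in
-- A hit is given the value (2 ^ b) ^ k, the number of all draws. The mean is then exactly the
-- number of solutions, and the bound on the ratio says that hits are not too rare.
theorem GraphProperty.exists_sampler_of_matching_star {Φ : GraphProperty} (hΦ : Φ.IsComputable)
    (hM : Φ.MatchingCriterion) (hS : Φ.StarCriterion) : Nonempty (Sampler Φ) := by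
  obtain ⟨d, hd, hdΦ⟩ := hΦ
  obtain ⟨o, ho, hoc⟩ := RamOp.exists_of_computable (computable_digitsTest hd)
  obtain ⟨k₀, hk₀⟩ : ∃ k₀, ∀ k, k₀ ≤ k →
      Φ.holds (matchingGraph k) ∧ Φ.holds (completeBipartiteGraph (Fin 1) (Fin k)) := by
    obtain ⟨a, ha⟩ := hM.bddAbove
    obtain ⟨b, hb⟩ := hS.bddAbove
    refine ⟨a + b + 1, fun k hk => ⟨?_, ?_⟩⟩ <;> by_contra h
    · have := ha h; omega
    · have := hb h; omega
  have hsum : ∀ x : EdgeSubInst, ∑ I : Fin x.k → Fin (2 ^ x.edgeBits),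
      (if x.Hit Φ (fun i => I i) then (2 ^ x.edgeBits) ^ x.k else 0) =
      (2 ^ x.edgeBits) ^ x.k * (1 * solutions Φ x) := by
    intro x
    rw [← x.card_hit Φ x.m_le_two_pow, ← Finset.sum_filter, Finset.sum_const, smul_eq_mul, one_mul,
      mul_comm, ← Set.ncard_coe_finset]
    simp
  have hpow : Primrec fun k : ℕ => (16 * (k * k)) ^ k := Primrec.nat_pow.comp
    (Primrec.nat_mul.comp (Primrec.const 16) (Primrec.nat_mul.comp .id .id)) .id
  exact ⟨{
    setup := edgeSetup
    body := edgeBody o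
    bound := fun k => (16 * (k * k)) ^ k * k.factorial
    -- For k < k₀ the counting lemma may fail, but the number of draws is at most (2m)^k ≤ L^k₀. The
    -- exponent is a constant that depends on Φ only.
    deg := k₀
    scale := fun _ => 1
    r := fun x => x.k
    b := fun x => x.edgeBits
    g := fun x I => if x.Hit Φ (fun i => I i) then (2 ^ x.edgeBits) ^ x.k else 0
    Ready := fun x s => x.EdgesReady s
    setupTime := fun k L => L * (2 * RamOp.mulCost L + 60) + k * (L * 20 + 20) +
      RamOp.mulCost L + 4 * L + 100
    bodyTime := EdgeSubInst.edgeBodyTime o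
    bitTime := fun _ L => L
    bound_computable := (Primrec.nat_mul.comp hpow Primrec.nat_factorial).to_comp
    scale_computable := Computable.const 1
    scale_pos := fun _ => one_pos
    setupTime_fpt := by
      have hL := IsFPT.length
      have hk := IsFPT.param Computable.id
      exact ((((hL.mul (((IsFPT.const 2).mul hL.mulCost).add (IsFPT.const 60))).add
        (hk.mul ((hL.mul (IsFPT.const 20)).add (IsFPT.const 20)))).add hL.mulCost).add
        ((IsFPT.const 4).mul hL)).add (IsFPT.const 100)
    bodyTime_fpt := by
      have hL := IsFPT.length
      have hk := IsFPT.param Computable.id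
      have hC := hk.add hk
      have hp : IsFPT fun k _ _ _ => ((k + k) * (k + k)) ^ k :=
        IsFPT.param (Primrec.nat_pow.comp (Primrec.nat_mul.comp (Primrec.nat_add.comp .id .id)
          (Primrec.nat_add.comp .id .id)) .id).to_comp
      exact ((((hk.mul (((IsFPT.const 2).mul hL.mulCost).add (IsFPT.const 80))).add
        (IsFPT.const 20)).add ((hk.mul ((((hk.mul (IsFPT.const 100)).add hp.mulCost).add
        ((IsFPT.const 2).mul hC.mulCost)).add (IsFPT.const 100))).add (IsFPT.const 20))).add
        (IsFPT.param (EdgeSubInst.computable_testTime hoc))).add (IsFPT.const 50)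
    bitTime_fpt := IsFPT.length
    r_le := fun x => x.k_le
    b_le := fun x => x.edgeBits_le
    setup_wregs := by decide
    setup_noFlip := by simp [edgeSetup, NoFlip]
    setup_warrs := by decide
    setup_spec := fun x s hx => x.edgeSetup_spec s hx
    ready_congr := fun x s s' h hr ha => ⟨(hr 30 (by norm_num)).trans h.m,
      (hr 31 (by norm_num)).trans h.colors, (hr 32 (by norm_num)).trans h.weight,
      fun j hj => by rw [ha 2 le_rfl]; exact h.edges j hj⟩
    body_wregs := by simp [edgeBody, edgeLookup, edgeEncode, wregs]
    body_noFlip := by simp [edgeBody, edgeLookup, edgeEncode, NoFlip]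
    body_warrs := by simp [edgeBody, edgeLookup, edgeEncode, warrs]
    body_spec := fun x s I hx hs _ _ hI => by
      have := x.edgeBody_spec hdΦ o ho s hx hs
      simpa only [hI] using this
    sum_g := hsum
    g_le := fun x I => by
      -- Without solutions all values must vanish; this follows from their sum being zero.
      rcases Nat.eq_zero_or_pos (solutions Φ x) with h0 | h0
      · have h1 := hsum x
        rw [h0, mul_zero, mul_zero, Finset.sum_eq_zero_iff] at h1
        rw [h1 I (Finset.mem_univ _)]
        exact Nat.zero_le _
      refine (show _ ≤ (2 ^ x.edgeBits) ^ x.k by split_ifs <;> simp).trans ?_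
      have hk : 0 < x.k := x.2.pos
      have hL : 0 < x.L := lt_of_lt_of_le hk x.k_le
      have hm : 0 < x.m := by
        by_contra hm
        have h1 := x.card_hit Φ x.m_le_two_pow
        rw [← h1] at h0
        obtain ⟨I, hI⟩ := (Set.ncard_pos (Set.toFinite _)).1 h0
        have := hI.2.1 ⟨0, hk⟩
        omega
      -- Rounding the range of edge numbers up to a power of two at most doubles it, since m > 0.
      have hle : (2 ^ x.edgeBits) ^ x.k ≤ (2 * x.m) ^ x.k := by
        refine Nat.pow_le_pow_left ?_ _
        rcases Nat.eq_zero_or_pos x.edgeBits with h | h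
        · rw [h]; omega
        · have h1 : ¬ x.edgeBits ≤ x.edgeBits - 1 := by omega
          rw [EdgeSubInst.edgeBits, RamOp.clogDiv_le_iff one_ne_zero, one_mul, not_le,
            ← EdgeSubInst.edgeBits] at h1
          calc 2 ^ x.edgeBits = 2 * 2 ^ (x.edgeBits - 1) := by
                rw [← pow_succ']; congr 1; omega
            _ ≤ 2 * x.m := by omega
      refine hle.trans ?_
      have hb : 1 ≤ (16 * (x.k * x.k)) ^ x.k * x.k.factorial := by
        have := x.k.factorial_pos
        exact Nat.succ_le_of_lt (by positivity)
      rcases lt_or_ge x.k k₀ with hlt | hge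
      · calc (2 * x.m) ^ x.k ≤ x.L ^ x.k := Nat.pow_le_pow_left x.two_mul_m_le _
          _ ≤ x.L ^ k₀ := Nat.pow_le_pow_right hL hlt.le
          _ = 1 * x.L ^ k₀ * (1 * 1) := by ring
          _ ≤ _ := by gcongr; exact h0
      · have h1 := card_edgeFinset_pow_le x.1.2 hk (hk₀ _ hge).1 (hk₀ _ hge).2 h0
        rw [x.card_edgeFinset] at h1
        calc (2 * x.m) ^ x.k ≤ _ := h1
          _ = (16 * (x.k * x.k)) ^ x.k * x.k.factorial * 1 * (1 * solutions Φ x) := by ring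
          _ ≤ _ := by gcongr; exact Nat.one_le_pow _ _ hL }⟩

/-! ### Colour-preserving homomorphisms -/

section ColorSum

variable (E : ℕ → ℕ → ℕ) (χ : ℕ → ℕ) (n : ℕ)

/-- The product of `E` over the edges of the list `T`, if the variables have the values `ρ`. -/
def edgeProd (T : List (ℕ × ℕ)) (ρ : ℕ → ℕ) : ℕ := (T.map fun e => E (ρ e.1) (ρ e.2)).prod

/-- The sum of `edgeProd` over all values less than `n` of the variables `cs`, where the value of
the variable `c` has to have colour `c`. -/
def colorSum (T : List (ℕ × ℕ)) : List ℕ → (ℕ → ℕ) → ℕ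
  | [], ρ => edgeProd E T ρ
  | c :: cs, ρ => ∑ x ∈ Finset.range n, if χ x = c then colorSum T cs (Function.update ρ c x) else 0

/-- `v` is an end of an edge in the list. -/
def OccursIn (T : List (ℕ × ℕ)) (v : ℕ) : Prop := ∃ e ∈ T, e.1 = v ∨ e.2 = v

variable {E χ n}

theorem edgeProd_map {T : List (ℕ × ℕ)} {f : ℕ → ℕ} {ρ ρ' : ℕ → ℕ}
    (h : ∀ v, OccursIn T v → ρ' (f v) = ρ v) :
    edgeProd E (T.map (Prod.map f f)) ρ' = edgeProd E T ρ := by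
  unfold edgeProd
  rw [List.map_map]
  congr 1
  refine List.map_congr_left fun e he => ?_
  simp only [Function.comp, Prod.map_fst, Prod.map_snd]
  rw [h _ ⟨e, he, Or.inl rfl⟩, h _ ⟨e, he, Or.inr rfl⟩]

/-- Substitution for free variables: bound variables stay fixed, and a free variable may be renamed
if no capture occurs and the environment is adapted. Both the independence of irrelevant variables
and the binding of a slot are instances. -/
theorem colorSum_map {T : List (ℕ × ℕ)} {f : ℕ → ℕ} {cs : List ℕ} (hcs : cs.Nodup) {ρ ρ' : ℕ → ℕ}
    (h : ∀ v, OccursIn T v → (v ∈ cs → f v = v) ∧ (v ∉ cs → f v ∉ cs ∧ ρ' (f v) = ρ v)) :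
    colorSum E χ n (T.map (Prod.map f f)) cs ρ' = colorSum E χ n T cs ρ := by
  induction cs generalizing ρ ρ' with
  | nil => exact edgeProd_map fun v hv => ((h v hv).2 (by simp)).2
  | cons c cs ih =>
    rw [List.nodup_cons] at hcs
    rw [colorSum, colorSum]
    refine Finset.sum_congr rfl fun x _ => ?_
    congr 1
    refine ih hcs.2 fun v hv => ⟨fun hc => (h v hv).1 (by simp [hc]), fun hc => ?_⟩
    by_cases hvc : v = c
    · subst hvc
      rw [(h v hv).1 (by simp)]
      exact ⟨hc, by simp⟩
    · obtain ⟨h1, h2⟩ := (h v hv).2 (by simp [hc, hvc])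
      simp only [List.mem_cons, not_or] at h1
      exact ⟨h1.2, by rw [Function.update_of_ne h1.1, Function.update_of_ne hvc, h2]⟩

theorem colorSum_congr {T : List (ℕ × ℕ)} {cs : List ℕ} (hcs : cs.Nodup) {ρ ρ' : ℕ → ℕ}
    (h : ∀ v, OccursIn T v → ρ' v = ρ v) :
    colorSum E χ n T cs ρ' = colorSum E χ n T cs ρ := by
  have := colorSum_map (E := E) (χ := χ) (n := n) (T := T) (f := id) hcs (ρ := ρ) (ρ' := ρ')
    fun v hv => ⟨fun _ => rfl, fun hc => ⟨hc, h v hv⟩⟩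
  simpa using this

/-- The distributive law: a factor may be moved under a sum whose variable does not occur in it. -/
theorem colorSum_mul {T U : List (ℕ × ℕ)} {cs ds : List ℕ} (hds : ds.Nodup)
    (hT : ∀ v, OccursIn T v → v ∉ ds) (hU : ∀ v, OccursIn U v → v ∉ cs) (ρ : ℕ → ℕ) :
    colorSum E χ n T cs ρ * colorSum E χ n U ds ρ = colorSum E χ n (T ++ U) (cs ++ ds) ρ := by
  induction cs generalizing ρ with
  | nil =>
    simp only [colorSum, List.nil_append]
    clear hU
    induction ds generalizing ρ with
    | nil => simp [colorSum, edgeProd]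
    | cons d ds ih =>
      rw [colorSum, colorSum, Finset.mul_sum]
      refine Finset.sum_congr rfl fun x _ => ?_
      rw [mul_ite, mul_zero]
      congr 1
      rw [List.nodup_cons] at hds
      rw [← ih hds.2 fun v hv hd => hT v hv (by simp [hd])]
      congr 1
      have := edgeProd_map (E := E) (T := T) (f := id) (ρ := Function.update ρ d x) (ρ' := ρ)
        fun v hv => (Function.update_of_ne (fun hd => hT v hv (List.mem_cons.2 (Or.inl hd))) _ _).symm
      simpa using this
  | cons c cs ih =>
    rw [colorSum, List.cons_append, colorSum, Finset.sum_mul]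
    refine Finset.sum_congr rfl fun x _ => ?_
    rw [ite_mul, zero_mul]
    congr 1
    rw [← ih fun v hv hc => hU v hv (by simp [hc])]
    congr 1
    exact (colorSum_congr hds fun v hv => Function.update_of_ne
      (fun hc => hU v hv (by simp [hc])) _ _).symm

/-- Summing over the vertices of colour c placed in slot s is the same as binding a variable called
c. Names of bound variables thus coincide with their colours, and a slot becomes free for reuse. -/
theorem colorSum_rename {T : List (ℕ × ℕ)} {cs : List ℕ} (hcs : cs.Nodup) {s c : ℕ} (hs : s ∉ cs)
    (hc : c ∉ cs) (hT : ¬ OccursIn T c) (ρ : ℕ → ℕ) :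
    (∑ x ∈ Finset.range n, if χ x = c then colorSum E χ n T cs (Function.update ρ s x) else 0) =
      colorSum E χ n (T.map (Prod.map (fun v => if v = s then c else v)
        (fun v => if v = s then c else v))) (c :: cs) ρ := by
  rw [colorSum]
  refine Finset.sum_congr rfl fun x _ => ?_
  congr 1
  symm
  refine colorSum_map hcs fun v hv => ⟨fun h => ?_, fun h => ?_⟩
  · rw [if_neg]
    rintro rfl
    exact hs h
  · have hvc : v ≠ c := fun e => hT (e ▸ hv)
    split_ifs with hvs
    · subst hvs
      exact ⟨hc, by simp⟩
    · exact ⟨h, by rw [Function.update_of_ne hvc, Function.update_of_ne hvs]⟩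

theorem colorSum_le (hE : ∀ u v, E u v ≤ 1) (T : List (ℕ × ℕ)) (cs : List ℕ) (ρ : ℕ → ℕ) :
    colorSum E χ n T cs ρ ≤ n ^ cs.length := by
  induction cs generalizing ρ with
  | nil =>
    simp only [colorSum, edgeProd, List.length_nil, pow_zero]
    induction T with
    | nil => simp
    | cons e T ih => simpa using Nat.mul_le_mul (hE (ρ e.1) (ρ e.2)) ih
  | cons c cs ih =>
    rw [colorSum, List.length_cons, pow_succ']
    refine (Finset.sum_le_card_nsmul _ _ (n ^ cs.length) fun x _ => ?_).trans (by simp)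
    split_ifs
    exacts [ih _, Nat.zero_le _]

variable (χ n)

/-- The assignments that are counted by `colorSum`. -/
noncomputable def colorMaps : List ℕ → (ℕ → ℕ) → Finset (ℕ → ℕ)
  | [], ρ => {ρ}
  | c :: cs, ρ => open Classical in
    ((Finset.range n).filter fun x => χ x = c).biUnion fun x => colorMaps cs (Function.update ρ c x)

variable {χ n}

theorem mem_colorMaps {cs : List ℕ} (hcs : cs.Nodup) {ρ f : ℕ → ℕ} :
    f ∈ colorMaps χ n cs ρ ↔
      (∀ c ∈ cs, f c < n ∧ χ (f c) = c) ∧ ∀ v, v ∉ cs → f v = ρ v := by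
  induction cs generalizing ρ with
  | nil => simp [colorMaps, funext_iff]
  | cons c cs ih =>
    rw [List.nodup_cons] at hcs
    simp only [colorMaps, Finset.mem_biUnion, Finset.mem_filter, Finset.mem_range, ih hcs.2]
    constructor
    · rintro ⟨x, ⟨hx, hxc⟩, h1, h2⟩
      have hfc : f c = x := by simpa using h2 c hcs.1
      refine ⟨fun d hd => ?_, fun v hv => ?_⟩
      · rcases List.mem_cons.1 hd with rfl | hd
        · exact hfc ▸ ⟨hx, hxc⟩
        · exact h1 d hd
      · simp only [List.mem_cons, not_or] at hv
        rw [h2 v hv.2, Function.update_of_ne hv.1]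
    · rintro ⟨h1, h2⟩
      refine ⟨f c, h1 c (by simp), fun d hd => h1 d (by simp [hd]), fun v hv => ?_⟩
      by_cases hvc : v = c
      · subst hvc; simp
      · rw [Function.update_of_ne hvc]
        exact h2 v (by simp [hv, hvc])

theorem colorSum_eq_sum {T : List (ℕ × ℕ)} {cs : List ℕ} (hcs : cs.Nodup) (ρ : ℕ → ℕ) :
    colorSum E χ n T cs ρ = ∑ f ∈ colorMaps χ n cs ρ, edgeProd E T f := by
  induction cs generalizing ρ with
  | nil => simp [colorSum, colorMaps]
  | cons c cs ih =>
    have hcs' := List.nodup_cons.1 hcs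
    classical
    rw [colorSum, colorMaps, Finset.sum_biUnion, Finset.sum_filter]
    · exact Finset.sum_congr rfl fun x _ => by rw [ih hcs'.2]
    · intro x _ y _ hxy
      refine Finset.disjoint_left.2 fun f hf hf' => hxy ?_
      have h1 := ((mem_colorMaps hcs'.2).1 hf).2 c hcs'.1
      have h2 := ((mem_colorMaps hcs'.2).1 hf').2 c hcs'.1
      rw [Function.update_self] at h1 h2
      exact h1.symm.trans h2

theorem edgeProd_eq_ite {E : ℕ → ℕ → ℕ} (hE : ∀ u v, E u v ≤ 1) (T : List (ℕ × ℕ)) (f : ℕ → ℕ)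
    [Decidable (∀ e ∈ T, E (f e.1) (f e.2) ≠ 0)] :
    edgeProd E T f = if ∀ e ∈ T, E (f e.1) (f e.2) ≠ 0 then 1 else 0 := by
  split_ifs with h
  · refine List.prod_eq_one fun a ha => ?_
    obtain ⟨e, he, rfl⟩ := List.mem_map.1 ha
    have := h e he
    have := hE (f e.1) (f e.2)
    omega
  · push Not at h
    obtain ⟨e, he, h0⟩ := h
    exact List.prod_eq_zero (List.mem_map.2 ⟨e, he, h0⟩)

end ColorSum

/-! ### Sets of edges with a given pattern of colours -/

/-- The colours are distinct on the ends of the edges in `A`, and the edges with these colours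
are those in the list `l`. -/
def HasPattern {n : ℕ} (χ : Fin n → ℕ) (A : Finset (Sym2 (Fin n))) (l : List (ℕ × ℕ)) : Prop :=
  Set.InjOn χ {v | ∃ e ∈ A, v ∈ e} ∧
    ∀ z, (∃ e ∈ A, Sym2.map χ e = z) ↔ ∃ p ∈ l, s(p.1, p.2) = z

open Classical in
/-- `colorSum` counts the sets of edges with a given pattern. -/
theorem colorSum_eq_card {n : ℕ} (G : SimpleGraph (Fin n)) {E : ℕ → ℕ → ℕ}
    (hE : ∀ u v : Fin n, E u v = if G.Adj u v then 1 else 0) (hE' : ∀ u v, E u v ≤ 1)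
    {χ : ℕ → ℕ} {l T : List (ℕ × ℕ)} {cs : List ℕ} (hl : ∀ p ∈ l, p.1 < p.2) (hcs : cs.Nodup)
    (hT : ∀ e, e ∈ T ↔ e ∈ l) (hv : ∀ v, v ∈ cs ↔ OccursIn l v) (ρ : ℕ → ℕ) :
    colorSum E χ n T cs ρ = {A : Finset (Sym2 (Fin n)) | (A : Set (Sym2 (Fin n))) ⊆ G.edgeSet ∧
      HasPattern (fun v => χ v) A l}.ncard := by
  rw [colorSum_eq_sum hcs, Finset.sum_congr rfl fun f _ => edgeProd_eq_ite hE' T f,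
    ← Finset.sum_filter, Finset.sum_const, smul_eq_mul, mul_one, ← Set.ncard_coe_finset]
  have hmem : ∀ f, f ∈ (↑((colorMaps χ n cs ρ).filter fun f => ∀ e ∈ T, E (f e.1) (f e.2) ≠ 0) :
      Set (ℕ → ℕ)) ↔ ((∀ c ∈ cs, f c < n ∧ χ (f c) = c) ∧ ∀ v, v ∉ cs → f v = ρ v) ∧
      ∀ p ∈ l, E (f p.1) (f p.2) ≠ 0 := by
    intro f
    rw [Finset.coe_filter, Set.mem_setOf_eq, mem_colorMaps hcs]
    simp only [hT]
  have hcs1 : ∀ p ∈ l, p.1 ∈ cs := fun p hp => (hv _).2 ⟨p, hp, Or.inl rfl⟩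
  have hcs2 : ∀ p ∈ l, p.2 ∈ cs := fun p hp => (hv _).2 ⟨p, hp, Or.inr rfl⟩
  have himg : ∀ (f : ℕ → ℕ) (e : Sym2 (Fin n)), e ∈ (Finset.univ.filter fun e : Sym2 (Fin n) =>
      ∃ p ∈ l, ∃ u v : Fin n, e = s(u, v) ∧ f p.1 = u ∧ f p.2 = v) ↔
      ∃ p ∈ l, ∃ u v : Fin n, e = s(u, v) ∧ f p.1 = u ∧ f p.2 = v := by simp
  -- An assignment corresponds to the set of edges onto which it maps the pattern. In the other
  -- direction, each colour goes to the only end of an edge in A with that colour, and variables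
  -- outside `cs` keep the values of `ρ`.
  refine Set.ncard_congr (fun f _ => Finset.univ.filter fun e : Sym2 (Fin n) =>
    ∃ p ∈ l, ∃ u v : Fin n, e = s(u, v) ∧ f p.1 = u ∧ f p.2 = v) ?_ ?_ ?_
  · intro f hf
    obtain ⟨⟨h1, h2⟩, h3⟩ := (hmem f).1 hf
    refine ⟨?_, ?_, ?_⟩
    · intro e he
      obtain ⟨p, hp, u, v, rfl, hu, hv⟩ := (himg f e).1 he
      have := h3 p hp
      rw [hu, hv, hE] at this
      by_contra hn
      exact this (if_neg hn)
    · have key : ∀ v : Fin n, v ∈ {v | ∃ e ∈ (Finset.univ.filter fun e : Sym2 (Fin n) =>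
          ∃ p ∈ l, ∃ u v : Fin n, e = s(u, v) ∧ f p.1 = u ∧ f p.2 = v), v ∈ e} →
          f (χ v) = v := by
        rintro w ⟨e, he, hw⟩
        obtain ⟨p, hp, u, v, rfl, hu, hv⟩ := (himg f e).1 he
        rcases Sym2.mem_iff.1 hw with rfl | rfl
        · rw [← hu, (h1 _ (hcs1 p hp)).2]
        · rw [← hv, (h1 _ (hcs2 p hp)).2]
      intro u hu v hv h
      have h' : χ u = χ v := h
      exact Fin.ext (by rw [← key u hu, ← key v hv, h'])
    · intro z
      constructor
      · rintro ⟨e, he, rfl⟩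
        obtain ⟨p, hp, u, v, rfl, hu, hv⟩ := (himg f e).1 he
        refine ⟨p, hp, ?_⟩
        rw [Sym2.map_mk, ← hu, ← hv, (h1 _ (hcs1 p hp)).2, (h1 _ (hcs2 p hp)).2]
      · rintro ⟨p, hp, rfl⟩
        refine ⟨_, (himg f _).2 ⟨p, hp, ⟨f p.1, (h1 _ (hcs1 p hp)).1⟩,
          ⟨f p.2, (h1 _ (hcs2 p hp)).1⟩, rfl, rfl, rfl⟩, ?_⟩
        simp [(h1 _ (hcs1 p hp)).2, (h1 _ (hcs2 p hp)).2]
  · intro f f' hf hf' h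
    obtain ⟨⟨h1, h2⟩, h3⟩ := (hmem f).1 hf
    obtain ⟨⟨h1', h2'⟩, h3'⟩ := (hmem f').1 hf'
    funext c
    by_cases hc : c ∈ cs
    swap
    · rw [h2 c hc, h2' c hc]
    have key : ∀ p ∈ l, f p.1 = f' p.1 ∧ f p.2 = f' p.2 := by
      intro p hp
      have he : s((⟨f p.1, (h1 _ (hcs1 p hp)).1⟩ : Fin n), (⟨f p.2, (h1 _ (hcs2 p hp)).1⟩ : Fin n)) ∈
          (Finset.univ.filter fun e : Sym2 (Fin n) =>
            ∃ p ∈ l, ∃ u v : Fin n, e = s(u, v) ∧ f p.1 = u ∧ f p.2 = v) :=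
        (himg f _).2 ⟨p, hp, _, _, rfl, rfl, rfl⟩
      rw [h] at he
      obtain ⟨p', hp', u, v, he, hu, hv⟩ := (himg f' _).1 he
      have c1 := (h1 _ (hcs1 p hp)).2
      have c2 := (h1 _ (hcs2 p hp)).2
      have c1' := (h1' _ (hcs1 p' hp')).2
      have c2' := (h1' _ (hcs2 p' hp')).2
      have l1 := hl p hp
      have l2 := hl p' hp'
      rcases Sym2.eq_iff.1 he with ⟨e1, e2⟩ | ⟨e1, e2⟩
      · have e1' : f p.1 = f' p'.1 := by rw [hu, ← e1]
        have e2' : f p.2 = f' p'.2 := by rw [hv, ← e2]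
        have q1 : p.1 = p'.1 := by rw [← c1, e1', c1']
        have q2 : p.2 = p'.2 := by rw [← c2, e2', c2']
        rw [e1', e2', q1, q2]
        exact ⟨rfl, rfl⟩
      -- The reversed orientation would give p.1 = p'.2 and p.2 = p'.1, against the order within the
      -- pairs.
      · have e1' : f p.1 = f' p'.2 := by rw [hv, ← e1]
        have e2' : f p.2 = f' p'.1 := by rw [hu, ← e2]
        have q1 : p.1 = p'.2 := by rw [← c1, e1', c2']
        have q2 : p.2 = p'.1 := by rw [← c2, e2', c1']
        omega
    obtain ⟨p, hp, rfl | rfl⟩ := (hv c).1 hc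
    exacts [(key p hp).1, (key p hp).2]
  · rintro A ⟨hAG, hinj, hpat⟩
    have hpair : ∀ p ∈ l, ∃ u v : Fin n, s(u, v) ∈ A ∧ χ u = p.1 ∧ χ v = p.2 := by
      intro p hp
      obtain ⟨e, he, hz⟩ := (hpat s(p.1, p.2)).2 ⟨p, hp, rfl⟩
      induction e with
      | _ u v =>
        rcases Sym2.eq_iff.1 hz with h | h
        · exact ⟨u, v, he, h.1, h.2⟩
        · exact ⟨v, u, Sym2.eq_swap ▸ he, h.2, h.1⟩
    have hex : ∀ c, ∃ w : ℕ, (c ∈ cs → ∃ v : Fin n, v.1 = w ∧ χ v = c ∧ ∃ e ∈ A, v ∈ e) ∧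
        (c ∉ cs → w = ρ c) := by
      intro c
      by_cases hc : c ∈ cs
      · obtain ⟨p, hp, rfl | rfl⟩ := (hv c).1 hc
        · obtain ⟨u, v, he, h1, h2⟩ := hpair p hp
          exact ⟨u, fun _ => ⟨u, rfl, h1, _, he, by simp⟩, fun h => absurd hc h⟩
        · obtain ⟨u, v, he, h1, h2⟩ := hpair p hp
          exact ⟨v, fun _ => ⟨v, rfl, h2, _, he, by simp⟩, fun h => absurd hc h⟩
      · exact ⟨ρ c, fun h => absurd h hc, fun _ => rfl⟩
    choose f hf1 hf2 using hex
    have hfu : ∀ u : Fin n, (∃ e ∈ A, u ∈ e) → χ u ∈ cs → f (χ u) = u := by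
      intro u hu hc
      obtain ⟨v, hv1, hv2, hv3⟩ := hf1 _ hc
      rw [← hv1, hinj hv3 hu hv2]
    have hfp : ∀ p ∈ l, ∀ u v : Fin n, s(u, v) ∈ A → χ u = p.1 → χ v = p.2 →
        f p.1 = u ∧ f p.2 = v := by
      intro p hp u v he h1 h2
      rw [← h1, ← h2]
      exact ⟨hfu u ⟨_, he, by simp⟩ (h1 ▸ hcs1 p hp), hfu v ⟨_, he, by simp⟩ (h2 ▸ hcs2 p hp)⟩
    refine ⟨f, (hmem f).2 ⟨⟨fun c hc => ?_, fun v hv => hf2 v hv⟩, fun p hp => ?_⟩, ?_⟩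
    · obtain ⟨v, hv1, hv2, -⟩ := hf1 c hc
      rw [← hv1]
      exact ⟨v.2, hv2⟩
    · obtain ⟨u, v, he, h1, h2⟩ := hpair p hp
      obtain ⟨e1, e2⟩ := hfp p hp u v he h1 h2
      have hadj : G.Adj u v := hAG he
      rw [e1, e2, hE, if_pos hadj]
      exact one_ne_zero
    · ext e
      rw [himg]
      constructor
      · rintro ⟨p, hp, u, v, rfl, hu, hv⟩
        obtain ⟨u', v', he, h1, h2⟩ := hpair p hp
        obtain ⟨e1, e2⟩ := hfp p hp u' v' he h1 h2
        have q1 : u = u' := Fin.ext (hu.symm.trans e1)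
        have q2 : v = v' := Fin.ext (hv.symm.trans e2)
        rwa [q1, q2]
      · intro he
        obtain ⟨p, hp, hz⟩ := (hpat _).1 ⟨e, he, rfl⟩
        induction e with
        | _ u v =>
          rcases Sym2.eq_iff.1 hz with h | h
          · obtain ⟨e1, e2⟩ := hfp p hp u v he h.1.symm h.2.symm
            exact ⟨p, hp, u, v, rfl, e1, e2⟩
          · obtain ⟨e1, e2⟩ := hfp p hp v u (Sym2.eq_swap ▸ he) h.1.symm h.2.symm
            exact ⟨p, hp, v, u, Sym2.eq_swap, e1, e2⟩

/-! ### Stack programs -/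

/-- A symbolic table: the colours of the variables that have been summed out, and the edges of a
graph whose vertices are colours and slots. The slot `i` is represented by `C + i`. -/
abbrev SymTable := List ℕ × List (ℕ × ℕ)

/-- An instruction: `(0, i, j)` pushes the adjacency of the slots `i` and `j`, `(1, _, _)`
multiplies the two topmost tables, `(2, i, c)` sums the topmost table over the values of colour `c`
of the slot `i`, and `(3, w, _)` removes the topmost table and adds `w` times its value. -/
abbrev Instr := ℕ × ℕ × ℕ

/-- The topmost table. -/
def symTop (st : List SymTable) : SymTable := st.getD 0 ([], [])

/-- The table below the topmost table. -/
def symNext (st : List SymTable) : SymTable := st.getD 1 ([], [])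

/-- The effect of an instruction. -/
def symStep (C : ℕ) (st : List SymTable) (i : Instr) : List SymTable :=
  if i.1 = 0 then ([], [(C + i.2.1, C + i.2.2)]) :: st
  else if i.1 = 1 then
    ((symNext st).1 ++ (symTop st).1, (symNext st).2 ++ (symTop st).2) :: st.tail.tail
  else if i.1 = 2 then
    (i.2.2 :: (symTop st).1, (symTop st).2.map (Prod.map (fun v => if v = C + i.2.1 then i.2.2 else v)
      (fun v => if v = C + i.2.1 then i.2.2 else v))) :: st.tail
  else st.tail

/-- The instruction is admissible. -/
def SymOk (C B : ℕ) (st : List SymTable) (i : Instr) : Prop :=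
  (i.1 = 0 → i.2.1 < B ∧ i.2.2 < B) ∧
  (i.1 = 1 → 2 ≤ st.length ∧ ∀ c ∈ (symTop st).1, c ∉ (symNext st).1) ∧
  (i.1 = 2 → 1 ≤ st.length ∧ i.2.1 < B ∧ i.2.2 < C ∧ i.2.2 ∉ (symTop st).1) ∧
  (2 < i.1 → 1 ≤ st.length)

/-- All instructions are admissible. -/
def RunsOk (C B : ℕ) : List Instr → List SymTable → Prop
  | [], _ => True
  | i :: P, st => SymOk C B st i ∧ RunsOk C B P (symStep C st i)

theorem RunsOk.append {C B : ℕ} {P Q : List Instr} {st : List SymTable} (h : RunsOk C B P st)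
    (h' : RunsOk C B Q (P.foldl (symStep C) st)) : RunsOk C B (P ++ Q) st := by
  induction P generalizing st with
  | nil => exact h'
  | cons i P ih => exact ⟨h.1, ih h.2 h'⟩

/-- The table has distinct colours below `C`, and these include the vertices below `C`. -/
structure SymTable.WF (C : ℕ) (S : SymTable) : Prop where
  nodup : S.1.Nodup
  lt : ∀ c ∈ S.1, c < C
  mem : ∀ v, OccursIn S.2 v → v < C → v ∈ S.1

theorem SymTable.WF.length_le {C : ℕ} {S : SymTable} (h : S.WF C) : S.1.length ≤ C := by
  rw [← List.toFinset_card_of_nodup h.nodup]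
  refine (Finset.card_le_card (t := Finset.range C) fun c hc => ?_).trans (by simp)
  exact Finset.mem_range.2 (h.lt c (List.mem_toFinset.1 hc))

theorem OccursIn.append {T U : List (ℕ × ℕ)} {v : ℕ} :
    OccursIn (T ++ U) v ↔ OccursIn T v ∨ OccursIn U v := by
  simp [OccursIn, or_and_right, exists_or]

theorem OccursIn.map {T : List (ℕ × ℕ)} {f : ℕ → ℕ} {v : ℕ} :
    OccursIn (T.map (Prod.map f f)) v ↔ ∃ u, OccursIn T u ∧ f u = v := by
  constructor
  · rintro ⟨e, he, hv⟩
    obtain ⟨e', he', rfl⟩ := List.mem_map.1 he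
    rcases hv with hv | hv
    exacts [⟨_, ⟨e', he', Or.inl rfl⟩, hv⟩, ⟨_, ⟨e', he', Or.inr rfl⟩, hv⟩]
  · rintro ⟨u, ⟨e, he, hu⟩, rfl⟩
    refine ⟨_, List.mem_map_of_mem he, ?_⟩
    rcases hu with rfl | rfl
    exacts [Or.inl rfl, Or.inr rfl]

theorem symTop_mem {st : List SymTable} (h : 1 ≤ st.length) : symTop st ∈ st := by
  rw [symTop, List.getD_eq_getElem _ _ h]
  exact List.getElem_mem _

theorem symNext_mem {st : List SymTable} (h : 2 ≤ st.length) : symNext st ∈ st := by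
  rw [symNext, List.getD_eq_getElem _ _ h]
  exact List.getElem_mem _

theorem symStep_wf {C B : ℕ} {st : List SymTable} {i : Instr} (h : ∀ S ∈ st, S.WF C)
    (hi : SymOk C B st i) : ∀ S ∈ symStep C st i, S.WF C := by
  intro S hS
  obtain ⟨-, h1, h2, -⟩ := hi
  unfold symStep at hS
  split_ifs at hS with c0 c1 c2
  · rcases List.mem_cons.1 hS with rfl | hS
    · refine ⟨List.nodup_nil, by simp, ?_⟩
      rintro v ⟨e, he, hv⟩ hlt
      obtain rfl := List.mem_singleton.1 he
      rcases hv with rfl | rfl <;> simp at hlt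
    · exact h S hS
  · obtain ⟨hl, hd⟩ := h1 c1
    have ht := h _ (symTop_mem (by omega : 1 ≤ st.length))
    have hn := h _ (symNext_mem hl)
    rcases List.mem_cons.1 hS with rfl | hS
    · refine ⟨hn.nodup.append ht.nodup fun c hc hc' => hd c hc' hc, fun c hc => ?_,
        fun v hv hlt => ?_⟩
      · rcases List.mem_append.1 hc with hc | hc
        exacts [hn.lt c hc, ht.lt c hc]
      · rcases OccursIn.append.1 hv with hv | hv
        · exact List.mem_append.2 (Or.inl (hn.mem v hv hlt))
        · exact List.mem_append.2 (Or.inr (ht.mem v hv hlt))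
    · exact h S (List.mem_of_mem_tail (List.mem_of_mem_tail hS))
  · obtain ⟨hl, -, hc, hcn⟩ := h2 c2
    have ht := h _ (symTop_mem hl)
    rcases List.mem_cons.1 hS with rfl | hS
    · refine ⟨List.nodup_cons.2 ⟨hcn, ht.nodup⟩, fun c hc' => ?_, fun v hv hlt => ?_⟩
      · rcases List.mem_cons.1 hc' with rfl | hc'
        exacts [hc, ht.lt c hc']
      · obtain ⟨u, hu, rfl⟩ := OccursIn.map.1 hv
        split_ifs at hlt ⊢ with hu'
        · exact List.mem_cons_self
        · exact List.mem_cons_of_mem _ (ht.mem u hu hlt)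
    · exact h S (List.mem_of_mem_tail hS)
  · exact h S (List.mem_of_mem_tail hS)

/-- The program computes the number of homomorphisms from the graph given by `l`. -/
def Accepts (C B : ℕ) (l : List (ℕ × ℕ)) (P : List Instr) : Prop :=
  (∀ i ∈ P, i.1 < 3) ∧ RunsOk C B P [] ∧ (P.foldl (symStep C) []).length = 1 ∧
  (∀ e ∈ (symTop (P.foldl (symStep C) [])).2, e ∈ l) ∧
  (∀ e ∈ l, e ∈ (symTop (P.foldl (symStep C) [])).2 ∧
    e.1 ∈ (symTop (P.foldl (symStep C) [])).1 ∧ e.2 ∈ (symTop (P.foldl (symStep C) [])).1) ∧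
  ∀ c ∈ (symTop (P.foldl (symStep C) [])).1, ∃ e ∈ l, e.1 = c ∨ e.2 = c

/-! ### Programs from tree decompositions -/

section Factor

variable (C B : ℕ) (σ : ℕ → ℕ)

/-- A vertex is represented by itself if it is in `cs`, and by its slot otherwise. -/
def slotVar (cs : List ℕ) (a : ℕ) : ℕ := if a ∈ cs then a else C + σ a

/-- There is a program for the table of the graph `F` in which the vertices `cs` have
been summed out. -/
def IsFactor (F : List (ℕ × ℕ)) (cs : List ℕ) : Prop :=
  (∀ c ∈ cs, OccursIn F c) ∧ ∃ P : List Instr, (∀ i ∈ P, i.1 < 3) ∧ ∀ st, RunsOk C B P st ∧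
    P.foldl (symStep C) st = (cs, F.map (Prod.map (slotVar C σ cs) (slotVar C σ cs))) :: st

variable {C B σ}

theorem IsFactor.atom (hσ : ∀ v, σ v < B) (e : ℕ × ℕ) : IsFactor C B σ [e] [] := by
  refine ⟨by simp, [(0, σ e.1, σ e.2)], by simp, fun st => ⟨⟨?_, trivial⟩, ?_⟩⟩
  · exact ⟨fun _ => ⟨hσ _, hσ _⟩, by simp, by simp, by simp⟩
  · simp [symStep, slotVar, Prod.map]

theorem map_congr_of_occursIn {F : List (ℕ × ℕ)} {f g : ℕ → ℕ}
    (h : ∀ a, OccursIn F a → f a = g a) : F.map (Prod.map f f) = F.map (Prod.map g g) := by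
  refine List.map_congr_left fun e he => ?_
  rw [Prod.map_apply', Prod.map_apply', h _ ⟨e, he, Or.inl rfl⟩, h _ ⟨e, he, Or.inr rfl⟩]

/-- Juxtaposed programs leave their two tables on top of the stack. The products of tables are
correct only if no vertex summed out in one factor occurs in the other. -/
theorem IsFactor.mul {F G : List (ℕ × ℕ)} {cs ds : List ℕ} (hF : IsFactor C B σ F cs)
    (hG : IsFactor C B σ G ds) (h1 : ∀ a, OccursIn F a → a ∉ ds)
    (h2 : ∀ a, OccursIn G a → a ∉ cs) : IsFactor C B σ (F ++ G) (cs ++ ds) := by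
  obtain ⟨hFo, P, hP3, hP⟩ := hF
  obtain ⟨hGo, Q, hQ3, hQ⟩ := hG
  refine ⟨fun c hc => OccursIn.append.2 ((List.mem_append.1 hc).imp (hFo c) (hGo c)),
    P ++ (Q ++ [(1, 0, 0)]), ?_, fun st => ⟨?_, ?_⟩⟩
  · intro i hi
    simp only [List.mem_append, List.mem_singleton] at hi
    rcases hi with hi | hi | rfl
    exacts [hP3 i hi, hQ3 i hi, by norm_num]
  · refine (hP st).1.append ?_
    rw [(hP st).2]
    refine (hQ _).1.append ?_
    rw [(hQ _).2]
    refine ⟨⟨by simp, fun _ => ⟨by simp, fun c hc => ?_⟩, by simp, by simp⟩, trivial⟩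
    simp only [symTop, symNext, List.getD_cons_zero, List.getD_cons_succ] at hc ⊢
    exact h2 c (hGo c hc)
  · rw [List.foldl_append, (hP st).2, List.foldl_append, (hQ _).2]
    simp only [List.foldl_cons, List.foldl_nil, symStep, symTop, symNext, List.getD_cons_zero,
      List.getD_cons_succ, List.tail_cons, one_ne_zero, if_false, if_true, List.map_append]
    have e1 := map_congr_of_occursIn (F := F) (f := slotVar C σ cs) (g := slotVar C σ (cs ++ ds))
      fun a ha => by simp [slotVar, h1 a ha]
    have e2 := map_congr_of_occursIn (F := G) (f := slotVar C σ ds) (g := slotVar C σ (cs ++ ds))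
      fun a ha => by simp [slotVar, h2 a ha]
    rw [e1, e2]

/-- The instruction acts on a slot, not on a vertex. By injectivity no other vertex that is still
free sits in the slot of v, so replacing the slot by the colour v affects v only. -/
theorem IsFactor.sum {F : List (ℕ × ℕ)} {cs : List ℕ} (hF : IsFactor C B σ F cs)
    (hσ : ∀ v, σ v < B) (hC : ∀ a, OccursIn F a → a < C) {v : ℕ} (hv : OccursIn F v) (hvc : v ∉ cs)
    (hinj : ∀ a, OccursIn F a → a ∉ cs → σ a = σ v → a = v) : IsFactor C B σ F (v :: cs) := by
  obtain ⟨hFo, P, hP3, hP⟩ := hF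
  refine ⟨?_, P ++ [(2, σ v, v)], ?_, fun st => ⟨?_, ?_⟩⟩
  · intro c hc
    rcases List.mem_cons.1 hc with rfl | hc
    exacts [hv, hFo c hc]
  · intro i hi
    simp only [List.mem_append, List.mem_singleton] at hi
    rcases hi with hi | rfl
    exacts [hP3 i hi, by norm_num]
  · refine (hP st).1.append ?_
    rw [(hP st).2]
    exact ⟨⟨by simp, by simp, fun _ => ⟨by simp, hσ v, hC v hv, by simpa [symTop] using hvc⟩,
      by simp⟩, trivial⟩
  · rw [List.foldl_append, (hP st).2]
    simp only [List.foldl_cons, List.foldl_nil, symStep, symTop, List.getD_cons_zero,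
      List.tail_cons, OfNat.ofNat_ne_zero, OfNat.ofNat_ne_one, if_false, if_true, List.map_map]
    congr 2
    rw [Prod.map_comp_map]
    refine map_congr_of_occursIn fun a ha => ?_
    have hac := hC a ha
    by_cases h1 : a ∈ cs
    · have e1 : slotVar C σ cs a = a := if_pos h1
      have e2 : slotVar C σ (v :: cs) a = a := if_pos (by simp [h1])
      simp only [Function.comp, e1, e2]
      rw [if_neg (by omega)]
    · have e1 : slotVar C σ cs a = C + σ a := if_neg h1
      simp only [Function.comp, e1]
      by_cases h2 : a = v
      · subst h2
        rw [if_pos rfl, slotVar, if_pos (by simp)]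
      · have e2 : slotVar C σ (v :: cs) a = C + σ a := if_neg (by simp [h1, h2])
        rw [e2, if_neg]
        intro h
        exact h2 (hinj a ha h1 (by omega))

theorem IsFactor.sum_list {F : List (ℕ × ℕ)} {cs : List ℕ} (hF : IsFactor C B σ F cs)
    (hσ : ∀ v, σ v < B) (hC : ∀ a, OccursIn F a → a < C) (R : List ℕ)
    (hR : ∀ v ∈ R, OccursIn F v) (hinj : Set.InjOn σ {a | OccursIn F a ∧ a ∉ cs}) :
    ∃ ds, IsFactor C B σ F ds ∧ ∀ c, c ∈ ds ↔ c ∈ cs ∨ c ∈ R := by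
  induction R with
  | nil => exact ⟨cs, hF, by simp⟩
  | cons v R ih =>
    obtain ⟨ds, hds, h⟩ := ih fun u hu => hR u (by simp [hu])
    by_cases hv : v ∈ ds
    · refine ⟨ds, hds, fun c => ?_⟩
      rw [h, List.mem_cons]
      have := (h v).1 hv
      constructor
      · tauto
      · rintro (h1 | rfl | h1) <;> tauto
    · refine ⟨v :: ds, hds.sum hσ hC (hR v (by simp)) hv fun a ha had hav => ?_, fun c => ?_⟩
      · rw [h, not_or] at had hv
        exact hinj ⟨ha, had.1⟩ ⟨hR v (by simp), hv.1⟩ hav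
      · rw [List.mem_cons, List.mem_cons, h]
        tauto

/-- The vertices of each of the graphs have not been summed out in the other one. -/
def Compat (f g : List (ℕ × ℕ) × List ℕ) : Prop :=
  (∀ a, OccursIn f.1 a → a ∉ g.2) ∧ ∀ a, OccursIn g.1 a → a ∉ f.2

theorem Compat.symm {f g : List (ℕ × ℕ) × List ℕ} (h : Compat f g) : Compat g f := ⟨h.2, h.1⟩

theorem occursIn_iff_of_mem {G : List (ℕ × ℕ)} {Fs : List (List (ℕ × ℕ) × List ℕ)}
    (h : ∀ e, e ∈ G ↔ ∃ f ∈ Fs, e ∈ f.1) (a : ℕ) : OccursIn G a ↔ ∃ f ∈ Fs, OccursIn f.1 a := by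
  constructor
  · rintro ⟨e, he, ha⟩
    obtain ⟨f, hf, hef⟩ := (h e).1 he
    exact ⟨f, hf, e, hef, ha⟩
  · rintro ⟨f, hf, e, he, ha⟩
    exact ⟨e, (h e).2 ⟨f, hf, he⟩, ha⟩

theorem exists_factor_of_pairwise {Fs : List (List (ℕ × ℕ) × List ℕ)} (hne : Fs ≠ [])
    (hFs : ∀ f ∈ Fs, IsFactor C B σ f.1 f.2) (hc : Fs.Pairwise Compat) :
    ∃ G ds, IsFactor C B σ G ds ∧ (∀ e, e ∈ G ↔ ∃ f ∈ Fs, e ∈ f.1) ∧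
      ∀ c, c ∈ ds ↔ ∃ f ∈ Fs, c ∈ f.2 := by
  induction Fs with
  | nil => exact absurd rfl hne
  | cons f Fs ih =>
    rcases eq_or_ne Fs [] with rfl | hne'
    · exact ⟨f.1, f.2, hFs f (by simp), by simp, by simp⟩
    · rw [List.pairwise_cons] at hc
      obtain ⟨G, ds, hG, h1, h2⟩ := ih hne' (fun g hg => hFs g (by simp [hg])) hc.2
      refine ⟨f.1 ++ G, f.2 ++ ds, (hFs f (by simp)).mul hG (fun a ha had => ?_)
        fun a ha => ?_, fun e => ?_, fun c => ?_⟩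
      · obtain ⟨g, hg, hag⟩ := (h2 a).1 had
        exact (hc.1 g hg).1 a ha hag
      · obtain ⟨g, hg, hag⟩ := (occursIn_iff_of_mem h1 a).1 ha
        exact (hc.1 g hg).2 a hag
      · simp [h1]
      · simp [h2]

/-- A list of bags has the running intersection property: the intersection of every bag with
the union of the later ones is contained in one of the later ones. -/
def RunningIntersection : List (Finset ℕ) → Prop
  | [] => True
  | b :: L => RunningIntersection L ∧
    (L = [] ∨ ∃ p ∈ L, ∀ b' ∈ L, ∀ v, v ∈ b → v ∈ b' → v ∈ p)

open Classical in
-- Variable elimination. All factors whose free vertices fit into the first bag are multiplied, and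
-- the vertices of the bag that occur in no later bag are summed out. By the running intersection
-- property the vertices left free lie in a single later bag, so the product fits there and the
-- induction continues with a shorter list of bags. Slots stay distinguishable because at any time
-- the free vertices involved belong to one bag.
theorem exists_factor_of_runningIntersection (hσ : ∀ v, σ v < B) (L : List (Finset ℕ))
    (hL : RunningIntersection L) (hinj : ∀ b ∈ L, Set.InjOn σ b) :
    ∀ Fs : List (List (ℕ × ℕ) × List ℕ), Fs ≠ [] → (∀ f ∈ Fs, IsFactor C B σ f.1 f.2) →
      Fs.Pairwise Compat → (∀ f ∈ Fs, ∀ a, OccursIn f.1 a → a < C) →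
      (∀ f ∈ Fs, ∃ b ∈ L, ∀ a, OccursIn f.1 a → a ∉ f.2 → a ∈ b) →
      ∃ G ds, IsFactor C B σ G ds ∧ (∀ e, e ∈ G ↔ ∃ f ∈ Fs, e ∈ f.1) ∧
        ∀ a, OccursIn G a → a ∈ ds := by
  induction L with
  | nil =>
    intro Fs hne _ _ _ h
    obtain ⟨f, hf⟩ := List.exists_mem_of_ne_nil _ hne
    obtain ⟨b, hb, -⟩ := h f hf
    simp at hb
  | cons b L ih =>
    intro Fs hne hFs hc hlt hbag
    have ih' := ih hL.1 fun b' hb' => hinj b' (by simp [hb'])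
    set fits : List (ℕ × ℕ) × List ℕ → Bool :=
      fun f => decide (∀ a, OccursIn f.1 a → a ∉ f.2 → a ∈ b) with hfits
    have hrest : ∀ f ∈ Fs, fits f = false → ∃ b ∈ L, ∀ a, OccursIn f.1 a → a ∉ f.2 → a ∈ b := by
      intro f hf hff
      obtain ⟨b', hb', h⟩ := hbag f hf
      rcases List.mem_cons.1 hb' with rfl | hb'
      · exact absurd (decide_eq_true h) (by rw [hfits] at hff; simp only at hff; rw [hff]; simp)
      · exact ⟨b', hb', h⟩
    have hperm : (Fs.filter fits ++ Fs.filter fun f => !fits f).Perm Fs :=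
      List.filter_append_perm _ _
    have hc' := (hperm.pairwise_iff fun h => Compat.symm h).2 hc
    rw [List.pairwise_append] at hc'
    obtain ⟨hc1, hc2, hc12⟩ := hc'
    rcases eq_or_ne (Fs.filter fits) [] with he | hne1
    · refine ih' Fs hne hFs hc hlt fun f hf => hrest f hf ?_
      have := List.filter_eq_nil_iff.1 he f hf
      simpa using this
    obtain ⟨G, ds, hG, h1, h2⟩ := exists_factor_of_pairwise hne1
      (fun f hf => hFs f (List.mem_of_mem_filter hf)) hc1
    have hocc := occursIn_iff_of_mem h1
    have hGlt : ∀ a, OccursIn G a → a < C := fun a ha => by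
      obtain ⟨f, hf, haf⟩ := (hocc a).1 ha
      exact hlt f (List.mem_of_mem_filter hf) a haf
    have hGb : ∀ a, OccursIn G a → a ∉ ds → a ∈ b := fun a ha had => by
      obtain ⟨f, hf, haf⟩ := (hocc a).1 ha
      have h3 := (List.mem_filter.1 hf).2
      refine of_decide_eq_true h3 a haf fun h => had ((h2 a).2 ⟨f, hf, h⟩)
    -- A vertex in no later bag cannot be free in a remaining factor, so it may be summed out now.
    obtain ⟨ds', hG', h3⟩ := hG.sum_list hσ hGlt
      (b.toList.filter fun v => decide (OccursIn G v ∧ ∀ b' ∈ L, v ∉ b'))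
      (fun v hv => (of_decide_eq_true (List.mem_filter.1 hv).2).1)
      ((hinj b (by simp)).mono fun a ha => hGb a ha.1 ha.2)
    have h3' : ∀ c, c ∈ ds' ↔ c ∈ ds ∨ (c ∈ b ∧ OccursIn G c ∧ ∀ b' ∈ L, c ∉ b') := fun c => by
      rw [h3]; simp
    rcases hL.2 with rfl | ⟨p, hp, hpb⟩
    · refine ⟨G, ds', hG', fun e => ?_, fun a ha => ?_⟩
      · rw [h1]
        constructor
        · rintro ⟨f, hf, hef⟩
          exact ⟨f, List.mem_of_mem_filter hf, hef⟩
        · rintro ⟨f, hf, hef⟩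
          refine ⟨f, List.mem_filter.2 ⟨hf, ?_⟩, hef⟩
          by_contra hff
          obtain ⟨b', hb', -⟩ := hrest f hf (by simpa using hff)
          simp at hb'
      · rw [h3']
        by_cases had : a ∈ ds
        · exact Or.inl had
        · exact Or.inr ⟨hGb a ha had, ha, by simp⟩
    -- The product replaces the factors that were multiplied, and the bag `p` witnesses that it fits
    -- later.
    · refine Exists.elim (ih' ((G, ds') :: Fs.filter fun f => !fits f) (by simp) ?_ ?_ ?_ ?_) ?_
      · intro f hf
        rcases List.mem_cons.1 hf with rfl | hf
        exacts [hG', hFs f (List.mem_of_mem_filter hf)]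
      · refine List.pairwise_cons.2 ⟨fun g hg => ⟨fun a ha hag => ?_, fun a ha had => ?_⟩, hc2⟩
        · obtain ⟨f, hf, haf⟩ := (hocc a).1 ha
          exact (hc12 f hf g hg).1 a haf hag
        · rcases (h3' a).1 had with had | ⟨-, hGa, hL'⟩
          · obtain ⟨f, hf, haf⟩ := (h2 a).1 had
            exact (hc12 f hf g hg).2 a ha haf
          · obtain ⟨f, hf, haf⟩ := (hocc a).1 hGa
            have hag := (hc12 f hf g hg).1 a haf
            obtain ⟨b', hb', h⟩ := hrest g (List.mem_of_mem_filter hg)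
              (by simpa using (List.mem_filter.1 hg).2)
            exact hL' b' hb' (h a ha hag)
      · intro f hf a ha
        rcases List.mem_cons.1 hf with rfl | hf
        exacts [hGlt a ha, hlt f (List.mem_of_mem_filter hf) a ha]
      · intro f hf
        rcases List.mem_cons.1 hf with rfl | hf
        · refine ⟨p, hp, fun a ha had => ?_⟩
          rw [h3'] at had
          push Not at had
          have hab := hGb a ha had.1
          obtain ⟨b', hb', hab'⟩ := had.2 hab ha
          exact hpb b' hb' a hab hab'
        · exact hrest f (List.mem_of_mem_filter hf) (by simpa using (List.mem_filter.1 hf).2)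
      · rintro G' ⟨es, hG'', h4, h5⟩
        refine ⟨G', es, hG'', fun e => ?_, h5⟩
        rw [h4]
        constructor
        · rintro ⟨f, hf, hef⟩
          rcases List.mem_cons.1 hf with rfl | hf
          · obtain ⟨f, hf, hef⟩ := (h1 e).1 hef
            exact ⟨f, List.mem_of_mem_filter hf, hef⟩
          · exact ⟨f, List.mem_of_mem_filter hf, hef⟩
        · rintro ⟨f, hf, hef⟩
          rcases List.mem_append.1 (hperm.mem_iff.2 hf) with hf | hf
          · exact ⟨(G, ds'), by simp, (h1 e).2 ⟨f, hf, hef⟩⟩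
          · exact ⟨f, List.mem_cons_of_mem _ hf, hef⟩

end Factor

/-- Greedy choice: as long as the bag has at most B elements, each new vertex finds a slot that the
other vertices of the bag do not use. -/
theorem exists_slot_extension {B : ℕ} {σ : ℕ → ℕ} (hσ : ∀ v, σ v < B) (s t : Finset ℕ)
    (hst : Disjoint s t) (hs : Set.InjOn σ s) (hB : (s ∪ t).card ≤ B) :
    ∃ τ : ℕ → ℕ, (∀ v, τ v < B) ∧ Set.InjOn τ (s ∪ t : Finset ℕ) ∧ ∀ v ∉ t, τ v = σ v := by
  induction t using Finset.induction_on with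
  | empty => exact ⟨σ, hσ, by simpa using hs, fun _ _ => rfl⟩
  | insert a t ha ih =>
    rw [Finset.disjoint_insert_right] at hst
    have hau : a ∉ s ∪ t := by simp [hst.1, ha]
    rw [Finset.union_insert, Finset.card_insert_of_notMem hau] at hB
    obtain ⟨τ, h1, h2, h3⟩ := ih hst.2 (by omega)
    obtain ⟨i, hi, hi'⟩ : ∃ i ∈ Finset.range B, i ∉ (s ∪ t).image τ := by
      refine Finset.exists_mem_notMem_of_card_lt_card ?_
      rw [Finset.card_range]
      exact Finset.card_image_le.trans_lt (by omega)
    have hne : ∀ v ∈ s ∪ t, v ≠ a := fun v hv h => hau (h ▸ hv)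
    refine ⟨Function.update τ a i, fun v => ?_, ?_, fun v hv => ?_⟩
    · by_cases hv : v = a
      · subst hv; simpa using Finset.mem_range.1 hi
      · rw [Function.update_of_ne hv]; exact h1 v
    · rw [Finset.union_insert, Finset.coe_insert, Set.injOn_insert (by simpa using hau)]
      refine ⟨fun u hu v hv h => ?_, ?_⟩
      · rw [Function.update_of_ne (hne u hu), Function.update_of_ne (hne v hv)] at h
        exact h2 hu hv h
      · rintro ⟨v, hv, h⟩
        rw [Function.update_self, Function.update_of_ne (hne v hv)] at h
        exact hi' (Finset.mem_image.2 ⟨v, hv, h⟩)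
    · rw [Finset.mem_insert, not_or] at hv
      rw [Function.update_of_ne hv.1, h3 v hv.2]

/-- Slots are assigned from the last bag to the first. The vertices that a bag shares with later
ones all lie in one later bag, where their slots are already distinct; the others are new and can be
assigned without disturbing later bags. -/
theorem exists_slots {B : ℕ} (hB : 0 < B) (L : List (Finset ℕ)) (hL : RunningIntersection L)
    (hc : ∀ b ∈ L, b.card ≤ B) :
    ∃ σ : ℕ → ℕ, (∀ v, σ v < B) ∧ ∀ b ∈ L, Set.InjOn σ b := by
  classical
  induction L with
  | nil => exact ⟨fun _ => 0, fun _ => hB, by simp⟩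
  | cons b L ih =>
    obtain ⟨σ, h1, h2⟩ := ih hL.1 fun b' hb' => hc b' (by simp [hb'])
    set s := b.filter fun v => ∃ b' ∈ L, v ∈ b' with hs
    have hinj : Set.InjOn σ s := by
      rcases hL.2 with rfl | ⟨p, hp, hpb⟩
      · simp [hs]
      · refine (h2 p hp).mono fun v hv => ?_
        obtain ⟨hvb, b', hb', hvb'⟩ := Finset.mem_filter.1 hv
        exact hpb b' hb' v hvb hvb'
    have hu : s ∪ (b \ s) = b := Finset.union_sdiff_of_subset (Finset.filter_subset _ _)
    obtain ⟨τ, h3, h4, h5⟩ := exists_slot_extension h1 s (b \ s) Finset.disjoint_sdiff hinj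
      (by rw [hu]; exact hc b (by simp))
    rw [hu] at h4
    refine ⟨τ, h3, fun b' hb' => ?_⟩
    rcases List.mem_cons.1 hb' with rfl | hb'
    · exact h4
    · intro u hu v hv h
      have key : ∀ v ∈ b', τ v = σ v := fun v hv => h5 v fun h => by
        obtain ⟨hvb, hvs⟩ := Finset.mem_sdiff.1 h
        exact hvs (Finset.mem_filter.2 ⟨hvb, b', hb', hv⟩)
      rw [key u hu, key v hv] at h
      exact h2 b' hb' hu hv h

/-- A graph with a list of bags of size at most `B` that cover its edges and have the running
intersection property has a program with `B` slots. -/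
theorem exists_accepts {C B : ℕ} (hB : 0 < B) {l : List (ℕ × ℕ)} (hne : l ≠ [])
    (hlt : ∀ e ∈ l, e.1 < C ∧ e.2 < C) (L : List (Finset ℕ)) (hL : RunningIntersection L)
    (hc : ∀ b ∈ L, b.card ≤ B) (hcov : ∀ e ∈ l, ∃ b ∈ L, e.1 ∈ b ∧ e.2 ∈ b) :
    ∃ P, Accepts C B l P := by
  obtain ⟨σ, hσ, hinj⟩ := exists_slots hB L hL hc
  have hocc : ∀ (e : ℕ × ℕ) a, OccursIn [e] a ↔ e.1 = a ∨ e.2 = a := by simp [OccursIn]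
  refine Exists.elim (exists_factor_of_runningIntersection (C := C) hσ L hL
    hinj (l.map fun e => ([e], [])) (by simpa using hne) ?_ ?_ ?_ ?_) ?_
  · intro f hf
    obtain ⟨e, -, rfl⟩ := List.mem_map.1 hf
    exact IsFactor.atom hσ e
  · rw [List.pairwise_map]
    exact List.pairwise_of_forall fun _ _ => ⟨by simp, by simp⟩
  · intro f hf a ha
    obtain ⟨e, he, rfl⟩ := List.mem_map.1 hf
    rcases (hocc e a).1 ha with rfl | rfl
    exacts [(hlt e he).1, (hlt e he).2]
  · intro f hf
    obtain ⟨e, he, rfl⟩ := List.mem_map.1 hf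
    obtain ⟨b, hb, hb1, hb2⟩ := hcov e he
    refine ⟨b, hb, fun a ha _ => ?_⟩
    rcases (hocc e a).1 ha with rfl | rfl
    exacts [hb1, hb2]
  · rintro G ⟨ds, ⟨hds, P, hP3, hP⟩, h1, h2⟩
    have hG : ∀ e, e ∈ G ↔ e ∈ l := fun e => by
      rw [h1]
      constructor
      · rintro ⟨f, hf, he⟩
        obtain ⟨e', he', rfl⟩ := List.mem_map.1 hf
        rwa [List.mem_singleton.1 he]
      · exact fun he => ⟨_, List.mem_map_of_mem he, by simp⟩
    have htop : symTop (P.foldl (symStep C) []) = (ds, G) := by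
      rw [(hP []).2, symTop, List.getD_cons_zero, map_congr_of_occursIn (g := id) fun a ha => ?_]
      · simp
      · rw [slotVar, if_pos (h2 a ha), id]
    refine ⟨P, hP3, (hP []).1, by rw [(hP []).2]; simp, ?_, ?_, ?_⟩
    · rw [htop]; exact fun e he => (hG e).1 he
    · rw [htop]
      exact fun e he => ⟨(hG e).2 he, h2 _ ⟨e, (hG e).2 he, Or.inl rfl⟩,
        h2 _ ⟨e, (hG e).2 he, Or.inr rfl⟩⟩
    · rw [htop]
      intro c hc
      obtain ⟨e, he, hec⟩ := hds c hc
      exact ⟨e, (hG e).1 he, hec⟩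

/-! ### Running intersection from tree decompositions -/

/-- Every two vertices of the set are joined by a walk in the set. -/
def WalkConnected {V : Type} (G : SimpleGraph V) (S : Set V) : Prop :=
  ∀ a ∈ S, ∀ b ∈ S, ∃ w : G.Walk a b, ∀ x ∈ w.support, x ∈ S

theorem WalkConnected.of_induce {V : Type} {G : SimpleGraph V} {S : Set V}
    (h : (G.induce S).Preconnected) : WalkConnected G S := by
  intro a ha b hb
  obtain ⟨w⟩ := h ⟨a, ha⟩ ⟨b, hb⟩
  refine ⟨w.map (SimpleGraph.Embedding.induce S).toHom, fun x hx => ?_⟩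
  have e := SimpleGraph.Walk.support_map (SimpleGraph.Embedding.induce (G := G) S).toHom w
  obtain ⟨y, -, rfl⟩ := List.mem_map.1 (e ▸ hx)
  exact y.2

theorem WalkConnected.insert_of_adj {V : Type} {G : SimpleGraph V} {S : Set V} (h : WalkConnected G S)
    {p t : V} (hp : p ∈ S) (hpt : G.Adj p t) : WalkConnected G (insert t S) := by
  have key : ∀ a ∈ S, ∃ w : G.Walk a t, ∀ x ∈ w.support, x ∈ insert t S := by
    intro a ha
    obtain ⟨w, hw⟩ := h a ha p hp
    refine ⟨w.concat hpt, fun x hx => ?_⟩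
    rw [SimpleGraph.Walk.support_concat, List.mem_append, List.mem_singleton] at hx
    rcases hx with hx | rfl
    exacts [Or.inr (hw x hx), Or.inl rfl]
  rintro a (rfl | ha) b (rfl | hb)
  · exact ⟨.nil, by simp⟩
  · obtain ⟨w, hw⟩ := key b hb
    exact ⟨w.reverse, by simpa using hw⟩
  · exact key a ha
  · obtain ⟨w, hw⟩ := h a ha b hb
    exact ⟨w, fun x hx => Or.inr (hw x hx)⟩

/-- In a tree, a connected set that contains a vertex outside of the connected set `S` and a
vertex of `S` contains all neighbours of the former in `S`. -/
theorem WalkConnected.mem_of_adj {V : Type} {G : SimpleGraph V} (hG : G.IsAcyclic) {S T : Set V}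
    (hS : WalkConnected G S) (hT : WalkConnected G T) {p t j : V} (hp : p ∈ S) (ht : t ∉ S)
    (hpt : G.Adj p t) (hj : j ∈ S) (hjT : j ∈ T) (htT : t ∈ T) : p ∈ T := by
  classical
  obtain ⟨w, hw⟩ := hS j hj p hp
  obtain ⟨u, hu⟩ := hT j hjT t htT
  have h1 : (w.bypass.concat hpt).IsPath :=
    w.bypass_isPath.concat (fun h => ht (hw t (w.support_bypass_subset h))) hpt
  have h2 := hG.path_unique ⟨_, h1⟩ ⟨_, u.bypass_isPath⟩
  have h3 : w.bypass.concat hpt = u.bypass := congrArg Subtype.val h2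
  refine hu p (u.support_bypass_subset ?_)
  rw [← h3, SimpleGraph.Walk.support_concat]
  exact List.mem_append_left _ (SimpleGraph.Walk.end_mem_support _)

/-- The nodes of the tree are listed so that each suffix of the list is connected: a boundary edge
of the current set supplies the next node t together with a neighbour p in the set. A vertex in the
bags of t and of an earlier chosen node lies in the bag of p, because the tree path between the two
nodes passes through p. -/
theorem TreeDecomposition.exists_runningIntersection {V : Type} {G : SimpleGraph V} {m : ℕ}
    (D : TreeDecomposition G (Fin m)) (β : Fin m → Finset ℕ)
    (hβ : ∀ a, WalkConnected D.tree {t | a ∈ β t}) :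
    ∃ L : List (Finset ℕ), RunningIntersection L ∧ (∀ b ∈ L, ∃ t, b = β t) ∧ ∀ t, β t ∈ L := by
  have key : ∀ k < m, ∃ N : List (Fin m), N.Nodup ∧ N.length = k + 1 ∧
      WalkConnected D.tree {t | t ∈ N} ∧ RunningIntersection (N.map β) := by
    intro k hk
    induction k with
    | zero =>
      refine ⟨[⟨0, hk⟩], by simp, by simp, ?_, by simp [RunningIntersection]⟩
      rintro a ha b hb
      obtain rfl := List.mem_singleton.1 ha
      obtain rfl := List.mem_singleton.1 hb
      exact ⟨.nil, by simp⟩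
    | succ k ih =>
      obtain ⟨N, h1, h2, h3, h4⟩ := ih (by omega)
      obtain ⟨t, ht⟩ : ∃ t, t ∉ N := by
        by_contra! h
        have := List.toFinset_card_of_nodup h1
        rw [show N.toFinset = Finset.univ from Finset.eq_univ_iff_forall.2 fun t => by simp [h t]]
          at this
        simp at this
        omega
      obtain ⟨s, hs⟩ : ∃ s, s ∈ N := List.exists_mem_of_length_pos (by omega)
      obtain ⟨w⟩ := D.isTree.connected.preconnected s t
      obtain ⟨d, -, hd1, hd2⟩ := w.exists_boundary_dart {t | t ∈ N} hs ht
      refine ⟨d.snd :: N, List.nodup_cons.2 ⟨hd2, h1⟩, by simp [h2], ?_, h4, Or.inr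
        ⟨β d.fst, List.mem_map_of_mem hd1, ?_⟩⟩
      · have := h3.insert_of_adj hd1 d.adj
        convert this using 1
        ext x; simp
      · intro b' hb' v hv hv'
        obtain ⟨j, hj, rfl⟩ := List.mem_map.1 hb'
        exact h3.mem_of_adj D.isTree.isAcyclic (hβ v) hd1 hd2 d.adj hj hv' hv
  have hm : 0 < m := by
    obtain ⟨⟨t⟩⟩ := D.isTree.connected.nonempty
    omega
  obtain ⟨N, h1, h2, -, h4⟩ := key (m - 1) (by omega)
  refine ⟨N.map β, h4, fun b hb => ?_, fun t => List.mem_map_of_mem ?_⟩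
  · obtain ⟨t, -, rfl⟩ := List.mem_map.1 hb
    exact ⟨t, rfl⟩
  · have h5 : N.toFinset = Finset.univ := by
      rw [← Finset.card_eq_iff_eq_univ, List.toFinset_card_of_nodup h1]
      simp; omega
    have := Finset.mem_univ t
    rwa [← h5, List.mem_toFinset] at this

/-- The tree decomposition with one bag. -/
def TreeDecomposition.trivial {V : Type} (G : SimpleGraph V) : TreeDecomposition G (Fin 1) where
  tree := ⊥
  isTree := ⟨⟨fun a b => by rw [Subsingleton.elim a b]⟩, fun v c hc => by
    have := hc.three_le_length
    cases c with
    | nil => simp at this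
    | cons h _ => exact h.elim⟩
  bag _ := Set.univ
  vertex_mem _ := ⟨0, Set.mem_univ _⟩
  edge_mem _ _ _ := ⟨0, Set.mem_univ _, Set.mem_univ _⟩
  connected v a b := by rw [Subsingleton.elim a b]

/-- The infimum defining the treewidth is attained because the set is nonempty, as the decomposition
with a single bag shows; the infimum of the empty set would be a meaningless 0. -/
theorem exists_treeDecomposition {V : Type} [Finite V] (G : SimpleGraph V) :
    ∃ (m : ℕ) (D : TreeDecomposition G (Fin m)), ∀ t, (D.bag t).ncard ≤ treewidth G + 1 := by
  have : treewidth G ∈ {w : ℕ | ∃ (m : ℕ) (D : TreeDecomposition G (Fin m)),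
      ∀ t, (D.bag t).ncard ≤ w + 1} :=
    Nat.sInf_mem ⟨Nat.card V, 1, TreeDecomposition.trivial G, fun t => by
      rw [TreeDecomposition.trivial, Set.ncard_univ]; omega⟩
  exact this

/-- A graph of treewidth less than `B` has a program with `B` slots. -/
theorem exists_accepts_of_treewidth {C B : ℕ} {l : List (ℕ × ℕ)} (hne : l ≠ [])
    (hlt : ∀ e ∈ l, e.1 < C ∧ e.2 < C) (hl : ∀ e ∈ l, e.1 ≠ e.2)
    (hB : treewidth (pairGraph C l) < B) : ∃ P, Accepts C B l P := by
  classical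
  obtain ⟨m, D, hD⟩ := exists_treeDecomposition (pairGraph C l)
  let ν : Fin (pairVerts C l).length → ℕ := fun i => (pairVerts C l)[i]
  have hν : Function.Injective ν := fun i j h =>
    Fin.ext ((nodup_pairVerts C l).getElem_inj_iff.1 h)
  have hmem : ∀ a (e : ℕ × ℕ), e ∈ l → (e.1 = a ∨ e.2 = a) → ∃ i, ν i = a := by
    intro a e he h
    have : a ∈ pairVerts C l := by
      refine mem_pairVerts.2 ⟨?_, e, he, h⟩
      rcases h with rfl | rfl
      exacts [(hlt e he).1, (hlt e he).2]
    obtain ⟨i, hi, h⟩ := List.mem_iff_getElem.1 this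
    exact ⟨⟨i, hi⟩, h⟩
  obtain ⟨L, h1, h2, h3⟩ := D.exists_runningIntersection
    (fun t => (D.bag t).toFinset.image ν) (fun a => by
      by_cases ha : ∃ i, ν i = a
      · obtain ⟨i, rfl⟩ := ha
        have := WalkConnected.of_induce (D.connected i)
        convert this using 3
        simp [hν.eq_iff]
      · intro t ht
        obtain ⟨i, -, hi⟩ := Finset.mem_image.1 (Set.mem_setOf_eq.mp ht)
        exact absurd ⟨i, hi⟩ ha)
  refine exists_accepts (by omega) hne hlt L h1 (fun b hb => ?_) fun e he => ?_
  · obtain ⟨t, rfl⟩ := h2 b hb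
    refine Finset.card_image_le.trans ?_
    rw [← Set.ncard_eq_toFinset_card']
    exact (hD t).trans hB
  · obtain ⟨i, hi⟩ := hmem _ e he (Or.inl rfl)
    obtain ⟨j, hj⟩ := hmem _ e he (Or.inr rfl)
    obtain ⟨t, hit, hjt⟩ := D.edge_mem i j (by
      show PairAdj l (ν i) (ν j)
      rw [hi, hj]
      exact ⟨hl e he, Or.inl he⟩)
    refine ⟨_, h3 t, ?_, ?_⟩
    · rw [← hi]; exact Finset.mem_image_of_mem _ (by simpa using hit)
    · rw [← hj]; exact Finset.mem_image_of_mem _ (by simpa using hjt)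

theorem GraphProperty.exists_accepts_of_boundedTreewidth {Φ : GraphProperty}
    (h : Φ.BoundedTreewidth) : ∃ B, ∀ (C : ℕ) (l : List (ℕ × ℕ)), l ≠ [] →
      (∀ e ∈ l, e.1 < C ∧ e.2 < C) → (∀ e ∈ l, e.1 ≠ e.2) → Φ.holds (pairGraph C l) →
        ∃ P, Accepts C B l P := by
  obtain ⟨B, hB⟩ := h
  refine ⟨B, fun C l hne hlt hl hΦ => exists_accepts_of_treewidth hne hlt hl ?_⟩
  by_contra hc
  exact hB _ _ (not_lt.1 hc) hΦ

/-! ### Finding programs -/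

theorem primrecRel_mem_list {α : Type*} [Primcodable α] [DecidableEq α] :
    PrimrecRel fun (a : α) (l : List α) => a ∈ l := by
  have h : PrimrecRel fun (b a : α) => b = a := Primrec.eq
  exact (PrimrecRel.of_eq h.exists_mem_list fun l a => by simp).swap

theorem primrec_symTop : Primrec symTop := (Primrec.list_getD _).comp Primrec.id (Primrec.const 0)

theorem primrec_symNext : Primrec symNext := (Primrec.list_getD _).comp Primrec.id (Primrec.const 1)

theorem primrec_symStep : Primrec fun q : (ℕ × List SymTable) × Instr => symStep q.1.1 q.1.2 q.2 := by
  have hC : Primrec fun q : (ℕ × List SymTable) × Instr => q.1.1 := Primrec.fst.comp Primrec.fst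
  have hst : Primrec fun q : (ℕ × List SymTable) × Instr => q.1.2 := Primrec.snd.comp Primrec.fst
  have ho : Primrec fun q : (ℕ × List SymTable) × Instr => q.2.1 := Primrec.fst.comp Primrec.snd
  have ha : Primrec fun q : (ℕ × List SymTable) × Instr => q.2.2.1 :=
    Primrec.fst.comp (Primrec.snd.comp Primrec.snd)
  have hb : Primrec fun q : (ℕ × List SymTable) × Instr => q.2.2.2 :=
    Primrec.snd.comp (Primrec.snd.comp Primrec.snd)
  have ht := primrec_symTop.comp hst
  have hn := primrec_symNext.comp hst
  have hren : Primrec₂ fun (q : (ℕ × List SymTable) × Instr) (v : ℕ) =>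
      if v = q.1.1 + q.2.2.1 then q.2.2.2 else v :=
    Primrec.ite (Primrec.eq.comp Primrec.snd ((Primrec.nat_add.comp hC ha).comp Primrec.fst))
      (hb.comp Primrec.fst) Primrec.snd
  unfold symStep
  refine Primrec.ite (Primrec.eq.comp ho (Primrec.const 0)) ?_ <|
    Primrec.ite (Primrec.eq.comp ho (Primrec.const 1)) ?_ <|
    Primrec.ite (Primrec.eq.comp ho (Primrec.const 2)) ?_ (Primrec.list_tail.comp hst)
  · exact Primrec.list_cons.comp ((Primrec.const []).pair (Primrec.list_cons.comp
      ((Primrec.nat_add.comp hC ha).pair (Primrec.nat_add.comp hC hb)) (Primrec.const []))) hst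
  · exact Primrec.list_cons.comp
      ((Primrec.list_append.comp (Primrec.fst.comp hn) (Primrec.fst.comp ht)).pair
        (Primrec.list_append.comp (Primrec.snd.comp hn) (Primrec.snd.comp ht)))
      (Primrec.list_tail.comp (Primrec.list_tail.comp hst))
  · refine Primrec.list_cons.comp ((Primrec.list_cons.comp hb (Primrec.fst.comp ht)).pair
      (Primrec.list_map (Primrec.snd.comp ht) ?_)) (Primrec.list_tail.comp hst)
    exact (hren.comp Primrec.fst (Primrec.fst.comp Primrec.snd)).pair
      (hren.comp Primrec.fst (Primrec.snd.comp Primrec.snd))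

theorem primrecPred_symOk (B : ℕ) :
    PrimrecPred fun q : (ℕ × List SymTable) × Instr => SymOk q.1.1 B q.1.2 q.2 := by
  have hC : Primrec fun q : (ℕ × List SymTable) × Instr => q.1.1 := Primrec.fst.comp Primrec.fst
  have hst : Primrec fun q : (ℕ × List SymTable) × Instr => q.1.2 := Primrec.snd.comp Primrec.fst
  have ho : Primrec fun q : (ℕ × List SymTable) × Instr => q.2.1 := Primrec.fst.comp Primrec.snd
  have ha : Primrec fun q : (ℕ × List SymTable) × Instr => q.2.2.1 :=
    Primrec.fst.comp (Primrec.snd.comp Primrec.snd)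
  have hb : Primrec fun q : (ℕ × List SymTable) × Instr => q.2.2.2 :=
    Primrec.snd.comp (Primrec.snd.comp Primrec.snd)
  have ht := Primrec.fst.comp (primrec_symTop.comp hst)
  have hn := Primrec.fst.comp (primrec_symNext.comp hst)
  have hl := Primrec.list_length.comp hst
  have hB := Primrec.const (α := (ℕ × List SymTable) × Instr) B
  have him : ∀ {p r : (ℕ × List SymTable) × Instr → Prop}, PrimrecPred p → PrimrecPred r →
      PrimrecPred fun q => p q → r q := fun hp hr =>
    (hp.not.or hr).of_eq fun q => imp_iff_not_or.symm
  have hmem : PrimrecRel fun (c : ℕ) (l : List ℕ) => c ∉ l :=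
    PrimrecPred.not primrecRel_mem_list
  have h0 := Primrec.eq.comp ho (Primrec.const 0)
  have h1 := Primrec.eq.comp ho (Primrec.const 1)
  have h2 := Primrec.eq.comp ho (Primrec.const 2)
  have h3 := Primrec.nat_lt.comp (Primrec.const 2) ho
  have l1 := Primrec.nat_le.comp (Primrec.const 1) hl
  have l2 := Primrec.nat_le.comp (Primrec.const 2) hl
  exact (him h0 ((Primrec.nat_lt.comp ha hB).and (Primrec.nat_lt.comp hb hB))).and <|
    (him h1 (l2.and (hmem.forall_mem_list.comp ht hn))).and <|
    (him h2 (l1.and ((Primrec.nat_lt.comp ha hB).and ((Primrec.nat_lt.comp hb hC).and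
      (hmem.comp hb ht))))).and (him h3 l1)

open Classical in
/-- Executes a program, and records whether all instructions are admissible. -/
noncomputable def symCheck (C B : ℕ) (P : List Instr) (q : Bool × List SymTable) :
    Bool × List SymTable :=
  P.foldl (fun q i => (q.1 && decide (SymOk C B q.2 i), symStep C q.2 i)) q

theorem symCheck_snd (C B : ℕ) (P : List Instr) (q : Bool × List SymTable) :
    (symCheck C B P q).2 = P.foldl (symStep C) q.2 := by
  unfold symCheck
  induction P generalizing q with
  | nil => rfl
  | cons i P ih => rw [List.foldl_cons, ih, List.foldl_cons]

theorem symCheck_fst (C B : ℕ) (P : List Instr) (q : Bool × List SymTable) :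
    (symCheck C B P q).1 = true ↔ q.1 = true ∧ RunsOk C B P q.2 := by
  unfold symCheck
  induction P generalizing q with
  | nil => simp [RunsOk]
  | cons i P ih =>
    rw [List.foldl_cons, ih]
    simp [RunsOk, and_assoc]

theorem primrec_symCheck (B : ℕ) :
    Primrec fun q : ℕ × List Instr => symCheck q.1 B q.2 (true, []) := by
  have h : Primrec fun q : (ℕ × List Instr) × (Bool × List SymTable) × Instr =>
      ((q.1.1, q.2.1.2), q.2.2) :=
    ((Primrec.fst.comp Primrec.fst).pair (Primrec.snd.comp (Primrec.fst.comp Primrec.snd))).pair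
      (Primrec.snd.comp Primrec.snd)
  classical
  have hstep : Primrec₂ fun (q : ℕ × List Instr) (p : (Bool × List SymTable) × Instr) =>
      (p.1.1 && decide (SymOk q.1 B p.1.2 p.2), symStep q.1 p.1.2 p.2) :=
    (Primrec.and.comp (Primrec.fst.comp (Primrec.fst.comp Primrec.snd))
      ((primrecPred_symOk B).decide.comp h)).pair (primrec_symStep.comp h)
  refine (Primrec.list_foldl Primrec.snd (Primrec.const (true, [])) hstep).of_eq fun q => ?_
  unfold symCheck
  congr!

/-- Correctness of a program is checked by running it symbolically, which involves neither the host
graph nor tree decompositions. This decidability is what allows programs to be found by search. -/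
theorem primrecPred_accepts (B : ℕ) :
    PrimrecPred fun q : (ℕ × List (ℕ × ℕ)) × List Instr => Accepts q.1.1 B q.1.2 q.2 := by
  have hc : Primrec fun q : (ℕ × List (ℕ × ℕ)) × List Instr =>
      symCheck q.1.1 B q.2 (true, []) :=
    (primrec_symCheck B).comp ((Primrec.fst.comp Primrec.fst).pair Primrec.snd)
  have hst := Primrec.snd.comp hc
  have htop := primrec_symTop.comp hst
  have hl : Primrec fun q : (ℕ × List (ℕ × ℕ)) × List Instr => q.1.2 := Primrec.snd.comp Primrec.fst
  have hm : PrimrecRel fun (e : ℕ × ℕ) (l : List (ℕ × ℕ)) => e ∈ l := primrecRel_mem_list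
  have hm' : PrimrecRel fun (c : ℕ) (l : List ℕ) => c ∈ l := primrecRel_mem_list
  have h1 : PrimrecPred fun P : List Instr => ∀ i ∈ P, i.1 < 3 :=
    PrimrecPred.forall_mem_list (Primrec.nat_lt.comp Primrec.fst (Primrec.const 3))
  have h2 : PrimrecRel fun (e : ℕ × ℕ) (S : SymTable) => e ∈ S.2 ∧ e.1 ∈ S.1 ∧ e.2 ∈ S.1 :=
    (hm.comp Primrec.fst (Primrec.snd.comp Primrec.snd)).and
      ((hm'.comp (Primrec.fst.comp Primrec.fst) (Primrec.fst.comp Primrec.snd)).and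
      (hm'.comp (Primrec.snd.comp Primrec.fst) (Primrec.fst.comp Primrec.snd)))
  have h3 : PrimrecRel fun (e : ℕ × ℕ) (c : ℕ) => e.1 = c ∨ e.2 = c :=
    (Primrec.eq.comp (Primrec.fst.comp Primrec.fst) Primrec.snd).or
      (Primrec.eq.comp (Primrec.snd.comp Primrec.fst) Primrec.snd)
  have h4 : PrimrecRel fun (c : ℕ) (l : List (ℕ × ℕ)) => ∃ e ∈ l, e.1 = c ∨ e.2 = c :=
    h3.exists_mem_list.swap
  refine ((h1.comp Primrec.snd).and ((Primrec.eq.comp (Primrec.fst.comp hc) (Primrec.const true)).and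
    ((Primrec.eq.comp (Primrec.list_length.comp hst) (Primrec.const 1)).and
    ((hm.forall_mem_list.comp (Primrec.snd.comp htop) hl).and
    ((h2.forall_mem_list.comp hl htop).and
    (h4.forall_mem_list.comp (Primrec.fst.comp htop) hl)))))).of_eq fun q => ?_
  simp only [symCheck_fst, symCheck_snd, true_and, Accepts]

/-! ### All patterns with a given number of edges -/

/-- The pairs of numbers below `C` given by the binary digits of a number. -/
def maskPairs (C mask : ℕ) : List (ℕ × ℕ) :=
  ((List.range (C * C)).filter fun p => decide (mask / 2 ^ p % 2 = 1)).map fun p => (p / C, p % C)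

theorem mem_maskPairs {C mask : ℕ} {e : ℕ × ℕ} :
    e ∈ maskPairs C mask ↔ e.1 < C ∧ e.2 < C ∧ mask.testBit (e.1 * C + e.2) = true := by
  simp only [maskPairs, List.mem_map, List.mem_filter, List.mem_range, decide_eq_true_eq,
    Nat.testBit_eq_decide_div_mod_eq]
  constructor
  · rintro ⟨p, ⟨hp, h⟩, rfl⟩
    refine ⟨Nat.div_lt_of_lt_mul_self hp, Nat.mod_lt_of_lt_mul_self hp, ?_⟩
    rwa [Nat.div_add_mod']
  · rintro ⟨h1, h2, h⟩
    refine ⟨_, ⟨Nat.mul_add_lt_mul_self h1 h2, h⟩, ?_⟩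
    rw [Nat.mul_add_div_of_lt h2, Nat.mul_add_mod_of_lt' h2]

theorem nodup_maskPairs (C mask : ℕ) : (maskPairs C mask).Nodup := by
  refine List.Nodup.map (fun p q h => ?_) (List.nodup_range.filter _)
  rw [Prod.mk.injEq] at h
  rw [← Nat.div_add_mod' p C, h.1, h.2, Nat.div_add_mod']

theorem exists_maskPairs (C : ℕ) (Q : ℕ × ℕ → Prop) :
    ∃ mask < 2 ^ (C * C), ∀ e, e ∈ maskPairs C mask ↔ e.1 < C ∧ e.2 < C ∧ Q e := by
  classical
  refine ⟨Nat.ofBits fun p : Fin (C * C) => decide (Q (p / C, p % C)), Nat.ofBits_lt_two_pow _,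
    fun e => ?_⟩
  rw [mem_maskPairs]
  refine and_congr_right fun h1 => and_congr_right fun h2 => ?_
  rw [Nat.testBit_ofBits_lt _ _ (Nat.mul_add_lt_mul_self h1 h2), decide_eq_true_eq]
  simp only [Nat.mul_add_div_of_lt h2, Nat.mul_add_mod_of_lt' h2]

theorem maskPairs_injOn {C m m' : ℕ} (hm : m < 2 ^ (C * C)) (hm' : m' < 2 ^ (C * C))
    (h : ∀ e, e ∈ maskPairs C m ↔ e ∈ maskPairs C m') : m = m' := by
  refine Nat.eq_of_testBit_eq fun p => ?_
  by_cases hp : p < C * C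
  · have := h (p / C, p % C)
    simp only [mem_maskPairs, Nat.div_lt_of_lt_mul_self hp, Nat.mod_lt_of_lt_mul_self hp,
      Nat.div_add_mod', true_and] at this
    exact Bool.eq_iff_iff.2 this
  · have h2 : 2 ^ (C * C) ≤ 2 ^ p := Nat.pow_le_pow_right (by norm_num) (by omega)
    rw [Nat.testBit_lt_two_pow (hm.trans_le h2), Nat.testBit_lt_two_pow (hm'.trans_le h2)]

theorem primrec_maskPairs : Primrec₂ maskPairs := by
  have h : PrimrecRel fun (p mask : ℕ) => mask / 2 ^ p % 2 = 1 :=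
    Primrec.eq.comp (Primrec.nat_mod.comp (Primrec.nat_div.comp Primrec.snd
      (Primrec.nat_pow.comp (Primrec.const 2) Primrec.fst)) (Primrec.const 2)) (Primrec.const 1)
  exact Primrec.list_map (h.listFilter.comp (Primrec.list_range.comp
    (Primrec.nat_mul.comp Primrec.fst Primrec.fst)) Primrec.snd)
    ((Primrec.nat_div.comp Primrec.snd (Primrec.fst.comp Primrec.fst)).pair
    (Primrec.nat_mod.comp Primrec.snd (Primrec.fst.comp Primrec.fst)))

/-- The number of colours. -/
def colors (k : ℕ) : ℕ := 2 ^ (k + k)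

theorem primrec_colors : Primrec colors :=
  Primrec.nat_pow.comp (Primrec.const 2) (Primrec.nat_add.comp Primrec.id Primrec.id)

/-- The weight of a set of edges whose ends have distinct colours. -/
def colorWeight (C v : ℕ) : ℕ := C ^ v * (C - v).factorial

theorem primrec_colorWeight : Primrec₂ colorWeight :=
  Primrec.nat_mul.comp (Primrec.nat_pow.comp Primrec.fst Primrec.snd)
    (Primrec.nat_factorial.comp (Primrec.nat_sub.comp Primrec.fst Primrec.snd))

/-- The number represents a graph with `k` edges that has the property. -/
def goodMask (d : List Bool → Bool) (k mask : ℕ) : Bool :=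
  decide ((maskPairs (colors k) mask).length = k ∧ k ≠ 0 ∧
    ∀ p ∈ maskPairs (colors k) mask, p.1 < p.2) && d (pairCode (colors k) (maskPairs (colors k) mask))

theorem computable_goodMask {d : List Bool → Bool} (hd : Computable d) :
    Computable₂ (goodMask d) := by
  have hm : Primrec fun q : ℕ × ℕ => maskPairs (colors q.1) q.2 :=
    primrec_maskPairs.comp (primrec_colors.comp Primrec.fst) Primrec.snd
  have h1 : PrimrecPred fun l : List (ℕ × ℕ) => ∀ p ∈ l, p.1 < p.2 :=
    PrimrecPred.forall_mem_list (Primrec.nat_lt.comp Primrec.fst Primrec.snd)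
  have h2 : PrimrecPred fun q : ℕ × ℕ => (maskPairs (colors q.1) q.2).length = q.1 ∧ q.1 ≠ 0 ∧
      ∀ p ∈ maskPairs (colors q.1) q.2, p.1 < p.2 :=
    (Primrec.eq.comp (Primrec.list_length.comp hm) Primrec.fst).and
      ((Primrec.eq.comp Primrec.fst (Primrec.const 0)).not.and (h1.comp hm))
  exact Primrec.and.to_comp.comp h2.decide.to_comp
    (hd.comp (primrec_pairCode.comp (primrec_colors.comp Primrec.fst) hm).to_comp)

/-- The part of the plan that belongs to a pattern. -/
def planPiece (d : List Bool → Bool) (prog : ℕ → ℕ → List Instr) (k mask : ℕ) : List Instr :=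
  if goodMask d k mask then prog k mask ++ [(3, colorWeight (colors k)
    (pairVerts (colors k) (maskPairs (colors k) mask)).length, 0)] else []

/-- For each good pattern, the first number that codes a correct program is taken. Existence of some
program makes the search terminate, so tree decompositions enter the existence proof but not the
algorithm. The plan concatenates the programs of all good patterns, each followed by the instruction
that adds its weighted result. -/
theorem exists_plan {d : List Bool → Bool} (hd : Computable d) {B : ℕ}
    (h : ∀ k mask, goodMask d k mask = true →
      ∃ P, Accepts (colors k) B (maskPairs (colors k) mask) P) :
    ∃ prog : ℕ → ℕ → List Instr, (∀ k mask, goodMask d k mask = true →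
      Accepts (colors k) B (maskPairs (colors k) mask) (prog k mask)) ∧
      Computable fun k => (List.range (2 ^ (colors k * colors k))).flatMap (planPiece d prog k) := by
  classical
  have hm : Primrec fun q : ℕ × ℕ => maskPairs (colors q.1) q.2 :=
    primrec_maskPairs.comp (primrec_colors.comp Primrec.fst) Primrec.snd
  have hacc : Primrec fun q : (ℕ × ℕ) × ℕ => decide (Accepts (colors q.1.1) B
      (maskPairs (colors q.1.1) q.1.2) ((Encodable.decode q.2 : Option (List Instr)).getD [])) :=
    ((primrecPred_accepts B).comp ((((primrec_colors.comp Primrec.fst).pair hm).comp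
      Primrec.fst).pair (Primrec.option_getD.comp (Primrec.decode.comp Primrec.snd)
      (Primrec.const [])))).decide
  -- The condition is an implication, so that the search is total: for a bad pattern the very first
  -- candidate passes.
  have hp : Computable₂ fun (q : ℕ × ℕ) (c : ℕ) => decide (goodMask d q.1 q.2 = true →
      Accepts (colors q.1) B (maskPairs (colors q.1) q.2)
        ((Encodable.decode c : Option (List Instr)).getD [])) := by
    refine (Primrec.or.to_comp.comp (Primrec.not.to_comp.comp ((computable_goodMask hd).comp
      (Computable.fst.comp Computable.fst) (Computable.snd.comp Computable.fst)))
      hacc.to_comp).of_eq fun q => ?_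
    rw [Bool.eq_iff_iff]
    simp [imp_iff_not_or]
  have hex : ∀ q : ℕ × ℕ, ∃ c, goodMask d q.1 q.2 = true →
      Accepts (colors q.1) B (maskPairs (colors q.1) q.2)
        ((Encodable.decode c : Option (List Instr)).getD []) := by
    intro q
    by_cases hg : goodMask d q.1 q.2 = true
    · obtain ⟨P, hP⟩ := h _ _ hg
      exact ⟨Encodable.encode P, fun _ => by simpa using hP⟩
    · exact ⟨0, fun h => absurd h hg⟩
  let prog : ℕ → ℕ → List Instr := fun k mask =>
    (Encodable.decode (Nat.find (hex (k, mask))) : Option (List Instr)).getD []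
  have hprog : Computable₂ prog := (Primrec.option_getD.comp Primrec.decode
    (Primrec.const [])).to_comp.comp (Computable.nat_find hp hex)
  have hpiece : Computable₂ (planPiece d prog) := by
    have hw : Primrec fun q : ℕ × ℕ => ((3, colorWeight (colors q.1)
        (pairVerts (colors q.1) (maskPairs (colors q.1) q.2)).length, 0) : Instr) :=
      (Primrec.const 3).pair ((primrec_colorWeight.comp (primrec_colors.comp Primrec.fst)
        (Primrec.list_length.comp (primrec_pairVerts.comp (primrec_colors.comp Primrec.fst) hm))).pair
        (Primrec.const 0))
    refine (Computable.cond (computable_goodMask hd) (Computable.list_append.comp hprog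
      (Primrec.list_cons.comp hw (Primrec.const [])).to_comp) (Computable.const [])).of_eq
      fun q => ?_
    rw [planPiece, Bool.cond_eq_ite]
  refine ⟨prog, fun k mask hg => Nat.find_spec (hex (k, mask)) hg, ?_⟩
  have hstep : Computable₂ fun (k : ℕ) (p : ℕ × List Instr) => p.2 ++ planPiece d prog k p.1 :=
    Computable.list_append.comp (Computable.snd.comp Computable.snd)
      (hpiece.comp Computable.fst (Computable.fst.comp Computable.snd))
  refine (Computable.nat_rec (Primrec.nat_pow.comp (Primrec.const 2)
    (Primrec.nat_mul.comp primrec_colors primrec_colors)).to_comp (Computable.const []) hstep).of_eq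
    fun k => ?_
  show _ = (List.range (2 ^ (colors k * colors k))).flatMap _
  induction 2 ^ (colors k * colors k) with
  | zero => rfl
  | succ n ih => rw [List.range_succ, List.flatMap_append, ← ih]; simp

/-! ### Patterns of sets of edges -/

section Pattern

variable {n : ℕ} {χ : Fin n → ℕ} {A : Finset (Sym2 (Fin n))} {l : List (ℕ × ℕ)}

theorem mem_support_fromEdgeSet_iff (hA : ∀ e ∈ A, ¬ e.IsDiag) {v : Fin n} :
    v ∈ (SimpleGraph.fromEdgeSet (A : Set (Sym2 (Fin n)))).support ↔ ∃ e ∈ A, v ∈ e := by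
  constructor
  · rintro ⟨w, hw⟩
    exact ⟨_, (SimpleGraph.fromEdgeSet_adj _).1 hw |>.1, Sym2.mem_mk_left _ _⟩
  · rintro ⟨e, he, hv⟩
    obtain ⟨w, rfl⟩ := hv
    exact ⟨w, (SimpleGraph.fromEdgeSet_adj _).2 ⟨he, fun h => hA _ he (Sym2.mk_isDiag_iff.2 h)⟩⟩

theorem not_isDiag_of_subset_edgeSet {G : SimpleGraph (Fin n)}
    (hA : (A : Set (Sym2 (Fin n))) ⊆ G.edgeSet) : ∀ e ∈ A, ¬ e.IsDiag :=
  fun _ he => G.not_isDiag_of_mem_edgeSet (hA he)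

/-- With the smaller colour first in each pair, the members of the list are determined by A and the
colouring. Hence a set of edges has at most one such pattern, up to the order of the list. -/
theorem HasPattern.mem_iff (h : HasPattern χ A l) (hl : ∀ p ∈ l, p.1 < p.2) (p : ℕ × ℕ) :
    p ∈ l ↔ p.1 < p.2 ∧ ∃ e ∈ A, Sym2.map χ e = s(p.1, p.2) := by
  constructor
  · exact fun hp => ⟨hl p hp, (h.2 _).2 ⟨p, hp, rfl⟩⟩
  · rintro ⟨hlt, he⟩
    obtain ⟨q, hq, hqp⟩ := (h.2 _).1 he
    have := hl q hq
    rcases Sym2.eq_iff.1 hqp with ⟨h1, h2⟩ | ⟨h1, h2⟩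
    · rwa [← Prod.ext h1 h2]
    · omega

theorem injOn_sym2_map (h : Set.InjOn χ {v | ∃ e ∈ A, v ∈ e}) :
    Set.InjOn (Sym2.map χ) (A : Set (Sym2 (Fin n))) := by
  intro e he e' he' hee
  induction e with | _ a b =>
  induction e' with | _ c d =>
  have ha : a ∈ {v | ∃ e ∈ A, v ∈ e} := ⟨_, he, Sym2.mem_mk_left _ _⟩
  have hb : b ∈ {v | ∃ e ∈ A, v ∈ e} := ⟨_, he, Sym2.mem_mk_right _ _⟩
  have hc : c ∈ {v | ∃ e ∈ A, v ∈ e} := ⟨_, he', Sym2.mem_mk_left _ _⟩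
  have hd : d ∈ {v | ∃ e ∈ A, v ∈ e} := ⟨_, he', Sym2.mem_mk_right _ _⟩
  rw [Sym2.map_mk, Sym2.map_mk] at hee
  rcases Sym2.eq_iff.1 hee with ⟨h1, h2⟩ | ⟨h1, h2⟩
  · rw [h ha hc h1, h hb hd h2]
  · rw [h ha hd h1, h hb hc h2, Sym2.eq_swap]

theorem HasPattern.length_eq (h : HasPattern χ A l) (hl : ∀ p ∈ l, p.1 < p.2) (hnd : l.Nodup) :
    l.length = A.card := by
  classical
  rw [← List.toFinset_card_of_nodup hnd, ← Finset.card_image_of_injOn (injOn_sym2_map h.1),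
    ← Finset.card_image_of_injOn (s := l.toFinset) (f := fun p => s(p.1, p.2))]
  · congr 1
    ext z
    simpa using (h.2 z).symm
  · intro p hp q hq hpq
    have h1 := hl p (by simpa using hp)
    have h2 := hl q (by simpa using hq)
    rcases Sym2.eq_iff.1 hpq with ⟨h3, h4⟩ | ⟨h3, h4⟩
    · exact Prod.ext h3 h4
    · omega

theorem HasPattern.nonempty_iso (h : HasPattern χ A l) {C : ℕ}
    (hC : ∀ v, χ v < C) (hA : ∀ e ∈ A, ¬ e.IsDiag) :
    Nonempty (edgeInduced (A : Set (Sym2 (Fin n))) ≃g pairGraph C l) := by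
  have hsup : (SimpleGraph.fromEdgeSet (A : Set (Sym2 (Fin n)))).support = {v | ∃ e ∈ A, v ∈ e} :=
    Set.ext fun v => mem_support_fromEdgeSet_iff hA
  have hinj := h.1
  rw [← hsup] at hinj
  refine nonempty_edgeInduced_iso_pairGraph _ C l χ hinj (fun v _ => hC v) (fun u v huv => ?_)
    fun p hp => ?_
  · refine ⟨fun he => huv.ne (hinj ⟨v, huv⟩ ⟨u, huv.symm⟩ he), ?_⟩
    obtain ⟨p, hp, hpe⟩ := (h.2 _).1 ⟨s(u, v), ((SimpleGraph.fromEdgeSet_adj _).1 huv).1, rfl⟩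
    rw [Sym2.map_mk] at hpe
    rcases Sym2.eq_iff.1 hpe with ⟨h1, h2⟩ | ⟨h1, h2⟩
    · exact Or.inl (by rwa [← h1, ← h2])
    · exact Or.inr (by rwa [← h1, ← h2])
  · obtain ⟨e, he, hez⟩ := (h.2 _).2 ⟨p, hp, rfl⟩
    have hadj : ∀ u v, s(u, v) ∈ A → (SimpleGraph.fromEdgeSet (A : Set (Sym2 (Fin n)))).Adj u v :=
      fun u v huv => (SimpleGraph.fromEdgeSet_adj _).2
        ⟨huv, fun h => hA _ huv (Sym2.mk_isDiag_iff.2 h)⟩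
    induction e with | _ u v =>
    rw [Sym2.map_mk] at hez
    rcases Sym2.eq_iff.1 hez with ⟨h1, h2⟩ | ⟨h1, h2⟩
    · exact ⟨u, v, hadj u v he, Prod.ext h1.symm h2.symm⟩
    · exact ⟨v, u, hadj v u (Sym2.eq_swap ▸ he), Prod.ext h2.symm h1.symm⟩

theorem ncard_support_le (A : Finset (Sym2 (Fin n))) :
    (SimpleGraph.fromEdgeSet (A : Set (Sym2 (Fin n)))).support.ncard ≤ A.card + A.card := by
  classical
  have hsub : (SimpleGraph.fromEdgeSet (A : Set (Sym2 (Fin n)))).support ⊆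
      ((A.image fun e => (Quot.out e).1) ∪ (A.image fun e => (Quot.out e).2) : Finset (Fin n)) := by
    rintro v ⟨w, hw⟩
    have he := ((SimpleGraph.fromEdgeSet_adj _).1 hw).1
    have h1 : s((Quot.out s(v, w)).1, (Quot.out s(v, w)).2) = s(v, w) := Quot.out_eq _
    rcases Sym2.eq_iff.1 h1 with h | h
    · exact Finset.mem_coe.2 (Finset.mem_union_left _ (Finset.mem_image.2 ⟨_, he, h.1⟩))
    · exact Finset.mem_coe.2 (Finset.mem_union_right _ (Finset.mem_image.2 ⟨_, he, h.2⟩))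
  refine (Set.ncard_le_ncard hsub).trans ?_
  rw [Set.ncard_coe_finset]
  exact (Finset.card_union_le _ _).trans (Nat.add_le_add Finset.card_image_le Finset.card_image_le)

end Pattern

open Classical in
/-- The weight of all solutions whose vertices have distinct colours. -/
noncomputable def colorValue (Φ : GraphProperty) (k : ℕ) {n : ℕ} (G : SimpleGraph (Fin n))
    (χ : Fin n → ℕ) : ℕ :=
  ∑ A : Finset (Sym2 (Fin n)), if A ∈ edgeSubs Φ k G ∧
    Set.InjOn χ (SimpleGraph.fromEdgeSet (A : Set (Sym2 (Fin n)))).support then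
      colorWeight (colors k) (SimpleGraph.fromEdgeSet (A : Set (Sym2 (Fin n)))).support.ncard else 0

open Classical in
-- After exchanging the sums, each set A is considered separately. If its ends have distinct colours
-- and it is a solution, exactly one mask is good and has the pattern of A; that pattern is
-- isomorphic to the graph of A, so it satisfies Φ and has the same number of vertices. In all other
-- cases no mask contributes.
theorem sum_goodMask {Φ : GraphProperty} {d : List Bool → Bool}
    (hd : ∀ (n : ℕ) (G : SimpleGraph (Fin n)), d (encodeGraph G) = true ↔ Φ.holds G)
    {k : ℕ} (hk : k ≠ 0) {n : ℕ} (G : SimpleGraph (Fin n)) (χ : Fin n → ℕ)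
    (hχ : ∀ v, χ v < colors k) :
    (∑ m ∈ Finset.range (2 ^ (colors k * colors k)), if goodMask d k m = true then
      colorWeight (colors k) (pairVerts (colors k) (maskPairs (colors k) m)).length *
        {A : Finset (Sym2 (Fin n)) | (A : Set (Sym2 (Fin n))) ⊆ G.edgeSet ∧
          HasPattern χ A (maskPairs (colors k) m)}.ncard else 0) = colorValue Φ k G χ := by
  set C := colors k with hC
  have hgood : ∀ m, goodMask d k m = true ↔ ((maskPairs C m).length = k ∧
      ∀ p ∈ maskPairs C m, p.1 < p.2) ∧ Φ.holds (pairGraph C (maskPairs C m)) := by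
    intro m
    rw [← hd, encodeGraph_pairGraph]
    simp [goodMask, hk, ← hC]
  have hsup : ∀ A : Finset (Sym2 (Fin n)), (A : Set (Sym2 (Fin n))) ⊆ G.edgeSet →
      (SimpleGraph.fromEdgeSet (A : Set (Sym2 (Fin n)))).support = {v | ∃ e ∈ A, v ∈ e} :=
    fun A hA => Set.ext fun v => mem_support_fromEdgeSet_iff (not_isDiag_of_subset_edgeSet hA)
  have key : ∀ (A : Finset (Sym2 (Fin n))) (l : List (ℕ × ℕ)),
      (A : Set (Sym2 (Fin n))) ⊆ G.edgeSet → HasPattern χ A l →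
      (Φ.holds (edgeInduced (A : Set (Sym2 (Fin n)))) ↔ Φ.holds (pairGraph C l)) ∧
      (pairVerts C l).length =
        (SimpleGraph.fromEdgeSet (A : Set (Sym2 (Fin n)))).support.ncard := by
    intro A l hA hp
    have hiso := hp.nonempty_iso hχ (not_isDiag_of_subset_edgeSet hA)
    refine ⟨Φ.iso_invariant _ _ hiso, ?_⟩
    obtain ⟨f⟩ := hiso
    rw [← Nat.card_coe_set_eq, Nat.card_congr f.toEquiv, Nat.card_eq_fintype_card, Fintype.card_fin]
  have hterm : ∀ m, (if goodMask d k m = true then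
      colorWeight C (pairVerts C (maskPairs C m)).length *
        {A : Finset (Sym2 (Fin n)) | (A : Set (Sym2 (Fin n))) ⊆ G.edgeSet ∧
          HasPattern χ A (maskPairs C m)}.ncard else 0) =
      ∑ A : Finset (Sym2 (Fin n)), if goodMask d k m = true ∧
        (A : Set (Sym2 (Fin n))) ⊆ G.edgeSet ∧ HasPattern χ A (maskPairs C m) then
          colorWeight C (pairVerts C (maskPairs C m)).length else 0 := by
    intro m
    by_cases hg : goodMask d k m = true
    · simp only [hg, if_true, true_and]
      rw [← Finset.sum_filter, Finset.sum_const, smul_eq_mul, mul_comm, ← Set.ncard_coe_finset]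
      simp
    · simp [hg]
  rw [Finset.sum_congr rfl fun m _ => hterm m, Finset.sum_comm]
  refine Finset.sum_congr rfl fun A _ => ?_
  by_cases hA : A ∈ edgeSubs Φ k G ∧
    Set.InjOn χ (SimpleGraph.fromEdgeSet (A : Set (Sym2 (Fin n)))).support
  · rw [if_pos hA]
    obtain ⟨⟨hAG, hAk, hAΦ⟩, hinj⟩ := hA
    have hinj' := hinj
    rw [hsup A hAG] at hinj'
    obtain ⟨m, hm, hmem⟩ := exists_maskPairs C fun p => p.1 < p.2 ∧
      ∃ e ∈ A, Sym2.map χ e = s(p.1, p.2)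
    have hl : ∀ p ∈ maskPairs C m, p.1 < p.2 := fun p hp => ((hmem p).1 hp).2.2.1
    have hpat : HasPattern χ A (maskPairs C m) := by
      refine ⟨hinj', fun z => ⟨?_, ?_⟩⟩
      · rintro ⟨e, he, rfl⟩
        induction e with | _ u v =>
        have hne : χ u ≠ χ v := fun h => not_isDiag_of_subset_edgeSet hAG _ he
          (Sym2.mk_isDiag_iff.2 (hinj' ⟨_, he, Sym2.mem_mk_left _ _⟩
            ⟨_, he, Sym2.mem_mk_right _ _⟩ h))
        rcases lt_or_gt_of_ne hne with h | h
        · exact ⟨(χ u, χ v), (hmem _).2 ⟨hχ u, hχ v, h, _, he, rfl⟩, rfl⟩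
        · exact ⟨(χ v, χ u), (hmem _).2 ⟨hχ v, hχ u, h, _, he, Sym2.eq_swap⟩, Sym2.eq_swap⟩
      · rintro ⟨p, hp, rfl⟩
        exact ((hmem p).1 hp).2.2.2
    obtain ⟨h1, h2⟩ := key A _ hAG hpat
    have hg : goodMask d k m = true :=
      (hgood m).2 ⟨⟨(hpat.length_eq hl (nodup_maskPairs _ _)).trans hAk, hl⟩, h1.1 hAΦ⟩
    rw [Finset.sum_eq_single m, if_pos ⟨hg, hAG, hpat⟩, h2]
    · rintro m' hm' hne
      refine if_neg ?_
      rintro ⟨hg', -, hpat'⟩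
      refine hne (maskPairs_injOn (Finset.mem_range.1 hm') hm fun p => ?_)
      rw [hpat.mem_iff hl, hpat'.mem_iff ((hgood m').1 hg').1.2]
    · exact fun h => absurd (Finset.mem_range.2 hm) h
  · rw [if_neg hA]
    refine Finset.sum_eq_zero fun m _ => if_neg ?_
    rintro ⟨hg, hAG, hpat⟩
    obtain ⟨⟨h1, h2⟩, h3⟩ := (hgood m).1 hg
    refine hA ⟨⟨hAG, ?_, (key A _ hAG hpat).1.2 h3⟩, ?_⟩
    · rw [← hpat.length_eq h2 (nodup_maskPairs _ _), h1]
    · rw [hsup A hAG]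
      exact hpat.1

/-! ### Random colourings -/

open Classical in
-- A colouring splits into its restrictions to S and to the complement; the first has to be an
-- embedding, the second is arbitrary.
theorem card_injOn {n C : ℕ} (S : Set (Fin n)) :
    (Finset.univ.filter fun I : Fin n → Fin C => Set.InjOn I S).card =
      C.descFactorial S.ncard * C ^ (n - S.ncard) := by
  let e := Equiv.piEquivPiSubtypeProd (fun v : Fin n => v ∈ S) fun _ => Fin C
  have h1 : (Finset.univ.filter fun I : Fin n → Fin C => Set.InjOn I S).card =
      ((Finset.univ.filter fun f : S → Fin C => Function.Injective f) ×ˢ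
        (Finset.univ : Finset ({v // v ∉ S} → Fin C))).card := by
    refine Finset.card_equiv e fun I => ?_
    simp only [Finset.mem_filter, Finset.mem_univ, true_and, Finset.mem_product, and_true]
    exact Set.injOn_iff_injective
  have h2 : Fintype.card S = S.ncard := by rw [← Nat.card_coe_set_eq, Nat.card_eq_fintype_card]
  have h3 : Fintype.card {v // v ∉ S} = n - S.ncard := by
    rw [Fintype.card_subtype_compl, Fintype.card_fin]
    exact congrArg _ h2
  rw [h1, Finset.card_product, Finset.card_univ, Fintype.card_fun, Fintype.card_fin, h3,
    ← Fintype.card_subtype, Fintype.card_congr (Equiv.subtypeInjectiveEquivEmbedding S (Fin C)),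
    Fintype.card_embedding_eq, Fintype.card_fin, h2]

theorem two_mul_le_colors (k : ℕ) : k + k ≤ colors k := Nat.lt_two_pow_self.le

open Classical in
-- A solution with v vertices has distinct colours in C!/(C - v)! · C^(n - v) of the C^n colourings.
-- The weight C^v (C - v)! cancels the dependence on v and leaves C^n · C!. There are enough colours
-- because v ≤ 2k ≤ C.
theorem sum_colorValue (Φ : GraphProperty) (k : ℕ) {n : ℕ} (G : SimpleGraph (Fin n)) :
    ∑ I : Fin n → Fin (colors k), colorValue Φ k G (fun v => I v) =
      colors k ^ n * ((colors k).factorial * (edgeSubs Φ k G).ncard) := by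
  set C := colors k with hC
  unfold colorValue
  rw [Finset.sum_comm]
  have hA : ∀ A : Finset (Sym2 (Fin n)), (∑ I : Fin n → Fin C, if A ∈ edgeSubs Φ k G ∧
      Set.InjOn (fun v => (I v : ℕ)) (SimpleGraph.fromEdgeSet (A : Set (Sym2 (Fin n)))).support then
      colorWeight C (SimpleGraph.fromEdgeSet (A : Set (Sym2 (Fin n)))).support.ncard else 0) =
      if A ∈ edgeSubs Φ k G then C ^ n * C.factorial else 0 := by
    intro A
    by_cases h : A ∈ edgeSubs Φ k G
    · simp only [h, true_and, if_true]
      set S := (SimpleGraph.fromEdgeSet (A : Set (Sym2 (Fin n)))).support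
      have hS : S.ncard ≤ C := by
        refine (ncard_support_le A).trans ?_
        rw [h.2.1]
        exact two_mul_le_colors k
      have hSn : S.ncard ≤ n := by
        simpa using Set.ncard_le_ncard (Set.subset_univ S)
      have hinj : ∀ I : Fin n → Fin C, Set.InjOn (fun v => (I v : ℕ)) S ↔ Set.InjOn I S :=
        fun I => ⟨fun h u hu v hv huv => h hu hv (congrArg Fin.val huv),
          fun h u hu v hv huv => h hu hv (Fin.ext huv)⟩
      simp only [hinj]
      have hpow : C ^ n = C ^ (n - S.ncard) * C ^ S.ncard := by
        rw [← pow_add, Nat.sub_add_cancel hSn]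
      rw [← Finset.sum_filter, Finset.sum_const, smul_eq_mul, card_injOn, colorWeight,
        ← Nat.factorial_mul_descFactorial hS, hpow]
      ring
    · simp [h]
  rw [Finset.sum_congr rfl fun A _ => hA A, ← Finset.sum_filter, Finset.sum_const, smul_eq_mul,
    ← Set.ncard_coe_finset]
  simp only [Finset.coe_filter, Finset.mem_univ, true_and, Set.setOf_mem_eq]
  ring

open Classical in
-- Each weight is at most C^C · C!, since v ≤ C. Compared with the mean, the loss is a factor that
-- depends only on k.
theorem colorValue_le (Φ : GraphProperty) (k : ℕ) {n : ℕ} (G : SimpleGraph (Fin n))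
    (χ : Fin n → ℕ) : colorValue Φ k G χ ≤
      colors k ^ colors k * ((colors k).factorial * (edgeSubs Φ k G).ncard) := by
  set C := colors k with hC
  have hC0 : 0 < C := Nat.two_pow_pos _
  unfold colorValue
  refine (Finset.sum_le_sum (g := fun A => if A ∈ edgeSubs Φ k G then C ^ C * C.factorial else 0)
    fun A _ => ?_).trans ?_
  · by_cases h : A ∈ edgeSubs Φ k G
    · simp only [h, true_and, if_true]
      split_ifs
      · have hS := ncard_support_le A
        rw [h.2.1] at hS
        exact Nat.mul_le_mul (Nat.pow_le_pow_right hC0 (hS.trans (two_mul_le_colors k)))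
          (Nat.factorial_le (Nat.sub_le _ _))
      · exact Nat.zero_le _
    · simp [h]
  · rw [← Finset.sum_filter, Finset.sum_const, smul_eq_mul, ← Set.ncard_coe_finset]
    simp only [Finset.coe_filter, Finset.mem_univ, true_and, Set.setOf_mem_eq]
    exact le_of_eq (by ring)

/-! ### The value of a plan -/

/-- The effect of an instruction on the accumulated value and on the stack. -/
def symRun (Z : SymTable → ℕ) (C : ℕ) (q : ℕ × List SymTable) (i : Instr) : ℕ × List SymTable :=
  (if 2 < i.1 then q.1 + i.2.1 * Z (symTop q.2) else q.1, symStep C q.2 i)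

theorem foldl_symRun_snd (Z : SymTable → ℕ) (C : ℕ) (P : List Instr) (q : ℕ × List SymTable) :
    (P.foldl (symRun Z C) q).2 = P.foldl (symStep C) q.2 := by
  induction P generalizing q with
  | nil => rfl
  | cons i P ih => rw [List.foldl_cons, ih, List.foldl_cons, symRun]

theorem foldl_symRun_fst (Z : SymTable → ℕ) (C : ℕ) {P : List Instr} (hP : ∀ i ∈ P, i.1 < 3)
    (q : ℕ × List SymTable) : (P.foldl (symRun Z C) q).1 = q.1 := by
  induction P generalizing q with
  | nil => rfl
  | cons i P ih =>
    have := hP i (by simp)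
    rw [List.foldl_cons, ih fun j hj => hP j (by simp [hj]), symRun, if_neg (by omega)]

theorem foldl_symStep_wf {C B : ℕ} {P : List Instr} {st : List SymTable} (h : ∀ S ∈ st, S.WF C)
    (hP : RunsOk C B P st) : ∀ S ∈ P.foldl (symStep C) st, S.WF C := by
  induction P generalizing st with
  | nil => exact h
  | cons i P ih => exact ih (symStep_wf h hP.1) hP.2

theorem RunsOk.symOk {C B : ℕ} {P : List Instr} {st : List SymTable} (h : RunsOk C B P st) (t : ℕ)
    (ht : t < P.length) : RunsOk C B (P.take t) st ∧
      SymOk C B ((P.take t).foldl (symStep C) st) P[t] := by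
  induction P generalizing st t with
  | nil => simp at ht
  | cons i P ih =>
    cases t with
    | zero => exact ⟨trivial, h.1⟩
    | succ t =>
      have := ih h.2 t (by simpa using ht)
      exact ⟨⟨h.1, this.1⟩, this.2⟩

theorem Accepts.run {C B : ℕ} {l : List (ℕ × ℕ)} {P : List Instr} (h : Accepts C B l P)
    (Z : SymTable → ℕ) (w a : ℕ) : RunsOk C B (P ++ [(3, w, 0)]) [] ∧
      (P ++ [(3, w, 0)]).foldl (symRun Z C) (a, []) =
        (a + w * Z (symTop (P.foldl (symStep C) [])), []) := by
  obtain ⟨h3, hok, hlen, -⟩ := h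
  refine ⟨hok.append ⟨⟨by simp, by simp, by simp, fun _ => hlen.ge⟩, trivial⟩, ?_⟩
  have h2 := foldl_symRun_snd Z C P (a, [])
  rw [List.foldl_append, List.foldl_cons, List.foldl_nil, symRun, h2, foldl_symRun_fst Z C h3]
  simp only [symStep, Nat.lt_add_one, if_true, OfNat.ofNat_ne_zero, if_false, OfNat.ofNat_ne_one,
    Nat.reduceEqDiff]
  rw [Prod.mk.injEq]
  exact ⟨rfl, List.length_eq_zero_iff.1 (by rw [List.length_tail, hlen])⟩

open Classical in
-- The final table has no free variables on its edges, so the environment is irrelevant; the machine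
-- may therefore read any entry of the table, and it reads the first.
theorem Accepts.colorSum_eq {C B : ℕ} {l : List (ℕ × ℕ)} {P : List Instr} (h : Accepts C B l P)
    {n : ℕ} (G : SimpleGraph (Fin n)) {E : ℕ → ℕ → ℕ}
    (hE : ∀ u v : Fin n, E u v = if G.Adj u v then 1 else 0) (hE' : ∀ u v, E u v ≤ 1)
    {χ : ℕ → ℕ} (hl : ∀ p ∈ l, p.1 < p.2) (ρ : ℕ → ℕ) :
    colorSum E χ n (symTop (P.foldl (symStep C) [])).2 (symTop (P.foldl (symStep C) [])).1 ρ =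
      {A : Finset (Sym2 (Fin n)) | (A : Set (Sym2 (Fin n))) ⊆ G.edgeSet ∧
        HasPattern (fun v => χ v) A l}.ncard := by
  obtain ⟨-, hok, hlen, h1, h2, h3⟩ := h
  have hwf := foldl_symStep_wf (by simp) hok _ (symTop_mem hlen.ge)
  refine colorSum_eq_card G hE hE' hl hwf.nodup (fun e => ⟨h1 e, fun he => (h2 e he).1⟩)
    (fun v => ⟨h3 v, ?_⟩) ρ
  rintro ⟨e, he, rfl | rfl⟩
  exacts [(h2 e he).2.1, (h2 e he).2.2]

open Classical in
theorem planPiece_run {d : List Bool → Bool} {B : ℕ} {prog : ℕ → ℕ → List Instr} {k : ℕ}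
    (hprog : ∀ mask, goodMask d k mask = true →
      Accepts (colors k) B (maskPairs (colors k) mask) (prog k mask)) {n : ℕ}
    (G : SimpleGraph (Fin n)) {E : ℕ → ℕ → ℕ}
    (hE : ∀ u v : Fin n, E u v = if G.Adj u v then 1 else 0) (hE' : ∀ u v, E u v ≤ 1)
    (χ : ℕ → ℕ) (ρ : ℕ → ℕ) (N a : ℕ) :
    RunsOk (colors k) B ((List.range N).flatMap (planPiece d prog k)) [] ∧
    ((List.range N).flatMap (planPiece d prog k)).foldl
      (symRun (fun S => colorSum E χ n S.2 S.1 ρ) (colors k)) (a, []) =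
      (a + ∑ m ∈ Finset.range N, if goodMask d k m = true then
        colorWeight (colors k) (pairVerts (colors k) (maskPairs (colors k) m)).length *
        {A : Finset (Sym2 (Fin n)) | (A : Set (Sym2 (Fin n))) ⊆ G.edgeSet ∧
          HasPattern (fun v => χ v) A (maskPairs (colors k) m)}.ncard else 0, []) := by
  induction N with
  | zero => exact ⟨trivial, by simp⟩
  | succ N ih =>
    set P := (List.range N).flatMap (planPiece d prog k)
    have hs : P.foldl (symStep (colors k)) [] = [] := by
      rw [← foldl_symRun_snd (fun S => colorSum E χ n S.2 S.1 ρ) _ _ (a, []), ih.2]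
    rw [List.range_succ, List.flatMap_append, Finset.sum_range_succ]
    simp only [List.flatMap_cons, List.flatMap_nil, List.append_nil]
    rw [List.foldl_append, ih.2]
    by_cases hg : goodMask d k N = true
    · have hacc := hprog N hg
      have hl : ∀ p ∈ maskPairs (colors k) N, p.1 < p.2 := by
        have := hg
        rw [goodMask, Bool.and_eq_true, decide_eq_true_eq] at this
        exact this.1.2.2
      have hr := hacc.run (fun S => colorSum E χ n S.2 S.1 ρ) (colorWeight (colors k)
        (pairVerts (colors k) (maskPairs (colors k) N)).length)
      rw [planPiece, if_pos hg, if_pos hg, (hr _).2, ← hacc.colorSum_eq G hE hE' hl ρ, add_assoc]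
      refine ⟨ih.1.append ?_, rfl⟩
      rw [hs]
      exact (hr a).1
    · rw [planPiece, if_neg hg, if_neg hg]
      exact ⟨ih.1.append trivial, by simp⟩

/-! ### Digits -/

theorem div_pow_mod_of_lt {n a r i : ℕ} (hn : 0 < n) (hr : r < n ^ i) (j : ℕ) :
    (a * n ^ i + r) / n ^ j % n = if j < i then r / n ^ j % n else a / n ^ (j - i) % n := by
  split_ifs with h
  · obtain ⟨m, rfl⟩ := Nat.exists_eq_add_of_lt h
    have e : a * n ^ (j + m + 1) + r = r + n ^ j * (n * (n ^ m * a)) := by ring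
    rw [e, Nat.add_mul_div_left _ _ (by positivity), Nat.add_mul_mod_self_left]
  · obtain ⟨m, rfl⟩ := Nat.exists_eq_add_of_le (not_lt.1 h)
    rw [pow_add, ← Nat.div_div_eq_div_mul, add_comm, Nat.add_mul_div_right _ _ (by positivity),
      Nat.div_eq_of_lt hr, zero_add, Nat.add_sub_cancel_left]

/-- The values of the slots that are represented by a number. -/
def slotVal (C n idx v : ℕ) : ℕ := if v < C then 0 else idx / n ^ (v - C) % n

/-- The number in which the digit with number `i` has been replaced. -/
def setDigit (n i idx y : ℕ) : ℕ := idx - idx / n ^ i % n * n ^ i + y * n ^ i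

/-- Separates the number into higher digits, the replaced digit and lower digits, without truncated
subtraction. -/
theorem setDigit_eq (n i idx y : ℕ) :
    setDigit n i idx y = (idx / n ^ i / n * n + y) * n ^ i + idx % n ^ i := by
  have h1 := Nat.div_add_mod' idx (n ^ i)
  have h2 := Nat.div_add_mod' (idx / n ^ i) n
  have h3 : idx - idx / n ^ i % n * n ^ i = idx / n ^ i / n * n * n ^ i + idx % n ^ i := by
    have h4 : idx / n ^ i / n * n * n ^ i + idx / n ^ i % n * n ^ i = idx / n ^ i * n ^ i := by
      rw [← add_mul, h2]
    refine Nat.sub_eq_of_eq_add ?_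
    linarith
  rw [setDigit, h3]
  ring

theorem setDigit_lt {n B i idx y : ℕ} (hi : i < B) (hidx : idx < n ^ B) (hy : y < n) :
    setDigit n i idx y < n ^ B := by
  have hn : 0 < n := by omega
  rw [setDigit_eq]
  have h1 : idx / n ^ i / n < n ^ (B - (i + 1)) := by
    rw [Nat.div_div_eq_div_mul, ← pow_succ]
    refine Nat.div_lt_of_lt_mul ?_
    rwa [← pow_add, Nat.add_sub_cancel' hi]
  have h2 : idx % n ^ i < n ^ i := Nat.mod_lt _ (by positivity)
  calc (idx / n ^ i / n * n + y) * n ^ i + idx % n ^ i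
      < (idx / n ^ i / n * n + y) * n ^ i + n ^ i := by omega
    _ = (idx / n ^ i / n * n + (y + 1)) * n ^ i := by ring
    _ ≤ (idx / n ^ i / n * n + n) * n ^ i := by gcongr; omega
    _ = (idx / n ^ i / n + 1) * n ^ (i + 1) := by ring
    _ ≤ n ^ (B - (i + 1)) * n ^ (i + 1) := Nat.mul_le_mul h1 le_rfl
    _ = n ^ B := by rw [← pow_add, Nat.sub_add_cancel hi]

/-- An index into a table is an assignment of vertices to slots, written in base n; replacing a
digit is updating a slot. This links the summation on the machine with the update of the environment
in `colorSum`. -/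
theorem slotVal_setDigit {C n i idx y : ℕ} (hy : y < n) :
    slotVal C n (setDigit n i idx y) = Function.update (slotVal C n idx) (C + i) y := by
  have hn : 0 < n := by omega
  have hr : idx % n ^ i < n ^ i := Nat.mod_lt _ (by positivity)
  funext v
  by_cases hv : v < C
  · rw [Function.update_of_ne (by omega), slotVal, slotVal, if_pos hv, if_pos hv]
  obtain ⟨j, rfl⟩ := Nat.exists_eq_add_of_le (not_lt.1 hv)
  have h0 : slotVal C n idx (C + j) = (idx / n ^ i * n ^ i + idx % n ^ i) / n ^ j % n := by
    rw [slotVal, if_neg hv, Nat.add_sub_cancel_left, Nat.div_add_mod']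
  rw [slotVal, if_neg hv, Nat.add_sub_cancel_left, setDigit_eq, div_pow_mod_of_lt hn hr]
  rcases lt_trichotomy j i with h | rfl | h
  · rw [if_pos h, Function.update_of_ne (by omega), h0, div_pow_mod_of_lt hn hr, if_pos h]
  · rw [if_neg (lt_irrefl _), Function.update_self, Nat.sub_self, pow_zero, Nat.div_one,
      Nat.mul_add_mod_of_lt' hy]
  · rw [if_neg (by omega), Function.update_of_ne (by omega), h0, div_pow_mod_of_lt hn hr,
      if_neg (by omega)]
    obtain ⟨m, rfl⟩ := Nat.exists_eq_add_of_lt h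
    have e : i + m + 1 - i = m + 1 := by omega
    rw [e, pow_succ', ← Nat.div_div_eq_div_mul, ← Nat.div_div_eq_div_mul, Nat.mul_add_div_of_lt hy]

/-! ### The stack in memory -/

/-- The tables of the stack, of size `W` each, are stored in the array one after the other. -/
def Stores (W : ℕ) (f : SymTable → ℕ → ℕ) (arr : ℕ → ℕ) : List SymTable → Prop
  | [] => True
  | S :: st => (∀ idx < W, arr (st.length * W + idx) = f S idx) ∧ Stores W f arr st

theorem Stores.congr {W : ℕ} {f : SymTable → ℕ → ℕ} {arr arr' : ℕ → ℕ} {st : List SymTable}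
    (h : Stores W f arr st) (h' : ∀ p < st.length * W, arr' p = arr p) : Stores W f arr' st := by
  induction st with
  | nil => trivial
  | cons S st ih =>
    rw [List.length_cons, add_mul, one_mul] at h'
    exact ⟨fun idx hidx => by rw [h' _ (by omega), h.1 idx hidx],
      ih h.2 fun p hp => h' p (by omega)⟩

open RamState Cmd Exp

/-! ### The stack machine -/

/-- Computes a power of `R₆`. -/
def powCmd (r e : ℕ) : Cmd := .set r 1 ;; .loop 38 (reg e) (.set r (reg 6 * reg r))

theorem powCmd_spec {r e : ℕ} (hr : r ≠ 6 ∧ r ≠ 38) (he : e ≠ r) (s : RamState) :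
    (powCmd r e).Spec s (s.reg e * (RamOp.mulCost (s.reg 6) + 20) + 10)
      fun s' => s'.reg r = s.reg 6 ^ s.reg e := by
  have e0 : eval (s.setReg r (eval s.reg 1)).reg (reg e) = s.reg e := by simp [he]
  refine Spec.mono (Spec.set_seq <| Spec.loop (fun i s' => s'.reg r = s.reg 6 ^ i)
    (RamOp.mulCost (s.reg 6) + 10) ?_ ?_) ?_ ?_
  · simp
  · intro i hi s' f h
    have e6 : s'.reg 6 = s.reg 6 := by
      rw [f.reg 6 (by simp [wregs]; omega)]
      simp [hr.1.symm]
    refine Spec.le (Spec.set ?_) ?_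
    · simp [h, e6, hr.2, pow_succ']
    · simp [e6]
      omega
  · rw [e0]
    simp
    nlinarith
  · intro s' _ h
    rwa [e0] at h

/-- Pushes the table of the adjacency of two slots. -/
def pushCmd : Cmd :=
  powCmd 37 35 ;; powCmd 39 36 ;; .loop 40 (reg 30)
    (.set 41 (reg 40 / reg 37) ;; .set 41 (reg 41 - reg 41 / reg 6 * reg 6) ;;
    .set 42 (reg 40 / reg 39) ;; .set 42 (reg 42 - reg 42 / reg 6 * reg 6) ;;
    .load 43 0 (reg 7 + (reg 41 * reg 6 + reg 42)) ;; .store 2 (reg 32 + reg 40) (reg 43)) ;;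
  .set 32 (reg 32 + reg 30)

/-- Multiplies the two topmost tables. -/
def mulCmd : Cmd :=
  .set 32 (reg 32 - reg 30) ;; .loop 40 (reg 30)
    (.load 41 2 (reg 32 - reg 30 + reg 40) ;; .load 42 2 (reg 32 + reg 40) ;;
    .store 2 (reg 32 - reg 30 + reg 40) (reg 41 * reg 42))

/-- Sums the topmost table over the values of a given colour of a slot. -/
def sumCmd : Cmd :=
  powCmd 37 35 ;; .loop 40 (reg 30)
    (.set 41 (reg 40 / reg 37) ;; .set 41 (reg 41 - reg 41 / reg 6 * reg 6) ;;
    .set 42 (reg 32 - reg 30 + (reg 40 - reg 41 * reg 37)) ;; .set 43 0 ;;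
    .loop 44 (reg 6) (.load 45 1 (reg 44) ;; .load 46 2 (reg 42 + reg 44 * reg 37) ;;
      .set 43 (.ite ((reg 45 - reg 36) + (reg 36 - reg 45)) (reg 43) (reg 43 + reg 46))) ;;
    .store 2 (reg 32 + reg 40) (reg 43)) ;;
  .loop 40 (reg 30) (.load 41 2 (reg 32 + reg 40) ;; .store 2 (reg 32 - reg 30 + reg 40) (reg 41))

/-- Removes the topmost table, and adds a multiple of its first entry. -/
def accCmd : Cmd :=
  .set 32 (reg 32 - reg 30) ;; .load 41 2 (reg 32) ;; .set 13 (reg 13 + reg 41 * reg 35)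

theorem Nat.sub_div_mul_eq_mod (a b : ℕ) : a - a / b * b = a % b := by
  have := Nat.div_add_mod' a b
  omega

section Table

variable (s : RamState) {n B W U : ℕ} (h6 : s.reg 6 = n) (hn : n ≤ U) (h30 : s.reg 30 = W)
  (hW : W ≤ U)

include h6 hn h30 hW in
theorem pushCmd_spec (hn0 : 0 < n) (ha : s.reg 35 < B) (hb : s.reg 36 < B) :
    pushCmd.Spec s (2 * (B * (RamOp.mulCost U + 20)) + U * (7 * RamOp.mulCost U + 100) + 100)
      fun s' => s'.reg 32 = s.reg 32 + W ∧ (∀ p < s.reg 32, s'.arr 2 p = s.arr 2 p) ∧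
        ∀ idx < W, s'.arr 2 (s.reg 32 + idx) = s.arr 0 (s.reg 7 +
          (idx / n ^ s.reg 35 % n * n + idx / n ^ s.reg 36 % n)) := by
  refine Spec.le (Spec.seq (T' := B * (RamOp.mulCost U + 20) + U * (7 * RamOp.mulCost U + 100) + 80)
    (powCmd_spec (r := 37) (e := 35) (by decide) (by decide) s) fun s₁ f₁ h₁ => ?_) ?_
  · refine Spec.le (Spec.seq (T' := U * (7 * RamOp.mulCost U + 100) + 60)
      (powCmd_spec (r := 39) (e := 36) (by decide) (by decide) s₁) fun s₂ f₂ h₂ => ?_) ?_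
    · have e37 : s₂.reg 37 = n ^ s.reg 35 := by rw [f₂.reg 37 (by decide), h₁, h6]
      have e39 : s₂.reg 39 = n ^ s.reg 36 := by
        rw [h₂, f₁.reg 36 (by decide), f₁.reg 6 (by decide), h6]
      have e6 : s₂.reg 6 = n := by rw [f₂.reg 6 (by decide), f₁.reg 6 (by decide), h6]
      have e7 : s₂.reg 7 = s.reg 7 := by rw [f₂.reg 7 (by decide), f₁.reg 7 (by decide)]
      have e30 : s₂.reg 30 = W := by rw [f₂.reg 30 (by decide), f₁.reg 30 (by decide), h30]
      have e32 : s₂.reg 32 = s.reg 32 := by rw [f₂.reg 32 (by decide), f₁.reg 32 (by decide)]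
      have ea0 : s₂.arr 0 = s.arr 0 := by rw [f₂.arr 0 (by decide), f₁.arr 0 (by decide)]
      have ea2 : s₂.arr 2 = s.arr 2 := by rw [f₂.arr 2 (by decide), f₁.arr 2 (by decide)]
      refine Spec.le (Spec.seq (T' := 10) (Spec.loop (fun i s' =>
        (∀ p < s.reg 32, s'.arr 2 p = s.arr 2 p) ∧
        ∀ idx < i, s'.arr 2 (s.reg 32 + idx) = s.arr 0 (s.reg 7 +
          (idx / n ^ s.reg 35 % n * n + idx / n ^ s.reg 36 % n))) (7 * RamOp.mulCost U + 80) ?_ ?_)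
        fun s₃ f₃ h₃ => ?_) ?_
      · exact ⟨fun p _ => by rw [ea2], by simp⟩
      · rintro i hi s' f ⟨i1, i2⟩
        have hi' : i ≤ U := by simp [e30] at hi; omega
        have g37 : s'.reg 37 = n ^ s.reg 35 := by rw [f.reg 37 (by decide), e37]
        have g39 : s'.reg 39 = n ^ s.reg 36 := by rw [f.reg 39 (by decide), e39]
        have g6 : s'.reg 6 = n := by rw [f.reg 6 (by decide), e6]
        have g7 : s'.reg 7 = s.reg 7 := by rw [f.reg 7 (by decide), e7]
        have g32 : s'.reg 32 = s.reg 32 := by rw [f.reg 32 (by decide), e32]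
        have ga0 : s'.arr 0 = s.arr 0 := by rw [f.arr 0 (by decide), ea0]
        have c1 := RamOp.mulCost_mono ((Nat.div_le_self i (n ^ s.reg 35)).trans hi')
        have c2 := RamOp.mulCost_mono ((Nat.div_le_self i (n ^ s.reg 36)).trans hi')
        have c3 := RamOp.mulCost_mono
          (((Nat.div_le_self _ n).trans (Nat.div_le_self i (n ^ s.reg 35))).trans hi')
        have c4 := RamOp.mulCost_mono
          (((Nat.div_le_self _ n).trans (Nat.div_le_self i (n ^ s.reg 36))).trans hi')
        have c5 := RamOp.mulCost_mono (((Nat.mod_lt (i / n ^ s.reg 35) hn0).le).trans hn)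
        refine Spec.le (Spec.set_seq <| Spec.set_seq <| Spec.set_seq <| Spec.set_seq <|
          Spec.load_seq <| Spec.store ⟨fun p hp => ?_, fun idx hidx => ?_⟩) ?_
        · have : p ≠ s.reg 32 + i := by omega
          simp [g32, this, i1 p hp]
        · rcases Nat.lt_succ_iff_lt_or_eq.1 hidx with hlt | rfl
          · simp [g32, hlt.ne, i2 idx hlt]
          · simp [g32, g7, g37, g39, g6, ga0, Nat.sub_div_mul_eq_mod]
        · simp [g37, g39, g6, Nat.sub_div_mul_eq_mod]
          omega
      · have g30 : s₃.reg 30 = W := by rw [f₃.reg 30 (by decide), e30]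
        have g32 : s₃.reg 32 = s.reg 32 := by rw [f₃.reg 32 (by decide), e32]
        simp only [eval_reg, e30] at h₃
        refine Spec.le (Spec.set ⟨?_, h₃.1, h₃.2⟩) ?_
        · simp [g32, g30]
        · simp
      · have : W * (7 * RamOp.mulCost U + 80 + 6) ≤ U * (7 * RamOp.mulCost U + 100) := by
          exact Nat.mul_le_mul hW (by omega)
        simp [e30]
        omega
    · have h1 : s₁.reg 36 * (RamOp.mulCost (s₁.reg 6) + 20) ≤ B * (RamOp.mulCost U + 20) := by
        rw [f₁.reg 36 (by decide), f₁.reg 6 (by decide), h6]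
        have := RamOp.mulCost_mono hn
        gcongr
      omega
  · have h1 : s.reg 35 * (RamOp.mulCost (s.reg 6) + 20) ≤ B * (RamOp.mulCost U + 20) := by
      rw [h6]
      have := RamOp.mulCost_mono hn
      gcongr
    omega

include h30 hW in
-- Multiplication works in place, because an entry of the product needs only the two entries with
-- the same index. A bound for the lower table suffices, as the time depends on the first factor.
theorem mulCmd_spec {M D : ℕ} (h32 : s.reg 32 = D + W + W)
    (hM : ∀ idx < W, s.arr 2 (D + idx) ≤ M) :
    mulCmd.Spec s (U * (RamOp.mulCost M + 40) + 20)
      fun s' => s'.reg 32 = D + W ∧ (∀ p < D, s'.arr 2 p = s.arr 2 p) ∧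
        ∀ idx < W, s'.arr 2 (D + idx) = s.arr 2 (D + idx) * s.arr 2 (D + W + idx) := by
  have e32 : D + W + W - W = D + W := by omega
  refine Spec.mono (Spec.set_seq <| Spec.loop (fun i s' => s'.reg 32 = D + W ∧
      (∀ p, (p < D ∨ D + i ≤ p) → s'.arr 2 p = s.arr 2 p) ∧
      ∀ idx < i, s'.arr 2 (D + idx) = s.arr 2 (D + idx) * s.arr 2 (D + W + idx))
      (RamOp.mulCost M + 30) ?_ ?_) ?_ ?_
  · exact ⟨by simp [h30, h32, e32], fun p _ => rfl, by simp⟩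
  · rintro i hi s' f ⟨g32, i1, i2⟩
    have g30 : s'.reg 30 = W := by rw [f.reg 30 (by decide)]; simp [h30]
    have hi' : i < W := by simpa [h30] using hi
    have v1 := i1 (D + i) (Or.inr le_rfl)
    have v2 := i1 (D + W + i) (Or.inr (by omega))
    have c := RamOp.mulCost_mono (hM i hi')
    have hD : D + W - W = D := by omega
    refine Spec.le (Spec.load_seq <| Spec.load_seq <| Spec.store ⟨by simpa using g32,
      fun p hp => ?_, fun idx hidx => ?_⟩) ?_
    · have : p ≠ D + i := by omega
      simp [g30, g32, hD, this, i1 p (by omega)]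
    · rcases Nat.lt_succ_iff_lt_or_eq.1 hidx with hlt | rfl
      · simp [g30, g32, hD, hlt.ne, i2 idx hlt]
      · simp [g30, g32, hD, v1, v2]
    · simp [g30, g32, hD, v1]
      omega
  · have : W * (RamOp.mulCost M + 30 + 6) ≤ U * (RamOp.mulCost M + 40) :=
        Nat.mul_le_mul hW (by omega)
    simp [h30]
    omega
  · rintro s' - ⟨h1, h2, h3⟩
    exact ⟨h1, fun p hp => h2 p (Or.inl hp), fun idx hidx => h3 idx (by simpa [h30] using hidx)⟩

include h6 hn h30 hW in
-- A new entry depends on all entries that differ from it in one digit, so the old table must stay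
-- intact during the summation. The result is written to the free space above the stack and copied
-- down afterwards.
theorem sumCmd_spec {D : ℕ} (hn0 : 0 < n) (h32 : s.reg 32 = D + W) (ha : s.reg 35 < B)
    (hlt : ∀ idx < W, ∀ y < n, setDigit n (s.reg 35) idx y < W) :
    sumCmd.Spec s (B * (RamOp.mulCost U + 20) + U * (U * (RamOp.mulCost U + 60) +
      5 * RamOp.mulCost U + 100) + 100)
      fun s' => s'.reg 32 = D + W ∧ (∀ p < D, s'.arr 2 p = s.arr 2 p) ∧
        ∀ idx < W, s'.arr 2 (D + idx) = ∑ y ∈ Finset.range n, if s.arr 1 y = s.reg 36 then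
          s.arr 2 (D + setDigit n (s.reg 35) idx y) else 0 := by
  have hD : D + W - W = D := by omega
  refine Spec.le (Spec.seq (T' := U * (U * (RamOp.mulCost U + 60) + 5 * RamOp.mulCost U + 100) + 80)
    (powCmd_spec (r := 37) (e := 35) (by decide) (by decide) s) fun s₁ f₁ h₁ => ?_) ?_
  swap
  · have h1 : s.reg 35 * (RamOp.mulCost (s.reg 6) + 20) ≤ B * (RamOp.mulCost U + 20) := by
      rw [h6]
      have := RamOp.mulCost_mono hn
      gcongr
    omega
  rw [h6] at h₁
  have e6 : s₁.reg 6 = n := by rw [f₁.reg 6 (by decide), h6]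
  have e30 : s₁.reg 30 = W := by rw [f₁.reg 30 (by decide), h30]
  have e32 : s₁.reg 32 = D + W := by rw [f₁.reg 32 (by decide), h32]
  have e36 : s₁.reg 36 = s.reg 36 := f₁.reg 36 (by decide)
  have ea1 : s₁.arr 1 = s.arr 1 := f₁.arr 1 (by decide)
  have ea2 : s₁.arr 2 = s.arr 2 := f₁.arr 2 (by decide)
  set F : ℕ → ℕ → ℕ := fun idx m => ∑ y ∈ Finset.range m, if s.arr 1 y = s.reg 36 then
    s.arr 2 (D + setDigit n (s.reg 35) idx y) else 0 with hF
  refine Spec.le (Spec.seq (T' := U * 40 + 10) (Spec.loop (fun i s' =>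
    (∀ p < D + W, s'.arr 2 p = s.arr 2 p) ∧ ∀ idx < i, s'.arr 2 (D + W + idx) = F idx n)
    (U * (RamOp.mulCost U + 60) + 5 * RamOp.mulCost U + 50) ?_ ?_) fun s₂ f₂ h₂ => ?_) ?_
  · exact ⟨fun p _ => by rw [ea2], by simp⟩
  · rintro i hi s' f ⟨i1, i2⟩
    have hiW : i < W := by simpa [e30] using hi
    have hi' : i ≤ U := hiW.le.trans hW
    have g37 : s'.reg 37 = n ^ s.reg 35 := by rw [f.reg 37 (by decide), h₁]
    have g6 : s'.reg 6 = n := by rw [f.reg 6 (by decide), e6]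
    have g30 : s'.reg 30 = W := by rw [f.reg 30 (by decide), e30]
    have g32 : s'.reg 32 = D + W := by rw [f.reg 32 (by decide), e32]
    have g36 : s'.reg 36 = s.reg 36 := by rw [f.reg 36 (by decide), e36]
    have ga1 : s'.arr 1 = s.arr 1 := by rw [f.arr 1 (by decide), ea1]
    have c1 := RamOp.mulCost_mono ((Nat.div_le_self i (n ^ s.reg 35)).trans hi')
    have c2 := RamOp.mulCost_mono
      (((Nat.div_le_self _ n).trans (Nat.div_le_self i (n ^ s.reg 35))).trans hi')
    have c3 := RamOp.mulCost_mono (((Nat.mod_lt (i / n ^ s.reg 35) hn0).le).trans hn)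
    refine Spec.le (Spec.set_seq <| Spec.set_seq <| Spec.set_seq <| Spec.set_seq <|
      Spec.seq (T' := 10) (Spec.loop (fun m s' => s'.reg 43 = F i m) (RamOp.mulCost U + 50) ?_ ?_)
      fun s₃ f₃ h₃ => ?_) ?_
    · simp [hF]
    · intro y hy s₃ f₃ h₃
      have hyn : y < n := by simpa [g6] using hy
      have k36 : s₃.reg 36 = s.reg 36 := by rw [f₃.reg 36 (by decide)]; simp [g36]
      have k37 : s₃.reg 37 = n ^ s.reg 35 := by rw [f₃.reg 37 (by decide)]; simp [g37]
      have k42 : s₃.reg 42 = D + (i - i / n ^ s.reg 35 % n * n ^ s.reg 35) := by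
        rw [f₃.reg 42 (by decide)]
        simp [g37, g6, g30, g32, hD, Nat.sub_div_mul_eq_mod]
      have ka1 : s₃.arr 1 = s.arr 1 := by rw [f₃.arr 1 (by decide)]; simp [ga1]
      have ka2 : s₃.arr 2 = s'.arr 2 := by rw [f₃.arr 2 (by decide)]; simp
      have hread : s₃.arr 2 (D + (i - i / n ^ s.reg 35 % n * n ^ s.reg 35) + y * n ^ s.reg 35) =
          s.arr 2 (D + setDigit n (s.reg 35) i y) := by
        have := hlt i hiW y hyn
        rw [ka2, add_assoc, ← i1 _ (by omega)]
        rfl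
      have c4 := RamOp.mulCost_mono (hyn.le.trans hn)
      have key : ∀ a b : ℕ, a - b = 0 ∧ b - a = 0 ↔ a = b := by intros; omega
      refine Spec.le (Spec.load_seq <| Spec.load_seq <| Spec.set ?_) ?_
      · have hFs : F i (y + 1) = F i y + if s.arr 1 y = s.reg 36 then
            s.arr 2 (D + setDigit n (s.reg 35) i y) else 0 := Finset.sum_range_succ _ _
        rw [hFs, ← h₃]
        by_cases hc : s.arr 1 y = s.reg 36
        · simp [k36, k37, k42, ka1, hread, hc]
        · have : ¬ (s.arr 1 y - s.reg 36 = 0 ∧ s.reg 36 - s.arr 1 y = 0) := by rwa [key]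
          rw [if_neg hc]
          simp [k36, k37, k42, ka1, hread]
          intro h1 h2
          exact absurd ⟨h1, h2⟩ this
      · simp
        split_ifs <;> omega
    · simp only [eval_reg, setReg_reg] at h₃
      norm_num at h₃
      have k32 : s₃.reg 32 = D + W := by rw [f₃.reg 32 (by decide)]; simp [g32]
      have k40 : s₃.reg 40 = i := by rw [f₃.reg 40 (by decide)]; simp
      have ka2 : s₃.arr 2 = s'.arr 2 := by rw [f₃.arr 2 (by decide)]; simp
      refine Spec.le (Spec.store ⟨fun p hp => ?_, fun idx hidx => ?_⟩) ?_
      · have : p ≠ D + W + i := by omega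
        simp [k32, k40, ka2, this, i1 p hp]
      · rcases Nat.lt_succ_iff_lt_or_eq.1 hidx with hlt' | rfl
        · simp [k32, k40, ka2, hlt'.ne, i2 idx hlt']
        · simp [k32, k40, h₃, g6]
      · simp
    · have : n * (RamOp.mulCost U + 50 + 6) ≤ U * (RamOp.mulCost U + 60) :=
        Nat.mul_le_mul hn (by omega)
      simp [g37, g6, Nat.sub_div_mul_eq_mod]
      omega
  · obtain ⟨i1, i2⟩ := h₂
    simp only [eval_reg, e30] at i2
    have g30 : s₂.reg 30 = W := by rw [f₂.reg 30 (by decide), e30]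
    have g32 : s₂.reg 32 = D + W := by rw [f₂.reg 32 (by decide), e32]
    refine Spec.mono (Spec.loop (fun i s' => s'.reg 32 = D + W ∧
      (∀ p < D, s'.arr 2 p = s.arr 2 p) ∧ (∀ idx < i, s'.arr 2 (D + idx) = F idx n) ∧
      ∀ idx < W, s'.arr 2 (D + W + idx) = F idx n) 30 ?_ ?_) ?_ ?_
    · exact ⟨g32, fun p hp => i1 p (by omega), by simp, i2⟩
    · rintro i hi s' f ⟨j1, j2, j3, j4⟩
      have hiW : i < W := by simpa [g30] using hi
      have k30 : s'.reg 30 = W := by rw [f.reg 30 (by decide), g30]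
      refine Spec.le (Spec.load_seq <| Spec.store ⟨by simpa using j1, fun p hp => ?_,
        fun idx hidx => ?_, fun idx hidx => ?_⟩) ?_
      · have : p ≠ D + i := by omega
        simp [k30, j1, hD, this, j2 p hp]
      · rcases Nat.lt_succ_iff_lt_or_eq.1 hidx with hlt' | rfl
        · simp [k30, j1, hD, hlt'.ne, j3 idx hlt']
        · simp [k30, j1, hD, j4 idx hiW]
      · have : D + W + idx ≠ D + i := by omega
        simp [k30, j1, hD, this, j4 idx hidx]
      · simp
    · have : W * (30 + 6) ≤ U * 40 :=
        Nat.mul_le_mul hW (by omega)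
      simp [g30]
      omega
    · rintro s' - ⟨j1, j2, j3, -⟩
      exact ⟨j1, j2, fun idx hidx => j3 idx (by simpa [g30] using hidx)⟩
  · have : W * (U * (RamOp.mulCost U + 60) + 5 * RamOp.mulCost U + 50 + 6) ≤
        U * (U * (RamOp.mulCost U + 60) + 5 * RamOp.mulCost U + 60) :=
        Nat.mul_le_mul hW (by omega)
    have h2 : U * (U * (RamOp.mulCost U + 60) + 5 * RamOp.mulCost U + 100) =
        U * (U * (RamOp.mulCost U + 60) + 5 * RamOp.mulCost U + 60) + U * 40 := by ring
    simp [e30]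
    omega

include h30 in
theorem accCmd_spec {M D : ℕ} (h32 : s.reg 32 = D + W) (hM : s.arr 2 D ≤ M) :
    accCmd.Spec s (RamOp.mulCost M + 40)
      fun s' => s'.reg 13 = s.reg 13 + s.reg 35 * s.arr 2 D ∧ s'.reg 32 = D ∧
        s'.arr 2 = s.arr 2 := by
  have hD : D + W - W = D := by omega
  have c := RamOp.mulCost_mono hM
  refine Spec.le (Spec.set_seq <| Spec.load_seq <| Spec.set ⟨?_, ?_, rfl⟩) ?_
  · simp [h30, h32, hD, mul_comm]
  · simp [h30, h32, hD]
  · simp [h30, h32, hD]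
    omega

end Table

/-! ### Executing a plan -/

open RamState Cmd Exp

/-- Executes the instruction in the registers `34`, `35` and `36`. -/
def stepCmd : Cmd :=
  .ite (reg 34) (.ite (reg 34 - 1) (.ite (reg 34 - 2) accCmd sumCmd) mulCmd) pushCmd

/-- A bound for the time of `stepCmd`. -/
def stepTime (B U T : ℕ) : ℕ :=
  2 * (B * (RamOp.mulCost U + 20)) + U * (U * (RamOp.mulCost U + 60) + 7 * RamOp.mulCost U + T + 200) +
    T + 200

namespace EdgeSubInst

variable (x : EdgeSubInst)

/-- The adjacency matrix. -/
noncomputable def adjBit (u v : ℕ) : ℕ := x.bit (x.base + (u * x.n + v))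

theorem adjBit_le (u v : ℕ) : x.adjBit u v ≤ 1 := Bool.toNat_le _

/-- The entries of a table. -/
noncomputable def tableVal (χ : ℕ → ℕ) (C : ℕ) (S : SymTable) (idx : ℕ) : ℕ :=
  colorSum x.adjBit χ x.n S.2 S.1 (slotVal C x.n idx)

/-- Bounds the entries by the number of assignments of the summed variables. Their bit length is
then at most about C · L, which keeps the multiplications of table entries cheap. -/
theorem tableVal_le {χ : ℕ → ℕ} {C : ℕ} {S : SymTable} (hS : S.WF C) (hn : 0 < x.n) (idx : ℕ) :
    x.tableVal χ C S idx ≤ x.n ^ C :=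
  (colorSum_le x.adjBit_le _ _ _).trans (Nat.pow_le_pow_right hn hS.length_le)

theorem tableVal_mul {χ : ℕ → ℕ} {C : ℕ} {S S' : SymTable} (hS : S.WF C) (hS' : S'.WF C)
    (hd : ∀ c ∈ S.1, c ∉ S'.1) (idx : ℕ) :
    x.tableVal χ C (S'.1 ++ S.1, S'.2 ++ S.2) idx =
      x.tableVal χ C S' idx * x.tableVal χ C S idx :=
  (colorSum_mul hS.nodup (fun v hv h => hd v h (hS'.mem v hv (hS.lt v h)))
    (fun v hv h => hd v (hS.mem v hv (hS'.lt v h)) h) _).symm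

theorem tableVal_sum {χ : ℕ → ℕ} {C i c : ℕ} {S : SymTable} (hS : S.WF C) (hc : c < C)
    (hcS : c ∉ S.1) (idx : ℕ) :
    x.tableVal χ C (c :: S.1, S.2.map (Prod.map (fun v => if v = C + i then c else v)
      (fun v => if v = C + i then c else v))) idx =
    ∑ y ∈ Finset.range x.n, if χ y = c then x.tableVal χ C S (setDigit x.n i idx y) else 0 := by
  rw [tableVal, ← colorSum_rename hS.nodup (s := C + i) (fun h => by have := hS.lt _ h; omega) hcS
    (fun h => hcS (hS.mem c h hc))]
  refine Finset.sum_congr rfl fun y hy => ?_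
  rw [tableVal, slotVal_setDigit (Finset.mem_range.1 hy)]

/-- One instruction keeps the memory in accordance with the symbolic stack. The four cases match the
algebra of `colorSum`: an adjacency entry, the distributive law, the binding of a slot, and the
reading of a closed table. -/
theorem stepCmd_spec {s : RamState} {st : List SymTable} {i : Instr} {C B U T : ℕ} (hx : x.Parsed s)
    (hn : 0 < x.n) (hnU : x.n ≤ U) (hWU : x.n ^ B ≤ U) (hT : RamOp.mulCost (x.n ^ C) ≤ T)
    (h30 : s.reg 30 = x.n ^ B) (h32 : s.reg 32 = st.length * x.n ^ B) (h34 : s.reg 34 = i.1)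
    (h35 : s.reg 35 = i.2.1) (h36 : s.reg 36 = i.2.2) (hok : SymOk C B st i)
    (hwf : ∀ S ∈ st, S.WF C) (hst : Stores (x.n ^ B) (x.tableVal (s.arr 1) C) (s.arr 2) st) :
    stepCmd.Spec s (stepTime B U T) fun s' =>
      s'.reg 13 = (symRun (fun S => x.tableVal (s.arr 1) C S 0) C (s.reg 13, st) i).1 ∧
      s'.reg 32 = (symStep C st i).length * x.n ^ B ∧
      Stores (x.n ^ B) (x.tableVal (s.arr 1) C) (s'.arr 2) (symStep C st i) := by
  set W := x.n ^ B with hW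
  set f := x.tableVal (s.arr 1) C with hf
  have hW0 : 0 < W := by positivity
  obtain ⟨ok0, ok1, ok2, ok3⟩ := hok
  set T' := 2 * (B * (RamOp.mulCost U + 20)) + U * (U * (RamOp.mulCost U + 60) +
    7 * RamOp.mulCost U + T + 200) + T + 150 with hT'
  have hpush : U * (7 * RamOp.mulCost U + 100) ≤ U * (U * (RamOp.mulCost U + 60) +
    7 * RamOp.mulCost U + T + 200) := Nat.mul_le_mul_left _ (by omega)
  have hsum : U * (U * (RamOp.mulCost U + 60) + 5 * RamOp.mulCost U + 100) ≤
    U * (U * (RamOp.mulCost U + 60) + 7 * RamOp.mulCost U + T + 200) :=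
    Nat.mul_le_mul_left _ (by omega)
  have hmul : U * (RamOp.mulCost (x.n ^ C) + 40) ≤
    U * (U * (RamOp.mulCost U + 60) + 7 * RamOp.mulCost U + T + 200) :=
    Nat.mul_le_mul_left _ (by omega)
  refine Spec.le (Spec.ite (T := T' + 30) (fun c0 => ?_) fun c0 => ?_) ?_
  · simp only [eval_reg, h34] at c0
    refine Spec.le (Spec.ite (T := T' + 20) (fun c1 => ?_) fun c1 => ?_) ?_
    · simp only [eval_reg, eval_sub, eval_num, h34] at c1
      refine Spec.le (Spec.ite (T := T') (fun c2 => ?_) fun c2 => ?_) ?_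
      · simp only [eval_reg, eval_sub, eval_num, h34] at c2
        have hlen := ok3 (by omega)
        obtain ⟨S, st, rfl⟩ := List.exists_cons_of_length_pos hlen
        have e32 : s.reg 32 = st.length * W + W := by rw [h32, List.length_cons]; ring
        have hval : s.arr 2 (st.length * W) = f S 0 := hst.1 0 hW0
        have hstep : symStep C (S :: st) i = st := by
          rw [symStep, if_neg c0, if_neg (by omega), if_neg (by omega), List.tail_cons]
        refine Spec.mono (accCmd_spec s h30 e32
          (hval.le.trans (x.tableVal_le (hwf S (by simp)) hn 0))) (by omega) ?_
        rintro s' - ⟨h1, h2, h3⟩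
        rw [hstep, h3]
        refine ⟨?_, h2, hst.2⟩
        rw [h1, h35, hval, symRun, if_pos (by omega)]
        rfl
      · simp only [eval_reg, eval_sub, eval_num, h34] at c2
        have hi : i.1 = 2 := by omega
        obtain ⟨hlen, hiB, hcC, hc⟩ := ok2 hi
        obtain ⟨S, st, rfl⟩ := List.exists_cons_of_length_pos hlen
        have e32 : s.reg 32 = st.length * W + W := by rw [h32, List.length_cons]; ring
        have hlt : ∀ idx < W, ∀ y < x.n, setDigit x.n (s.reg 35) idx y < W := by
          rw [h35]
          exact fun idx hidx y hy => setDigit_lt hiB hidx hy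
        refine Spec.mono (sumCmd_spec s (B := B) hx.n hnU h30 hWU hn e32 (by rwa [h35]) hlt)
          (by omega) ?_
        rintro s' fr ⟨h1, h2, h3⟩
        have hstep : symStep C (S :: st) i = (i.2.2 :: S.1, S.2.map (Prod.map
            (fun v => if v = C + i.2.1 then i.2.2 else v)
            (fun v => if v = C + i.2.1 then i.2.2 else v))) :: st := by
          rw [symStep, if_neg c0, if_neg (by omega), if_pos hi]
          rfl
        rw [symRun, if_neg (by omega), hstep]
        refine ⟨fr.reg 13 (by decide), ?_, fun idx hidx => ?_, hst.2.congr h2⟩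
        · rw [h1, List.length_cons]; ring
        · rw [h3 idx hidx, hf, x.tableVal_sum (hwf S (by simp)) hcC hc]
          refine Finset.sum_congr rfl fun y hy => ?_
          rw [hst.1 _ (hlt idx hidx y (Finset.mem_range.1 hy)), h35, h36]
      · simp
        omega
    · simp only [eval_reg, eval_sub, eval_num, h34] at c1
      have hi : i.1 = 1 := by omega
      obtain ⟨hlen, hd⟩ := ok1 hi
      obtain ⟨S, S', st, rfl⟩ : ∃ S S' st', st = S :: S' :: st' := by
        match st, hlen with
        | S :: S' :: st', _ => exact ⟨S, S', st', rfl⟩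
      have e32 : s.reg 32 = st.length * W + W + W := by
        rw [h32, List.length_cons, List.length_cons]; ring
      have hS := hwf S (by simp)
      have hS' := hwf S' (by simp)
      refine Spec.mono (mulCmd_spec s h30 hWU e32
        (fun idx hidx => (hst.2.1 idx hidx).le.trans (x.tableVal_le hS' hn idx))) (by omega) ?_
      rintro s' fr ⟨h1, h2, h3⟩
      have hstep : symStep C (S :: S' :: st) i = (S'.1 ++ S.1, S'.2 ++ S.2) :: st := by
        rw [symStep, if_neg c0, if_pos hi]
        rfl
      rw [symRun, if_neg (by omega), hstep]
      refine ⟨fr.reg 13 (by decide), ?_, fun idx hidx => ?_, hst.2.2.congr h2⟩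
      · rw [h1, List.length_cons]; ring
      · have h4 := hst.1 idx hidx
        rw [List.length_cons, add_mul, one_mul] at h4
        rw [h3 idx hidx, hst.2.1 idx hidx, h4, hf, x.tableVal_mul hS hS' hd]
    · simp
      omega
  · simp only [eval_reg, h34] at c0
    obtain ⟨ha, hb⟩ := ok0 c0
    refine Spec.mono (pushCmd_spec s (B := B) hx.n hnU h30 hWU hn (by rwa [h35]) (by rwa [h36]))
      (by omega) ?_
    rintro s' fr ⟨h1, h2, h3⟩
    rw [h32] at h1 h2 h3
    have hstep : symStep C st i = ([], [(C + i.2.1, C + i.2.2)]) :: st := by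
      rw [symStep, if_pos c0]
    rw [symRun, if_neg (by omega), hstep]
    refine ⟨fr.reg 13 (by decide), ?_, fun idx hidx => ?_, hst.congr h2⟩
    · rw [h1, List.length_cons]; ring
    · rw [h3 idx hidx, hx.input, hx.base, h35, h36]
      simp [hf, tableVal, colorSum, edgeProd, adjBit, slotVal]
  · simp [stepTime, hT']
    omega

end EdgeSubInst

/-- The length and the instructions of a plan. -/
def planFn (plan : ℕ → List Instr) (k j : ℕ) : ℕ :=
  if j = 0 then (plan k).length
  else if (j - 1) % 3 = 0 then ((plan k).getD ((j - 1) / 3) (0, 0, 0)).1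
  else if (j - 1) % 3 = 1 then ((plan k).getD ((j - 1) / 3) (0, 0, 0)).2.1
  else ((plan k).getD ((j - 1) / 3) (0, 0, 0)).2.2

theorem computable_planFn {plan : ℕ → List Instr} (h : Computable plan) :
    Computable₂ (planFn plan) := by
  have hj : Primrec fun q : ℕ × ℕ => (q.2 - 1) / 3 :=
    Primrec.nat_div.comp (Primrec.nat_sub.comp Primrec.snd (Primrec.const 1)) (Primrec.const 3)
  have hm : Primrec fun q : ℕ × ℕ => (q.2 - 1) % 3 :=
    Primrec.nat_mod.comp (Primrec.nat_sub.comp Primrec.snd (Primrec.const 1)) (Primrec.const 3)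
  have hp : Computable fun q : ℕ × ℕ => plan q.1 := h.comp Computable.fst
  have hi : Computable fun q : ℕ × ℕ => (plan q.1).getD ((q.2 - 1) / 3) (0, 0, 0) :=
    (Primrec.list_getD _).to_comp.comp hp hj.to_comp
  have h0 : Computable fun q : ℕ × ℕ => decide (q.2 = 0) :=
    (Primrec.eq.comp Primrec.snd (Primrec.const 0)).decide.to_comp
  have h1 : Computable fun q : ℕ × ℕ => decide ((q.2 - 1) % 3 = 0) :=
    (Primrec.eq.comp hm (Primrec.const 0)).decide.to_comp
  have h2 : Computable fun q : ℕ × ℕ => decide ((q.2 - 1) % 3 = 1) :=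
    (Primrec.eq.comp hm (Primrec.const 1)).decide.to_comp
  refine (Computable.cond h0 (Computable.list_length.comp hp) (Computable.cond h1
    (Computable.fst.comp hi) (Computable.cond h2 (Computable.fst.comp (Computable.snd.comp hi))
    (Computable.snd.comp (Computable.snd.comp hi))))).of_eq fun q => ?_
  simp only [planFn, Bool.cond_decide]

/-- A bound for the time that is needed to compute the plan. -/
def planTime (o : RamOp) (k : ℕ) : ℕ := ∑ j ∈ Finset.range (3 * o.fn k 0 + 1), o.cost k j

theorem cost_le_planTime {o : RamOp} {k j : ℕ} (h : j < 3 * o.fn k 0 + 1) :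
    o.cost k j ≤ planTime o k :=
  Finset.single_le_sum (f := fun j => o.cost k j) (fun _ _ => Nat.zero_le _) (Finset.mem_range.2 h)

/-- Executes the plan that is computed by the operation. -/
def colorBody (B : ℕ) (o : RamOp) : Cmd :=
  .set 31 (num B) ;; powCmd 30 31 ;; .set 32 0 ;;
  .loop 33 (.ite (reg 6) (op o (reg 5) 0) 0)
    (.set 34 (op o (reg 5) (reg 33 + reg 33 + reg 33 + 1)) ;;
    .set 35 (op o (reg 5) (reg 33 + reg 33 + reg 33 + 2)) ;;
    .set 36 (op o (reg 5) (reg 33 + reg 33 + reg 33 + 3)) ;; stepCmd)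

/-- A bound for the time of `colorBody`. -/
def colorBodyTime (B : ℕ) (o : RamOp) (k L : ℕ) : ℕ :=
  B * (RamOp.mulCost L + 20) + planTime o k + o.fn k 0 * (3 * planTime o k +
    stepTime B (L ^ B + L) (29 * (L * colors k + 2) ^ 2) + 100) + 100

namespace EdgeSubInst

variable (x : EdgeSubInst)

open Classical in
-- The instructions are recomputed from k one by one, at a cost that depends only on k. For n = 0
-- the loop is not entered, as tables and digits to the base n need a positive n.
theorem colorBody_spec {B : ℕ} {o : RamOp} {plan : ℕ → List Instr} (ho : o.fn = planFn plan)
    {χ : ℕ → ℕ} {v : ℕ} (hok : RunsOk (colors x.k) B (plan x.k) [])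
    (hv : 0 < x.n → ∀ a, ((plan x.k).foldl (symRun (fun S => x.tableVal χ (colors x.k) S 0)
      (colors x.k)) (a, [])).1 = a + v) (hv0 : x.n = 0 → v = 0)
    (s : RamState) (hx : x.Parsed s) (hχ : s.arr 1 = χ) :
    (colorBody B o).Spec s (colorBodyTime B o x.k x.L) fun s' => s'.reg 13 = s.reg 13 + v := by
  set C := colors x.k with hC
  set P := plan x.k with hP
  set Z : SymTable → ℕ := fun S => x.tableVal χ C S 0 with hZ
  set st : ℕ → List SymTable := fun t => (P.take t).foldl (symStep C) [] with hst
  have hlen : o.fn x.k 0 = P.length := by rw [ho, planFn, if_pos rfl]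
  have hL : 0 < x.L := lt_of_lt_of_le x.2.pos x.k_le
  set T := 29 * (x.L * C + 2) ^ 2 with hT
  -- Although n ^ C is not polynomial in L with a fixed exponent, its bit length is at most L · C +
  -- 1.
  have hcost : RamOp.mulCost (x.n ^ C) ≤ T := by
    refine RamOp.mulCost_le_of_lt (m := x.L * C + 1) ?_
    calc x.n ^ C ≤ (2 ^ x.L) ^ C := Nat.pow_le_pow_left (x.n_le.trans Nat.lt_two_pow_self.le) _
      _ = 2 ^ (x.L * C) := (pow_mul _ _ _).symm
      _ < 2 ^ (x.L * C + 1) := Nat.pow_lt_pow_right (by norm_num) (by omega)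
  have hnU : x.n ≤ x.L ^ B + x.L := x.n_le.trans (by omega)
  have hWU : x.n ^ B ≤ x.L ^ B + x.L := (Nat.pow_le_pow_left x.n_le B).trans (by omega)
  have hpt := cost_le_planTime (o := o) (k := x.k) (j := 0) (by omega)
  have hm := RamOp.mulCost_mono x.n_le
  have hpow : B * (RamOp.mulCost x.n + 20) ≤ B * (RamOp.mulCost x.L + 20) := by gcongr
  refine Spec.le (Spec.set_seq <| Spec.seq (T' := planTime o x.k + o.fn x.k 0 * (3 * planTime o x.k +
    stepTime B (x.L ^ B + x.L) T + 100) + 60)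
    (powCmd_spec (r := 30) (e := 31) (by decide) (by decide) _) fun s₁ f₁ h₁ => ?_) ?_
  swap
  · rw [colorBodyTime, ← hC, ← hT]
    simp [hx.n]
    omega
  have e30 : s₁.reg 30 = x.n ^ B := by rw [h₁]; simp [hx.n]
  have e6 : s₁.reg 6 = x.n := by rw [f₁.reg 6 (by decide)]; simp [hx.n]
  have e5 : s₁.reg 5 = x.k := by rw [f₁.reg 5 (by decide)]; simp [hx.k]
  have e13 : s₁.reg 13 = s.reg 13 := by rw [f₁.reg 13 (by decide)]; simp
  refine Spec.mono (Spec.set_seq <| Spec.loop (fun t s' =>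
    s'.reg 13 = ((P.take t).foldl (symRun Z C) (s.reg 13, [])).1 ∧
    s'.reg 32 = (st t).length * x.n ^ B ∧
    Stores (x.n ^ B) (x.tableVal χ C) (s'.arr 2) (st t))
    (3 * planTime o x.k + stepTime B (x.L ^ B + x.L) T + 80) ?_ ?_) ?_ ?_
  · simp [hst, Stores, e13]
  · rintro t ht s' f ⟨i1, i2, i3⟩
    have hw : ∀ q, q < 30 → q ≠ 13 → q ∉ (Cmd.loop 33 (.ite (reg 6) (op o (reg 5) 0) 0)
        (.set 34 (op o (reg 5) (reg 33 + reg 33 + reg 33 + 1)) ;;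
        .set 35 (op o (reg 5) (reg 33 + reg 33 + reg 33 + 2)) ;;
        .set 36 (op o (reg 5) (reg 33 + reg 33 + reg 33 + 3)) ;; stepCmd)).wregs := by
      intro q h1 h2
      simp [wregs, stepCmd, accCmd, sumCmd, mulCmd, pushCmd, powCmd]
      omega
    have g0 : s'.reg 0 = x.L := by
      rw [f.reg 0 (hw 0 (by norm_num) (by norm_num))]
      simp [f₁.reg 0 (by decide), hx.length]
    have g5 : s'.reg 5 = x.k := by
      rw [f.reg 5 (hw 5 (by norm_num) (by norm_num))]
      simp [e5]
    have g6 : s'.reg 6 = x.n := by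
      rw [f.reg 6 (hw 6 (by norm_num) (by norm_num))]
      simp [e6]
    have g7 : s'.reg 7 = x.base := by
      rw [f.reg 7 (hw 7 (by norm_num) (by norm_num))]
      simp [f₁.reg 7 (by decide), hx.base]
    have g30 : s'.reg 30 = x.n ^ B := by
      rw [f.reg 30 (by simp [wregs, stepCmd, accCmd, sumCmd, mulCmd, pushCmd, powCmd])]
      simp [e30]
    have ga0 : s'.arr 0 = x.bit := by
      rw [f.arr 0 (by simp [warrs, stepCmd, accCmd, sumCmd, mulCmd, pushCmd, powCmd])]
      simp [f₁.arr 0 (by decide), hx.input]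
    have ga1 : s'.arr 1 = χ := by
      rw [f.arr 1 (by simp [warrs, stepCmd, accCmd, sumCmd, mulCmd, pushCmd, powCmd])]
      simp [f₁.arr 1 (by decide), hχ]
    simp only [eval_ite, eval_reg, eval_op, eval_num, setReg_reg] at ht
    norm_num [e6, e5] at ht
    split_ifs at ht with hn0
    · exact absurd ht (Nat.not_lt_zero _)
    rw [hlen] at ht
    obtain ⟨ok1, ok2⟩ := hok.symOk t ht
    have hget : P.getD t (0, 0, 0) = P[t] := List.getD_eq_getElem _ _ ht
    have q1 : o.fn x.k (t + t + t + 1) = P[t].1 := by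
      rw [ho, planFn, if_neg (by omega), if_pos (by omega), ← hP,
        show (t + t + t + 1 - 1) / 3 = t by omega, hget]
    have q2 : o.fn x.k (t + t + t + 2) = P[t].2.1 := by
      rw [ho, planFn, if_neg (by omega), if_neg (by omega), if_pos (by omega), ← hP,
        show (t + t + t + 2 - 1) / 3 = t by omega, hget]
    have q3 : o.fn x.k (t + t + t + 3) = P[t].2.2 := by
      rw [ho, planFn, if_neg (by omega), if_neg (by omega), if_neg (by omega), ← hP,
        show (t + t + t + 3 - 1) / 3 = t by omega, hget]
    have c1 := cost_le_planTime (o := o) (k := x.k) (j := t + t + t + 1) (by omega)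
    have c2 := cost_le_planTime (o := o) (k := x.k) (j := t + t + t + 2) (by omega)
    have c3 := cost_le_planTime (o := o) (k := x.k) (j := t + t + t + 3) (by omega)
    have hstep : (P.take (t + 1)).foldl (symRun Z C) (s.reg 13, []) =
        symRun Z C ((P.take t).foldl (symRun Z C) (s.reg 13, [])) P[t] := by
      rw [List.take_add_one, List.getElem?_eq_getElem ht, List.foldl_append]
      rfl
    have hst' : st (t + 1) = symStep C (st t) P[t] := by
      rw [hst]
      simp only
      rw [List.take_add_one, List.getElem?_eq_getElem ht, List.foldl_append]
      rfl
    have hfst : (P.take t).foldl (symRun Z C) (s.reg 13, []) = (s'.reg 13, st t) :=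
      Prod.ext i1.symm (foldl_symRun_snd Z C _ _)
    refine Spec.le (Spec.set_seq <| Spec.set_seq <| Spec.set_seq <| Spec.mono
      (x.stepCmd_spec (st := st t) (i := P[t]) (C := C) (B := B) ?_ (Nat.pos_of_ne_zero hn0) hnU
        hWU hcost ?_ ?_ ?_ ?_ ?_ ok2 (foldl_symStep_wf (by simp) ok1) ?_) le_rfl ?_) ?_
    · constructor
      · simp [g0]
      · simp [g5]
      · simp [g6]
      · simp [g7]
      · simp [ga0]
    · simp [g30]
    · simpa using i2
    · simp [g5, q1]
    · simp [g5, q2]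
    · simp [g5, q3]
    · simpa [ga1] using i3
    · rintro s'' - ⟨h1, h2, h3⟩
      simp only [setReg_arr, ga1] at h1 h3
      rw [hst', hstep, hfst]
      refine ⟨?_, h2, h3⟩
      rw [h1]
      simp [hZ]
    · simp [g5]
      omega
  · have h1 : (if s₁.reg 6 ≠ 0 then o.fn (s₁.reg 5) 0 else 0) ≤ o.fn x.k 0 := by
      rw [e5]; split_ifs <;> simp
    have h2 := Nat.mul_le_mul_right (3 * planTime o x.k + stepTime B (x.L ^ B + x.L) T + 80 + 6) h1
    have h3 : o.fn x.k 0 * (3 * planTime o x.k + stepTime B (x.L ^ B + x.L) T + 80 + 6) ≤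
      o.fn x.k 0 * (3 * planTime o x.k + stepTime B (x.L ^ B + x.L) T + 100) :=
      Nat.mul_le_mul_left _ (by omega)
    have h4 : (if s₁.reg 6 ≠ 0 then 2 + (1 + o.cost (s₁.reg 5) 0) else 1) ≤ planTime o x.k + 4 := by
      rw [e5]; split_ifs <;> omega
    simp only [cost_ite, cost_num, cost_reg, cost_op, eval_ite, eval_reg, eval_op, eval_num,
      setReg_reg]
    norm_num at h1 h2 h4 ⊢
    omega
  · rintro s' - ⟨h1, -, -⟩
    rw [h1]
    simp only [eval_ite, eval_reg, eval_op, eval_num, setReg_reg]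
    norm_num [e6, e5]
    split_ifs with hn0
    · simp [hv0 hn0]
    · rw [hlen, List.take_length, hv (Nat.pos_of_ne_zero hn0)]

end EdgeSubInst

/-! ### The sampler by random colourings -/

open RamState Cmd Exp

/-- Fixes the number of vertices and the number of bits of a colour. -/
def colorSetup : Cmd := .set 14 (reg 6) ;; .set 15 (reg 5 + reg 5)

theorem stepTime_fpt {B : ℕ} {U T : ℕ → ℕ → ℕ → ℕ → ℕ} (hU : IsFPT U) (hT : IsFPT T) :
    IsFPT fun k L E ℓ => stepTime B (U k L E ℓ) (T k L E ℓ) :=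
  ((((IsFPT.const 2).mul ((IsFPT.const B).mul (hU.mulCost.add (IsFPT.const 20)))).add
    (hU.mul ((((hU.mul (hU.mulCost.add (IsFPT.const 60))).add
    ((IsFPT.const 7).mul hU.mulCost)).add hT).add (IsFPT.const 200)))).add hT).add (IsFPT.const 200)

theorem colorBodyTime_fpt {B : ℕ} {o : RamOp} (ho : Computable₂ o.fn) (hc : Computable₂ o.cost) :
    IsFPT fun k L _ _ => colorBodyTime B o k L := by
  have hL := IsFPT.length
  have hlen : Computable fun k => o.fn k 0 := ho.comp Computable.id (Computable.const 0)
  have hplan : IsFPT fun k _ _ _ => planTime o k := IsFPT.param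
    (Computable.sum_range (Computable.succ.comp (Primrec.nat_mul.to_comp.comp (Computable.const 3)
      hlen)) hc)
  have hT := (IsFPT.const 29).mul (((hL.mul (IsFPT.param primrec_colors.to_comp)).add
    (IsFPT.const 2)).pow 2)
  exact ((((IsFPT.const B).mul (hL.mulCost.add (IsFPT.const 20))).add hplan).add
    ((IsFPT.param hlen).mul ((((IsFPT.const 3).mul hplan).add
    (stepTime_fpt ((hL.pow B).add hL) hT)).add (IsFPT.const 100)))).add (IsFPT.const 100)

theorem colorValue_of_isEmpty (Φ : GraphProperty) {k n : ℕ} (hk : k ≠ 0) (hn : n = 0)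
    (G : SimpleGraph (Fin n)) (χ : Fin n → ℕ) : colorValue Φ k G χ = 0 := by
  subst hn
  refine Finset.sum_eq_zero fun A _ => if_neg ?_
  rintro ⟨⟨-, hA, -⟩, -⟩
  obtain ⟨e, -⟩ := Finset.card_pos.1 (by omega : 0 < A.card)
  induction e with | _ u v => exact u.elim0

open Classical in
-- Every good pattern satisfies Φ, hence has small treewidth and a program with `B` slots. As `B`
-- depends on Φ alone, tables of n^B entries have polynomial size, and the length of the plan is a
-- computable function of k.
theorem GraphProperty.exists_sampler_of_boundedTreewidth {Φ : GraphProperty}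
    (hΦ : Φ.IsComputable) (hB : Φ.BoundedTreewidth) : Nonempty (Sampler Φ) := by
  obtain ⟨d, hd, hdΦ⟩ := hΦ
  obtain ⟨B, hB⟩ := GraphProperty.exists_accepts_of_boundedTreewidth hB
  obtain ⟨prog, hprog, hplan⟩ := exists_plan hd (B := B) fun k mask hg => by
    rw [goodMask, Bool.and_eq_true, decide_eq_true_eq] at hg
    obtain ⟨⟨h1, h2, h3⟩, h4⟩ := hg
    refine hB _ _ (fun h => h2 (by rw [← h1, h, List.length_nil])) (fun e he => ?_)
      (fun e he => (h3 e he).ne) ?_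
    · exact ⟨(mem_maskPairs.1 he).1, (mem_maskPairs.1 he).2.1⟩
    · rwa [← hdΦ, encodeGraph_pairGraph]
  obtain ⟨o, ho, hoc⟩ := RamOp.exists_of_computable (computable_planFn hplan)
  have hon : Computable₂ o.fn := by rw [ho]; exact computable_planFn hplan
  exact ⟨{
    setup := colorSetup
    body := colorBody B o
    bound := fun k => colors k ^ colors k
    deg := 0
    scale := fun k => (colors k).factorial
    r := fun x => x.n
    -- The number of colours is the power 2 ^ (2k), so a uniform colour is exactly 2k coin flips.
    b := fun x => x.k + x.k
    g := fun x I => colorValue Φ x.k x.1.2 fun v => I v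
    Ready := fun _ _ => True
    setupTime := fun _ _ => 100
    bodyTime := colorBodyTime B o
    bitTime := fun _ L => L + L
    bound_computable := (Primrec.nat_pow.comp primrec_colors primrec_colors).to_comp
    scale_computable := (Primrec.nat_factorial.comp primrec_colors).to_comp
    scale_pos := fun k => Nat.factorial_pos _
    setupTime_fpt := IsFPT.const 100
    bodyTime_fpt := colorBodyTime_fpt hon hoc
    bitTime_fpt := IsFPT.length.add IsFPT.length
    r_le := fun x => x.n_le.trans (Nat.le_add_left _ _)
    b_le := fun x => Nat.add_le_add x.k_le x.k_le
    setup_wregs := by decide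
    setup_noFlip := by simp [colorSetup, NoFlip]
    setup_warrs := by decide
    setup_spec := fun x s hx => by
      refine Spec.le (Spec.set_seq <| Spec.set ⟨?_, ?_, trivial⟩) ?_
      · simp [hx.n]
      · simp [hx.k]
      · simp
    ready_congr := fun _ _ _ _ _ _ => trivial
    body_wregs := by
      simp [colorBody, wregs, stepCmd, accCmd, sumCmd, mulCmd, pushCmd, powCmd]
    body_noFlip := by
      simp [colorBody, NoFlip, stepCmd, accCmd, sumCmd, mulCmd, pushCmd, powCmd]
    body_warrs := by
      simp [colorBody, warrs, stepCmd, accCmd, sumCmd, mulCmd, pushCmd, powCmd]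
    body_spec := fun x s I hx _ _ _ hI => by
      have hE : ∀ u v : Fin x.n, x.adjBit u v = if x.1.2.Adj u v then 1 else 0 := x.bit_adj
      have hrun := planPiece_run (hprog x.k) x.1.2 hE x.adjBit_le (s.arr 1)
        (slotVal (colors x.k) x.n 0) (2 ^ (colors x.k * colors x.k))
      have hχ : (fun v : Fin x.n => s.arr 1 v) = fun v => (I v : ℕ) := funext hI
      have hval := sum_goodMask hdΦ x.2.ne_zero x.1.2 (fun v => s.arr 1 v) (fun v => by
        rw [hI v]; exact (I v).2)
      refine Spec.mono (x.colorBody_spec ho (χ := s.arr 1)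
        (v := colorValue Φ x.k x.1.2 fun v => I v) (hrun 0).1 (fun _ a => ?_)
        (fun hn => colorValue_of_isEmpty Φ x.2.ne_zero hn _ _) s hx rfl) le_rfl
        fun s' _ h => ⟨h, trivial⟩
      have h2 := congrArg Prod.fst (hrun a).2
      refine h2.trans ?_
      show a + _ = _
      rw [hval, hχ]
    sum_g := fun x => sum_colorValue Φ x.k x.1.2
    g_le := fun x I => by
      rw [pow_zero, mul_one]
      exact colorValue_le Φ x.k x.1.2 _ }⟩

theorem mainTheorem5 (Φ : GraphProperty) (hΦ : Φ.IsComputable)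
    (h : (Φ.MatchingCriterion ∧ Φ.StarCriterion) ∨ Φ.BoundedTreewidth) :
    (edgeSubProblem Φ).HasFPTRAS := by
  rcases h with ⟨hM, hS⟩ | hB
  · obtain ⟨A⟩ := GraphProperty.exists_sampler_of_matching_star hΦ hM hS
    exact A.hasFPTRAS
  · obtain ⟨A⟩ := GraphProperty.exists_sampler_of_boundedTreewidth hΦ hB
    exact A.hasFPTRAS
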